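/- Conventions. Let $d\ge 3$. A polyhedron in $\mathbb R^d$ is a map $f:|K|\to\mathbb R^d$, affine on every simplex, where $K$ is a finite simplicial complex that is a closed strongly connected $(d-1)$-dimensional pseudomanifold: $K\neq\emptyset$, every simplex lies in a $(d-1)$-simplex, every $(d-2)$-simplex lies in exactly two $(d-1)$-simplices, and any two $(d-1)$-simplices are joined by a chain of $(d-1)$-simplices in which consecutive ones share a $(d-2)$-simplex. The image $f(|K|)$ is also called the polyhedron, the images of the simplices are its faces. It is embedded if $f$ is injective; $[\![P]\!]$ denotes the bounded domain whose boundary is the embedded polyhedron $P$, and the interior dihedral angle $\varphi(x)\in(0,2\pi)$ at a $(d-2)$-face $x$ is the angle of the wedge with which $[\![P]\!]$ coincides near each relative interior point of $x$. Let $I=[0,1]$ or $I=[0,1)$. A flex $\{P_t\}_{t\in I}$ of $P_0$ is a family of polyhedra $P_t=f_t(|K|)$ with the same $K$, with $f_t$ depending continuously on $t$, such that, for every $t\in I\setminus\{0\}$, $f_t$ and $f_0$ are congruent on every simplex of $K$ (they differ there by an isometry of $\mathbb R^d$), but $f_t$ and $f_0$ are not congruent on the whole of $|K|$. $P_0$ is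 flexible if it has a flex $\{P_t\}_{t\in[0,1]}$. Lemma 2. Let $d\ge 3$, $\varepsilon>0$, and let $P_0$ be an embedded flexible polyhedron in $\mathbb R^d$. Then there are an embedded flexible polyhedron $\widetilde P_0\subset\mathbb R^d$ and a flex $\{\widetilde P_s\}_{s\in[0,1)}$ of it such that ($\widetilde\alpha$) the simplicial complex of $\widetilde P_0$ is a subdivision of the simplicial complex of $P_0$; ($\widetilde\beta$) the Hausdorff distance between $\widetilde P_0$ and $P_0$ is less than $\varepsilon$; ($\widetilde\gamma$) for every $s\in(0,1)$, $\widetilde P_s$ is an embedded polyhedron; moreover, there is a $(d-2)$-face $\widetilde x_0$ of $\widetilde P_0$ such that, writing $\widetilde y_s$ for the face of $\widetilde P_s$ corresponding to a face $\widetilde y_0$ of $\widetilde P_0$ (the image of the same simplex): ($\widetilde\gamma_1$) the interior dihedral angle $\varphi(\widetilde x_s)$ of $\widetilde P_s$ at $\widetilde x_s$ tends to $0$ as $s\to1$; ($\widetilde\gamma_2$) there are constants $0<\widetilde m<\widetilde M<2\pi$ such that $\widetilde m<\varphi(\widetilde y_s)<\widetilde M$ for every $(d-2)$-face $\widetilde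 y_0\ne\widetilde x_0$ of $\widetilde P_0$ and every $s\in[0,1)$. -/

import Mathlib

open Set Filter Topology

namespace FlexPoly

section Polyhedra

variable {V V' : Type*} [Fintype V] [Fintype V']

/-- The geometric realization `|K|` of a finite simplicial complex `K`, in barycentric
coordinates: the nonnegative weights of total mass `1` that vanish outside some simplex. -/
def realization (K : AbstractSimplicialComplex V) : Set (V → ℝ) :=
  {w | (∀ v, 0 ≤ w v) ∧ ∑ v, w v = 1 ∧ ∃ σ ∈ K, ∀ v, v ∉ σ → w v = 0}

/-- The map given by the images `f v` of the vertices and affine on every simplex. -/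
noncomputable def affExtend {M : Type*} [AddCommGroup M] [Module ℝ M] (f : V → M) (w : V → ℝ) : M :=
  ∑ v, w v • f v

/-- `K` is a boundary-free complex of dimension `d - 1`, i.e. a closed strongly connected
pseudomanifold. A simplex of dimension `k` is a set of `k + 1` vertices. -/
structure IsClosedComplex (d : ℕ) (K : AbstractSimplicialComplex V) : Prop where
  nonempty : Nonempty V
  /-- every simplex lies in a `(d - 1)`-dimensional one -/
  pure : ∀ σ ∈ K, ∃ τ ∈ K, τ.card = d ∧ σ ⊆ τ
  /-- every `(d - 2)`-simplex lies in exactly two `(d - 1)`-simplices -/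
  boundary_free : ∀ σ ∈ K, σ.card + 1 = d → {τ | τ ∈ K ∧ τ.card = d ∧ σ ⊆ τ}.ncard = 2
  /-- any two `(d - 1)`-simplices are joined by a chain of `(d - 1)`-simplices in which
  neighbours share a `(d - 2)`-simplex -/
  strongly_connected : ∀ σ ∈ K, ∀ τ ∈ K, σ.card = d → τ.card = d →
    Relation.ReflTransGen (fun a b : Finset V =>
      (a ∈ K ∧ a.card = d) ∧ (b ∈ K ∧ b.card = d) ∧
        ∃ ρ ∈ K, ρ.card + 1 = d ∧ ρ ⊆ a ∧ ρ ⊆ b) σ τ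

/-- `K'` is a subdivision of `K`: the vertices of `K'` can be placed at points of `|K|` so that
every simplex of `K'` lies in a simplex of `K` and `|K'|` is mapped bijectively onto `|K|`. -/
def IsSubdivision (K' : AbstractSimplicialComplex V') (K : AbstractSimplicialComplex V) : Prop :=
  ∃ g : V' → (V → ℝ),
    (∀ σ ∈ K', ∃ τ ∈ K, ∀ v ∈ σ, ∀ u, u ∉ τ → g v u = 0) ∧
    BijOn (affExtend g) (realization K') (realization K)

variable {d : ℕ}

/-- The polyhedron, as a subset of `ℝ^d`, with the vertices `f v`. -/
def polyhedron (K : AbstractSimplicialComplex V) (f : V → EuclideanSpace ℝ (Fin d)) :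
    Set (EuclideanSpace ℝ (Fin d)) :=
  affExtend f '' realization K

/-- The polyhedron is embedded: the piecewise affine map is injective on `|K|`. -/
def IsEmbedded (K : AbstractSimplicialComplex V) (f : V → EuclideanSpace ℝ (Fin d)) : Prop :=
  InjOn (affExtend f) (realization K)

/-- `F t`, `t ∈ I`, is a flex of the polyhedron `F 0`: a continuous family of polyhedra with the
same complex whose faces stay congruent to those of `F 0`, and none of which, for `t ≠ 0`, is
congruent to `F 0` as a whole. -/
structure IsFlex (K : AbstractSimplicialComplex V) (I : Set ℝ)
    (F : ℝ → V → EuclideanSpace ℝ (Fin d)) : Prop where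
  continuousOn : ∀ v, ContinuousOn (fun t => F t v) I
  face_congruent : ∀ t ∈ I, ∀ σ ∈ K, Congruent (fun v : σ => F t v) (fun v : σ => F 0 v)
  not_congruent : ∀ t ∈ I, t ≠ 0 → ¬ Congruent (F t) (F 0)

/-- The polyhedron with vertices `f v` is flexible. -/
def IsFlexible (K : AbstractSimplicialComplex V) (f : V → EuclideanSpace ℝ (Fin d)) : Prop :=
  ∃ F : ℝ → V → EuclideanSpace ℝ (Fin d), F 0 = f ∧ IsFlex K (Icc 0 1) F

/-- `D` is the bounded domain with boundary `P`. -/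
structure IsDomainBoundedBy (D P : Set (EuclideanSpace ℝ (Fin d))) : Prop where
  isOpen : IsOpen D
  isConnected : IsConnected D
  isBounded : Bornology.IsBounded D
  frontier_eq : frontier D = P

/-- `φ` is the interior dihedral angle of the domain `D` at the `(d - 2)`-dimensional simplex with
vertices `f v`, `v ∈ σ`: near every point `p` of the relative interior of the simplex, `D` is the
open wedge of angle `φ ∈ (0, 2π)` whose edge is the affine hull of the simplex. The orthonormal
vectors `e₁, e₂` span the orthogonal complement of the direction of the simplex. -/
def IsInteriorDihedralAngle (D : Set (EuclideanSpace ℝ (Fin d)))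
    (f : V → EuclideanSpace ℝ (Fin d)) (σ : Finset V) (φ : ℝ) : Prop :=
  0 < φ ∧ φ < 2 * Real.pi ∧
  ∃ e₁ e₂ : EuclideanSpace ℝ (Fin d),
    ‖e₁‖ = 1 ∧ ‖e₂‖ = 1 ∧ inner ℝ e₁ e₂ = 0 ∧
    (∀ u ∈ σ, ∀ v ∈ σ, inner ℝ (f u - f v) e₁ = 0 ∧ inner ℝ (f u - f v) e₂ = 0) ∧
    ∀ w : V → ℝ, (∀ v ∈ σ, 0 < w v) → ∑ v ∈ σ, w v = 1 →
      ∀ p, p = ∑ v ∈ σ, w v • f v →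
        ∀ᶠ q in 𝓝 p, q ∈ D ↔
          ∃ ρ θ : ℝ, 0 < ρ ∧ 0 < θ ∧ θ < φ ∧
            inner ℝ (q - p) e₁ = ρ * Real.cos θ ∧ inner ℝ (q - p) e₂ = ρ * Real.sin θ

end Polyhedra

end FlexPoly

open FlexPoly

namespace FlexPoly

/-! ### Signed barycentric weights and pairs of simplices -/

section Weights

variable {V : Type*} [Fintype V] {M : Type*} [AddCommGroup M] [Module ℝ M]

/-! The flex is turned into one that closes a single hinge, and two low tents at this hinge then use
up the angle that is left.

The hinge. Embeddedness is an open condition on the vertices (`Separated.perturb`), so it persists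
near `t = 0`. If no distance between the two vertices opposite a ridge changed there, the
deformation would be a rigid motion (`congruent_of_ridge_dist_eq`). Hence the cosine of the angle at
some ridge `x`, with facets `x ∪ {a}` and `x ∪ {b}`, is not constant. A stretch of the flex on which
this cosine passes between two values inside `(-1, 1)`, run in the suitable direction, has an
interior angle `φ` at `x` with `φ 1 < φ t` for all `t < 1` (`exists_isHingeFlex`).

The tents. The facet `x ∪ {a}` is replaced by the cone over its boundary whose apex lies at a small
distance from the barycentre of `x`, in the direction that makes the angle `α` with this facet
inside the wedge. The apex is rigidly attached to the facet, so the flex extends. The angle at `x`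
becomes `φ - α`, and the new complex is a subdivision. A tent needs `α < π`, whereas `φ 1` may be
`π` or more; so two tents with `α = φ 1 / 2` are erected, the second on the facet of the first one
at `x`. The final angle `φ - φ 1` is positive before time `1` and tends to `0`
(`IsHingeFlex.exists_tent`, `IsHingeFlex.exists_closing`). At time `1` the hinge has closed up, but
two facets adjacent along any other ridge still meet properly. By compactness of `[0, 1]` the
cosines at these ridges stay below some `k < 1`, which keeps the angles away from `0` and `2π`
(`exists_cos_le`, `IsHingeFlex.exists_angles`).

The interior. The bounded domain is built by counting modulo 2 the facets crossed by the segment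
from a far away point (`exists_isInside`). The count jumps across facets; its two level sets off the
polyhedron are connected because one can travel along a chain of facets, passing through a wedge at
each ridge (`IsInside.isPreconnected`). The count is stable under small deformations
(`IsInside.exists_stable`), so the interior stays on one side of the hinge during the motion; it is
unchanged beyond a tent (`IsInside.eq_tent`), so the wedge that remains is still the interior one.

Throughout, embeddedness is used in the linear form `Compat` and in the quantitative form
`Separated`, whose constant `c` controls the size of all neighbourhoods and the height of the tents.
-/

theorem affExtend_eq_linearCombination (f : V → M) (w : V → ℝ) :
    affExtend f w = Fintype.linearCombination ℝ f w := rfl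

theorem affExtend_add (f : V → M) (w w' : V → ℝ) :
    affExtend f (w + w') = affExtend f w + affExtend f w' := by
  simp only [affExtend_eq_linearCombination, map_add]

theorem affExtend_sub (f : V → M) (w w' : V → ℝ) :
    affExtend f (w - w') = affExtend f w - affExtend f w' := by
  simp only [affExtend_eq_linearCombination, map_sub]

theorem affExtend_neg (f : V → M) (w : V → ℝ) : affExtend f (-w) = -affExtend f w := by
  simp only [affExtend_eq_linearCombination, map_neg]

theorem affExtend_smul (f : V → M) (c : ℝ) (w : V → ℝ) :
    affExtend f (c • w) = c • affExtend f w := by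
  simp only [affExtend_eq_linearCombination, map_smul]

@[simp]
theorem affExtend_zero (f : V → M) : affExtend f 0 = 0 := by
  simp only [affExtend_eq_linearCombination, map_zero]

theorem affExtend_single [DecidableEq V] (f : V → M) (v : V) (c : ℝ) :
    affExtend f (Pi.single v c) = c • f v := by
  simp [affExtend_eq_linearCombination]

theorem affExtend_eq_sum_of_support (f : V → M) {σ : Finset V} {w : V → ℝ}
    (hw : ∀ v ∉ σ, w v = 0) : affExtend f w = ∑ v ∈ σ, w v • f v := by
  unfold affExtend
  symm
  apply Finset.sum_subset (Finset.subset_univ _)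
  intro v _ hv
  simp [hw v hv]

theorem sum_eq_of_support {σ : Finset V} {w : V → ℝ}
    (hw : ∀ v ∉ σ, w v = 0) : ∑ v, w v = ∑ v ∈ σ, w v := by
  symm
  apply Finset.sum_subset (Finset.subset_univ _)
  intro v _ hv
  simp [hw v hv]

theorem affExtend_sub_const (f : V → M) (z : M) (w : V → ℝ) :
    affExtend (fun v => f v - z) w = affExtend f w - (∑ v, w v) • z := by
  simp [affExtend, smul_sub, Finset.sum_sub_distrib, Finset.sum_smul]

/-- Weights of total mass zero supported in `σ`; they describe the vectors parallel to the
simplex `σ`. -/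
def balanced (σ : Finset V) : Submodule ℝ (V → ℝ) where
  carrier := {δ | ∑ v, δ v = 0 ∧ ∀ v ∉ σ, δ v = 0}
  add_mem' := by
    rintro a b ⟨ha, ha'⟩ ⟨hb, hb'⟩
    refine ⟨by simp [Finset.sum_add_distrib, ha, hb], fun v hv => by simp [ha' v hv, hb' v hv]⟩
  zero_mem' := by simp
  smul_mem' := by
    rintro c a ⟨ha, ha'⟩
    refine ⟨by simp [← Finset.mul_sum, ha], fun v hv => by simp [ha' v hv]⟩

theorem balanced_mono {σ τ : Finset V} (h : σ ⊆ τ) : balanced (V := V) σ ≤ balanced τ :=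
  fun _ hδ => ⟨hδ.1, fun v hv => hδ.2 v fun hv' => hv (h hv')⟩

theorem single_sub_single_mem_balanced [DecidableEq V] {σ : Finset V} {u v : V} (hu : u ∈ σ)
    (hv : v ∈ σ) : (Pi.single u 1 - Pi.single v 1 : V → ℝ) ∈ balanced σ := by
  refine ⟨by simp, fun w hw => ?_⟩
  have h1 : w ≠ u := fun h => hw (h ▸ hu)
  have h2 : w ≠ v := fun h => hw (h ▸ hv)
  simp [h1, h2]

theorem sub_mem_balanced {σ : Finset V} {w w' : V → ℝ} (h : ∑ v, w v = ∑ v, w' v)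
    (hw : ∀ v ∉ σ, w v = 0) (hw' : ∀ v ∉ σ, w' v = 0) : w - w' ∈ balanced σ :=
  ⟨by simp [Finset.sum_sub_distrib, h], fun v hv => by simp [hw v hv, hw' v hv]⟩

/-- The simplices `σ` and `τ` meet only in their common face and are nondegenerate: a signed
combination of total mass zero, positive only on `σ` and negative only on `τ`, that is mapped to
zero has to vanish. -/
def Compat (f : V → M) (σ τ : Finset V) : Prop :=
  ∀ δ : V → ℝ, ∑ v, δ v = 0 → (∀ v ∉ σ, δ v ≤ 0) → (∀ v ∉ τ, 0 ≤ δ v) →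
    affExtend f δ = 0 → δ = 0

theorem Compat.symm {f : V → M} {σ τ : Finset V} (h : Compat f σ τ) : Compat f τ σ := by
  intro δ h0 h1 h2 h3
  have := h (-δ) (by simp [h0]) (fun v hv => by simpa using h2 v hv)
    (fun v hv => by simpa using h1 v hv) (by rw [affExtend_neg, h3, neg_zero])
  simpa using this

theorem Compat.mono {f : V → M} {σ τ σ' τ' : Finset V} (h : Compat f σ τ) (h1 : σ' ⊆ σ)
    (h2 : τ' ⊆ τ) : Compat f σ' τ' := fun δ h0 hs ht =>
  h δ h0 (fun v hv => hs v fun hv' => hv (h1 hv')) (fun v hv => ht v fun hv' => hv (h2 hv'))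

theorem Compat.eq_zero_of_balanced {f : V → M} {σ : Finset V} (h : Compat f σ σ) {δ : V → ℝ}
    (hδ : δ ∈ balanced σ) (h0 : affExtend f δ = 0) : δ = 0 :=
  h δ hδ.1 (fun v hv => (hδ.2 v hv).le) (fun v hv => (hδ.2 v hv).ge) h0

theorem Compat.affineIndependent {f : V → M} {σ : Finset V} (h : Compat f σ σ) :
    AffineIndependent ℝ (fun v : σ => f v) := by
  classical
  rw [affineIndependent_iff]
  intro s w hw h0
  set δ : V → ℝ := fun v => if hv : v ∈ σ then (if (⟨v, hv⟩ : σ) ∈ s then w ⟨v, hv⟩ else 0) else 0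
    with hδ
  have hsupp : ∀ v ∉ σ, δ v = 0 := fun v hv => by simp [hδ, hv]
  have hval : ∀ v : σ, δ v = if v ∈ s then w v else 0 := fun v => by simp [hδ]
  have h1 : ∑ v, δ v = 0 := by
    rw [sum_eq_of_support hsupp, ← Finset.sum_coe_sort]
    simp only [hval]
    rw [Finset.sum_ite_mem, Finset.univ_inter]
    exact hw
  have h2 : affExtend f δ = 0 := by
    rw [affExtend_eq_sum_of_support f hsupp, ← Finset.sum_coe_sort]
    simp only [hval, ite_smul, zero_smul]
    rw [Finset.sum_ite_mem, Finset.univ_inter]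
    exact h0
  have := h.eq_zero_of_balanced ⟨h1, hsupp⟩ h2
  intro e he
  have h3 := hval e
  rw [this] at h3
  simpa [he] using h3.symm

end Weights

/-! ### Quantitative embeddedness, inner products from edge lengths, directions of simplices -/

section Embedded

variable {V : Type*} [Fintype V] {d : ℕ}

/-- The difference of two points of `|K|` has the sign pattern of `Compat`. Conversely, the positive
and the negative part of such a signed weight, normalised, are two points of `|K|` with the same
image. -/
theorem isEmbedded_iff_compat {K : AbstractSimplicialComplex V}
    {f : V → EuclideanSpace ℝ (Fin d)} :
    IsEmbedded K f ↔ ∀ σ ∈ K, ∀ τ ∈ K, Compat f σ τ := by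
  constructor
  · intro h σ hσ τ hτ δ h0 hp hn hz
    by_contra hne
    -- The positive and the negative mass agree since `δ` has total mass zero, so one factor `S⁻¹`
    -- normalises both parts.
    set S := ∑ v, max (δ v) 0 with hS
    have hS' : S = ∑ v, max (-δ v) 0 := by
      have : ∀ v, max (δ v) 0 = δ v + max (-δ v) 0 := fun v => by
        rcases le_total (δ v) 0 with hv | hv
        · rw [max_eq_right hv, max_eq_left (by linarith)]; ring
        · rw [max_eq_left hv, max_eq_right (by linarith)]; ring
      rw [hS, Finset.sum_congr rfl fun v _ => this v, Finset.sum_add_distrib, h0, zero_add]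
    have hSpos : 0 < S := by
      by_contra hcon
      have hS0 : S = 0 := le_antisymm (not_lt.1 hcon)
        (Finset.sum_nonneg fun v _ => le_max_right _ _)
      apply hne
      have e1 := (Finset.sum_eq_zero_iff_of_nonneg fun v _ => le_max_right (δ v) 0).1 hS0
      have e2 := (Finset.sum_eq_zero_iff_of_nonneg fun v _ => le_max_right (-δ v) 0).1
        (hS'.symm.trans hS0)
      funext v
      have := e1 v (Finset.mem_univ _)
      have := e2 v (Finset.mem_univ _)
      have := le_max_left (δ v) 0
      have := le_max_left (-δ v) 0
      simp only [Pi.zero_apply]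
      linarith
    set w : V → ℝ := fun v => S⁻¹ * max (δ v) 0 with hw
    set w' : V → ℝ := fun v => S⁻¹ * max (-δ v) 0 with hw'
    have hwr : w ∈ realization K := by
      refine ⟨fun v => mul_nonneg (inv_nonneg.2 hSpos.le) (le_max_right _ _), ?_, σ, hσ, ?_⟩
      · rw [← Finset.mul_sum, ← hS, inv_mul_cancel₀ hSpos.ne']
      · intro v hv
        simp [hw, max_eq_right (hp v hv)]
    have hwr' : w' ∈ realization K := by
      refine ⟨fun v => mul_nonneg (inv_nonneg.2 hSpos.le) (le_max_right _ _), ?_, τ, hτ, ?_⟩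
      · rw [← Finset.mul_sum, ← hS', inv_mul_cancel₀ hSpos.ne']
      · intro v hv
        have := hn v hv
        simp [hw', max_eq_right (show -δ v ≤ 0 by linarith)]
    have hdiff : w - w' = S⁻¹ • δ := by
      funext v
      simp only [hw, hw', Pi.sub_apply, Pi.smul_apply, smul_eq_mul, ← mul_sub]
      congr 1
      rcases le_total (δ v) 0 with hv | hv
      · rw [max_eq_right hv, max_eq_left (by linarith)]; ring
      · rw [max_eq_left hv, max_eq_right (by linarith)]; ring
    have heq : w = w' := by
      apply h hwr hwr'
      rw [← sub_eq_zero, ← affExtend_sub, hdiff, affExtend_smul, hz, smul_zero]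
    rw [heq, sub_self] at hdiff
    exact hne ((smul_eq_zero.1 hdiff.symm).resolve_left (inv_ne_zero hSpos.ne'))
  · rintro h w ⟨hw0, hw1, σ, hσ, hwσ⟩ w' ⟨hw0', hw1', τ, hτ, hwτ⟩ heq
    have := h σ hσ τ hτ (w - w') (by simp [Finset.sum_sub_distrib, hw1, hw1'])
      (fun v hv => by simpa [hwσ v hv] using hw0' v)
      (fun v hv => by simpa [hwτ v hv] using hw0 v)
      (by rw [affExtend_sub, heq, sub_self])
    exact sub_eq_zero.1 this

/-- A quantitative form of embeddedness: the piecewise affine map expands the `ℓ¹`-distance of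
barycentric coordinates at least by the factor `c`. -/
def Separated (K : AbstractSimplicialComplex V) (f : V → EuclideanSpace ℝ (Fin d)) (c : ℝ) : Prop :=
  0 < c ∧ ∀ σ ∈ K, ∀ τ ∈ K, ∀ δ : V → ℝ, ∑ v, δ v = 0 → (∀ v ∉ σ, δ v ≤ 0) →
    (∀ v ∉ τ, 0 ≤ δ v) → c * ∑ v, |δ v| ≤ ‖affExtend f δ‖

theorem continuousOn_affExtend {X : Type*} [TopologicalSpace X] {T : Set X}
    {F : X → V → EuclideanSpace ℝ (Fin d)} {w : X → V → ℝ}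
    (hF : ∀ v, ContinuousOn (fun t => F t v) T) (hw : ∀ v, ContinuousOn (fun t => w t v) T) :
    ContinuousOn (fun t => affExtend (F t) (w t)) T := by
  unfold affExtend
  exact continuousOn_finsetSum _ fun v _ => (hw v).smul (hF v)

theorem norm_affExtend_le (f : V → EuclideanSpace ℝ (Fin d)) {C : ℝ} (hC : ∀ v, ‖f v‖ ≤ C)
    (w : V → ℝ) : ‖affExtend f w‖ ≤ C * ∑ v, |w v| := by
  unfold affExtend
  refine (norm_sum_le _ _).trans ?_
  rw [Finset.mul_sum]
  refine Finset.sum_le_sum fun v _ => ?_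
  rw [norm_smul, Real.norm_eq_abs, mul_comm]
  exact mul_le_mul_of_nonneg_right (hC v) (abs_nonneg _)

/-- By homogeneity only weights of `ℓ¹`-norm one matter. These form a compact set, on which the norm
of the image, jointly continuous in time and weight, attains a positive minimum. -/
theorem exists_uniform_lower_bound {X : Type*} [TopologicalSpace X] {T : Set X}
    (hT : IsCompact T) {F : X → V → EuclideanSpace ℝ (Fin d)}
    (hF : ∀ v, ContinuousOn (fun t => F t v) T) {C : Set (V → ℝ)} (hC : IsClosed C)
    (hsmul : ∀ δ ∈ C, ∀ r : ℝ, 0 < r → r • δ ∈ C)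
    (h : ∀ t ∈ T, ∀ δ ∈ C, affExtend (F t) δ = 0 → δ = 0) :
    ∃ c : ℝ, 0 < c ∧ ∀ t ∈ T, ∀ δ ∈ C, c * ∑ v, |δ v| ≤ ‖affExtend (F t) δ‖ := by
  set N : Set (V → ℝ) := {δ | ∑ v, |δ v| = 1} with hN
  have hNc : IsCompact N := by
    apply Metric.isCompact_of_isClosed_isBounded
    · exact isClosed_eq (by fun_prop) continuous_const
    · apply (Metric.isBounded_closedBall (x := (0 : V → ℝ)) (r := 1)).subset
      intro δ hδ
      rw [mem_closedBall_zero_iff, pi_norm_le_iff_of_nonneg zero_le_one]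
      intro v
      rw [← show ∑ v, |δ v| = 1 from hδ]
      exact Finset.single_le_sum (f := fun v => |δ v|) (fun v _ => abs_nonneg _)
        (Finset.mem_univ v)
  have hcomp : IsCompact (T ×ˢ (N ∩ C)) := hT.prod (hNc.inter_right hC)
  have hscale : ∀ c : ℝ, (∀ t ∈ T, ∀ δ ∈ N ∩ C, c ≤ ‖affExtend (F t) δ‖) →
      ∀ t ∈ T, ∀ δ ∈ C, c * ∑ v, |δ v| ≤ ‖affExtend (F t) δ‖ := by
    intro c hc t ht δ hδ
    rcases (Finset.sum_nonneg fun v _ => abs_nonneg (δ v) : 0 ≤ ∑ v, |δ v|).eq_or_lt with h0 | h0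
    · rw [← h0, mul_zero]; exact norm_nonneg _
    · set S := ∑ v, |δ v|
      have := hc t ht (S⁻¹ • δ) ⟨by
        simp only [hN, mem_ofPred_eq, Pi.smul_apply, smul_eq_mul, abs_mul, ← Finset.mul_sum,
          abs_of_pos (inv_pos.2 h0)]
        exact inv_mul_cancel₀ h0.ne', hsmul δ hδ _ (inv_pos.2 h0)⟩
      rw [affExtend_smul, norm_smul, Real.norm_eq_abs, abs_of_pos (inv_pos.2 h0),
        inv_mul_eq_div, le_div_iff₀ h0] at this
      exact this
  rcases (T ×ˢ (N ∩ C)).eq_empty_or_nonempty with he | hne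
  · refine ⟨1, one_pos, hscale 1 fun t ht δ hδ => ?_⟩
    have : (t, δ) ∈ T ×ˢ (N ∩ C) := ⟨ht, hδ⟩
    rw [he] at this
    exact this.elim
  · have hcont : ContinuousOn (fun x : X × (V → ℝ) => ‖affExtend (F x.1) x.2‖)
        (T ×ˢ (N ∩ C)) := by
      have h1 : ∀ v, ContinuousOn (fun x : X × (V → ℝ) => F x.1 v) (T ×ˢ (N ∩ C)) := fun v =>
        (hF v).comp continuousOn_fst fun x hx => hx.1
      have h2 : ∀ v, ContinuousOn (fun x : X × (V → ℝ) => x.2 v) (T ×ˢ (N ∩ C)) := fun v =>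
        ((continuous_apply v).comp continuous_snd).continuousOn
      exact (continuousOn_finsetSum _ fun v _ => (h2 v).smul (h1 v)).norm
    obtain ⟨⟨t₀, δ₀⟩, ⟨ht₀, hδN, hδC⟩, hmin⟩ := hcomp.exists_isMinOn hne hcont
    refine ⟨‖affExtend (F t₀) δ₀‖, ?_, hscale _ fun t ht δ hδ => ?_⟩
    · rw [norm_pos_iff]
      intro h0
      have := h t₀ ht₀ δ₀ hδC h0
      subst this
      simp [hN] at hδN
    · exact isMinOn_iff.1 hmin (t, δ) (Set.mk_mem_prod ht hδ)

theorem exists_separated_of_compact {X : Type*} [TopologicalSpace X] {T : Set X}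
    (hT : IsCompact T) {K : AbstractSimplicialComplex V}
    {F : X → V → EuclideanSpace ℝ (Fin d)}
    (hF : ∀ v, ContinuousOn (fun t => F t v) T) (h : ∀ t ∈ T, IsEmbedded K (F t)) :
    ∃ c : ℝ, 0 < c ∧ ∀ t ∈ T, Separated K (F t) c := by
  classical
  -- Pairs not made of simplices of `K` get the dummy constant `1`, so that the minimum can be taken
  -- over all pairs of vertex sets.
  have key : ∀ p : Finset V × Finset V, ∃ c : ℝ, 0 < c ∧ (p.1 ∈ K → p.2 ∈ K → ∀ t ∈ T,
      ∀ δ : V → ℝ, ∑ v, δ v = 0 → (∀ v ∉ p.1, δ v ≤ 0) →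
        (∀ v ∉ p.2, 0 ≤ δ v) → c * ∑ v, |δ v| ≤ ‖affExtend (F t) δ‖) := by
    rintro ⟨σ, τ⟩
    by_cases hσ : σ ∈ K
    swap
    · exact ⟨1, one_pos, fun h => (hσ h).elim⟩
    by_cases hτ : τ ∈ K
    swap
    · exact ⟨1, one_pos, fun _ h => (hτ h).elim⟩
    obtain ⟨c, hc, hc'⟩ := exists_uniform_lower_bound (C := {δ : V → ℝ | ∑ v, δ v = 0 ∧
      (∀ v ∉ σ, δ v ≤ 0) ∧ (∀ v ∉ τ, 0 ≤ δ v)}) hT hF (by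
        simp only [ofPred_and, ofPred_forall]
        refine (isClosed_eq (by fun_prop) continuous_const).inter (IsClosed.inter ?_ ?_)
        · exact isClosed_iInter fun v => isClosed_iInter fun _ =>
            isClosed_le (continuous_apply v) continuous_const
        · exact isClosed_iInter fun v => isClosed_iInter fun _ =>
            isClosed_le continuous_const (continuous_apply v))
      (by
        rintro δ ⟨h0, h1, h2⟩ r hr
        refine ⟨by simp [← Finset.mul_sum, h0], fun v hv => ?_, fun v hv => ?_⟩
        · exact mul_nonpos_of_nonneg_of_nonpos hr.le (h1 v hv)
        · exact mul_nonneg hr.le (h2 v hv))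
      (fun t ht δ hδ h0 => isEmbedded_iff_compat.1 (h t ht) σ hσ τ hτ δ hδ.1 hδ.2.1 hδ.2.2 h0)
    exact ⟨c, hc, fun _ _ t ht δ h0 h1 h2 => hc' t ht δ ⟨h0, h1, h2⟩⟩
  choose c hc hc' using key
  obtain ⟨p₀, -, hp₀⟩ := (Finset.univ : Finset (Finset V × Finset V)).exists_min_image c
    ⟨(∅, ∅), Finset.mem_univ _⟩
  refine ⟨c p₀, hc p₀, fun t ht => ⟨hc p₀, fun σ hσ τ hτ δ h0 h1 h2 => ?_⟩⟩
  refine le_trans ?_ (hc' (σ, τ) hσ hτ t ht δ h0 h1 h2)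
  exact mul_le_mul_of_nonneg_right (hp₀ _ (Finset.mem_univ _))
    (Finset.sum_nonneg fun v _ => abs_nonneg _)

theorem exists_separated {K : AbstractSimplicialComplex V}
    {f : V → EuclideanSpace ℝ (Fin d)} (h : IsEmbedded K f) : ∃ c : ℝ, Separated K f c := by
  obtain ⟨c, -, hc⟩ := exists_separated_of_compact (X := Unit) (T := univ) isCompact_univ
    (F := fun _ => f) (K := K) (fun v => continuousOn_const) (fun _ _ => h)
  exact ⟨c, hc () trivial⟩

theorem Separated.isEmbedded {K : AbstractSimplicialComplex V}
    {f : V → EuclideanSpace ℝ (Fin d)} {c : ℝ} (h : Separated K f c) : IsEmbedded K f := by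
  rw [isEmbedded_iff_compat]
  intro σ hσ τ hτ δ h0 h1 h2 h3
  have := h.2 σ hσ τ hτ δ h0 h1 h2
  rw [h3, norm_zero] at this
  have h4 : ∑ v, |δ v| ≤ 0 := by
    by_contra hcon
    exact absurd this (not_le.2 (mul_pos h.1 (not_le.1 hcon)))
  have h5 := (Finset.sum_eq_zero_iff_of_nonneg fun v _ => abs_nonneg (δ v)).1
    (le_antisymm h4 (Finset.sum_nonneg fun v _ => abs_nonneg _))
  funext v
  simpa using h5 v (Finset.mem_univ _)

theorem Separated.norm_balanced {K : AbstractSimplicialComplex V}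
    {f : V → EuclideanSpace ℝ (Fin d)} {c : ℝ} (h : Separated K f c) {σ : Finset V} (hσ : σ ∈ K)
    {δ : V → ℝ} (hδ : δ ∈ balanced σ) : c * ∑ v, |δ v| ≤ ‖affExtend f δ‖ :=
  h.2 σ hσ σ hσ δ hδ.1 (fun v hv => (hδ.2 v hv).le) (fun v hv => (hδ.2 v hv).ge)

theorem Separated.dist_le {K : AbstractSimplicialComplex V}
    {f : V → EuclideanSpace ℝ (Fin d)} {c : ℝ} (h : Separated K f c) {w w' : V → ℝ}
    (hw : w ∈ realization K) (hw' : w' ∈ realization K) :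
    c * ∑ v, |w v - w' v| ≤ ‖affExtend f w - affExtend f w'‖ := by
  obtain ⟨hw0, hw1, σ, hσ, hwσ⟩ := hw
  obtain ⟨hw0', hw1', τ, hτ, hwτ⟩ := hw'
  have := h.2 σ hσ τ hτ (w - w') (by simp [Finset.sum_sub_distrib, hw1, hw1'])
    (fun v hv => by simpa [hwσ v hv] using hw0' v)
    (fun v hv => by simpa [hwτ v hv] using hw0 v)
  rwa [affExtend_sub] at this

/-- Expanding `dist ^ 2`, the terms `‖f u‖ ^ 2` are annihilated by the zero total masses. Hence
inner products of vectors inside a simplex depend on its edge lengths only and are preserved by a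
flex. -/
theorem inner_affExtend_of_sum_eq_zero (f : V → EuclideanSpace ℝ (Fin d)) {δ δ' : V → ℝ}
    (hδ : ∑ v, δ v = 0) (hδ' : ∑ v, δ' v = 0) :
    inner ℝ (affExtend f δ) (affExtend f δ') =
      -(1 / 2) * ∑ u, ∑ v, δ u * δ' v * dist (f u) (f v) ^ 2 := by
  have h1 : ∀ u v, δ u * δ' v * dist (f u) (f v) ^ 2 =
      (δ u * ‖f u‖ ^ 2) * δ' v + δ u * (δ' v * ‖f v‖ ^ 2)
        - 2 * (δ u * (δ' v * inner ℝ (f u) (f v))) := by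
    intro u v
    rw [dist_eq_norm, norm_sub_sq_real]
    ring
  simp only [h1, Finset.sum_sub_distrib, Finset.sum_add_distrib, ← Finset.mul_sum,
    hδ', mul_zero, zero_add]
  rw [← Finset.sum_mul, hδ, zero_mul]
  simp only [affExtend, sum_inner, inner_sum, real_inner_smul_left, real_inner_smul_right]
  rw [Finset.sum_comm]
  simp only [Finset.mul_sum]
  rw [zero_sub, ← Finset.sum_neg_distrib, Finset.mul_sum]
  refine Finset.sum_congr rfl fun u _ => ?_
  rw [← Finset.sum_neg_distrib, Finset.mul_sum]
  refine Finset.sum_congr rfl fun v _ => ?_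
  ring

theorem inner_affExtend_eq_of_dist_eq {f g : V → EuclideanSpace ℝ (Fin d)} {δ δ' : V → ℝ}
    (hδ : ∑ v, δ v = 0) (hδ' : ∑ v, δ' v = 0)
    (h : ∀ u v, δ u ≠ 0 → δ' v ≠ 0 → dist (f u) (f v) = dist (g u) (g v)) :
    inner ℝ (affExtend f δ) (affExtend f δ') = inner ℝ (affExtend g δ) (affExtend g δ') := by
  rw [inner_affExtend_of_sum_eq_zero f hδ hδ', inner_affExtend_of_sum_eq_zero g hδ hδ']
  congr 1
  refine Finset.sum_congr rfl fun u _ => Finset.sum_congr rfl fun v _ => ?_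
  by_cases hu : δ u = 0
  · simp [hu]
  by_cases hv : δ' v = 0
  · simp [hv]
  rw [h u v hu hv]

theorem inner_affExtend_eq_of_balanced {f g : V → EuclideanSpace ℝ (Fin d)} {σ : Finset V}
    {δ δ' : V → ℝ} (hδ : δ ∈ balanced σ) (hδ' : δ' ∈ balanced σ)
    (h : ∀ u ∈ σ, ∀ v ∈ σ, dist (f u) (f v) = dist (g u) (g v)) :
    inner ℝ (affExtend f δ) (affExtend f δ') = inner ℝ (affExtend g δ) (affExtend g δ') :=
  inner_affExtend_eq_of_dist_eq hδ.1 hδ'.1 fun u v hu hv =>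
    h u (by_contra fun hh => hu (hδ.2 u hh)) v (by_contra fun hh => hv (hδ'.2 v hh))

/-- The vectors parallel to the simplex with vertices `f v`, `v ∈ σ`. -/
noncomputable def direction (f : V → EuclideanSpace ℝ (Fin d)) (σ : Finset V) :
    Submodule ℝ (EuclideanSpace ℝ (Fin d)) :=
  (balanced σ).map (Fintype.linearCombination ℝ f)

theorem mem_direction {f : V → EuclideanSpace ℝ (Fin d)} {σ : Finset V}
    {x : EuclideanSpace ℝ (Fin d)} :
    x ∈ direction f σ ↔ ∃ δ ∈ balanced σ, affExtend f δ = x := Iff.rfl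

theorem sub_mem_direction {f : V → EuclideanSpace ℝ (Fin d)} {σ : Finset V} {u v : V}
    (hu : u ∈ σ) (hv : v ∈ σ) : f u - f v ∈ direction f σ := by
  classical
  refine mem_direction.2 ⟨_, single_sub_single_mem_balanced hu hv, ?_⟩
  simp [affExtend_sub, affExtend_single]

theorem inner_direction_eq_zero {f : V → EuclideanSpace ℝ (Fin d)} {σ : Finset V}
    {n : EuclideanSpace ℝ (Fin d)} (hn : ∀ u ∈ σ, ∀ v ∈ σ, inner ℝ (f u - f v) n = 0)
    {δ : V → ℝ} (hδ : δ ∈ balanced σ) : inner ℝ (affExtend f δ) n = 0 := by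
  classical
  rcases σ.eq_empty_or_nonempty with rfl | ⟨v₀, hv₀⟩
  · have : δ = 0 := funext fun v => hδ.2 v (by simp)
    simp [this]
  have h1 : affExtend f δ = affExtend (fun v => f v - f v₀) δ := by
    rw [affExtend_sub_const, hδ.1, zero_smul, sub_zero]
  rw [h1, affExtend_eq_sum_of_support _ hδ.2, sum_inner]
  refine Finset.sum_eq_zero fun v hv => ?_
  rw [real_inner_smul_left, hn v hv v₀ hv₀, mul_zero]

/-- The foot of the perpendicular is recorded by weights `l`, possibly negative, so that the same
`l` can be used for every position of a moving simplex. -/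
theorem exists_orthogonal_foot (f : V → EuclideanSpace ℝ (Fin d)) {σ : Finset V}
    (hσ : σ.Nonempty) (z : EuclideanSpace ℝ (Fin d)) :
    ∃ l : V → ℝ, ∑ v, l v = 1 ∧ (∀ v ∉ σ, l v = 0) ∧
      ∀ δ ∈ balanced σ, inner ℝ (affExtend f δ) (z - affExtend f l) = 0 := by
  classical
  obtain ⟨v₀, hv₀⟩ := hσ
  obtain ⟨δ₀, hδ₀, hδ₀'⟩ := mem_direction.1
    ((direction f σ).starProjection_apply_mem (z - f v₀))
  refine ⟨Pi.single v₀ 1 + δ₀, ?_, ?_, ?_⟩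
  · simp [Finset.sum_add_distrib, hδ₀.1]
  · intro v hv
    have : v ≠ v₀ := fun h => hv (h ▸ hv₀)
    simp [this, hδ₀.2 v hv]
  · intro δ hδ
    have := Submodule.starProjection_inner_eq_zero (K := direction f σ) (z - f v₀)
      (affExtend f δ) (mem_direction.2 ⟨δ, hδ, rfl⟩)
    rw [real_inner_comm, affExtend_add, affExtend_single, one_smul, hδ₀', ← sub_sub]
    exact this

theorem finrank_direction_ge {f : V → EuclideanSpace ℝ (Fin d)} {σ : Finset V}
    (h : Compat f σ σ) {k : ℕ} (hk : σ.card = k + 1) : k ≤ Module.finrank ℝ (direction f σ) := by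
  have h1 := h.affineIndependent.finrank_vectorSpan (n := k) (by simpa using hk)
  rw [← h1]
  apply Submodule.finrank_mono
  rw [vectorSpan_def, Submodule.span_le]
  rintro _ ⟨_, ⟨u, rfl⟩, _, ⟨v, rfl⟩, rfl⟩
  exact sub_mem_direction u.2 v.2

/-- Dimension count: the direction space has dimension at least `k` and lies in the orthogonal
complement of `S`, whose dimension is at most `k`. -/
theorem mem_direction_of_orthogonal {f : V → EuclideanSpace ℝ (Fin d)} {σ : Finset V}
    (h : Compat f σ σ) {k : ℕ} (hk : σ.card = k + 1)
    {S : Submodule ℝ (EuclideanSpace ℝ (Fin d))} (hS : d ≤ k + Module.finrank ℝ S)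
    (hortho : ∀ δ ∈ balanced σ, ∀ n ∈ S, inner ℝ (affExtend f δ) n = 0)
    {x : EuclideanSpace ℝ (Fin d)} (hx : ∀ n ∈ S, inner ℝ x n = 0) : x ∈ direction f σ := by
  have h1 : direction f σ = Sᗮ := by
    apply Submodule.eq_of_le_of_finrank_le
    · rintro _ ⟨δ, hδ, rfl⟩
      rw [Submodule.mem_orthogonal']
      exact fun n hn => hortho δ hδ n hn
    · have h2 := S.finrank_add_finrank_orthogonal
      rw [finrank_euclideanSpace, Fintype.card_fin] at h2
      have h3 := finrank_direction_ge h hk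
      omega
  rw [h1, Submodule.mem_orthogonal']
  exact hx

theorem mem_direction_of_orthogonal_normal {f : V → EuclideanSpace ℝ (Fin d)} {σ : Finset V}
    (h : Compat f σ σ) (hσ : σ.card = d) (hd : 0 < d) {n : EuclideanSpace ℝ (Fin d)} (hn0 : n ≠ 0)
    (hn : ∀ δ ∈ balanced σ, inner ℝ (affExtend f δ) n = 0)
    {x : EuclideanSpace ℝ (Fin d)} (hx : inner ℝ x n = 0) : x ∈ direction f σ := by
  apply mem_direction_of_orthogonal h (k := d - 1) (by omega) (S := Submodule.span ℝ {n})
  · rw [finrank_span_singleton hn0]; omega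
  · intro δ hδ m hm
    obtain ⟨c, rfl⟩ := Submodule.mem_span_singleton.1 hm
    rw [real_inner_smul_right, hn δ hδ, mul_zero]
  · intro m hm
    obtain ⟨c, rfl⟩ := Submodule.mem_span_singleton.1 hm
    rw [real_inner_smul_right, hx, mul_zero]

theorem mem_direction_of_orthogonal_pair {f : V → EuclideanSpace ℝ (Fin d)} {σ : Finset V}
    (h : Compat f σ σ) (hσ : σ.card + 1 = d) (hd : 1 < d) {e₁ e₂ : EuclideanSpace ℝ (Fin d)}
    (h1 : ‖e₁‖ = 1) (h2 : ‖e₂‖ = 1) (h12 : inner ℝ e₁ e₂ = 0)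
    (he₁ : ∀ δ ∈ balanced σ, inner ℝ (affExtend f δ) e₁ = 0)
    (he₂ : ∀ δ ∈ balanced σ, inner ℝ (affExtend f δ) e₂ = 0)
    {x : EuclideanSpace ℝ (Fin d)} (hx₁ : inner ℝ x e₁ = 0) (hx₂ : inner ℝ x e₂ = 0) :
    x ∈ direction f σ := by
  have hon : Orthonormal ℝ ![e₁, e₂] := by
    rw [orthonormal_iff_ite]
    intro i j
    fin_cases i <;> fin_cases j <;> simp [h1, h2, h12, real_inner_comm]
  apply mem_direction_of_orthogonal h (k := d - 2) (by omega)
    (S := Submodule.span ℝ (Set.range ![e₁, e₂]))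
  · rw [finrank_span_eq_card hon.linearIndependent]
    simp only [Fintype.card_fin]
    omega
  · intro δ hδ m hm
    induction hm using Submodule.span_induction with
    | mem m hm =>
      obtain ⟨i, rfl⟩ := hm
      fin_cases i
      · exact he₁ δ hδ
      · exact he₂ δ hδ
    | zero => simp
    | add a b _ _ ha hb => rw [inner_add_right, ha, hb, add_zero]
    | smul c a _ ha => rw [real_inner_smul_right, ha, mul_zero]
  · intro m hm
    induction hm using Submodule.span_induction with
    | mem m hm =>
      obtain ⟨i, rfl⟩ := hm
      fin_cases i
      · exact hx₁
      · exact hx₂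
    | zero => simp
    | add a b _ _ ha hb => rw [inner_add_right, ha, hb, add_zero]
    | smul c a _ ha => rw [real_inner_smul_right, ha, mul_zero]

end Embedded


/-! ### General position, local constancy and parity -/

section Generic

/-- The complement of a level set of a nonzero functional is open and dense, because a line on which
the functional is not constant meets the level set at most once. Zero functionals are exempted, so
families indexed by all vertex sets need no case distinction. -/
theorem exists_mem_forall_apply_ne {E : Type*} [NormedAddCommGroup E] [NormedSpace ℝ E]
    [FiniteDimensional ℝ E] {ι : Type*} [Finite ι] (l : ι → E →ₗ[ℝ] ℝ) (c : ι → ℝ) {U : Set E}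
    (hU : IsOpen U) (hne : U.Nonempty) : ∃ q ∈ U, ∀ i, l i ≠ 0 → l i q ≠ c i := by
  have : CompleteSpace E := FiniteDimensional.complete ℝ E
  have h1 : ∀ i, IsOpen {q | l i ≠ 0 → l i q ≠ c i} := by
    intro i
    by_cases hi : l i = 0
    · simp [hi]
    · simp only [ne_eq, hi, not_false_eq_true, true_implies]
      exact (isClosed_eq (l i).continuous_of_finiteDimensional continuous_const).isOpen_compl
  have h2 : ∀ i, Dense {q | l i ≠ 0 → l i q ≠ c i} := by
    intro i
    by_cases hi : l i = 0
    · simp [hi]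
    · simp only [ne_eq, hi, not_false_eq_true, true_implies]
      obtain ⟨x, hx⟩ : ∃ x, l i x ≠ 0 := by
        by_contra hcon
        push Not at hcon
        exact hi (LinearMap.ext hcon)
      intro q
      rw [mem_closure_iff_frequently]
      have ht : Tendsto (fun s : ℝ => q + s • x) (𝓝[≠] 0) (𝓝 q) := by
        have : ContinuousAt (fun s : ℝ => q + s • x) 0 := by fun_prop
        have := this.tendsto
        simp only [zero_smul, add_zero] at this
        exact this.mono_left nhdsWithin_le_nhds
      apply ht.frequently
      have hsub : {s : ℝ | l i (q + s • x) = c i}.Subsingleton := by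
        intro s hs s' hs'
        simp only [mem_ofPred_eq, map_add, map_smul, smul_eq_mul] at hs hs'
        have : s * l i x = s' * l i x := by linarith
        exact mul_right_cancel₀ hx this
      have h3 : ∀ᶠ s : ℝ in 𝓝[≠] 0, l i (q + s • x) ≠ c i := by
        rcases hsub.eq_empty_or_singleton with he | ⟨s₀, hs₀⟩
        · refine Eventually.of_forall fun s hs => ?_
          have : s ∈ {s : ℝ | l i (q + s • x) = c i} := hs
          rw [he] at this
          exact this
        · by_cases h0 : s₀ = 0
          · filter_upwards [self_mem_nhdsWithin] with s hs hs'
            have : s ∈ {s : ℝ | l i (q + s • x) = c i} := hs'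
            rw [hs₀] at this
            exact hs (by rw [mem_singleton_iff.1 this, h0]; rfl)
          · have : ∀ᶠ s : ℝ in 𝓝 0, s ≠ s₀ := isOpen_ne.mem_nhds (Ne.symm h0)
            filter_upwards [nhdsWithin_le_nhds this] with s hs hs'
            have : s ∈ {s : ℝ | l i (q + s • x) = c i} := hs'
            rw [hs₀] at this
            exact hs this
      exact h3.frequently
  obtain ⟨q, hqU, hq⟩ := (dense_iInter_of_isOpen h1 h2).inter_open_nonempty U hU hne
  exact ⟨q, hqU, fun i => mem_iInter.1 hq i⟩

theorem eq_of_isPreconnected {X α : Type*} [TopologicalSpace X] {s : Set X}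
    (hs : IsPreconnected s) {h : X → α} (hh : ∀ x ∈ s, ∀ᶠ y in 𝓝 x, h y = h x) {x y : X}
    (hx : x ∈ s) (hy : y ∈ s) : h x = h y := by
  -- For the discrete topology on `α` local constancy is continuity.
  let _ : TopologicalSpace α := ⊥
  have : DiscreteTopology α := ⟨rfl⟩
  refine hs.constant (f := h) (fun z hz => ?_) hx hy
  apply ContinuousAt.continuousWithinAt
  rw [ContinuousAt, nhds_discrete α, tendsto_pure]
  exact hh z hz

/-- The function may take exceptional values at isolated parameters, but its limit along punctured
neighbourhoods is locally constant on `[0, 1]` and agrees with `h` at both ends. -/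
theorem eq_of_eventually_const_punctured {α : Type*} {h : ℝ → α}
    (hh : ∀ r ∈ Icc (0 : ℝ) 1, ∃ a, ∀ᶠ s in 𝓝[≠] r, h s = a)
    (h0 : ∀ᶠ s in 𝓝 0, h s = h 0) (h1 : ∀ᶠ s in 𝓝 1, h s = h 1) : h 0 = h 1 := by
  have hh' : ∀ r : Icc (0 : ℝ) 1, ∃ a, ∀ᶠ s in 𝓝[≠] (r : ℝ), h s = a := fun r => hh r r.2
  choose a ha using hh'
  have uniq : ∀ (r : Icc (0 : ℝ) 1) b, (∀ᶠ s in 𝓝[≠] (r : ℝ), h s = b) → a r = b := by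
    intro r b hb
    obtain ⟨s, hs, hs'⟩ := ((ha r).and hb).exists
    exact hs.symm.trans hs'
  have hloc : ∀ r ∈ (univ : Set (Icc (0 : ℝ) 1)), ∀ᶠ r' in 𝓝 r, a r' = a r := by
    intro r _
    have h2 := eventually_eventually_nhdsWithin.2 (ha r)
    rw [eventually_nhdsWithin_iff] at h2
    have h3 := (continuous_subtype_val (p := fun x => x ∈ Icc (0 : ℝ) 1)).continuousAt
      (x := r) |>.eventually h2
    filter_upwards [h3] with r' hr'
    by_cases he : r' = r
    · rw [he]
    · have hne : (r' : ℝ) ≠ r := fun hcon => he (Subtype.ext hcon)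
      apply uniq
      have := hr' hne
      rw [(isOpen_compl_singleton.nhdsWithin_eq hne)] at this
      exact nhdsWithin_le_nhds this
  have e := eq_of_isPreconnected (isPreconnected_univ (α := Icc (0 : ℝ) 1)) hloc
    (mem_univ (⟨0, by simp⟩ : Icc (0 : ℝ) 1)) (mem_univ (⟨1, by simp⟩ : Icc (0 : ℝ) 1))
  rw [uniq ⟨0, by simp⟩ (h 0) (nhdsWithin_le_nhds h0),
    uniq ⟨1, by simp⟩ (h 1) (nhdsWithin_le_nhds h1)] at e
  exact e

/-- The unique partner defines an involution without fixed points, so the terms cancel in pairs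
modulo 2. -/
theorem card_even_of_symmetric_pairing {α : Type*} (s : Finset α) (R : α → α → Prop)
    (hsymm : ∀ a b, R a b → R b a) (hirr : ∀ a, ¬ R a a)
    (hex : ∀ a ∈ s, ∃ b ∈ s, R a b) (huniq : ∀ a ∈ s, ∀ b c, R a b → R a c → b = c) :
    ∑ _a ∈ s, (1 : ZMod 2) = 0 := by
  choose g hgs hgR using hex
  refine Finset.sum_involution g (fun _ _ => by decide) (fun a ha _ h => ?_) hgs
    (fun a ha => ?_)
  · have := hgR a ha
    rw [h] at this
    exact hirr a this
  · exact huniq _ (hgs a ha) _ _ (hgR _ (hgs a ha)) (hsymm _ _ (hgR a ha))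

end Generic

/-! ### Facets of a closed complex -/

section Complex

variable {V : Type*} {d : ℕ} {K : AbstractSimplicialComplex V}

theorem face_of_subset {σ τ : Finset V} (hτ : τ ∈ K)
    (h : σ ⊆ τ) (hne : σ.Nonempty) : σ ∈ K :=
  (K.isRelLowerSet_faces hτ).2 h hne

theorem face_nonempty {σ : Finset V} (hσ : σ ∈ K) :
    σ.Nonempty :=
  (K.isRelLowerSet_faces hσ).1

theorem IsClosedComplex.card_le (hK : IsClosedComplex d K) {σ : Finset V} (hσ : σ ∈ K) :
    σ.card ≤ d := by
  obtain ⟨τ, -, hτ, h⟩ := hK.pure σ hσ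
  exact hτ ▸ Finset.card_le_card h

theorem IsClosedComplex.eq_of_subset (hK : IsClosedComplex d K) {A τ : Finset V} (hτ : τ ∈ K)
    (hA : A.card = d) (h : A ⊆ τ) : τ = A :=
  (Finset.eq_of_subset_of_card_le h (hA ▸ hK.card_le hτ)).symm

theorem IsClosedComplex.exists_other_facet (hK : IsClosedComplex d K) {y τ : Finset V}
    (hy : y ∈ K) (hyd : y.card + 1 = d) (hτ : τ ∈ K) (hτd : τ.card = d) (hyτ : y ⊆ τ) :
    ∃ τ' ∈ K, τ'.card = d ∧ y ⊆ τ' ∧ τ' ≠ τ ∧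
      ∀ ρ ∈ K, ρ.card = d → y ⊆ ρ → ρ = τ ∨ ρ = τ' := by
  obtain ⟨α, β, hne, hαβ⟩ := Set.ncard_eq_two.1 (hK.boundary_free y hy hyd)
  have hα : α ∈ {τ | τ ∈ K ∧ τ.card = d ∧ y ⊆ τ} := hαβ ▸ Or.inl rfl
  have hβ : β ∈ {τ | τ ∈ K ∧ τ.card = d ∧ y ⊆ τ} := hαβ ▸ Or.inr rfl
  have hτ' : τ ∈ ({α, β} : Set (Finset V)) := hαβ ▸ ⟨hτ, hτd, hyτ⟩
  rcases hτ' with rfl | hτ'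
  · refine ⟨β, hβ.1, hβ.2.1, hβ.2.2, hne.symm, fun ρ h1 h2 h3 => ?_⟩
    have : ρ ∈ ({τ, β} : Set (Finset V)) := hαβ ▸ ⟨h1, h2, h3⟩
    exact this
  · rw [mem_singleton_iff] at hτ'
    subst hτ'
    refine ⟨α, hα.1, hα.2.1, hα.2.2, hne, fun ρ h1 h2 h3 => ?_⟩
    have : ρ ∈ ({α, τ} : Set (Finset V)) := hαβ ▸ ⟨h1, h2, h3⟩
    exact this.symm

/-- The `(d - 1)`-dimensional simplices. -/
noncomputable def facets [Fintype V] (d : ℕ) (K : AbstractSimplicialComplex V) : Finset (Finset V) := by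
  classical exact Finset.univ.filter fun τ => τ ∈ K ∧ τ.card = d

theorem mem_facets [Fintype V] {τ : Finset V} : τ ∈ facets d K ↔ τ ∈ K ∧ τ.card = d := by
  simp [facets]

end Complex

/-! ### Cones over the facets and points in general position -/

section Crossings

variable {V : Type*} [Fintype V] {d : ℕ} {K : AbstractSimplicialComplex V}
  {g : V → EuclideanSpace ℝ (Fin d)}

/-- The vectors `g v`, `v ∈ τ`, are linearly independent. -/
def ConeIndep (g : V → EuclideanSpace ℝ (Fin d)) (τ : Finset V) : Prop :=
  ∀ w : V → ℝ, (∀ v ∉ τ, w v = 0) → affExtend g w = 0 → w = 0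

/-- `μ τ` gives the coordinates with respect to the basis `g v`, `v ∈ τ`, of `ℝ^d`. -/
structure IsConeCoord (K : AbstractSimplicialComplex V) (g : V → EuclideanSpace ℝ (Fin d))
    (μ : Finset V → EuclideanSpace ℝ (Fin d) →ₗ[ℝ] (V → ℝ)) : Prop where
  supp : ∀ τ ∈ facets d K, ∀ z, ∀ v ∉ τ, μ τ z v = 0
  affExtend_eq : ∀ τ ∈ facets d K, ∀ z, affExtend g (μ τ z) = z
  unique : ∀ τ ∈ facets d K, ∀ w : V → ℝ, (∀ v ∉ τ, w v = 0) → μ τ (affExtend g w) = w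

theorem exists_isConeCoord (hd : 0 < d) (h : ∀ τ ∈ facets d K, ConeIndep g τ) :
    ∃ μ, IsConeCoord K g μ := by
  classical
  have key : ∀ τ, ∃ m : EuclideanSpace ℝ (Fin d) →ₗ[ℝ] (V → ℝ), τ ∈ facets d K →
      (∀ z, ∀ v ∉ τ, m z v = 0) ∧ (∀ z, affExtend g (m z) = z) ∧
      ∀ w : V → ℝ, (∀ v ∉ τ, w v = 0) → m (affExtend g w) = w := by
    intro τ
    by_cases hτ : τ ∈ facets d K
    swap
    · exact ⟨0, fun h => (hτ h).elim⟩
    have hli : LinearIndependent ℝ (fun v : τ => g v) := by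
      rw [Fintype.linearIndependent_iff]
      intro c hc i
      set w : V → ℝ := fun v => if hv : v ∈ τ then c ⟨v, hv⟩ else 0 with hw
      have hws : ∀ v ∉ τ, w v = 0 := fun v hv => by simp [hw, hv]
      have := h τ hτ w hws (by
        rw [affExtend_eq_sum_of_support g hws, ← Finset.sum_coe_sort]
        simpa [hw] using hc)
      have := congrFun this i
      simpa [hw] using this
    have hcard : τ.card = d := (mem_facets.1 hτ).2
    have : Nonempty τ := (Finset.card_pos.1 (hcard ▸ hd)).to_subtype
    set b := basisOfLinearIndependentOfCardEqFinrank hli (by simp [hcard]) with hb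
    have hbv : ∀ v, b v = g v := fun v => by simp [hb]
    set m : EuclideanSpace ℝ (Fin d) →ₗ[ℝ] (V → ℝ) :=
      LinearMap.pi fun v => if hv : v ∈ τ then b.coord ⟨v, hv⟩ else 0 with hm
    have hms : ∀ z, ∀ v ∉ τ, m z v = 0 := fun z v hv => by simp [hm, hv]
    have hmv : ∀ z, ∀ v : τ, m z v = b.repr z v := fun z v => by simp [hm]
    have hma : ∀ z, affExtend g (m z) = z := by
      intro z
      rw [affExtend_eq_sum_of_support g (hms z), ← Finset.sum_coe_sort]
      simp only [hmv, ← hbv]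
      exact b.sum_repr z
    refine ⟨m, fun _ => ⟨hms, hma, fun w hw => ?_⟩⟩
    rw [← sub_eq_zero]
    apply h τ hτ
    · intro v hv
      simp [hms _ v hv, hw v hv]
    · rw [affExtend_sub, hma, sub_self]
  choose μ hμ using key
  exact ⟨μ, fun τ hτ => (hμ τ hτ).1, fun τ hτ => (hμ τ hτ).2.1, fun τ hτ => (hμ τ hτ).2.2⟩

variable {μ : Finset V → EuclideanSpace ℝ (Fin d) →ₗ[ℝ] (V → ℝ)}

/-- The segment from the origin to `q` crosses the relative interior of the simplex `τ`. -/
def Crosses (μ : Finset V → EuclideanSpace ℝ (Fin d) →ₗ[ℝ] (V → ℝ)) (τ : Finset V)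
    (q : EuclideanSpace ℝ (Fin d)) : Prop :=
  (∀ v ∈ τ, 0 < μ τ q v) ∧ 1 < ∑ v, μ τ q v

open Classical in
/-- The number modulo `2` of the facets crossed by the segment from the origin to `q`. -/
noncomputable def crossings (K : AbstractSimplicialComplex V)
    (μ : Finset V → EuclideanSpace ℝ (Fin d) →ₗ[ℝ] (V → ℝ))
    (q : EuclideanSpace ℝ (Fin d)) : ZMod 2 :=
  ∑ τ ∈ facets d K, if Crosses μ τ q then 1 else 0

/-- The line through the origin and `q` avoids the `(d - 2)`-dimensional simplices. -/
def Generic (K : AbstractSimplicialComplex V)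
    (μ : Finset V → EuclideanSpace ℝ (Fin d) →ₗ[ℝ] (V → ℝ))
    (q : EuclideanSpace ℝ (Fin d)) : Prop :=
  ∀ τ ∈ facets d K, ∀ v ∈ τ, μ τ q v ≠ 0

theorem continuous_coneCoord {V : Type*}
    {μ : Finset V → EuclideanSpace ℝ (Fin d) →ₗ[ℝ] (V → ℝ)} (τ : Finset V) (v : V) : Continuous fun q => μ τ q v :=
  ((LinearMap.proj v).comp (μ τ)).continuous_of_finiteDimensional

theorem IsConeCoord.apply_vertex [DecidableEq V] (hμ : IsConeCoord K g μ) {τ : Finset V}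
    (hτ : τ ∈ facets d K) {v : V} (hv : v ∈ τ) : μ τ (g v) = Pi.single v 1 := by
  have h := hμ.unique τ hτ (Pi.single v 1) (fun u hu => by
    have : u ≠ v := fun h => hu (h ▸ hv)
    simp [this])
  rwa [affExtend_single, one_smul] at h

theorem IsConeCoord.mem_polyhedron (hμ : IsConeCoord K g μ) {τ : Finset V}
    (hτ : τ ∈ facets d K) {q : EuclideanSpace ℝ (Fin d)} (h0 : ∀ v ∈ τ, 0 ≤ μ τ q v)
    (h1 : ∑ v, μ τ q v = 1) : q ∈ polyhedron K g := by
  refine ⟨μ τ q, ⟨fun v => ?_, h1, τ, (mem_facets.1 hτ).1, hμ.supp τ hτ q⟩,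
    hμ.affExtend_eq τ hτ q⟩
  by_cases hv : v ∈ τ
  · exact h0 v hv
  · rw [hμ.supp τ hτ q v hv]

/-- The condition on the products says that no combination of `qᵢ` and `q` other than zero has two
vanishing coordinates in one facet. So the segment from `qᵢ` to `q` meets the boundary of a cone
over a facet only in the cones over its ridges. One `q` serves both points. -/
theorem exists_generic (hμ : IsConeCoord K g μ) {U : Set (EuclideanSpace ℝ (Fin d))}
    (hU : IsOpen U) (hne : U.Nonempty) {q₁ q₂ : EuclideanSpace ℝ (Fin d)}
    (h₁ : Generic K μ q₁) (h₂ : Generic K μ q₂) :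
    ∃ q ∈ U, Generic K μ q ∧ ∀ τ ∈ facets d K, ∀ v ∈ τ, ∀ w ∈ τ, v ≠ w →
      μ τ q₁ v * μ τ q w ≠ μ τ q₁ w * μ τ q v ∧ μ τ q₂ v * μ τ q w ≠ μ τ q₂ w * μ τ q v := by
  classical
  set cf : Finset V → V → EuclideanSpace ℝ (Fin d) →ₗ[ℝ] ℝ :=
    fun τ v => (LinearMap.proj v).comp (μ τ) with hcf
  have hcf' : ∀ τ v q, cf τ v q = μ τ q v := fun τ v q => rfl
  obtain ⟨q, hqU, hq⟩ := exists_mem_forall_apply_ne (ι := (Finset V × V × V) × Fin 3)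
    (fun i => ![cf i.1.1 i.1.2.1,
      μ i.1.1 q₁ i.1.2.1 • cf i.1.1 i.1.2.2 - μ i.1.1 q₁ i.1.2.2 • cf i.1.1 i.1.2.1,
      μ i.1.1 q₂ i.1.2.1 • cf i.1.1 i.1.2.2 - μ i.1.1 q₂ i.1.2.2 • cf i.1.1 i.1.2.1] i.2)
    (fun _ => 0) hU hne
  -- Evaluation at the vertex `g w` shows that the functional is not zero, since its value there is
  -- the coordinate of `q'` at `v`.
  have hgp : ∀ q' : EuclideanSpace ℝ (Fin d), Generic K μ q' → ∀ τ ∈ facets d K, ∀ v ∈ τ,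
      ∀ w ∈ τ, v ≠ w → μ τ q' v • cf τ w - μ τ q' w • cf τ v ≠ 0 := by
    intro q' hq' τ hτ v hv w hw hvw h0
    have := LinearMap.congr_fun h0 (g w)
    simp only [LinearMap.sub_apply, LinearMap.smul_apply, hcf', hμ.apply_vertex hτ hw,
      LinearMap.zero_apply] at this
    simp [hvw] at this
    exact hq' τ hτ v hv this
  refine ⟨q, hqU, fun τ hτ v hv => ?_, fun τ hτ v hv w hw hvw => ⟨?_, ?_⟩⟩
  · refine hq ((τ, v, v), 0) fun h0 => ?_
    have := LinearMap.congr_fun h0 (g v)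
    simp [hcf', hμ.apply_vertex hτ hv] at this
  · have := hq ((τ, v, w), 1) (hgp q₁ h₁ τ hτ v hv w hw hvw)
    intro h
    apply this
    simp [hcf', h]
  · have := hq ((τ, v, w), 2) (hgp q₂ h₂ τ hτ v hv w hw hvw)
    intro h
    apply this
    simp [hcf', h]

theorem exists_generic' (hμ : IsConeCoord K g μ) {U : Set (EuclideanSpace ℝ (Fin d))}
    (hU : IsOpen U) (hne : U.Nonempty) : ∃ q ∈ U, Generic K μ q := by
  classical
  obtain ⟨q, hqU, hq⟩ := exists_mem_forall_apply_ne (ι := Finset V × V)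
    (fun i => (LinearMap.proj i.2).comp (μ i.1)) (fun _ => 0) hU hne
  refine ⟨q, hqU, fun τ hτ v hv => hq (τ, v) fun h0 => ?_⟩
  have := LinearMap.congr_fun h0 (g v)
  simp [hμ.apply_vertex hτ hv] at this

end Crossings


/-! ### Invariance of the crossing parity off the polyhedron -/

section Parity

variable {V : Type*} [Fintype V] {d : ℕ} {K : AbstractSimplicialComplex V}
  {g : V → EuclideanSpace ℝ (Fin d)} {μ : Finset V → EuclideanSpace ℝ (Fin d) →ₗ[ℝ] (V → ℝ)}

/-- The segment from the origin to `q` crosses the relative interior of a `(d - 2)`-dimensional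
face of the simplex `τ`. -/
def Touches (μ : Finset V → EuclideanSpace ℝ (Fin d) →ₗ[ℝ] (V → ℝ)) (τ : Finset V)
    (q : EuclideanSpace ℝ (Fin d)) : Prop :=
  (∀ v ∈ τ, 0 ≤ μ τ q v) ∧ (∃ v ∈ τ, μ τ q v = 0) ∧ 1 < ∑ v, μ τ q v

-- A touched facet has exactly one vanishing coordinate, so it determines a ridge. The only other
-- facet through this ridge is touched as well, at the same point. Touched facets thus come in
-- pairs.
open Classical in
theorem sum_touches_eq_zero (hd : 2 ≤ d) (hK : IsClosedComplex d K) (hμ : IsConeCoord K g μ)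
    {q : EuclideanSpace ℝ (Fin d)}
    (hq : ∀ τ ∈ facets d K, ∀ v ∈ τ, ∀ w ∈ τ, μ τ q v = 0 → μ τ q w = 0 → v = w) :
    (∑ τ ∈ facets d K, if Touches μ τ q then (1 : ZMod 2) else 0) = 0 := by
  rw [← Finset.sum_filter]
  refine card_even_of_symmetric_pairing _ (fun τ τ' => τ ≠ τ' ∧ (τ ∈ facets d K ∧
    Touches μ τ q) ∧ (τ' ∈ facets d K ∧ Touches μ τ' q) ∧ ∃ y ∈ K, y.card + 1 = d ∧ y ⊆ τ ∧
      y ⊆ τ' ∧ ∀ u ∈ y, 0 < μ τ q u ∧ 0 < μ τ' q u) ?_ ?_ ?_ ?_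
  · rintro τ τ' ⟨hne, h1, h2, y, hy, hyd, hy1, hy2, hp⟩
    exact ⟨hne.symm, h2, h1, y, hy, hyd, hy2, hy1, fun u hu => (hp u hu).symm⟩
  · rintro τ ⟨hne, -⟩
    exact hne rfl
  · intro τ hτ
    obtain ⟨hτf, hτt⟩ := Finset.mem_filter.1 hτ
    obtain ⟨hpos, ⟨v, hv, hv0⟩, hsum⟩ := hτt
    obtain ⟨hτK, hτd⟩ := mem_facets.1 hτf
    have hyd : (τ.erase v).card + 1 = d := by rw [Finset.card_erase_add_one hv, hτd]
    have hyK : τ.erase v ∈ K := face_of_subset hτK (Finset.erase_subset _ _)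
      (Finset.card_pos.1 (by omega))
    obtain ⟨τ', hτ'K, hτ'd, hyτ', hne, -⟩ :=
      hK.exists_other_facet hyK hyd hτK hτd (Finset.erase_subset _ _)
    have hτ'f : τ' ∈ facets d K := mem_facets.2 ⟨hτ'K, hτ'd⟩
    have hsupp : ∀ u ∉ τ.erase v, μ τ q u = 0 := by
      intro u hu
      by_cases huv : u = v
      · rw [huv, hv0]
      · exact hμ.supp τ hτf q u fun h => hu (Finset.mem_erase.2 ⟨huv, h⟩)
    -- The coordinates of `q` are supported on the common ridge, so they are its coordinates in both
    -- facets.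
    have heq : μ τ' q = μ τ q := by
      have := hμ.unique τ' hτ'f (μ τ q) fun u hu => hsupp u fun h => hu (hyτ' h)
      rwa [hμ.affExtend_eq τ hτf] at this
    have hypos : ∀ u ∈ τ.erase v, 0 < μ τ q u := by
      intro u hu
      obtain ⟨huv, huτ⟩ := Finset.mem_erase.1 hu
      exact (hpos u huτ).lt_of_ne fun h => huv (hq τ hτf u huτ v hv h.symm hv0)
    have htouch : Touches μ τ' q := by
      refine ⟨fun u hu => ?_, ?_, by rw [heq]; exact hsum⟩
      · rw [heq]
        by_cases hu' : u ∈ τ.erase v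
        · exact (hypos u hu').le
        · exact (hsupp u hu').ge
      · obtain ⟨u, hu, hu'⟩ := Finset.exists_mem_notMem_of_card_lt_card
          (s := τ.erase v) (t := τ') (by omega)
        exact ⟨u, hu, by rw [heq]; exact hsupp u hu'⟩
    refine ⟨τ', Finset.mem_filter.2 ⟨hτ'f, htouch⟩, hne.symm, ⟨hτf, hpos, ⟨v, hv, hv0⟩, hsum⟩,
      ⟨hτ'f, htouch⟩, τ.erase v, hyK, hyd, Finset.erase_subset _ _, hyτ', fun u hu => ?_⟩
    rw [heq]
    exact ⟨hypos u hu, hypos u hu⟩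
  · rintro τ hτ τ₁ τ₂ ⟨hne₁, h1, h2, y, hy, hyd, hyτ, hyτ₁, hp⟩
      ⟨hne₂, -, h2', y', hy', hyd', hyτ', hyτ₂, hp'⟩
    obtain ⟨hτf, hτt⟩ := Finset.mem_filter.1 hτ
    obtain ⟨hpos, ⟨v, hv, hv0⟩, hsum⟩ := hτt
    obtain ⟨hτK, hτd⟩ := mem_facets.1 hτf
    have key : ∀ z : Finset V, z.card + 1 = d → z ⊆ τ → (∀ u ∈ z, 0 < μ τ q u) →
        z = τ.erase v := by
      intro z hz hzτ hzp
      apply Finset.eq_of_subset_of_card_le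
      · intro u hu
        refine Finset.mem_erase.2 ⟨fun h => ?_, hzτ hu⟩
        have := hzp u hu
        rw [h, hv0] at this
        exact lt_irrefl _ this
      · have := Finset.card_erase_add_one hv
        omega
    have hyy : y = y' := (key y hyd hyτ fun u hu => (hp u hu).1).trans
      (key y' hyd' hyτ' fun u hu => (hp' u hu).1).symm
    subst hyy
    obtain ⟨ρ, -, -, -, -, huniq⟩ := hK.exists_other_facet hy hyd hτK hτd hyτ
    rw [mem_facets] at h2 h2'
    rcases huniq τ₁ h2.1.1 h2.1.2 hyτ₁ with h | h
    · exact absurd h.symm hne₁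
    · rcases huniq τ₂ h2'.1.1 h2'.1.2 hyτ₂ with h' | h'
      · exact absurd h'.symm hne₂
      · rw [h, h']

-- Off the polyhedron the indicator of a crossing can change only when a coordinate changes sign
-- while the others are positive and the sum exceeds one, that is, when the facet is touched. Modulo
-- 2 appearing and disappearing are the same change.
open Classical in
theorem eventually_crosses_of_line {τ : Finset V} {q₁ q₂ : EuclideanSpace ℝ (Fin d)} {r₀ : ℝ}
    (hq₁ : ∀ v ∈ τ, μ τ q₁ v ≠ 0)
    (hgp : ∀ v ∈ τ, ∀ w ∈ τ, v ≠ w → μ τ q₁ v * μ τ q₂ w ≠ μ τ q₁ w * μ τ q₂ v)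
    (hoff : (∀ v ∈ τ, 0 ≤ μ τ (q₁ + r₀ • (q₂ - q₁)) v) →
      ∑ v, μ τ (q₁ + r₀ • (q₂ - q₁)) v ≠ 1) :
    ∃ a : ZMod 2, (∀ᶠ r in 𝓝[<] r₀, (if Crosses μ τ (q₁ + r • (q₂ - q₁)) then 1 else 0) = a) ∧
      (∀ᶠ r in 𝓝[>] r₀, (if Crosses μ τ (q₁ + r • (q₂ - q₁)) then 1 else 0) =
        a + if Touches μ τ (q₁ + r₀ • (q₂ - q₁)) then 1 else 0) := by
  set p : ℝ → EuclideanSpace ℝ (Fin d) := fun r => q₁ + r • (q₂ - q₁) with hp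
  have hpc : Continuous p := by fun_prop
  have hc : ∀ v, Continuous fun r => μ τ (p r) v := fun v => (continuous_coneCoord τ v).comp hpc
  have hsc : Continuous fun r => ∑ v, μ τ (p r) v := continuous_finsetSum _ fun v _ => hc v
  have hval : ∀ v r, μ τ (p r) v = μ τ q₁ v + r * (μ τ q₂ v - μ τ q₁ v) := by
    intro v r
    simp [hp]
  have hconst : ∀ b : Prop, ¬ Touches μ τ (p r₀) → (∀ᶠ r in 𝓝 r₀, Crosses μ τ (p r) ↔ b) →
      ∃ a : ZMod 2, (∀ᶠ r in 𝓝[<] r₀, (if Crosses μ τ (p r) then 1 else 0) = a) ∧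
      (∀ᶠ r in 𝓝[>] r₀, (if Crosses μ τ (p r) then 1 else 0) =
        a + if Touches μ τ (p r₀) then 1 else 0) := by
    intro b hnt hb
    refine ⟨if b then 1 else 0, ?_, ?_⟩
    · filter_upwards [nhdsWithin_le_nhds hb] with r hr
      simp only [hr]
    · filter_upwards [nhdsWithin_le_nhds hb] with r hr
      simp only [hr, hnt, if_false, add_zero]
  by_cases hneg : ∃ v ∈ τ, μ τ (p r₀) v < 0
  · obtain ⟨v, hv, hv0⟩ := hneg
    refine hconst False (fun h => absurd (h.1 v hv) (not_le.2 hv0)) ?_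
    filter_upwards [(hc v).continuousAt.eventually_lt continuousAt_const hv0] with r hr
    exact iff_false_intro fun h => lt_asymm (h.1 v hv) hr
  push Not at hneg
  rcases lt_or_gt_of_ne (hoff hneg) with hlt | hgt
  · refine hconst False (fun h => lt_asymm h.2.2 hlt) ?_
    filter_upwards [hsc.continuousAt.eventually_lt continuousAt_const hlt] with r hr
    exact iff_false_intro fun h => lt_asymm h.2 hr
  by_cases hz : ∃ v ∈ τ, μ τ (p r₀) v = 0
  swap
  · push Not at hz
    refine hconst True (fun h => ?_) ?_
    · obtain ⟨v, hv, hv0⟩ := h.2.1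
      exact hz v hv hv0
    · have h1 : ∀ᶠ r in 𝓝 r₀, ∀ v ∈ τ, 0 < μ τ (p r) v := by
        rw [Filter.eventually_all_finset]
        intro v hv
        exact continuousAt_const.eventually_lt (hc v).continuousAt
          ((hneg v hv).lt_of_ne (hz v hv).symm)
      filter_upwards [h1, continuousAt_const.eventually_lt hsc.continuousAt hgt] with r hr hr'
      exact iff_true_intro ⟨hr, hr'⟩
  · have htouch : Touches μ τ (p r₀) := ⟨hneg, hz, hgt⟩
    obtain ⟨v, hv, hv0⟩ := hz
    have hother : ∀ w ∈ τ, w ≠ v → 0 < μ τ (p r₀) w := by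
      intro w hw hwv
      refine (hneg w hw).lt_of_ne fun h => hgp v hv w hw hwv.symm ?_
      have e1 := hval v r₀
      have e2 := hval w r₀
      rw [hv0] at e1
      rw [← h] at e2
      have hr₀ : r₀ ≠ 0 := by
        rintro rfl
        apply hq₁ v hv
        linarith
      have e3 : r₀ * (μ τ q₁ v * μ τ q₂ w - μ τ q₁ w * μ τ q₂ v) = 0 := by
        linear_combination (-μ τ q₁ v) * e2 + (μ τ q₁ w) * e1
      have := (mul_eq_zero.1 e3).resolve_left hr₀
      linarith
    -- The vanishing coordinate is affine in `r` with slope `k`; its sign decides on which side of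
    -- `r₀` the facet is crossed.
    set k := μ τ q₂ v - μ τ q₁ v with hk
    have hvr : ∀ r, μ τ (p r) v = k * (r - r₀) := by
      intro r
      have e1 := hval v r₀
      rw [hv0] at e1
      rw [hval v r]
      linear_combination -e1
    have hk0 : k ≠ 0 := by
      intro h
      have := hval v 0
      rw [hvr 0, h] at this
      apply hq₁ v hv
      linarith
    have hcross : ∀ᶠ r in 𝓝 r₀, Crosses μ τ (p r) ↔ 0 < k * (r - r₀) := by
      have h1 : ∀ᶠ r in 𝓝 r₀, ∀ w ∈ τ, w ≠ v → 0 < μ τ (p r) w := by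
        rw [Filter.eventually_all_finset]
        intro w hw
        by_cases hwv : w = v
        · simp [hwv]
        · filter_upwards [continuousAt_const.eventually_lt (hc w).continuousAt
            (hother w hw hwv)] with r hr _ using hr
      filter_upwards [h1, continuousAt_const.eventually_lt hsc.continuousAt hgt] with r hr hr'
      constructor
      · intro h
        rw [← hvr]
        exact h.1 v hv
      · intro h
        refine ⟨fun w hw => ?_, hr'⟩
        by_cases hwv : w = v
        · rw [hwv, hvr]
          exact h
        · exact hr w hw hwv
    have hl : ∀ᶠ r in 𝓝[<] r₀, Crosses μ τ (p r) ↔ k < 0 := by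
      filter_upwards [nhdsWithin_le_nhds hcross, self_mem_nhdsWithin] with r hr hr'
      rw [hr]
      have : r - r₀ < 0 := sub_neg.2 hr'
      rw [mul_pos_iff]
      constructor
      · rintro (h | h)
        · exact absurd h.2 (not_lt.2 this.le)
        · exact h.1
      · exact fun h => Or.inr ⟨h, this⟩
    have hr : ∀ᶠ r in 𝓝[>] r₀, Crosses μ τ (p r) ↔ 0 < k := by
      filter_upwards [nhdsWithin_le_nhds hcross, self_mem_nhdsWithin] with r hr hr'
      rw [hr]
      have : 0 < r - r₀ := sub_pos.2 hr'
      exact mul_pos_iff_of_pos_right this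
    change ∃ a : ZMod 2, (∀ᶠ r in 𝓝[<] r₀, (if Crosses μ τ (p r) then 1 else 0) = a) ∧
      (∀ᶠ r in 𝓝[>] r₀, (if Crosses μ τ (p r) then 1 else 0) =
        a + if Touches μ τ (p r₀) then 1 else 0)
    rcases lt_or_gt_of_ne hk0 with hkn | hkp
    · refine ⟨1, ?_, ?_⟩
      · filter_upwards [hl] with r h
        simp [h, hkn]
      · filter_upwards [hr] with r h
        simp only [h, not_lt.2 hkn.le, htouch, if_true, if_false]
        decide
    · refine ⟨0, ?_, ?_⟩
      · filter_upwards [hl] with r h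
        simp [h, not_lt.2 hkp.le]
      · filter_upwards [hr] with r h
        simp [h, hkp, htouch]

/-- At a generic point off the polyhedron each inequality deciding a crossing is strict or strictly
violated, unless another one already is; both persist nearby. -/
theorem eventually_crossings_eq {q : EuclideanSpace ℝ (Fin d)}
    (h0 : Generic K μ q)
    (hoff : ∀ τ ∈ facets d K, (∀ v ∈ τ, 0 ≤ μ τ q v) → ∑ v, μ τ q v ≠ 1) :
    ∀ᶠ q' in 𝓝 q, crossings K μ q' = crossings K μ q := by
  classical
  have : ∀ᶠ q' in 𝓝 q, ∀ τ ∈ facets d K, (Crosses μ τ q' ↔ Crosses μ τ q) := by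
    rw [Filter.eventually_all_finset]
    intro τ hτ
    by_cases hneg : ∃ v ∈ τ, μ τ q v < 0
    · obtain ⟨v, hv, hv0⟩ := hneg
      filter_upwards [(continuous_coneCoord τ v).continuousAt.eventually_lt
        continuousAt_const hv0] with q' hq'
      exact ⟨fun h => absurd (h.1 v hv) (not_lt.2 hq'.le),
        fun h => absurd (h.1 v hv) (not_lt.2 hv0.le)⟩
    push Not at hneg
    have hsc : Continuous fun q => ∑ v, μ τ q v :=
      continuous_finsetSum _ fun v _ => continuous_coneCoord τ v
    rcases lt_or_gt_of_ne (hoff τ hτ hneg) with hlt | hgt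
    · filter_upwards [hsc.continuousAt.eventually_lt continuousAt_const hlt] with q' hq'
      exact ⟨fun h => absurd h.2 (not_lt.2 hq'.le), fun h => absurd h.2 (not_lt.2 hlt.le)⟩
    · have hpos : ∀ v ∈ τ, 0 < μ τ q v := fun v hv => (hneg v hv).lt_of_ne (h0 τ hτ v hv).symm
      have h1 : ∀ᶠ q' in 𝓝 q, ∀ v ∈ τ, 0 < μ τ q' v := by
        rw [Filter.eventually_all_finset]
        intro v hv
        exact continuousAt_const.eventually_lt (continuous_coneCoord τ v).continuousAt (hpos v hv)
      filter_upwards [h1, continuousAt_const.eventually_lt hsc.continuousAt hgt] with q' h2 h3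
      exact ⟨fun _ => ⟨hpos, hgt⟩, fun _ => ⟨h2, h3⟩⟩
  filter_upwards [this] with q' hq'
  unfold crossings
  refine Finset.sum_congr rfl fun τ hτ => ?_
  simp only [hq' τ hτ]

/-- At each parameter the total jump is the number of touched facets, which is even by
`sum_touches_eq_zero`. -/
theorem crossings_eq_of_segment (hd : 2 ≤ d) (hK : IsClosedComplex d K) (hμ : IsConeCoord K g μ)
    {q₁ q₂ : EuclideanSpace ℝ (Fin d)} (h₁ : Generic K μ q₁) (h₂ : Generic K μ q₂)
    (hgp : ∀ τ ∈ facets d K, ∀ v ∈ τ, ∀ w ∈ τ, v ≠ w →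
      μ τ q₁ v * μ τ q₂ w ≠ μ τ q₁ w * μ τ q₂ v)
    (hoff : ∀ r ∈ Icc (0 : ℝ) 1, q₁ + r • (q₂ - q₁) ∉ polyhedron K g) :
    crossings K μ q₁ = crossings K μ q₂ := by
  classical
  have hoff' : ∀ r ∈ Icc (0 : ℝ) 1, ∀ τ ∈ facets d K,
      (∀ v ∈ τ, 0 ≤ μ τ (q₁ + r • (q₂ - q₁)) v) → ∑ v, μ τ (q₁ + r • (q₂ - q₁)) v ≠ 1 :=
    fun r hr τ hτ h0 h1 => hoff r hr (hμ.mem_polyhedron hτ h0 h1)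
  have hpc : Continuous fun r : ℝ => q₁ + r • (q₂ - q₁) := by fun_prop
  have e0 : q₁ + (0 : ℝ) • (q₂ - q₁) = q₁ := by simp
  have e1 : q₁ + (1 : ℝ) • (q₂ - q₁) = q₂ := by simp
  have main := eq_of_eventually_const_punctured (h := fun r => crossings K μ (q₁ + r • (q₂ - q₁)))
    (fun r₀ hr₀ => ?_) ?_ ?_
  · simpa only [e0, e1] using main
  · have hloc := fun τ (hτ : τ ∈ facets d K) => eventually_crosses_of_line (r₀ := r₀) (h₁ τ hτ)
      (hgp τ hτ) (hoff' r₀ hr₀ τ hτ)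
    choose! a ha hb using hloc
    have ht := sum_touches_eq_zero hd hK hμ (q := q₁ + r₀ • (q₂ - q₁)) (by
      intro τ hτ v hv w hw hv0 hw0
      by_contra hvw
      simp only [map_add, map_smul, map_sub, Pi.add_apply, Pi.smul_apply, Pi.sub_apply,
        smul_eq_mul] at hv0 hw0
      apply hgp τ hτ v hv w hw hvw
      have hr₀ : r₀ ≠ 0 := by
        rintro rfl
        apply h₁ τ hτ v hv
        linarith
      have e3 : r₀ * (μ τ q₁ v * μ τ q₂ w - μ τ q₁ w * μ τ q₂ v) = 0 := by
        linear_combination (μ τ q₁ v) * hw0 - (μ τ q₁ w) * hv0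
      have := (mul_eq_zero.1 e3).resolve_left hr₀
      linarith)
    refine ⟨∑ τ ∈ facets d K, a τ, ?_⟩
    have hl : ∀ᶠ r in 𝓝[<] r₀, crossings K μ (q₁ + r • (q₂ - q₁)) = ∑ τ ∈ facets d K, a τ := by
      filter_upwards [(Filter.eventually_all_finset _).2 ha] with r hr
      exact Finset.sum_congr rfl hr
    have hr : ∀ᶠ r in 𝓝[>] r₀, crossings K μ (q₁ + r • (q₂ - q₁)) = ∑ τ ∈ facets d K, a τ := by
      filter_upwards [(Filter.eventually_all_finset _).2 hb] with r hr
      unfold crossings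
      rw [Finset.sum_congr rfl hr, Finset.sum_add_distrib, ht, add_zero]
    rw [← nhdsLT_sup_nhdsGT, eventually_sup]
    exact ⟨hl, hr⟩
  · rw [e0]
    have := eventually_crossings_eq h₁ (by
      have := hoff' 0 (by simp)
      rwa [e0] at this)
    have ht : Tendsto (fun r : ℝ => q₁ + r • (q₂ - q₁)) (𝓝 0) (𝓝 q₁) := by
      have := hpc.tendsto 0
      rwa [e0] at this
    exact ht.eventually this
  · rw [e1]
    have := eventually_crossings_eq h₂ (by
      have := hoff' 1 (by simp)
      rwa [e1] at this)
    have ht : Tendsto (fun r : ℝ => q₁ + r • (q₂ - q₁)) (𝓝 1) (𝓝 q₂) := by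
      have := hpc.tendsto 1
      rwa [e1] at this
    exact ht.eventually this

/-- Two generic points need not be in general position to each other, so they are joined through a
third point that is so with respect to both. -/
theorem crossings_eq_of_convex (hd : 2 ≤ d) (hK : IsClosedComplex d K) (hμ : IsConeCoord K g μ)
    {U : Set (EuclideanSpace ℝ (Fin d))} (hU : IsOpen U) (hUc : Convex ℝ U)
    (hUP : Disjoint U (polyhedron K g)) {q₁ q₂ : EuclideanSpace ℝ (Fin d)}
    (h₁ : Generic K μ q₁) (h₂ : Generic K μ q₂) (hq₁ : q₁ ∈ U) (hq₂ : q₂ ∈ U) :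
    crossings K μ q₁ = crossings K μ q₂ := by
  obtain ⟨q, hq, hqg, hgp⟩ := exists_generic hμ hU ⟨q₁, hq₁⟩ h₁ h₂
  have hseg : ∀ p ∈ U, ∀ r ∈ Icc (0 : ℝ) 1, p + r • (q - p) ∉ polyhedron K g := by
    intro p hp r hr
    exact disjoint_left.1 hUP (hUc.add_smul_sub_mem hp hq hr)
  rw [crossings_eq_of_segment hd hK hμ h₁ hqg (fun τ hτ v hv w hw hvw =>
      (hgp τ hτ v hv w hw hvw).1) (hseg q₁ hq₁),
    crossings_eq_of_segment hd hK hμ h₂ hqg (fun τ hτ v hv w hw hvw =>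
      (hgp τ hτ v hv w hw hvw).2) (hseg q₂ hq₂)]

end Parity


/-! ### The polyhedron near an interior point of a simplex -/

section Polyhedron

variable {V : Type*} [Fintype V] {d : ℕ} {K : AbstractSimplicialComplex V}
  {f g : V → EuclideanSpace ℝ (Fin d)} {c : ℝ}

theorem mem_realization_of_mem {σ : Finset V} (hσ : σ ∈ K) {w : V → ℝ} (h0 : ∀ v ∈ σ, 0 ≤ w v)
    (hs : ∀ v ∉ σ, w v = 0) (h1 : ∑ v, w v = 1) : w ∈ realization K := by
  refine ⟨fun v => ?_, h1, σ, hσ, hs⟩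
  by_cases hv : v ∈ σ
  · exact h0 v hv
  · rw [hs v hv]

theorem isCompact_realization (K : AbstractSimplicialComplex V) : IsCompact (realization K) := by
  have h1 : realization K =
      ⋃ σ ∈ {σ : Finset V | σ ∈ K}, (stdSimplex ℝ V ∩ {w | ∀ v, v ∉ σ → w v = 0}) := by
    ext w
    simp only [realization, stdSimplex, mem_ofPred_eq, mem_iUnion, mem_inter_iff, exists_prop]
    constructor
    · rintro ⟨h0, h1, σ, hσ, hs⟩
      exact ⟨σ, hσ, ⟨h0, h1⟩, hs⟩
    · rintro ⟨σ, hσ, ⟨h0, h1⟩, hs⟩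
      exact ⟨h0, h1, σ, hσ, hs⟩
  rw [h1]
  refine (Set.toFinite _).isCompact_biUnion fun σ _ => (isCompact_stdSimplex ℝ V).inter_right ?_
  simp only [ofPred_forall]
  exact isClosed_iInter fun v => isClosed_iInter fun _ =>
    isClosed_eq (continuous_apply v) continuous_const

theorem isCompact_polyhedron (K : AbstractSimplicialComplex V)
    (f : V → EuclideanSpace ℝ (Fin d)) : IsCompact (polyhedron K f) := by
  apply (isCompact_realization K).image
  unfold affExtend
  fun_prop

theorem isClosed_polyhedron (K : AbstractSimplicialComplex V)
    (f : V → EuclideanSpace ℝ (Fin d)) : IsClosed (polyhedron K f) :=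
  (isCompact_polyhedron K f).isClosed

theorem norm_le_of_mem_polyhedron {C : ℝ} (hC : ∀ v, ‖f v‖ ≤ C)
    {q : EuclideanSpace ℝ (Fin d)} (hq : q ∈ polyhedron K f) : ‖q‖ ≤ C := by
  obtain ⟨w, ⟨h0, h1, -⟩, rfl⟩ := hq
  refine (norm_affExtend_le f hC w).trans ?_
  simp [abs_of_nonneg (h0 _), h1]

theorem mem_polyhedron_sub_iff (z q : EuclideanSpace ℝ (Fin d)) :
    q ∈ polyhedron K (fun v => f v - z) ↔ q + z ∈ polyhedron K f := by
  constructor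
  · rintro ⟨w, hw, rfl⟩
    refine ⟨w, hw, ?_⟩
    rw [affExtend_sub_const, hw.2.1, one_smul, sub_add_cancel]
  · rintro ⟨w, hw, h⟩
    refine ⟨w, hw, ?_⟩
    rw [affExtend_sub_const, hw.2.1, one_smul, h, add_sub_cancel_right]

theorem Separated.sub_const (h : Separated K f c) (z : EuclideanSpace ℝ (Fin d)) :
    Separated K (fun v => f v - z) c := by
  refine ⟨h.1, fun σ hσ τ hτ δ h0 h1 h2 => ?_⟩
  rw [affExtend_sub_const, h0, zero_smul, sub_zero]
  exact h.2 σ hσ τ hτ δ h0 h1 h2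

/-- Separation bounds the change of a barycentric coordinate by the displacement divided by `c`. All
later neighbourhoods, of radius `c * w v`, come from this estimate. -/
theorem Separated.pos_of_near (h : Separated K f c) {w w' : V → ℝ} (hw : w ∈ realization K)
    (hw' : w' ∈ realization K) {v : V}
    (hv : ‖affExtend f w' - affExtend f w‖ < c * w v) : 0 < w' v := by
  have h1 := h.dist_le hw' hw
  have h2 : |w' v - w v| ≤ ∑ u, |w' u - w u| :=
    Finset.single_le_sum (f := fun u => |w' u - w u|) (fun u _ => abs_nonneg _)
      (Finset.mem_univ v)
  have h3 : c * |w' v - w v| < c * w v :=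
    (mul_le_mul_of_nonneg_left h2 h.1.le).trans_lt (h1.trans_lt hv)
  have h4 := (abs_lt.1 (lt_of_mul_lt_mul_left h3 h.1.le)).1
  linarith

/-- All weights on `A` stay positive, so a simplex carrying `q` contains the facet `A` and is equal
to it. Hence the polyhedron near the point lies in the hyperplane of `A`. -/
theorem Separated.exists_balanced_of_near (hK : IsClosedComplex d K) (h : Separated K f c)
    {A : Finset V} (hA : A ∈ K) (hAd : A.card = d) {w : V → ℝ} (hw : ∀ v ∈ A, 0 < w v)
    (hs : ∀ v ∉ A, w v = 0) (h1 : ∑ v, w v = 1) {q : EuclideanSpace ℝ (Fin d)}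
    (hq : q ∈ polyhedron K f) (hn : ∀ v ∈ A, ‖q - affExtend f w‖ < c * w v) :
    ∃ δ ∈ balanced A, affExtend f δ = q - affExtend f w := by
  obtain ⟨w', hw', rfl⟩ := hq
  have hwr := mem_realization_of_mem hA (fun v hv => (hw v hv).le) hs h1
  obtain ⟨h0', h1', τ, hτ, hsτ⟩ := id hw'
  have hsub : A ⊆ τ := by
    intro v hv
    by_contra hvτ
    have := h.pos_of_near hwr hw' (hn v hv)
    rw [hsτ v hvτ] at this
    exact lt_irrefl _ this
  have hτA := hK.eq_of_subset hτ hAd hsub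
  subst hτA
  exact ⟨w' - w, sub_mem_balanced (by rw [h1, h1']) hsτ hs, affExtend_sub _ _ _⟩

end Polyhedron

/-! ### The mod 2 indicator of the interior -/

section Inside

variable {V : Type*} [Fintype V] {d : ℕ} {K : AbstractSimplicialComplex V}
  {f g : V → EuclideanSpace ℝ (Fin d)} {c : ℝ}
  {μ : Finset V → EuclideanSpace ℝ (Fin d) →ₗ[ℝ] (V → ℝ)}

/-- `χ` is the indicator function modulo `2` of the interior of the polyhedron: it is locally
constant off the polyhedron, jumps at every facet, and vanishes far away. -/
structure IsInside (K : AbstractSimplicialComplex V) (f : V → EuclideanSpace ℝ (Fin d))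
    (χ : EuclideanSpace ℝ (Fin d) → ZMod 2) : Prop where
  locally_const : ∀ q ∉ polyhedron K f, ∀ᶠ q' in 𝓝 q, χ q' = χ q
  flip : ∀ A ∈ K, A.card = d → ∀ w : V → ℝ, (∀ v ∈ A, 0 < w v) → (∀ v ∉ A, w v = 0) →
    ∑ v, w v = 1 → ∀ n : EuclideanSpace ℝ (Fin d), n ≠ 0 →
    (∀ δ ∈ balanced A, inner ℝ (affExtend f δ) n = 0) →
    ∃ r > 0, ∀ q ∈ Metric.ball (affExtend f w) r, ∀ q' ∈ Metric.ball (affExtend f w) r,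
      0 < inner ℝ (q - affExtend f w) n → inner ℝ (q' - affExtend f w) n < 0 → χ q ≠ χ q'
  far : ∃ R : ℝ, ∀ q, R < ‖q‖ → χ q = 0

theorem isPreconnected_compl_closedBall (hd : 2 ≤ d) (z : EuclideanSpace ℝ (Fin d)) {R : ℝ}
    (hR : 0 ≤ R) : IsPreconnected {q : EuclideanSpace ℝ (Fin d) | R < ‖q - z‖} := by
  have hrank : 1 < Module.rank ℝ (EuclideanSpace ℝ (Fin d)) := by
    rw [← Module.finrank_eq_rank, finrank_euclideanSpace, Fintype.card_fin]
    exact_mod_cast hd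
  have h1 := isPreconnected_sphere hrank (0 : EuclideanSpace ℝ (Fin d)) 1
  have h2 := (h1.prod (isPreconnected_Ioi (a := R))).image
    (fun x : EuclideanSpace ℝ (Fin d) × ℝ => z + x.2 • x.1) (by fun_prop)
  convert h2 using 1
  ext q
  simp only [mem_ofPred_eq, mem_image, mem_prod, mem_sphere_zero_iff_norm, mem_Ioi, Prod.exists]
  constructor
  · intro hq
    have hpos : 0 < ‖q - z‖ := hR.trans_lt hq
    refine ⟨‖q - z‖⁻¹ • (q - z), ‖q - z‖, ⟨?_, hq⟩, ?_⟩
    · rw [norm_smul, norm_inv, norm_norm, inv_mul_cancel₀ hpos.ne']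
    · rw [smul_smul, mul_inv_cancel₀ hpos.ne', one_smul, add_sub_cancel]
  · rintro ⟨a, b, ⟨ha, hb⟩, rfl⟩
    rw [add_sub_cancel_left, norm_smul, ha, mul_one, Real.norm_eq_abs]
    exact hb.trans_le (le_abs_self b)

/-- The crossing count makes sense at generic points only; at other points off the polyhedron the
count of a generic point nearby is used, and convex sets show that the choice does not matter. -/
theorem exists_parity (hd : 2 ≤ d) (hK : IsClosedComplex d K) (hμ : IsConeCoord K g μ) :
    ∃ χ : EuclideanSpace ℝ (Fin d) → ZMod 2, ∀ U : Set (EuclideanSpace ℝ (Fin d)), IsOpen U →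
      Convex ℝ U → Disjoint U (polyhedron K g) → ∀ q ∈ U, ∀ q' ∈ U, Generic K μ q' →
        χ q = crossings K μ q' := by
  have key : ∀ q : EuclideanSpace ℝ (Fin d), ∃ x : ZMod 2,
      ∀ U : Set (EuclideanSpace ℝ (Fin d)), IsOpen U →
      Convex ℝ U → Disjoint U (polyhedron K g) → q ∈ U → ∀ q' ∈ U, Generic K μ q' →
        x = crossings K μ q' := by
    intro q
    by_cases hq : q ∈ polyhedron K g
    -- On the polyhedron the value is irrelevant.
    · exact ⟨0, fun U _ _ hU hqU => (disjoint_left.1 hU hqU hq).elim⟩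
    obtain ⟨r, hr, hball⟩ := Metric.isOpen_iff.1 (isClosed_polyhedron K g).isOpen_compl q hq
    obtain ⟨q₀, hq₀, hq₀g⟩ := exists_generic' hμ (U := Metric.ball q r) Metric.isOpen_ball
      ⟨q, Metric.mem_ball_self hr⟩
    refine ⟨crossings K μ q₀, fun U hU hUc hUP hqU q' hq' hq'g => ?_⟩
    obtain ⟨q₁, hq₁, hq₁g⟩ := exists_generic' hμ (U := U ∩ Metric.ball q r)
      (hU.inter Metric.isOpen_ball) ⟨q, hqU, Metric.mem_ball_self hr⟩
    rw [crossings_eq_of_convex hd hK hμ Metric.isOpen_ball (convex_ball q r)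
        (disjoint_left.2 fun x hx hx' => hball hx hx') hq₀g hq₁g hq₀ hq₁.2,
      crossings_eq_of_convex hd hK hμ hU hUc hUP hq₁g hq'g hq₁.1 hq']
  choose χ hχ using key
  exact ⟨χ, fun U h1 h2 h3 q hq => hχ q U h1 h2 h3 hq⟩

theorem Generic.smul {q : EuclideanSpace ℝ (Fin d)} (h : Generic K μ q) {s : ℝ} (hs : s ≠ 0) :
    Generic K μ (s • q) := by
  intro τ hτ v hv
  rw [map_smul, Pi.smul_apply, smul_eq_mul]
  exact mul_ne_zero hs (h τ hτ v hv)

/-- A generic point pushed radially from `(1 - s) • q` to `(1 + s) • q` passes through `A` and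
through no other facet, since the polyhedron near `p` lies in the hyperplane of `A`. The two half
balls are convex and miss the polyhedron, so each carries a single parity. -/
theorem parity_flip (hK : IsClosedComplex d K) (hμ : IsConeCoord K g μ)
    (hsep : Separated K g c) {χ : EuclideanSpace ℝ (Fin d) → ZMod 2}
    (hχ : ∀ U : Set (EuclideanSpace ℝ (Fin d)), IsOpen U →
      Convex ℝ U → Disjoint U (polyhedron K g) → ∀ q ∈ U, ∀ q' ∈ U, Generic K μ q' →
        χ q = crossings K μ q') (hd : 0 < d) {A : Finset V} (hA : A ∈ K) (hAd : A.card = d)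
    {w : V → ℝ} (hw : ∀ v ∈ A, 0 < w v) (hs : ∀ v ∉ A, w v = 0) (h1 : ∑ v, w v = 1)
    {n : EuclideanSpace ℝ (Fin d)} (hn0 : n ≠ 0)
    (hn : ∀ δ ∈ balanced A, inner ℝ (affExtend g δ) n = 0) :
    ∃ r > 0, ∀ q ∈ Metric.ball (affExtend g w) r, ∀ q' ∈ Metric.ball (affExtend g w) r,
      0 < inner ℝ (q - affExtend g w) n → inner ℝ (q' - affExtend g w) n < 0 → χ q ≠ χ q' := by
  classical
  set p := affExtend g w with hp
  have hAf : A ∈ facets d K := mem_facets.2 ⟨hA, hAd⟩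
  have hAne : A.Nonempty := face_nonempty hA
  obtain ⟨v₀, hv₀, hmin⟩ := A.exists_min_image w hAne
  set r := c * w v₀ with hr
  have hrpos : 0 < r := mul_pos hsep.1 (hw v₀ hv₀)
  have hball : ∀ q ∈ Metric.ball p r, ∀ v ∈ A, ‖q - p‖ < c * w v := by
    intro q hq v hv
    rw [mem_ball_iff_norm] at hq
    exact hq.trans_le (mul_le_mul_of_nonneg_left (hmin v hv) hsep.1.le)
  have hplane : ∀ q ∈ Metric.ball p r, q ∈ polyhedron K g → inner ℝ (q - p) n = 0 := by
    intro q hq hqP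
    obtain ⟨δ, hδ, hδq⟩ := hsep.exists_balanced_of_near hK hA hAd hw hs h1 hqP (hball q hq)
    rw [← hδq]
    exact hn δ hδ
  set Up : Set (EuclideanSpace ℝ (Fin d)) := Metric.ball p r ∩ {q | 0 < inner ℝ (q - p) n}
  set Un : Set (EuclideanSpace ℝ (Fin d)) := Metric.ball p r ∩ {q | inner ℝ (q - p) n < 0}
  have hUpo : IsOpen Up := Metric.isOpen_ball.inter
    (isOpen_lt continuous_const (by fun_prop))
  have hUno : IsOpen Un := Metric.isOpen_ball.inter
    (isOpen_lt (by fun_prop) continuous_const)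
  have hcombo : ∀ (x y : EuclideanSpace ℝ (Fin d)) (a b : ℝ), a + b = 1 →
      inner ℝ (a • x + b • y - p) n = a * inner ℝ (x - p) n + b * inner ℝ (y - p) n := by
    intro x y a b hab
    have : a • x + b • y - p = a • (x - p) + b • (y - p) := by
      rw [smul_sub, smul_sub]
      nth_rw 1 [← one_smul ℝ p]
      rw [← hab, add_smul]
      abel
    rw [this, inner_add_left, real_inner_smul_left, real_inner_smul_left]
  have hUpc : Convex ℝ Up := (convex_ball p r).inter (by
    intro x hx y hy a b ha hb hab
    simp only [mem_ofPred_eq] at hx hy ⊢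
    rw [hcombo x y a b hab]
    rcases ha.eq_or_lt with rfl | ha'
    · rw [zero_add] at hab
      subst hab
      simpa using hy
    · exact add_pos_of_pos_of_nonneg (mul_pos ha' hx) (mul_nonneg hb hy.le))
  have hUnc : Convex ℝ Un := (convex_ball p r).inter (by
    intro x hx y hy a b ha hb hab
    simp only [mem_ofPred_eq] at hx hy ⊢
    rw [hcombo x y a b hab]
    rcases ha.eq_or_lt with rfl | ha'
    · rw [zero_add] at hab
      subst hab
      simpa using hy
    · exact add_neg_of_neg_of_nonpos (mul_neg_of_pos_of_neg ha' hx)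
        (mul_nonpos_of_nonneg_of_nonpos hb hy.le))
  have hUpP : Disjoint Up (polyhedron K g) := disjoint_left.2 fun q hq hqP =>
    (ne_of_gt hq.2) (hplane q hq.1 hqP)
  have hUnP : Disjoint Un (polyhedron K g) := disjoint_left.2 fun q hq hqP =>
    (ne_of_lt hq.2) (hplane q hq.1 hqP)
  have hcompat : Compat g A A := isEmbedded_iff_compat.1 hsep.isEmbedded A hA A hA
  have hμp : μ A p = w := hμ.unique A hAf w hs
  -- If `p` were parallel to `A`, its coordinates would have sum `0` instead of `1`.
  have hpn : inner ℝ p n ≠ 0 := by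
    intro h0
    obtain ⟨δ, hδ, hδp⟩ := mem_direction.1 (mem_direction_of_orthogonal_normal hcompat hAd hd
      hn0 hn h0)
    have := hμ.unique A hAf δ hδ.2
    rw [hδp, hμp] at this
    rw [← this] at hδ
    have h2 := hδ.1
    rw [h1] at h2
    exact one_ne_zero h2
  obtain ⟨s, hs0, hs1, hsn⟩ : ∃ s : ℝ, 0 < s ∧ s < 1 ∧ s * ‖p‖ < r := by
    refine ⟨min (1 / 2) (r / (2 * (‖p‖ + 1))), by positivity, ?_, ?_⟩
    · exact (min_le_left _ _).trans_lt (by norm_num)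
    · have hnp : 0 ≤ ‖p‖ := norm_nonneg p
      calc min (1 / 2) (r / (2 * (‖p‖ + 1))) * ‖p‖ ≤ (r / (2 * (‖p‖ + 1))) * ‖p‖ :=
            mul_le_mul_of_nonneg_right (min_le_right _ _) hnp
        _ < r := by
          rw [div_mul_eq_mul_div, div_lt_iff₀ (by positivity)]
          nlinarith
  have hev : ∀ᶠ q in 𝓝 p, ((1 + s) • q ∈ Metric.ball p r ∧ (1 - s) • q ∈ Metric.ball p r) ∧
      (inner ℝ ((1 + s) • q - p) n * inner ℝ p n > 0 ∧
        inner ℝ ((1 - s) • q - p) n * inner ℝ p n < 0) ∧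
      (∀ v ∈ A, 0 < μ A q v) ∧ (1 < (1 + s) * ∑ v, μ A q v) ∧ (1 - s) * ∑ v, μ A q v < 1 := by
    have hsum : Continuous fun q => ∑ v, μ A q v :=
      continuous_finsetSum _ fun v _ => continuous_coneCoord A v
    have hb1 : (1 + s) • p ∈ Metric.ball p r := by
      rw [mem_ball_iff_norm, add_smul, one_smul, add_sub_cancel_left, norm_smul, Real.norm_eq_abs,
        abs_of_pos hs0]
      exact hsn
    have hb2 : (1 - s) • p ∈ Metric.ball p r := by
      rw [mem_ball_iff_norm, sub_smul, one_smul, sub_sub_cancel_left, norm_neg, norm_smul,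
        Real.norm_eq_abs, abs_of_pos hs0]
      exact hsn
    have hi1 : inner ℝ ((1 + s) • p - p) n * inner ℝ p n > 0 := by
      rw [add_smul, one_smul, add_sub_cancel_left, real_inner_smul_left, mul_assoc]
      exact mul_pos hs0 (mul_self_pos.2 hpn)
    have hi2 : inner ℝ ((1 - s) • p - p) n * inner ℝ p n < 0 := by
      rw [sub_smul, one_smul, sub_sub_cancel_left, inner_neg_left, real_inner_smul_left, neg_mul,
        mul_assoc, neg_lt_zero]
      exact mul_pos hs0 (mul_self_pos.2 hpn)
    refine Filter.Eventually.and (.and ?_ ?_) (.and (.and ?_ ?_) (.and ?_ (.and ?_ ?_)))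
    · exact (by fun_prop : Continuous fun q : EuclideanSpace ℝ (Fin d) =>
        (1 + s) • q).continuousAt.eventually (Metric.isOpen_ball.mem_nhds hb1)
    · exact (by fun_prop : Continuous fun q : EuclideanSpace ℝ (Fin d) =>
        (1 - s) • q).continuousAt.eventually (Metric.isOpen_ball.mem_nhds hb2)
    · exact ContinuousAt.eventually_lt continuousAt_const (by fun_prop) hi1
    · exact ContinuousAt.eventually_lt (by fun_prop) continuousAt_const hi2
    · rw [Filter.eventually_all_finset]
      intro v hv
      exact continuousAt_const.eventually_lt (continuous_coneCoord A v).continuousAt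
        (by rw [hμp]; exact hw v hv)
    · refine ContinuousAt.eventually_lt continuousAt_const
        (continuous_const.mul hsum).continuousAt ?_
      rw [hμp, h1]
      linarith
    · refine ContinuousAt.eventually_lt (continuous_const.mul hsum).continuousAt
        continuousAt_const ?_
      rw [hμp, h1]
      linarith
  obtain ⟨O, hOsub, hO, hpO⟩ := eventually_nhds_iff.1 hev
  obtain ⟨q, hqO, hqg⟩ := exists_generic' hμ hO ⟨p, hpO⟩
  obtain ⟨⟨hb1, hb2⟩, ⟨hi1, hi2⟩, hApos, hA1, hA2⟩ := hOsub q hqO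
  have hq1g : Generic K μ ((1 + s) • q) := hqg.smul (by linarith)
  have hq2g : Generic K μ ((1 - s) • q) := hqg.smul (by linarith)
  have hcrossA1 : Crosses μ A ((1 + s) • q) := by
    refine ⟨fun v hv => ?_, ?_⟩
    · rw [map_smul, Pi.smul_apply, smul_eq_mul]
      exact mul_pos (by linarith) (hApos v hv)
    · simp only [map_smul, Pi.smul_apply, smul_eq_mul, ← Finset.mul_sum]
      exact hA1
  have hcrossA2 : ¬ Crosses μ A ((1 - s) • q) := by
    rintro ⟨-, h⟩
    simp only [map_smul, Pi.smul_apply, smul_eq_mul, ← Finset.mul_sum] at h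
    exact lt_asymm h hA2
  have hcrossother : ∀ τ ∈ facets d K, τ ≠ A →
      (Crosses μ τ ((1 + s) • q) ↔ Crosses μ τ ((1 - s) • q)) := by
    intro τ hτ hτA
    constructor
    · rintro ⟨ha, hb⟩
      simp only [map_smul, Pi.smul_apply, smul_eq_mul, ← Finset.mul_sum] at ha hb
      have hpos : ∀ v ∈ τ, 0 < μ τ q v := fun v hv =>
        pos_of_mul_pos_right (ha v hv) (by linarith)
      refine ⟨fun v hv => ?_, ?_⟩
      · rw [map_smul, Pi.smul_apply, smul_eq_mul]
        exact mul_pos (by linarith) (hpos v hv)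
      simp only [map_smul, Pi.smul_apply, smul_eq_mul, ← Finset.mul_sum]
      by_contra hcon
      push Not at hcon
      -- The ray through `q` meets `τ` at `L⁻¹ • q`. If only the outer segment crossed `τ`, this
      -- point would lie between the two pushed points, hence in the ball, and this forces `τ = A`.
      set L := ∑ v, μ τ q v with hL
      have hLpos : 0 < L := pos_of_mul_pos_right (one_pos.trans hb) (by linarith)
      apply hτA
      have hmem : L⁻¹ • q ∈ polyhedron K g := by
        apply hμ.mem_polyhedron hτ
        · intro v hv
          rw [map_smul, Pi.smul_apply, smul_eq_mul]
          exact (mul_pos (inv_pos.2 hLpos) (hpos v hv)).le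
        · simp only [map_smul, Pi.smul_apply, smul_eq_mul, ← Finset.mul_sum, ← hL]
          exact inv_mul_cancel₀ hLpos.ne'
      have hball' : L⁻¹ • q ∈ Metric.ball p r := by
        have hconv := convex_ball p r
        have e1 : 1 - s ≤ L⁻¹ := by
          rw [le_inv_comm₀ (by linarith) hLpos, ← one_div, le_div_iff₀ (by linarith)]
          linarith
        have e2 : L⁻¹ < 1 + s := by
          rw [inv_lt_comm₀ hLpos (by linarith), ← one_div, div_lt_iff₀ (by linarith)]
          linarith
        have := hconv.add_smul_sub_mem hb2 hb1 (t := (L⁻¹ - (1 - s)) / (2 * s))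
          ⟨div_nonneg (by linarith) (by linarith), by
            rw [div_le_one (by linarith)]; linarith⟩
        convert this using 1
        rw [← sub_smul, smul_smul, ← add_smul]
        congr 1
        field_simp
        ring
      obtain ⟨δ, hδ, hδq⟩ := hsep.exists_balanced_of_near hK hA hAd hw hs h1 hmem
        (hball _ hball')
      have e3 : L⁻¹ • q = affExtend g (w + δ) := by
        rw [affExtend_add, hδq, ← hp, add_sub_cancel]
      have e4 : affExtend g (L⁻¹ • μ τ q) = affExtend g (w + δ) := by
        rw [affExtend_smul, hμ.affExtend_eq τ hτ, e3]
      have hr1 : L⁻¹ • μ τ q ∈ realization K := by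
        apply mem_realization_of_mem (mem_facets.1 hτ).1
        · intro v hv
          exact (mul_pos (inv_pos.2 hLpos) (hpos v hv)).le
        · intro v hv
          rw [Pi.smul_apply, hμ.supp τ hτ q v hv, smul_zero]
        · simp only [Pi.smul_apply, smul_eq_mul, ← Finset.mul_sum, ← hL]
          exact inv_mul_cancel₀ hLpos.ne'
      have hsub : A ⊆ τ := by
        intro v hv
        by_contra hvτ
        have hwr := mem_realization_of_mem hA (fun v hv => (hw v hv).le) hs h1
        have h5 := hsep.pos_of_near hwr hr1 (v := v) (by
          rw [e4, ← e3, ← hp]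
          exact hball _ hball' v hv)
        rw [Pi.smul_apply, hμ.supp τ hτ q v hvτ, smul_zero] at h5
        exact lt_irrefl _ h5
      exact hK.eq_of_subset (mem_facets.1 hτ).1 hAd hsub
    · rintro ⟨ha, hb⟩
      simp only [map_smul, Pi.smul_apply, smul_eq_mul, ← Finset.mul_sum] at ha hb
      have hpos : ∀ v ∈ τ, 0 < μ τ q v := fun v hv =>
        pos_of_mul_pos_right (ha v hv) (by linarith)
      refine ⟨fun v hv => ?_, ?_⟩
      · rw [map_smul, Pi.smul_apply, smul_eq_mul]
        exact mul_pos (by linarith) (hpos v hv)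
      · simp only [map_smul, Pi.smul_apply, smul_eq_mul, ← Finset.mul_sum]
        have hLpos : 0 < ∑ v, μ τ q v := pos_of_mul_pos_right (one_pos.trans hb) (by linarith)
        nlinarith
  have hcr : crossings K μ ((1 + s) • q) = crossings K μ ((1 - s) • q) + 1 := by
    unfold crossings
    rw [← Finset.add_sum_erase _ _ hAf, ← Finset.add_sum_erase _ _ hAf, if_pos hcrossA1,
      if_neg hcrossA2, zero_add, add_comm]
    congr 1
    refine Finset.sum_congr rfl fun τ hτ => ?_
    obtain ⟨hτA, hτf⟩ := Finset.mem_erase.1 hτ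
    simp only [hcrossother τ hτf hτA]
  have hne1 : ∀ x : ZMod 2, x + 1 ≠ x := by decide
  refine ⟨r, hrpos, fun x hx y hy hxn hyn => ?_⟩
  -- The point `(1 + s) • q` lies on the side of `A` away from the origin; the sign of `⟪p, n⟫`
  -- tells which half ball this is.
  rcases lt_or_gt_of_ne hpn with hneg | hpos
  · have hq1 : (1 + s) • q ∈ Un := ⟨hb1, neg_of_mul_pos_left hi1 hneg.le⟩
    have hq2 : (1 - s) • q ∈ Up := ⟨hb2, pos_of_mul_neg_left hi2 hneg.le⟩
    rw [hχ Up hUpo hUpc hUpP x ⟨hx, hxn⟩ _ hq2 hq2g, hχ Un hUno hUnc hUnP y ⟨hy, hyn⟩ _ hq1 hq1g,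
      hcr]
    exact (hne1 _).symm
  · have hq1 : (1 + s) • q ∈ Up := ⟨hb1, pos_of_mul_pos_left hi1 hpos.le⟩
    have hq2 : (1 - s) • q ∈ Un := ⟨hb2, neg_of_mul_neg_left hi2 hpos.le⟩
    rw [hχ Up hUpo hUpc hUpP x ⟨hx, hxn⟩ _ hq1 hq1g, hχ Un hUno hUnc hUnP y ⟨hy, hyn⟩ _ hq2 hq2g,
      hcr]
    exact hne1 _

/-- For `O` outside a ball containing the polyhedron, segments from `O` to nearby points cross
nothing; the exterior of the ball is connected, so the parity vanishes there. The second conclusion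
keeps the explicit count from `O`, needed to compare the insides of two polyhedra. -/
theorem exists_isInside_of_origin (hd : 2 ≤ d) (hK : IsClosedComplex d K)
    (hemb : IsEmbedded K f) {O : EuclideanSpace ℝ (Fin d)} {R : ℝ} (hR : ∀ v, ‖f v‖ ≤ R)
    (hO : R < ‖O‖) (hμ : IsConeCoord K (fun v => f v - O) μ) :
    ∃ χ, IsInside K f χ ∧ ∀ q ∉ polyhedron K f, Generic K μ (q - O) →
      χ q = crossings K μ (q - O) := by
  set g : V → EuclideanSpace ℝ (Fin d) := fun v => f v - O with hg
  obtain ⟨c, hc⟩ := exists_separated hemb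
  have hcg : Separated K g c := hc.sub_const O
  obtain ⟨χ, hχ⟩ := exists_parity hd hK hμ
  have hloc : ∀ q ∉ polyhedron K g, ∀ᶠ q' in 𝓝 q, χ q' = χ q := by
    intro q hq
    obtain ⟨r, hr, hball⟩ := Metric.isOpen_iff.1 (isClosed_polyhedron K g).isOpen_compl q hq
    obtain ⟨q₀, hq₀, hq₀g⟩ := exists_generic' hμ (U := Metric.ball q r) Metric.isOpen_ball
      ⟨q, Metric.mem_ball_self hr⟩
    filter_upwards [Metric.ball_mem_nhds q hr] with q' hq'
    have hdisj : Disjoint (Metric.ball q r) (polyhedron K g) :=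
      disjoint_left.2 fun x hx hx' => hball hx hx'
    rw [hχ _ Metric.isOpen_ball (convex_ball q r) hdisj q' hq' q₀ hq₀ hq₀g,
      hχ _ Metric.isOpen_ball (convex_ball q r) hdisj q (Metric.mem_ball_self hr) q₀ hq₀ hq₀g]
  have hR0 : 0 ≤ R := by
    obtain ⟨v⟩ := hK.nonempty
    exact (norm_nonneg _).trans (hR v)
  have hoff : ∀ q ∈ {q : EuclideanSpace ℝ (Fin d) | R < ‖q - (-O)‖}, q ∉ polyhedron K g := by
    intro q hq hqP
    rw [hg, mem_polyhedron_sub_iff] at hqP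
    rw [mem_ofPred_eq, sub_neg_eq_add] at hq
    exact absurd (norm_le_of_mem_polyhedron hR hqP) (not_le.2 hq)
  have h0mem : (0 : EuclideanSpace ℝ (Fin d)) ∈
      {q : EuclideanSpace ℝ (Fin d) | R < ‖q - (-O)‖} := by simpa using hO
  have h0 : χ 0 = 0 := by
    have hev : ∀ᶠ q in 𝓝 (0 : EuclideanSpace ℝ (Fin d)), (∀ τ ∈ facets d K, ∑ v, μ τ q v < 1) ∧
        χ q = χ 0 := by
      refine Eventually.and ?_ (hloc 0 (hoff 0 h0mem))
      rw [Filter.eventually_all_finset]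
      intro τ _
      exact (continuous_finsetSum _ fun v _ => continuous_coneCoord τ v).continuousAt.eventually_lt
        continuousAt_const (by simp)
    obtain ⟨r, hr, hball⟩ := Metric.isOpen_iff.1 (isClosed_polyhedron K g).isOpen_compl 0
      (hoff 0 h0mem)
    obtain ⟨O', hOsub, hO', hpO⟩ := eventually_nhds_iff.1 hev
    obtain ⟨q, ⟨hqO, hqb⟩, hqg⟩ := exists_generic' hμ (hO'.inter Metric.isOpen_ball)
      ⟨0, hpO, Metric.mem_ball_self hr⟩
    rw [hχ _ Metric.isOpen_ball (convex_ball 0 r) (disjoint_left.2 fun x hx hx' => hball hx hx')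
      0 (Metric.mem_ball_self hr) q hqb hqg]
    unfold crossings
    refine Finset.sum_eq_zero fun τ hτ => if_neg fun h => ?_
    exact lt_asymm h.2 ((hOsub q hqO).1 τ hτ)
  have hfar : ∀ q ∈ {q : EuclideanSpace ℝ (Fin d) | R < ‖q - (-O)‖}, χ q = 0 := by
    intro q hq
    rw [← h0]
    exact eq_of_isPreconnected (isPreconnected_compl_closedBall hd (-O) hR0)
      (fun x hx => hloc x (hoff x hx)) hq h0mem
  have hP : ∀ q, q ∉ polyhedron K f → q - O ∉ polyhedron K g := by
    intro q hq hq'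
    rw [hg, mem_polyhedron_sub_iff, sub_add_cancel] at hq'
    exact hq hq'
  have hbal : ∀ δ : V → ℝ, ∑ v, δ v = 0 → affExtend g δ = affExtend f δ := by
    intro δ hδ
    rw [hg, affExtend_sub_const, hδ, zero_smul, sub_zero]
  refine ⟨fun q => χ (q - O), ⟨fun q hq => ?_, ?_, ?_⟩, fun q hq hqg => ?_⟩
  · have ht : Tendsto (fun q' => q' - O) (𝓝 q) (𝓝 (q - O)) :=
      (continuous_id.sub continuous_const).tendsto q
    exact ht.eventually (hloc (q - O) (hP q hq))
  · intro A hA hAd w hw hs h1 n hn0 hn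
    obtain ⟨r, hr, hflip⟩ := parity_flip hK hμ hcg hχ (by omega) hA hAd hw hs h1 hn0
      (fun δ hδ => by rw [hbal δ hδ.1]; exact hn δ hδ)
    have hgw : affExtend g w = affExtend f w - O := by
      rw [hg, affExtend_sub_const, h1, one_smul]
    refine ⟨r, hr, fun q hq q' hq' h2 h3 => ?_⟩
    have e : ∀ x : EuclideanSpace ℝ (Fin d), x - O - (affExtend f w - O) = x - affExtend f w :=
      fun x => by abel
    rw [mem_ball_iff_norm] at hq hq'
    exact hflip (q - O) (by rw [mem_ball_iff_norm, hgw, e]; exact hq) (q' - O)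
      (by rw [mem_ball_iff_norm, hgw, e]; exact hq') (by rw [hgw, e]; exact h2)
      (by rw [hgw, e]; exact h3)
  · refine ⟨R, fun q hq => hfar _ ?_⟩
    simpa using hq
  · obtain ⟨r, hr, hball⟩ := Metric.isOpen_iff.1 (isClosed_polyhedron K g).isOpen_compl _ (hP q hq)
    exact hχ _ Metric.isOpen_ball (convex_ball (q - O) r)
      (disjoint_left.2 fun x hx hx' => hball hx hx') _ (Metric.mem_ball_self hr) _
      (Metric.mem_ball_self hr) hqg

theorem exists_orthogonal_of_card_lt {s : Finset (EuclideanSpace ℝ (Fin d))} (hs : s.card < d) :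
    ∃ n : EuclideanSpace ℝ (Fin d), ‖n‖ = 1 ∧ ∀ x ∈ s, inner ℝ x n = 0 := by
  have hne : Submodule.span ℝ (s : Set (EuclideanSpace ℝ (Fin d))) ≠ ⊤ := by
    intro htop
    have h1 := finrank_span_finset_le_card (R := ℝ) s
    rw [Set.finrank, htop, finrank_top, finrank_euclideanSpace, Fintype.card_fin] at h1
    omega
  obtain ⟨n, hn, hn0⟩ := Submodule.exists_mem_ne_zero_of_ne_bot
    (mt Submodule.orthogonal_eq_bot_iff.1 hne)
  refine ⟨‖n‖⁻¹ • n, norm_smul_inv_norm hn0, fun x hx => ?_⟩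
  rw [real_inner_smul_right, (Submodule.mem_orthogonal _ _).1 hn _ (Submodule.subset_span hx),
    mul_zero]

theorem exists_normal (hd : 0 < d) {A : Finset V} (hAd : A.card = d) :
    ∃ n : EuclideanSpace ℝ (Fin d), ‖n‖ = 1 ∧
      ∀ δ ∈ balanced A, inner ℝ (affExtend f δ) n = 0 := by
  classical
  obtain ⟨v₀, hv₀⟩ := Finset.card_pos.1 (hAd ▸ hd)
  have h4 := Finset.card_image_le (s := A.erase v₀) (f := fun v => f v - f v₀)
  have h5 := Finset.card_erase_add_one hv₀
  obtain ⟨n, hn1, hn⟩ := exists_orthogonal_of_card_lt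
    (s := (A.erase v₀).image fun v => f v - f v₀) (by omega)
  have hn' : ∀ v ∈ A, inner ℝ (f v - f v₀) n = 0 := by
    intro v hv
    by_cases hvv : v = v₀
    · rw [hvv, sub_self, inner_zero_left]
    · exact hn _ (Finset.mem_image_of_mem (fun v => f v - f v₀) (Finset.mem_erase.2 ⟨hvv, hv⟩))
  refine ⟨n, hn1, fun δ hδ => inner_direction_eq_zero (fun u hu v hv => ?_) hδ⟩
  rw [← sub_sub_sub_cancel_right _ _ (f v₀), inner_sub_left, hn' u hu, hn' v hv, sub_zero]

/-- Pairing a linear relation with the normal gives its total mass times the distance of `O` from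
the hyperplane. So the mass is zero, and affine independence applies. -/
theorem coneIndep_of_inner_ne {A : Finset V} (hc : Compat f A A)
    {O n : EuclideanSpace ℝ (Fin d)} {v₀ : V} (hv₀ : v₀ ∈ A)
    (hn : ∀ δ ∈ balanced A, inner ℝ (affExtend f δ) n = 0)
    (hO : inner ℝ (f v₀ - O) n ≠ 0) : ConeIndep (fun v => f v - O) A := by
  classical
  intro w hw h0
  have h1 : w - (∑ v, w v) • Pi.single v₀ 1 ∈ balanced A := by
    refine ⟨by simp [Finset.sum_sub_distrib, ← Finset.mul_sum], fun v hv => ?_⟩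
    have : v ≠ v₀ := fun h => hv (h ▸ hv₀)
    simp [hw v hv, this]
  have h2 := hn _ h1
  rw [affExtend_sub, affExtend_smul, affExtend_single, one_smul] at h2
  rw [affExtend_sub_const, sub_eq_zero] at h0
  rw [h0, ← smul_sub, real_inner_smul_left, ← neg_sub, inner_neg_left] at h2
  have h3 : ∑ v, w v = 0 := by
    rcases mul_eq_zero.1 h2 with h | h
    · exact h
    · exact absurd (neg_eq_zero.1 h) hO
  rw [h3, zero_smul] at h0
  exact hc.eq_zero_of_balanced ⟨h3, hw⟩ h0

/-- In every nonempty open set there is a point off the hyperplanes of all facets. -/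
theorem exists_forall_coneIndep (hd : 0 < d) (hemb : IsEmbedded K f)
    {ι : Type*} [Finite ι] (l : ι → EuclideanSpace ℝ (Fin d) →ₗ[ℝ] ℝ) (b : ι → ℝ)
    {U : Set (EuclideanSpace ℝ (Fin d))} (hU : IsOpen U) (hne : U.Nonempty) :
    ∃ O ∈ U, (∀ A ∈ facets d K, ConeIndep (fun v => f v - O) A) ∧
      ∀ i, l i ≠ 0 → l i O ≠ b i := by
  have h1 : ∀ A : Finset V, ∃ n : EuclideanSpace ℝ (Fin d), A ∈ facets d K → ‖n‖ = 1 ∧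
      ∀ δ ∈ balanced A, inner ℝ (affExtend f δ) n = 0 := by
    intro A
    by_cases hA : A ∈ facets d K
    · obtain ⟨n, hn⟩ := exists_normal (f := f) hd (mem_facets.1 hA).2
      exact ⟨n, fun _ => hn⟩
    · exact ⟨0, fun h => (hA h).elim⟩
  choose n hn using h1
  obtain ⟨O, hOU, hO⟩ := exists_mem_forall_apply_ne (ι := ι ⊕ Finset V × V)
    (Sum.elim l fun i => (innerSL ℝ (n i.1) : EuclideanSpace ℝ (Fin d) →ₗ[ℝ] ℝ))
    (Sum.elim b fun i => inner ℝ (n i.1) (f i.2)) hU hne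
  refine ⟨O, hOU, fun A hA => ?_, fun i => hO (Sum.inl i)⟩
  obtain ⟨v₀, hv₀⟩ := face_nonempty (mem_facets.1 hA).1
  have hcA := isEmbedded_iff_compat.1 hemb A (mem_facets.1 hA).1 A (mem_facets.1 hA).1
  refine coneIndep_of_inner_ne hcA hv₀ (hn A hA).2 ?_
  have := hO (Sum.inr (A, v₀)) (by
    intro h
    have h2 := LinearMap.congr_fun h (n A)
    simp [(hn A hA).1] at h2)
  simp only [Sum.elim_inr, ContinuousLinearMap.coe_coe, innerSL_apply_apply] at this
  rw [inner_sub_left, sub_ne_zero, real_inner_comm, real_inner_comm (n A)]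
  exact this.symm

theorem exists_isInside (hd : 2 ≤ d) (hK : IsClosedComplex d K) (hemb : IsEmbedded K f) :
    ∃ χ, IsInside K f χ := by
  obtain ⟨R, hR⟩ : ∃ R, ∀ v, ‖f v‖ ≤ R := by
    obtain ⟨R, hR⟩ := (Set.finite_range fun v => ‖f v‖).bddAbove
    exact ⟨R, fun v => hR ⟨v, rfl⟩⟩
  obtain ⟨O, hO, hOi, -⟩ := exists_forall_coneIndep (by omega) hemb (ι := Empty)
    (fun _ => 0) (fun _ => 0) (U := {O | R < ‖O‖})
    (isOpen_lt continuous_const continuous_norm) (by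
      have : Nontrivial (EuclideanSpace ℝ (Fin d)) := by
        have : Nontrivial (Fin d) := Fin.nontrivial_iff_two_le.2 hd
        infer_instance
      obtain ⟨x, hx⟩ := NormedSpace.exists_lt_norm ℝ (EuclideanSpace ℝ (Fin d)) R
      exact ⟨x, hx⟩)
  obtain ⟨μ, hμ⟩ := exists_isConeCoord (by omega) hOi
  obtain ⟨χ, hχ, -⟩ := exists_isInside_of_origin hd hK hemb hR hO hμ
  exact ⟨χ, hχ⟩

end Inside


/-! ### The two sides of a facet -/

section Tubes

variable {V : Type*} [Fintype V] {d : ℕ} {K : AbstractSimplicialComplex V}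
  {f : V → EuclideanSpace ℝ (Fin d)} {c : ℝ} {χ : EuclideanSpace ℝ (Fin d) → ZMod 2}

theorem IsInside.eq_of_isPreconnected (hχ : IsInside K f χ) {S : Set (EuclideanSpace ℝ (Fin d))}
    (hS : IsPreconnected S) (hSP : Disjoint S (polyhedron K f)) {q q' : EuclideanSpace ℝ (Fin d)}
    (hq : q ∈ S) (hq' : q' ∈ S) : χ q = χ q' :=
  FlexPoly.eq_of_isPreconnected hS
    (fun x hx => hχ.locally_const x (disjoint_left.1 hSP hx)) hq hq'

/-- The displacement is too short to make a weight on `y` nonpositive, and the sign condition takes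
care of the other vertices of `σ`. -/
theorem Separated.mem_polyhedron_of_near (h : Separated K f c) {σ y : Finset V} (hσ : σ ∈ K)
    {w δ : V → ℝ} (hws : ∀ v ∉ y, w v = 0) (hw1 : ∑ v, w v = 1) (hys : y ⊆ σ)
    (hδ : δ ∈ balanced σ) (hδ0 : ∀ v ∈ σ, v ∉ y → 0 ≤ δ v)
    (hn : ∀ v ∈ y, ‖affExtend f δ‖ < c * w v) :
    (∀ v ∈ y, 0 < (w + δ) v) ∧ affExtend f w + affExtend f δ ∈ polyhedron K f := by
  have hpos : ∀ v ∈ y, 0 < (w + δ) v := by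
    intro v hv
    have h1 := h.norm_balanced hσ hδ
    have h2 : |δ v| ≤ ∑ u, |δ u| :=
      Finset.single_le_sum (f := fun u => |δ u|) (fun u _ => abs_nonneg _) (Finset.mem_univ v)
    have h3 : c * |δ v| < c * w v :=
      (mul_le_mul_of_nonneg_left h2 h.1.le).trans_lt (h1.trans_lt (hn v hv))
    have h4 := (abs_lt.1 (lt_of_mul_lt_mul_left h3 h.1.le)).1
    simp only [Pi.add_apply]
    linarith
  refine ⟨hpos, w + δ, mem_realization_of_mem hσ (fun v hv => ?_) (fun v hv => ?_) ?_,
    affExtend_add _ _ _⟩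
  · by_cases hvy : v ∈ y
    · exact (hpos v hvy).le
    · simpa [hws v hvy] using hδ0 v hv hvy
  · simp [hws v fun hh => hv (hys hh), hδ.2 v hv]
  · simp [Finset.sum_add_distrib, hw1, hδ.1]

/-- One side of a neighbourhood of the relative interior of a facet `A` with normal `n`. -/
def facetTube (f : V → EuclideanSpace ℝ (Fin d)) (A : Finset V) (c : ℝ)
    (n : EuclideanSpace ℝ (Fin d)) : Set (EuclideanSpace ℝ (Fin d)) :=
  (fun x : (V → ℝ) × ℝ => affExtend f x.1 + x.2 • n) ''
    {x | (∀ v ∉ A, x.1 v = 0) ∧ ∑ v, x.1 v = 1 ∧ 0 < x.2 ∧ ∀ v ∈ A, x.2 < c * x.1 v}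

theorem continuous_affExtend (f : V → EuclideanSpace ℝ (Fin d)) : Continuous (affExtend f) := by
  unfold affExtend
  fun_prop

theorem isPreconnected_facetTube (A : Finset V) (c : ℝ) (n : EuclideanSpace ℝ (Fin d)) :
    IsPreconnected (facetTube f A c n) := by
  apply IsPreconnected.image
  · apply Convex.isPreconnected
    rintro ⟨w, s⟩ ⟨h1, h2, h3, h4⟩ ⟨w', s'⟩ ⟨h1', h2', h3', h4'⟩ a b ha hb hab
    dsimp only at h1 h2 h3 h4 h1' h2' h3' h4'
    have hpos : ∀ x y : ℝ, 0 < x → 0 < y → 0 < a * x + b * y := by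
      intro x y hx hy
      rcases ha.eq_or_lt with rfl | ha'
      · rw [zero_add] at hab
        subst hab
        simpa using hy
      · exact add_pos_of_pos_of_nonneg (mul_pos ha' hx) (mul_nonneg hb hy.le)
    refine ⟨fun v hv => ?_, ?_, hpos _ _ h3 h3', fun v hv => ?_⟩
    · simp [h1 v hv, h1' v hv]
    · simp [Finset.sum_add_distrib, ← Finset.mul_sum, h2, h2', hab]
    · have := hpos _ _ (sub_pos.2 (h4 v hv)) (sub_pos.2 (h4' v hv))
      simp only [Prod.fst_add, Prod.smul_fst, Pi.add_apply, Pi.smul_apply, smul_eq_mul,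
        Prod.snd_add, Prod.smul_snd]
      linarith
  · exact ((continuous_affExtend f).comp continuous_fst).add
      (continuous_snd.smul continuous_const) |>.continuousOn

theorem disjoint_facetTube (hK : IsClosedComplex d K) (hsep : Separated K f c) {A : Finset V}
    (hA : A ∈ K) (hAd : A.card = d) {n : EuclideanSpace ℝ (Fin d)} (hn1 : ‖n‖ = 1)
    (hn : ∀ δ ∈ balanced A, inner ℝ (affExtend f δ) n = 0) :
    Disjoint (facetTube f A c n) (polyhedron K f) := by
  rw [disjoint_left]
  rintro _ ⟨⟨w, s⟩, ⟨h1, h2, h3, h4⟩, rfl⟩ hP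
  dsimp only at h1 h2 h3 h4 hP
  have hw : ∀ v ∈ A, 0 < w v := fun v hv =>
    pos_of_mul_pos_right (h3.trans (h4 v hv)) hsep.1.le
  obtain ⟨δ, hδ, hδq⟩ := hsep.exists_balanced_of_near hK hA hAd hw h1 h2 hP (by
    intro v hv
    rw [add_sub_cancel_left, norm_smul, hn1, mul_one, Real.norm_eq_abs, abs_of_pos h3]
    exact h4 v hv)
  have := hn δ hδ
  rw [hδq, add_sub_cancel_left, real_inner_smul_left, real_inner_self_eq_norm_sq, hn1] at this
  norm_num at this
  exact h3.ne' this

/-- The barycentre of a simplex in barycentric coordinates. -/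
noncomputable def barycenter (σ : Finset V) : V → ℝ := by
  classical exact fun v => if v ∈ σ then (σ.card : ℝ)⁻¹ else 0

theorem barycenter_of_mem {V : Type*} {σ : Finset V} {v : V} (hv : v ∈ σ) :
    barycenter σ v = (σ.card : ℝ)⁻¹ := by
  simp [barycenter, hv]

theorem barycenter_of_notMem {V : Type*} {σ : Finset V} {v : V} (hv : v ∉ σ) :
    barycenter σ v = 0 := by
  simp [barycenter, hv]

theorem barycenter_pos {V : Type*} {σ : Finset V} {v : V} (hv : v ∈ σ) : 0 < barycenter σ v := by
  rw [barycenter_of_mem hv, inv_pos]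
  exact_mod_cast Finset.card_pos.2 ⟨v, hv⟩

theorem sum_barycenter {σ : Finset V} (hσ : σ.Nonempty) : ∑ v, barycenter σ v = 1 := by
  have : (σ.card : ℝ) ≠ 0 := by exact_mod_cast (Finset.card_pos.2 hσ).ne'
  rw [sum_eq_of_support fun v hv => barycenter_of_notMem hv,
    Finset.sum_congr rfl fun v hv => barycenter_of_mem hv]
  simp [this]

/-- Both tubes are connected and miss the polyhedron, so it suffices to compare one point of each
close to the barycentre, where `IsInside.flip` applies. -/
theorem facetTube_ne (hK : IsClosedComplex d K) (hsep : Separated K f c) (hχ : IsInside K f χ)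
    {A : Finset V} (hA : A ∈ K) (hAd : A.card = d) {n : EuclideanSpace ℝ (Fin d)} (hn1 : ‖n‖ = 1)
    (hn : ∀ δ ∈ balanced A, inner ℝ (affExtend f δ) n = 0) {q q' : EuclideanSpace ℝ (Fin d)}
    (hq : q ∈ facetTube f A c n) (hq' : q' ∈ facetTube f A c (-n)) : χ q ≠ χ q' := by
  have hn' : ∀ δ ∈ balanced A, inner ℝ (affExtend f δ) (-n) = 0 := fun δ hδ => by
    rw [inner_neg_right, hn δ hδ, neg_zero]
  have hn0 : n ≠ 0 := by
    rintro rfl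
    simp at hn1
  have hAne : A.Nonempty := face_nonempty hA
  set w := barycenter A with hw
  obtain ⟨r, hr, hflip⟩ := hχ.flip A hA hAd w (fun v hv => barycenter_pos hv)
    (fun v hv => barycenter_of_notMem hv) (sum_barycenter hAne) n hn0 hn
  have hcard : 0 < (A.card : ℝ)⁻¹ := by
    rw [inv_pos]
    exact_mod_cast Finset.card_pos.2 hAne
  obtain ⟨s, hs0, hs⟩ := exists_between (lt_min hr (mul_pos hsep.1 hcard))
  obtain ⟨hsr, hsc⟩ := lt_min_iff.1 hs
  have hmem : ∀ m : EuclideanSpace ℝ (Fin d), affExtend f w + s • m ∈ facetTube f A c m :=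
    fun m => ⟨(w, s), ⟨fun v hv => barycenter_of_notMem hv, sum_barycenter hAne, hs0,
      fun v hv => by simpa only [hw, barycenter_of_mem hv] using hsc⟩, rfl⟩
  rw [hχ.eq_of_isPreconnected (isPreconnected_facetTube A c n)
      (disjoint_facetTube hK hsep hA hAd hn1 hn) hq (hmem n),
    hχ.eq_of_isPreconnected (isPreconnected_facetTube A c (-n))
      (disjoint_facetTube hK hsep hA hAd (by rwa [norm_neg]) hn') hq' (hmem (-n))]
  apply hflip
  · rwa [mem_ball_iff_norm, add_sub_cancel_left, norm_smul, hn1, mul_one, Real.norm_eq_abs,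
      abs_of_pos hs0]
  · rwa [mem_ball_iff_norm, add_sub_cancel_left, norm_smul, norm_neg, hn1, mul_one,
      Real.norm_eq_abs, abs_of_pos hs0]
  · rw [add_sub_cancel_left, real_inner_smul_left, real_inner_self_eq_norm_sq, hn1]
    simpa using hs0
  · rw [add_sub_cancel_left, real_inner_smul_left, inner_neg_left, real_inner_self_eq_norm_sq, hn1]
    simpa using hs0

theorem facetTube_nonempty (hc : 0 < c) {A : Finset V} (hA : A ∈ K)
    (n : EuclideanSpace ℝ (Fin d)) : (facetTube f A c n).Nonempty := by
  have hAne : A.Nonempty := face_nonempty hA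
  have hcard : 0 < (A.card : ℝ)⁻¹ := by
    rw [inv_pos]
    exact_mod_cast Finset.card_pos.2 hAne
  obtain ⟨s, hs0, hsc⟩ := exists_between (mul_pos hc hcard)
  exact ⟨_, (barycenter A, s), ⟨fun v hv => barycenter_of_notMem hv, sum_barycenter hAne, hs0,
      fun v hv => by simpa only [barycenter_of_mem hv] using hsc⟩, rfl⟩

/-- The component of `n'` orthogonal to `n` is parallel to the facet, hence orthogonal to `n'` and
therefore to itself. -/
theorem eq_or_eq_neg_of_normal (hd : 0 < d) {A : Finset V} (hAd : A.card = d)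
    (hcA : Compat f A A) {n n' : EuclideanSpace ℝ (Fin d)} (hn1 : ‖n‖ = 1) (hn1' : ‖n'‖ = 1)
    (hn : ∀ δ ∈ balanced A, inner ℝ (affExtend f δ) n = 0)
    (hn' : ∀ δ ∈ balanced A, inner ℝ (affExtend f δ) n' = 0) : n' = n ∨ n' = -n := by
  have hn0 : n ≠ 0 := by
    rintro rfl
    simp at hn1
  set k : ℝ := inner ℝ n' n with hk
  have h1 : inner ℝ (n' - k • n) n = 0 := by
    rw [inner_sub_left, real_inner_smul_left, real_inner_self_eq_norm_sq, hn1]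
    simp [hk]
  obtain ⟨δ, hδ, hδn⟩ := mem_direction.1 (mem_direction_of_orthogonal_normal hcA hAd hd hn0 hn h1)
  have h2 : inner ℝ (n' - k • n) (n' - k • n) = 0 := by
    rw [inner_sub_right, real_inner_smul_right, h1, mul_zero, sub_zero, ← hδn]
    exact hn' δ hδ
  have h3 : n' = k • n := sub_eq_zero.1 (inner_self_eq_zero.1 h2)
  have h4 : |k| = 1 := by
    rw [h3, norm_smul, hn1, mul_one] at hn1'
    exact hn1'
  rcases (abs_eq zero_le_one).1 h4 with h | h
  · left
    rw [h3, h, one_smul]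
  · right
    rw [h3, h, neg_one_smul]

end Tubes

/-! ### Ridges and their two facets -/

section Ridge

variable {V : Type*} {d : ℕ} {K : AbstractSimplicialComplex V} {y : Finset V} {a b : V}

/-- The ridge `y` with its two facets `y ∪ {a}` and `y ∪ {b}`. -/
structure IsRidge [DecidableEq V] (d : ℕ) (K : AbstractSimplicialComplex V) (y : Finset V)
    (a b : V) : Prop where
  mem : y ∈ K
  card : y.card + 1 = d
  notMem_a : a ∉ y
  notMem_b : b ∉ y
  ne : a ≠ b
  mem_a : insert a y ∈ K
  mem_b : insert b y ∈ K
  eq_or_eq : ∀ ρ ∈ K, ρ.card = d → y ⊆ ρ → ρ = insert a y ∨ ρ = insert b y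

theorem IsRidge.swap [DecidableEq V] (h : IsRidge d K y a b) : IsRidge d K y b a :=
  ⟨h.mem, h.card, h.notMem_b, h.notMem_a, h.ne.symm, h.mem_b, h.mem_a,
    fun ρ h1 h2 h3 => (h.eq_or_eq ρ h1 h2 h3).symm⟩

theorem IsRidge.card_a [DecidableEq V] (h : IsRidge d K y a b) : (insert a y).card = d := by
  rw [Finset.card_insert_of_notMem h.notMem_a, h.card]

theorem exists_insert_of_card [DecidableEq V] {y τ : Finset V} (h : y ⊆ τ)
    (hc : τ.card = y.card + 1) : ∃ a, a ∉ y ∧ τ = insert a y := by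
  obtain ⟨a, ha, ha'⟩ := Finset.exists_mem_notMem_of_card_lt_card (s := y) (t := τ) (by omega)
  refine ⟨a, ha', (Finset.eq_of_subset_of_card_le (Finset.insert_subset ha h) ?_).symm⟩
  rw [Finset.card_insert_of_notMem ha', hc]

theorem IsClosedComplex.isRidge_of_facets [DecidableEq V] (hK : IsClosedComplex d K) (hy : y ∈ K)
    (hyd : y.card + 1 = d) {σ τ : Finset V} (hσ : σ ∈ K) (hσd : σ.card = d) (hyσ : y ⊆ σ)
    (hτ : τ ∈ K) (hτd : τ.card = d) (hyτ : y ⊆ τ) (hne : τ ≠ σ) :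
    ∃ a b, σ = insert a y ∧ τ = insert b y ∧ IsRidge d K y a b := by
  obtain ⟨a, ha, rfl⟩ := exists_insert_of_card hyσ (by omega)
  obtain ⟨b, hb, rfl⟩ := exists_insert_of_card hyτ (by omega)
  obtain ⟨ρ, -, -, -, -, huniq⟩ := hK.exists_other_facet hy hyd hσ hσd hyσ
  have hρ : insert b y = ρ := (huniq _ hτ hτd hyτ).resolve_left hne
  refine ⟨a, b, rfl, rfl, hy, hyd, ha, hb, ?_, hσ, hτ, fun ρ' h1 h2 h3 => ?_⟩
  · rintro rfl
    exact hne rfl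
  · rw [hρ]
    exact huniq ρ' h1 h2 h3

theorem IsClosedComplex.exists_isRidge [DecidableEq V] (hK : IsClosedComplex d K) (hy : y ∈ K)
    (hyd : y.card + 1 = d) : ∃ a b, IsRidge d K y a b := by
  obtain ⟨σ, hσ, hσd, hyσ⟩ := hK.pure y hy
  obtain ⟨τ, hτ, hτd, hyτ, hne, -⟩ := hK.exists_other_facet hy hyd hσ hσd hyσ
  obtain ⟨a, b, -, -, h⟩ := hK.isRidge_of_facets hy hyd hσ hσd hyσ hτ hτd hyτ hne
  exact ⟨a, b, h⟩

end Ridge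

/-! ### Hinges and wedges -/

section Hinge

variable {V : Type*} [Fintype V] {d : ℕ} {K : AbstractSimplicialComplex V}
  {f : V → EuclideanSpace ℝ (Fin d)} {c : ℝ} {χ : EuclideanSpace ℝ (Fin d) → ZMod 2}

/-- Rotating by `φ` gives `sin (φ - θ) = 0` with `φ - θ` in `(0, 2π)`, hence `φ - θ = π` and `t = -ρ
< 0`. The case `t = 0` is allowed, so the origin is excluded too. -/
theorem polar_ne {ρ t θ φ : ℝ} (hρ : 0 < ρ) (ht : 0 ≤ t) (h1 : θ < φ) (h2 : φ < θ + 2 * Real.pi)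
    (hc : ρ * Real.cos θ = t * Real.cos φ) (hs : ρ * Real.sin θ = t * Real.sin φ) : False := by
  have e1 : ρ * Real.sin (φ - θ) = 0 := by
    rw [Real.sin_sub]
    linear_combination (Real.sin φ) * hc - (Real.cos φ) * hs
  have e2 : ρ * Real.cos (φ - θ) = t := by
    rw [Real.cos_sub]
    linear_combination (Real.cos φ) * hc + (Real.sin φ) * hs + t * Real.sin_sq_add_cos_sq φ
  have e3 : Real.sin (φ - θ) = 0 := (mul_eq_zero.1 e1).resolve_left hρ.ne'
  rcases lt_trichotomy (φ - θ) Real.pi with h | h | h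
  · exact absurd e3 (Real.sin_pos_of_pos_of_lt_pi (by linarith) h).ne'
  · rw [h, Real.cos_pi] at e2
    linarith
  · have := Real.sin_pos_of_pos_of_lt_pi (x := φ - θ - Real.pi) (by linarith) (by linarith)
    rw [Real.sin_sub_pi, e3] at this
    simp at this

theorem exists_polar {α β : ℝ} (h : α ≠ 0 ∨ β ≠ 0) : ∃ ρ θ : ℝ, 0 < ρ ∧ 0 ≤ θ ∧ θ < 2 * Real.pi ∧
    α = ρ * Real.cos θ ∧ β = ρ * Real.sin θ := by
  set z : ℂ := ⟨α, β⟩ with hz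
  have hz0 : z ≠ 0 := by
    intro h0
    have h1 := congrArg Complex.re h0
    have h2 := congrArg Complex.im h0
    simp [hz] at h1 h2
    rcases h with h | h
    · exact h h1
    · exact h h2
  have hre : α = ‖z‖ * Real.cos z.arg := by
    rw [Complex.cos_arg hz0, mul_div_cancel₀ _ (norm_ne_zero_iff.2 hz0)]
  have him : β = ‖z‖ * Real.sin z.arg := by
    rw [Complex.sin_arg, mul_div_cancel₀ _ (norm_ne_zero_iff.2 hz0)]
  have hpi := Real.pi_pos
  have h1 := Complex.neg_pi_lt_arg z
  have h2 := Complex.arg_le_pi z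
  rcases le_or_gt 0 z.arg with h0 | h0
  · exact ⟨‖z‖, z.arg, norm_pos_iff.2 hz0, h0, by linarith, hre, him⟩
  · refine ⟨‖z‖, z.arg + 2 * Real.pi, norm_pos_iff.2 hz0, by linarith, by linarith, ?_, ?_⟩
    · rw [Real.cos_add_two_pi]
      exact hre
    · rw [Real.sin_add_two_pi]
      exact him

/-- The facets `y ∪ {a}` and `y ∪ {b}` make the angle `φ` at their common face `y`, measured from
the unit vector `e₁` parallel to the first one towards the unit normal `e₂`. -/
structure HingeFrame (f : V → EuclideanSpace ℝ (Fin d)) (y : Finset V) (a b : V)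
    (e₁ e₂ : EuclideanSpace ℝ (Fin d)) (φ : ℝ) : Prop where
  norm₁ : ‖e₁‖ = 1
  norm₂ : ‖e₂‖ = 1
  inner₁₂ : inner ℝ e₁ e₂ = 0
  orth₁ : ∀ δ ∈ balanced y, inner ℝ (affExtend f δ) e₁ = 0
  orth₂ : ∀ δ ∈ balanced y, inner ℝ (affExtend f δ) e₂ = 0
  pos : 0 < φ
  lt : φ < 2 * Real.pi
  foot_a : ∃ (l : V → ℝ) (r : ℝ), ∑ v, l v = 1 ∧ (∀ v ∉ y, l v = 0) ∧ 0 < r ∧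
    f a = affExtend f l + r • e₁
  foot_b : ∃ (l : V → ℝ) (r : ℝ), ∑ v, l v = 1 ∧ (∀ v ∉ y, l v = 0) ∧ 0 < r ∧
    f b = affExtend f l + r • (Real.cos φ • e₁ + Real.sin φ • e₂)

variable {y : Finset V} {a b : V} {e₁ e₂ : EuclideanSpace ℝ (Fin d)} {φ : ℝ}

/-- The complementary wedge of the same hinge, seen from the other side of the first facet. -/
theorem HingeFrame.flip (h : HingeFrame f y a b e₁ e₂ φ) :
    HingeFrame f y a b e₁ (-e₂) (2 * Real.pi - φ) where
  norm₁ := h.norm₁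
  norm₂ := by rw [norm_neg, h.norm₂]
  inner₁₂ := by rw [inner_neg_right, h.inner₁₂, neg_zero]
  orth₁ := h.orth₁
  orth₂ := fun δ hδ => by rw [inner_neg_right, h.orth₂ δ hδ, neg_zero]
  pos := by linarith [h.lt]
  lt := by linarith [h.pos]
  foot_a := h.foot_a
  foot_b := by
    rw [Real.cos_two_pi_sub, Real.sin_two_pi_sub, smul_neg, neg_smul, neg_neg]
    exact h.foot_b

theorem HingeFrame.inner_self₁ (h : HingeFrame f y a b e₁ e₂ φ) : inner ℝ e₁ e₁ = (1 : ℝ) := by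
  rw [real_inner_self_eq_norm_sq, h.norm₁, one_pow]

theorem HingeFrame.inner_self₂ (h : HingeFrame f y a b e₁ e₂ φ) : inner ℝ e₂ e₂ = (1 : ℝ) := by
  rw [real_inner_self_eq_norm_sq, h.norm₂, one_pow]

theorem HingeFrame.inner₂₁ (h : HingeFrame f y a b e₁ e₂ φ) : inner ℝ e₂ e₁ = (0 : ℝ) := by
  rw [real_inner_comm, h.inner₁₂]

theorem HingeFrame.inner_polar₁ (h : HingeFrame f y a b e₁ e₂ φ) (α β : ℝ) :
    inner ℝ (α • e₁ + β • e₂) e₁ = α := by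
  rw [inner_add_left, real_inner_smul_left, real_inner_smul_left, h.inner_self₁, h.inner₂₁]
  ring

theorem HingeFrame.inner_polar₂ (h : HingeFrame f y a b e₁ e₂ φ) (α β : ℝ) :
    inner ℝ (α • e₁ + β • e₂) e₂ = β := by
  rw [inner_add_left, real_inner_smul_left, real_inner_smul_left, h.inner_self₂, h.inner₁₂]
  ring

theorem HingeFrame.norm_sq_polar (h : HingeFrame f y a b e₁ e₂ φ) (α β : ℝ) :
    ‖α • e₁ + β • e₂‖ ^ 2 = α ^ 2 + β ^ 2 := by
  rw [← real_inner_self_eq_norm_sq, inner_add_right, real_inner_smul_right, real_inner_smul_right,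
    h.inner_polar₁, h.inner_polar₂]
  ring

theorem HingeFrame.norm_polar (h : HingeFrame f y a b e₁ e₂ φ) (θ : ℝ) :
    ‖Real.cos θ • e₁ + Real.sin θ • e₂‖ = 1 := by
  have := h.norm_sq_polar (Real.cos θ) (Real.sin θ)
  rw [Real.cos_sq_add_sin_sq] at this
  exact (pow_eq_one_iff_of_nonneg (norm_nonneg _) two_ne_zero).1 this

/-- The reflection of the normal plane exchanging the two rays preserves the wedge. It transfers
statements about the facet of `a` to the facet of `b`. -/
theorem HingeFrame.swap (h : HingeFrame f y a b e₁ e₂ φ) :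
    HingeFrame f y b a (Real.cos φ • e₁ + Real.sin φ • e₂) (Real.sin φ • e₁ - Real.cos φ • e₂)
      φ where
  norm₁ := h.norm_polar φ
  norm₂ := by
    have := h.norm_sq_polar (Real.sin φ) (-Real.cos φ)
    rw [neg_sq, Real.sin_sq_add_cos_sq, neg_smul, ← sub_eq_add_neg] at this
    exact (pow_eq_one_iff_of_nonneg (norm_nonneg _) two_ne_zero).1 this
  inner₁₂ := by
    rw [inner_sub_right, real_inner_smul_right, real_inner_smul_right, h.inner_polar₁,
      h.inner_polar₂]
    ring
  orth₁ := fun δ hδ => by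
    rw [inner_add_right, real_inner_smul_right, real_inner_smul_right, h.orth₁ δ hδ, h.orth₂ δ hδ]
    ring
  orth₂ := fun δ hδ => by
    rw [inner_sub_right, real_inner_smul_right, real_inner_smul_right, h.orth₁ δ hδ, h.orth₂ δ hδ]
    ring
  pos := h.pos
  lt := h.lt
  foot_a := h.foot_b
  foot_b := by
    have e : Real.cos φ • (Real.cos φ • e₁ + Real.sin φ • e₂) +
        Real.sin φ • (Real.sin φ • e₁ - Real.cos φ • e₂) = e₁ := by
      have := Real.cos_sq_add_sin_sq φ
      calc _ = (Real.cos φ ^ 2 + Real.sin φ ^ 2) • e₁ := by module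
        _ = e₁ := by rw [this, one_smul]
    rw [e]
    exact h.foot_a

/-- The wedge of angle `φ` at the relative interior of the simplex `y`. -/
def ridgeTube (f : V → EuclideanSpace ℝ (Fin d)) (y : Finset V) (c : ℝ)
    (e₁ e₂ : EuclideanSpace ℝ (Fin d)) (φ : ℝ) : Set (EuclideanSpace ℝ (Fin d)) :=
  (fun x : (V → ℝ) × ℝ × ℝ => affExtend f x.1 + x.2.1 • (Real.cos x.2.2 • e₁ + Real.sin x.2.2 • e₂))
    '' {x | (∀ v ∉ y, x.1 v = 0) ∧ ∑ v, x.1 v = 1 ∧ 0 < x.2.1 ∧ (∀ v ∈ y, x.2.1 < c * x.1 v) ∧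
      0 < x.2.2 ∧ x.2.2 < φ}

theorem isPreconnected_ridgeTube (f : V → EuclideanSpace ℝ (Fin d)) (y : Finset V) (c : ℝ)
    (e₁ e₂ : EuclideanSpace ℝ (Fin d)) (φ : ℝ) : IsPreconnected (ridgeTube f y c e₁ e₂ φ) := by
  apply IsPreconnected.image
  · apply Convex.isPreconnected
    rintro ⟨w, s, θ⟩ ⟨h1, h2, h3, h4, h5, h6⟩ ⟨w', s', θ'⟩ ⟨h1', h2', h3', h4', h5', h6'⟩ a b ha hb
      hab
    dsimp only at h1 h2 h3 h4 h1' h2' h3' h4' h5 h6 h5' h6'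
    have hpos : ∀ x y : ℝ, 0 < x → 0 < y → 0 < a * x + b * y := by
      intro x y hx hy
      rcases ha.eq_or_lt with rfl | ha'
      · rw [zero_add] at hab
        subst hab
        simpa using hy
      · exact add_pos_of_pos_of_nonneg (mul_pos ha' hx) (mul_nonneg hb hy.le)
    refine ⟨fun v hv => ?_, ?_, hpos _ _ h3 h3', fun v hv => ?_, hpos _ _ h5 h5', ?_⟩
    · simp [h1 v hv, h1' v hv]
    · simp [Finset.sum_add_distrib, ← Finset.mul_sum, h2, h2', hab]
    · have := hpos _ _ (sub_pos.2 (h4 v hv)) (sub_pos.2 (h4' v hv))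
      simp only [Prod.fst_add, Prod.smul_fst, Pi.add_apply, Pi.smul_apply, smul_eq_mul,
        Prod.snd_add, Prod.smul_snd]
      linarith
    · have := hpos _ _ (sub_pos.2 h6) (sub_pos.2 h6')
      simp only [Prod.smul_snd, Prod.snd_add, smul_eq_mul]
      have e : a * (φ - θ) + b * (φ - θ') = (a + b) * φ - (a * θ + b * θ') := by ring
      rw [e, hab] at this
      linarith
  · refine (((continuous_affExtend f).comp continuous_fst).add ?_).continuousOn
    fun_prop

theorem HingeFrame.exists_balanced_insert [DecidableEq V] (h : HingeFrame f y a b e₁ e₂ φ)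
    (ha : a ∉ y) {δ : V → ℝ} (hδ : δ ∈ balanced (insert a y)) :
    ∃ δ' ∈ balanced y, ∃ r > 0, affExtend f δ = affExtend f δ' + (δ a * r) • e₁ := by
  obtain ⟨l, r, hl1, hls, hr, hfa⟩ := h.foot_a
  refine ⟨δ - δ a • (Pi.single a 1 - l), ⟨?_, fun v hv => ?_⟩, r, hr, ?_⟩
  · simp [Finset.sum_sub_distrib, ← Finset.mul_sum, hδ.1, hl1]
  · by_cases hva : v = a
    · subst hva
      simp [hls v hv]
    · simp [hls v hv, hva, hδ.2 v (by simp [hva, hv])]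
  · rw [affExtend_sub, affExtend_smul, affExtend_sub, affExtend_single, one_smul, hfa]
    module

/-- A point of the polyhedron this near to the ridge lies in a simplex through `y`, hence in one of
the two facets. Its projection to the plane of `e₁, e₂` is then on the ray of angle `0` or `φ`,
which the open wedge avoids. -/
theorem disjoint_ridgeTube [DecidableEq V] (hK : IsClosedComplex d K) (hsep : Separated K f c)
    (hy : IsRidge d K y a b) (h : HingeFrame f y a b e₁ e₂ φ) :
    Disjoint (ridgeTube f y c e₁ e₂ φ) (polyhedron K f) := by
  rw [disjoint_left]
  rintro _ ⟨⟨w, ρ, θ⟩, ⟨h1, h2, h3, h4, h5, h6⟩, rfl⟩ ⟨w', hw', hw'eq⟩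
  dsimp only at h1 h2 h3 h4 h5 h6 hw'eq
  have hw : ∀ v ∈ y, 0 < w v := fun v hv => pos_of_mul_pos_right (h3.trans (h4 v hv)) hsep.1.le
  have hwr := mem_realization_of_mem hy.mem (fun v hv => (hw v hv).le) h1 h2
  obtain ⟨h0', h1', τ, hτ, hsτ⟩ := id hw'
  have hsub : y ⊆ τ := by
    intro v hv
    by_contra hvτ
    have := hsep.pos_of_near hwr hw' (v := v) (by
      rw [hw'eq, add_sub_cancel_left, norm_smul, h.norm_polar, mul_one, Real.norm_eq_abs,
        abs_of_pos h3]
      exact h4 v hv)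
    rw [hsτ v hvτ] at this
    exact lt_irrefl _ this
  obtain ⟨σ, hσ, hσd, hτσ⟩ := hK.pure τ hτ
  have hsσ : ∀ v ∉ σ, w' v = 0 := fun v hv => hsτ v fun hh => hv (hτσ hh)
  have hdiff : affExtend f (w' - w) = ρ • (Real.cos θ • e₁ + Real.sin θ • e₂) := by
    rw [affExtend_sub, hw'eq, add_sub_cancel_left]
  have hbal : w' - w ∈ balanced σ := sub_mem_balanced (by rw [h1', h2]) hsσ
    fun v hv => h1 v fun hh => hv (hτσ (hsub hh))
  have hin1 : inner ℝ (affExtend f (w' - w)) e₁ = ρ * Real.cos θ := by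
    rw [hdiff, real_inner_smul_left, h.inner_polar₁]
  have hin2 : inner ℝ (affExtend f (w' - w)) e₂ = ρ * Real.sin θ := by
    rw [hdiff, real_inner_smul_left, h.inner_polar₂]
  rcases hy.eq_or_eq σ hσ hσd (hsub.trans hτσ) with rfl | rfl
  · obtain ⟨δ', hδ', r, hr, he⟩ := h.exists_balanced_insert hy.notMem_a hbal
    have hna : 0 ≤ (w' - w) a * r := by
      rw [Pi.sub_apply, h1 a hy.notMem_a, sub_zero]
      exact mul_nonneg (h0' a) hr.le
    rw [he, inner_add_left, h.orth₁ δ' hδ', real_inner_smul_left, h.inner_self₁] at hin1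
    rw [he, inner_add_left, h.orth₂ δ' hδ', real_inner_smul_left, h.inner₁₂] at hin2
    -- The ray of the first facet is given the angle `2π` instead of `0`, to be larger than `θ`.
    refine polar_ne (t := (w' - w) a * r) (θ := θ) (φ := 2 * Real.pi) h3 hna (h6.trans h.lt)
      (by linarith) ?_ ?_
    · rw [Real.cos_two_pi, ← hin1]
      ring
    · rw [Real.sin_two_pi, ← hin2]
      ring
  · obtain ⟨δ', hδ', r, hr, he⟩ := h.swap.exists_balanced_insert hy.notMem_b hbal
    have hna : 0 ≤ (w' - w) b * r := by
      rw [Pi.sub_apply, h1 b hy.notMem_b, sub_zero]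
      exact mul_nonneg (h0' b) hr.le
    rw [he, inner_add_left, h.orth₁ δ' hδ', real_inner_smul_left, h.inner_polar₁] at hin1
    rw [he, inner_add_left, h.orth₂ δ' hδ', real_inner_smul_left, h.inner_polar₂] at hin2
    exact polar_ne (t := (w' - w) b * r) (θ := θ) (φ := φ) h3 hna h6
      (by linarith [h.lt]) (by rw [← hin1]; ring) (by rw [← hin2]; ring)

theorem ridgeTube_swap (f : V → EuclideanSpace ℝ (Fin d)) (y : Finset V) (c : ℝ)
    (e₁ e₂ : EuclideanSpace ℝ (Fin d)) (φ : ℝ) :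
    ridgeTube f y c (Real.cos φ • e₁ + Real.sin φ • e₂) (Real.sin φ • e₁ - Real.cos φ • e₂) φ =
      ridgeTube f y c e₁ e₂ φ := by
  have e : ∀ θ, Real.cos θ • (Real.cos φ • e₁ + Real.sin φ • e₂) +
      Real.sin θ • (Real.sin φ • e₁ - Real.cos φ • e₂) =
        Real.cos (φ - θ) • e₁ + Real.sin (φ - θ) • e₂ := by
    intro θ
    rw [Real.cos_sub, Real.sin_sub]
    module
  ext q
  constructor
  · rintro ⟨⟨w, ρ, θ⟩, ⟨h1, h2, h3, h4, h5, h6⟩, rfl⟩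
    dsimp only at h1 h2 h3 h4 h5 h6 ⊢
    rw [e]
    exact ⟨(w, ρ, φ - θ), ⟨h1, h2, h3, h4, sub_pos.2 h6, by dsimp only; linarith⟩, rfl⟩
  · rintro ⟨⟨w, ρ, θ⟩, ⟨h1, h2, h3, h4, h5, h6⟩, rfl⟩
    dsimp only at h1 h2 h3 h4 h5 h6 ⊢
    refine ⟨(w, ρ, φ - θ), ⟨h1, h2, h3, h4, sub_pos.2 h6, by dsimp only; linarith⟩, ?_⟩
    dsimp only
    rw [e, sub_sub_cancel]

theorem HingeFrame.normal [DecidableEq V] (h : HingeFrame f y a b e₁ e₂ φ) (ha : a ∉ y)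
    {δ : V → ℝ} (hδ : δ ∈ balanced (insert a y)) : inner ℝ (affExtend f δ) e₂ = 0 := by
  obtain ⟨δ', hδ', r, -, he⟩ := h.exists_balanced_insert ha hδ
  rw [he, inner_add_left, h.orth₂ δ' hδ', real_inner_smul_left, h.inner₁₂]
  ring

/-- At a small angle `θ` over the first facet the wedge lies above the relative interior of this
facet. This overlap is what passes information from a ridge to a side of a facet and back. -/
theorem ridgeTube_inter_facetTube [DecidableEq V] (hc : 0 < c) (hyne : y.Nonempty)
    (h : HingeFrame f y a b e₁ e₂ φ) (ha : a ∉ y) :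
    (ridgeTube f y c e₁ e₂ φ ∩ facetTube f (insert a y) c e₂).Nonempty := by
  obtain ⟨l, r, hl1, hls, hr, hfa⟩ := h.foot_a
  set m : ℝ := (y.card : ℝ)⁻¹ with hm
  have hmpos : 0 < m := by
    rw [hm, inv_pos]
    exact_mod_cast Finset.card_pos.2 hyne
  obtain ⟨L, hL0, hL⟩ : ∃ L : ℝ, 0 < L ∧ ∀ v, |l v| ≤ L := by
    obtain ⟨L, hL⟩ := (Set.finite_range fun v => |l v|).bddAbove
    exact ⟨max L 1, lt_max_of_lt_right one_pos, fun v => le_max_of_le_left (hL ⟨v, rfl⟩)⟩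
  -- The first bound is the one in `ridgeTube`; by the second one, moving along the facet by at most
  -- `ρ` changes every weight on `y` by less than half of its value `m`.
  obtain ⟨ρ, hρ0, hρ⟩ := exists_between (lt_min (mul_pos hc hmpos)
    (div_pos (mul_pos hmpos hr) (mul_pos two_pos hL0)))
  obtain ⟨hρ1, hρ2⟩ := lt_min_iff.1 hρ
  rw [lt_div_iff₀ (by positivity)] at hρ2
  have hev : ∀ᶠ θ in 𝓝[>] (0 : ℝ), (Real.sin θ < c * (Real.cos θ / r) ∧
      ρ * Real.sin θ < c * (m / 2)) ∧ (0 < Real.cos θ ∧ 0 < Real.sin θ) ∧ 0 < θ ∧ θ < φ := by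
    have hcos : ContinuousAt Real.cos 0 := Real.continuous_cos.continuousAt
    have hsin : ContinuousAt Real.sin 0 := Real.continuous_sin.continuousAt
    refine Filter.Eventually.and (.and ?_ ?_) (.and (.and ?_ ?_) (.and ?_ ?_))
    · refine nhdsWithin_le_nhds (hsin.eventually_lt (continuousAt_const.mul (hcos.div_const r)) ?_)
      change Real.sin 0 < c * (Real.cos 0 / r)
      rw [Real.sin_zero, Real.cos_zero]
      positivity
    · refine nhdsWithin_le_nhds ((continuousAt_const.mul hsin).eventually_lt continuousAt_const ?_)
      change ρ * Real.sin 0 < c * (m / 2)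
      rw [Real.sin_zero, mul_zero]
      positivity
    · refine nhdsWithin_le_nhds (continuousAt_const.eventually_lt hcos ?_)
      simp
    · filter_upwards [self_mem_nhdsWithin, nhdsWithin_le_nhds (eventually_lt_nhds Real.pi_pos)]
        with θ h1 h2
      exact Real.sin_pos_of_pos_of_lt_pi h1 h2
    · exact self_mem_nhdsWithin
    · exact nhdsWithin_le_nhds (eventually_lt_nhds h.pos)
  obtain ⟨θ, ⟨h1, h2⟩, ⟨h3, h3'⟩, h4, h5⟩ := hev.exists
  -- The weight of `a` in the projection of the point to the hyperplane of the facet.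
  set κ : ℝ := ρ * Real.cos θ / r with hκ
  have hκ0 : 0 < κ := by positivity
  have hκl : ∀ v, |κ * l v| < m / 2 := by
    intro v
    rw [abs_mul, abs_of_pos hκ0]
    have e1 : κ ≤ ρ / r := by
      rw [hκ]
      gcongr
      exact mul_le_of_le_one_right hρ0.le (Real.cos_le_one θ)
    have e2 : ρ / r * L < m / 2 := by
      rw [div_mul_eq_mul_div, div_lt_iff₀ hr]
      linarith
    exact (mul_le_mul e1 (hL v) (abs_nonneg _) (by positivity)).trans_lt e2
  have hay : ∀ v ∈ y, v ≠ a := fun v hv hva => ha (hva ▸ hv)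
  refine ⟨affExtend f (barycenter y) + ρ • (Real.cos θ • e₁ + Real.sin θ • e₂),
    ⟨(barycenter y, ρ, θ), ⟨fun v hv => barycenter_of_notMem hv, sum_barycenter hyne, hρ0,
      fun v hv => ?_, h4, h5⟩, rfl⟩,
    ⟨(barycenter y + κ • (Pi.single a 1 - l), ρ * Real.sin θ), ⟨fun v hv => ?_, ?_, ?_,
      fun v hv => ?_⟩, ?_⟩⟩
  · dsimp only
    rwa [barycenter_of_mem hv]
  · rw [Finset.mem_insert, not_or] at hv
    simp [barycenter_of_notMem hv.2, hv.1, hls v hv.2]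
  · simp [Finset.sum_add_distrib, Finset.sum_sub_distrib, ← Finset.mul_sum, sum_barycenter hyne,
      hl1]
  · exact mul_pos hρ0 h3'
  · dsimp only
    rcases Finset.mem_insert.1 hv with rfl | hvy
    · have e1 : (barycenter y + κ • (Pi.single v 1 - l) : V → ℝ) v = κ := by
        simp [barycenter_of_notMem ha, hls v ha]
      rw [e1, hκ, mul_div_assoc]
      calc ρ * Real.sin θ < ρ * (c * (Real.cos θ / r)) := mul_lt_mul_of_pos_left h1 hρ0
        _ = c * (ρ * (Real.cos θ / r)) := by ring
    · have e1 : (barycenter y + κ • (Pi.single a 1 - l) : V → ℝ) v = m - κ * l v := by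
        simp [barycenter_of_mem hvy, hay v hvy, ← hm]
        ring
      rw [e1]
      refine h2.trans (mul_lt_mul_of_pos_left ?_ hc)
      have := (abs_lt.1 (hκl v)).2
      linarith
  · dsimp only
    have e1 : κ * r = ρ * Real.cos θ := by
      rw [hκ]
      field_simp
    rw [affExtend_add, affExtend_smul, affExtend_sub, affExtend_single, one_smul, hfa,
      add_sub_cancel_left, smul_smul, e1]
    module

end Hinge


/-! ### Existence of hinge frames -/

section Frames

variable {V : Type*} [Fintype V] [DecidableEq V] {d : ℕ} {K : AbstractSimplicialComplex V}
  {f : V → EuclideanSpace ℝ (Fin d)} {c : ℝ} {χ : EuclideanSpace ℝ (Fin d) → ZMod 2}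
  {y : Finset V} {a b : V} {e₁ e₂ : EuclideanSpace ℝ (Fin d)} {φ : ℝ}

theorem exists_unit_foot (hc : Compat f (insert a y) (insert a y)) (hyne : y.Nonempty)
    (ha : a ∉ y) : ∃ (l : V → ℝ) (r : ℝ) (u : EuclideanSpace ℝ (Fin d)), ∑ v, l v = 1 ∧
      (∀ v ∉ y, l v = 0) ∧ 0 < r ∧ ‖u‖ = 1 ∧ (∀ δ ∈ balanced y, inner ℝ (affExtend f δ) u = 0) ∧
      f a = affExtend f l + r • u := by
  obtain ⟨l, hl1, hls, hl⟩ := exists_orthogonal_foot f hyne (f a)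
  have hz : f a - affExtend f l ≠ 0 := by
    intro h0
    have h1 : (Pi.single a 1 - l : V → ℝ) ∈ balanced (insert a y) := by
      refine ⟨by simp [Finset.sum_sub_distrib, hl1], fun v hv => ?_⟩
      rw [Finset.mem_insert, not_or] at hv
      simp [hv.1, hls v hv.2]
    have h2 := hc.eq_zero_of_balanced h1 (by rw [affExtend_sub, affExtend_single, one_smul, h0])
    have h3 := congrFun h2 a
    simp [hls a ha] at h3
  refine ⟨l, ‖f a - affExtend f l‖, ‖f a - affExtend f l‖⁻¹ • (f a - affExtend f l), hl1, hls,
    norm_pos_iff.2 hz, norm_smul_inv_norm hz, fun δ hδ => ?_, ?_⟩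
  · rw [real_inner_smul_right, hl δ hδ, mul_zero]
  · rw [smul_smul, mul_inv_cancel₀ (norm_ne_zero_iff.2 hz), one_smul, add_sub_cancel]

/-- If the two unit vectors agreed, the facets would overlap on one side of `y`; the difference of
the two perpendiculars, scaled to unit length, would be a nonzero weight violating `Compat`. -/
theorem Compat.inner_lt_one (hc : Compat f (insert a y) (insert b y)) (ha : a ∉ y) (hb : b ∉ y)
    (hab : a ≠ b)
    {l l' : V → ℝ} {r r' : ℝ} {u u' : EuclideanSpace ℝ (Fin d)} (hl : ∑ v, l v = 1)
    (hls : ∀ v ∉ y, l v = 0) (hr : 0 < r) (hu : ‖u‖ = 1) (hf : f a = affExtend f l + r • u)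
    (hl' : ∑ v, l' v = 1) (hls' : ∀ v ∉ y, l' v = 0) (hr' : 0 < r') (hu' : ‖u'‖ = 1)
    (hf' : f b = affExtend f l' + r' • u') : inner ℝ u u' < (1 : ℝ) := by
  refine lt_of_le_of_ne ?_ fun h1 => ?_
  · have := real_inner_le_norm u u'
    rwa [hu, hu', mul_one] at this
  · have huu : u = u' := (inner_eq_one_iff_of_norm_eq_one hu hu').1 h1
    set δ : V → ℝ := r⁻¹ • (Pi.single a 1 - l) - r'⁻¹ • (Pi.single b 1 - l') with hδ
    have h2 : δ = 0 := by
      apply hc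
      · simp [hδ, Finset.sum_sub_distrib, ← Finset.mul_sum, hl, hl']
      · intro v hv
        rw [Finset.mem_insert, not_or] at hv
        by_cases hvb : v = b
        · subst hvb
          simp [hδ, hv.1, hls v hv.2, hls' v hv.2, hr'.le]
        · simp [hδ, hv.1, hls v hv.2, hls' v hv.2, hvb]
      · intro v hv
        rw [Finset.mem_insert, not_or] at hv
        by_cases hva : v = a
        · subst hva
          simp [hδ, hv.1, hls v hv.2, hls' v hv.2, hr.le]
        · simp [hδ, hv.1, hls v hv.2, hls' v hv.2, hva]
      · rw [hδ, affExtend_sub, affExtend_smul, affExtend_smul, affExtend_sub, affExtend_sub,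
          affExtend_single, affExtend_single, one_smul, one_smul, hf, hf', add_sub_cancel_left,
          add_sub_cancel_left, smul_smul, smul_smul, inv_mul_cancel₀ hr.ne', inv_mul_cancel₀ hr'.ne',
          one_smul, one_smul, huu, sub_self]
    have h3 := congrFun h2 a
    simp [hδ, hls a ha, hls' a ha, hab] at h3
    exact hr.ne' h3

/-- Two unit vectors in the plane orthogonal to `y` can be completed to a hinge frame. -/
theorem exists_frame_of_unit (hd : 2 ≤ d) (hyd : y.card + 1 = d) (hyne : y.Nonempty)
    {u u' : EuclideanSpace ℝ (Fin d)} (hu : ‖u‖ = 1) (hu' : ‖u'‖ = 1)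
    (ho : ∀ δ ∈ balanced y, inner ℝ (affExtend f δ) u = 0)
    (ho' : ∀ δ ∈ balanced y, inner ℝ (affExtend f δ) u' = 0) :
    ∃ e : EuclideanSpace ℝ (Fin d), ‖e‖ = 1 ∧ inner ℝ u e = (0 : ℝ) ∧
      (∀ δ ∈ balanced y, inner ℝ (affExtend f δ) e = 0) ∧
      u' = Real.cos (Real.arccos (inner ℝ u u')) • u +
        Real.sin (Real.arccos (inner ℝ u u')) • e := by
  set k : ℝ := inner ℝ u u' with hk
  have hk1 : k ≤ 1 := by
    have := real_inner_le_norm u u'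
    rwa [hu, hu', mul_one] at this
  have hk2 : -1 ≤ k := by
    have := neg_le_of_abs_le (abs_real_inner_le_norm u u')
    rwa [hu, hu', mul_one] at this
  have huu : inner ℝ u u = (1 : ℝ) := by rw [real_inner_self_eq_norm_sq, hu, one_pow]
  have hnorm : ‖u' - k • u‖ = Real.sqrt (1 - k ^ 2) := by
    rw [← Real.sqrt_sq (norm_nonneg (u' - k • u)), norm_sub_sq_real, norm_smul, hu, hu',
      real_inner_smul_right, real_inner_comm, ← hk, mul_one, Real.norm_eq_abs, sq_abs]
    congr 1
    ring
  rw [Real.cos_arccos hk2 hk1, Real.sin_arccos]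
  -- Here `u' = u` or `u' = -u`, the sine is zero, and any unit vector orthogonal to `u` and to the
  -- ridge will do.
  by_cases h0 : u' - k • u = 0
  · obtain ⟨v₀, hv₀⟩ := hyne
    have h4 := Finset.card_image_le (s := y.erase v₀) (f := fun v => f v - f v₀)
    have h5 := Finset.card_erase_add_one hv₀
    have h6 := Finset.card_insert_le u ((y.erase v₀).image fun v => f v - f v₀)
    obtain ⟨e, he1, he⟩ := exists_orthogonal_of_card_lt
      (s := insert u ((y.erase v₀).image fun v => f v - f v₀)) (by omega)
    have hn' : ∀ v ∈ y, inner ℝ (f v - f v₀) e = 0 := by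
      intro v hv
      by_cases hvv : v = v₀
      · rw [hvv, sub_self, inner_zero_left]
      · exact he _ (Finset.mem_insert_of_mem
          (Finset.mem_image_of_mem (fun v => f v - f v₀) (Finset.mem_erase.2 ⟨hvv, hv⟩)))
    refine ⟨e, he1, he u (Finset.mem_insert_self _ _),
      fun δ hδ => inner_direction_eq_zero (fun v hv w hw => ?_) hδ, ?_⟩
    · rw [← sub_sub_sub_cancel_right _ _ (f v₀), inner_sub_left, hn' v hv, hn' w hw, sub_zero]
    · rw [← hnorm, h0, norm_zero, zero_smul, add_zero]
      exact sub_eq_zero.1 h0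
  · refine ⟨‖u' - k • u‖⁻¹ • (u' - k • u), norm_smul_inv_norm h0, ?_, fun δ hδ => ?_, ?_⟩
    · rw [real_inner_smul_right, inner_sub_right, real_inner_smul_right, huu, ← hk]
      ring
    · rw [real_inner_smul_right, inner_sub_right, real_inner_smul_right, ho δ hδ, ho' δ hδ]
      ring
    · rw [← hnorm, smul_smul, mul_inv_cancel₀ (norm_ne_zero_iff.2 h0), one_smul, add_sub_cancel]

theorem exists_hingeFrame (hd : 2 ≤ d) (hemb : IsEmbedded K f) (hy : IsRidge d K y a b) :
    ∃ e₁ e₂ φ, HingeFrame f y a b e₁ e₂ φ := by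
  have hE := isEmbedded_iff_compat.1 hemb
  have hyne := face_nonempty hy.mem
  obtain ⟨l, r, u, hl, hls, hr, hu, ho, hf⟩ := exists_unit_foot (hE _ hy.mem_a _ hy.mem_a) hyne
    hy.notMem_a
  obtain ⟨l', r', u', hl', hls', hr', hu', ho', hf'⟩ := exists_unit_foot (hE _ hy.mem_b _ hy.mem_b)
    hyne hy.notMem_b
  have hlt := (hE _ hy.mem_a _ hy.mem_b).inner_lt_one hy.notMem_a hy.notMem_b hy.ne hl hls hr hu hf
    hl' hls' hr' hu' hf'
  obtain ⟨e, he, hue, hoe, hu'e⟩ := exists_frame_of_unit hd hy.card hyne hu hu' ho ho'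
  refine ⟨u, e, Real.arccos (inner ℝ u u'), hu, he, hue, ho, hoe, Real.arccos_pos.2 hlt, ?_,
    ⟨l, r, hl, hls, hr, hf⟩, ⟨l', r', hl', hls', hr', ?_⟩⟩
  · linarith [Real.arccos_le_pi (inner ℝ u u'), Real.pi_pos]
  · rw [← hu'e]
    exact hf'

end Frames

/-! ### Connectedness of the inside and the outside; the bounded domain -/

section Domain

variable {V : Type*} [Fintype V] {d : ℕ} {K : AbstractSimplicialComplex V}
  {f : V → EuclideanSpace ℝ (Fin d)} {c : ℝ} {χ χ' : EuclideanSpace ℝ (Fin d) → ZMod 2}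

/-- A walk on a segment from near `q` towards an interior point `p` of a facet, up to the first hit
with the polyhedron. A small change of the starting point makes the hit occur in the relative
interior of a facet, and just before it the walk is in a tube of that facet. -/
theorem exists_facetTube_subset (hd : 2 ≤ d) (hK : IsClosedComplex d K) (hsep : Separated K f c)
    (hχ : IsInside K f χ) {q : EuclideanSpace ℝ (Fin d)} (hq : q ∉ polyhedron K f) :
    ∃ A ∈ K, A.card = d ∧ ∃ n : EuclideanSpace ℝ (Fin d), ‖n‖ = 1 ∧
      (∀ δ ∈ balanced A, inner ℝ (affExtend f δ) n = 0) ∧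
      facetTube f A c n ⊆ connectedComponentIn {x | x ∉ polyhedron K f ∧ χ x = χ q} q := by
  classical
  set P := polyhedron K f with hP
  set C := {x | x ∉ P ∧ χ x = χ q} with hC
  have hqC : q ∈ C := ⟨hq, rfl⟩
  have hprecon : ∀ S : Set (EuclideanSpace ℝ (Fin d)), IsPreconnected S → Disjoint S P →
      ∀ z ∈ S, z ∈ C → S ⊆ C := fun S hS hSP z hz hzC x hx =>
    ⟨disjoint_left.1 hSP hx, (hχ.eq_of_isPreconnected hS hSP hx hz).trans hzC.2⟩
  obtain ⟨v₁⟩ := hK.nonempty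
  obtain ⟨A₀, hA₀, hA₀d, -⟩ := hK.pure {v₁} (K.singleton_mem v₁)
  have hA₀ne := face_nonempty hA₀
  set w₀ := barycenter A₀ with hw₀
  have hw₀r : w₀ ∈ realization K := mem_realization_of_mem hA₀ (fun v hv => (barycenter_pos hv).le)
    (fun v hv => barycenter_of_notMem hv) (sum_barycenter hA₀ne)
  set p := affExtend f w₀ with hp
  obtain ⟨r, hr, hball⟩ := Metric.isOpen_iff.1 (isClosed_polyhedron K f).isOpen_compl q hq
  -- For every set `y` of fewer than `d` vertices, a normal of a hyperplane containing `p` and `y`;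
  -- the starting point `q'` is chosen off all of them.
  have hn : ∀ y : Finset V, ∃ n : EuclideanSpace ℝ (Fin d), y.card < d →
      ‖n‖ = 1 ∧ ∀ v ∈ y, inner ℝ (f v - p) n = 0 := by
    intro y
    by_cases hy : y.card < d
    · obtain ⟨n, hn1, hn⟩ := exists_orthogonal_of_card_lt
        (s := y.image fun v => f v - p) (Finset.card_image_le.trans_lt hy)
      exact ⟨n, fun _ => ⟨hn1, fun v hv => hn _ (Finset.mem_image_of_mem (fun v => f v - p) hv)⟩⟩
    · exact ⟨0, fun h => (hy h).elim⟩
  choose n hn using hn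
  obtain ⟨q', hq'b, hq'⟩ := exists_mem_forall_apply_ne
    (fun y : Finset V => (innerSL ℝ (n y) : EuclideanSpace ℝ (Fin d) →ₗ[ℝ] ℝ))
    (fun y => inner ℝ (n y) p) Metric.isOpen_ball ⟨q, Metric.mem_ball_self hr⟩
  have hq'n : ∀ y : Finset V, y.card < d → inner ℝ (q' - p) (n y) ≠ 0 := by
    intro y hy h0
    refine hq' y (fun h => ?_) ?_
    · have h2 := LinearMap.congr_fun h (n y)
      simp [(hn y hy).1] at h2
    · rw [inner_sub_left, sub_eq_zero, real_inner_comm, real_inner_comm (n y)] at h0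
      simpa using h0
  have hball' : Disjoint (Metric.ball q r) P := disjoint_left.2 fun x hx hx' => hball hx hx'
  have hbC := hprecon _ Metric.isPreconnected_ball hball' q (Metric.mem_ball_self hr) hqC
  set γ : ℝ → EuclideanSpace ℝ (Fin d) := fun r => q' + r • (p - q') with hγ
  have hγc : Continuous γ := by fun_prop
  have hS : IsCompact (Icc (0 : ℝ) 1 ∩ γ ⁻¹' P) :=
    isCompact_Icc.inter_right ((isClosed_polyhedron K f).preimage hγc)
  obtain ⟨r₁, ⟨⟨hr₁0, hr₁1⟩, hr₁P⟩, hr₁min⟩ := hS.exists_isLeast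
    ⟨1, by simp, by simpa [hγ] using ⟨w₀, hw₀r, rfl⟩⟩
  have hbefore : ∀ s, 0 ≤ s → s < r₁ → γ s ∉ P := fun s h0 h1 hs =>
    absurd (hr₁min ⟨⟨h0, (h1.trans_le hr₁1).le⟩, hs⟩) (not_le.2 h1)
  have hr₁pos : 0 < r₁ := by
    refine hr₁0.lt_of_ne fun h => (hbC hq'b).1 ?_
    rw [← h] at hr₁P
    simpa [hγ] using hr₁P
  obtain ⟨w₁, hw₁r, hw₁⟩ := hr₁P
  obtain ⟨hw₁0, hw₁1, τ', hτ', hw₁s'⟩ := id hw₁r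
  obtain ⟨τ, hτ, hτd, hτ'τ⟩ := hK.pure τ' hτ'
  have hw₁s : ∀ v ∉ τ, w₁ v = 0 := fun v hv => hw₁s' v fun h => hv (hτ'τ h)
  have hγp : γ r₁ - p = (1 - r₁) • (q' - p) := by
    simp only [hγ]
    module
  -- A hit on the boundary of `τ` would lie in one of these hyperplanes, which the segment meets
  -- only at its end `p`. But `p` is interior to its facet.
  have hw₁pos : ∀ v ∈ τ, 0 < w₁ v := by
    intro v hv
    refine (hw₁0 v).lt_of_ne fun h0 => ?_
    have hycard : (τ.erase v).card < d := by
      have := Finset.card_erase_add_one hv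
      omega
    have hsupp : ∀ u ∉ τ.erase v, w₁ u = 0 := by
      intro u hu
      by_cases huv : u = v
      · rw [huv, ← h0]
      · exact hw₁s u fun h => hu (Finset.mem_erase.2 ⟨huv, h⟩)
    have h1 : inner ℝ (γ r₁ - p) (n (τ.erase v)) = 0 := by
      rw [← hw₁, show affExtend f w₁ - p = affExtend (fun v => f v - p) w₁ by
        rw [affExtend_sub_const, hw₁1, one_smul], affExtend_eq_sum_of_support _ hsupp, sum_inner]
      refine Finset.sum_eq_zero fun u hu => ?_
      rw [real_inner_smul_left, (hn _ hycard).2 u hu, mul_zero]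
    rw [hγp, real_inner_smul_left] at h1
    have h2 := (mul_eq_zero.1 h1).resolve_right (hq'n _ hycard)
    have h3 : affExtend f w₁ = affExtend f w₀ := by
      rw [h2, zero_smul, sub_eq_zero] at hγp
      rw [hw₁, hγp]
    have h4 := hsep.isEmbedded hw₁r hw₀r h3
    have h5 : A₀ ⊆ τ := by
      intro u hu
      by_contra hu'
      have h6 := hw₁s u hu'
      rw [h4] at h6
      exact (barycenter_pos hu).ne' h6
    have h6 := hK.eq_of_subset hτ hA₀d h5
    rw [h4] at h0
    exact (barycenter_pos (h6 ▸ hv)).ne h0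
  obtain ⟨m, hm1, hm⟩ := exists_normal (f := f) (by omega) hτd
  have hcτ : Compat f τ τ := isEmbedded_iff_compat.1 hsep.isEmbedded τ hτ τ hτ
  have hγr : ∀ ε : ℝ, γ (r₁ - ε) = affExtend f w₁ + ε • (q' - p) := by
    intro ε
    rw [hw₁]
    simp only [hγ]
    module
  have hevpos : ∀ δ : V → ℝ, ∀ᶠ ε in 𝓝[>] (0 : ℝ), ∀ v ∈ τ, 0 < (w₁ + ε • δ) v := by
    intro δ
    refine nhdsWithin_le_nhds ((Filter.eventually_all_finset _).2 fun v hv => ?_)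
    have hcont : Continuous fun ε : ℝ => (w₁ + ε • δ) v :=
      continuous_const.add (continuous_id.mul continuous_const)
    refine continuousAt_const.eventually_lt hcont.continuousAt ?_
    simpa using hw₁pos v hv
  have hm0 : m ≠ 0 := by
    rintro rfl
    simp at hm1
  -- A segment parallel to `τ` would have been inside `τ` already before the first hit.
  have hk0 : inner ℝ (q' - p) m ≠ 0 := by
    intro h0
    obtain ⟨δ, hδ, hδq⟩ := mem_direction.1 (mem_direction_of_orthogonal_normal hcτ hτd (by omega)
      hm0 hm h0)
    have hev : ∀ᶠ ε in 𝓝[>] (0 : ℝ), ε < r₁ := nhdsWithin_le_nhds (eventually_lt_nhds hr₁pos)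
    have hev0 : ∀ᶠ ε in 𝓝[>] (0 : ℝ), 0 < ε := self_mem_nhdsWithin
    obtain ⟨ε, h1, h2, h3⟩ := (hev0.and (hev.and (hevpos δ))).exists
    refine hbefore (r₁ - ε) (by linarith) (by linarith) ?_
    rw [hγr, ← hδq, ← affExtend_smul, ← affExtend_add]
    refine ⟨_, mem_realization_of_mem hτ (fun v hv => (h3 v hv).le) (fun v hv => ?_) ?_, rfl⟩
    · simp [hw₁s v hv, hδ.2 v hv]
    · simp [Finset.sum_add_distrib, ← Finset.mul_sum, hw₁1, hδ.1]
  obtain ⟨m', hm'1, hm', hk⟩ : ∃ m' : EuclideanSpace ℝ (Fin d), ‖m'‖ = 1 ∧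
      (∀ δ ∈ balanced τ, inner ℝ (affExtend f δ) m' = 0) ∧ 0 < inner ℝ (q' - p) m' := by
    rcases lt_or_gt_of_ne hk0 with h | h
    · exact ⟨-m, by rw [norm_neg, hm1], fun δ hδ => by rw [inner_neg_right, hm δ hδ, neg_zero],
        by rw [inner_neg_right]; linarith⟩
    · exact ⟨m, hm1, hm, h⟩
  have hm'0 : m' ≠ 0 := by
    rintro rfl
    simp at hm'1
  set k : ℝ := inner ℝ (q' - p) m' with hkdef
  obtain ⟨δ, hδ, hδq⟩ := mem_direction.1 (mem_direction_of_orthogonal_normal hcτ hτd (by omega)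
    hm'0 hm' (x := q' - p - k • m') (by
      rw [inner_sub_left, real_inner_smul_left, real_inner_self_eq_norm_sq, hm'1, ← hkdef]
      ring))
  have hev1 : ∀ᶠ ε in 𝓝[>] (0 : ℝ), ε < r₁ := nhdsWithin_le_nhds (eventually_lt_nhds hr₁pos)
  have hev2 : ∀ᶠ ε in 𝓝[>] (0 : ℝ), ∀ v ∈ τ, ε * k < c * (w₁ + ε • δ) v := by
    refine nhdsWithin_le_nhds ((Filter.eventually_all_finset _).2 fun v hv => ?_)
    have hcont : Continuous fun ε : ℝ => c * (w₁ + ε • δ) v :=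
      continuous_const.mul (continuous_const.add (continuous_id.mul continuous_const))
    refine (continuous_mul_const k).continuousAt.eventually_lt hcont.continuousAt ?_
    simpa using mul_pos hsep.1 (hw₁pos v hv)
  have hev0 : ∀ᶠ ε in 𝓝[>] (0 : ℝ), 0 < ε := self_mem_nhdsWithin
  obtain ⟨ε, hε, h2, h3⟩ := (hev0.and (hev1.and hev2)).exists
  have hmem : γ (r₁ - ε) ∈ facetTube f τ c m' := by
    refine ⟨(w₁ + ε • δ, ε * k), ⟨fun v hv => ?_, ?_, mul_pos hε hk, h3⟩, ?_⟩
    · simp [hw₁s v hv, hδ.2 v hv]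
    · simp [Finset.sum_add_distrib, ← Finset.mul_sum, hw₁1, hδ.1]
    · dsimp only
      rw [hγr, affExtend_add, affExtend_smul, hδq]
      module
  have hseg : IsPreconnected (γ '' Ico 0 r₁) :=
    (isPreconnected_Ico.image _ hγc.continuousOn)
  have hsegP : Disjoint (γ '' Ico 0 r₁) P := by
    rw [disjoint_left]
    rintro _ ⟨s, hs, rfl⟩
    exact hbefore s hs.1 hs.2
  have hq'seg : q' ∈ γ '' Ico 0 r₁ := ⟨0, ⟨le_rfl, hr₁pos⟩, by simp [hγ]⟩
  have hsegC := hprecon _ hseg hsegP q' hq'seg (hbC hq'b)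
  have hzseg : γ (r₁ - ε) ∈ γ '' Ico 0 r₁ := ⟨r₁ - ε, ⟨by linarith, by linarith⟩, rfl⟩
  have htube := isPreconnected_facetTube (f := f) τ c m'
  have htubeP := disjoint_facetTube hK hsep hτ hτd hm'1 hm'
  have htubeC := hprecon _ htube htubeP _ hmem (hsegC hzseg)
  refine ⟨τ, hτ, hτd, m', hm'1, hm', ?_⟩
  have hU := ((Metric.isPreconnected_ball (x := q) (r := r)).union q' hq'b hq'seg hseg).union
    (γ (r₁ - ε)) (Or.inr hzseg) hmem htube
  exact subset_union_right.trans (hU.subset_connectedComponentIn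
    (Or.inl (Or.inl (Metric.mem_ball_self hr))) (union_subset (union_subset hbC hsegC) htubeC))

/-- The wedge and its complement reach opposite sides of the facet of `a`. -/
theorem ridgeTube_ne [DecidableEq V] (hK : IsClosedComplex d K) (hsep : Separated K f c)
    (hχ : IsInside K f χ) {y : Finset V} {a b : V} (hy : IsRidge d K y a b)
    {e₁ e₂ : EuclideanSpace ℝ (Fin d)} {φ : ℝ} (h : HingeFrame f y a b e₁ e₂ φ)
    {q q' : EuclideanSpace ℝ (Fin d)} (hq : q ∈ ridgeTube f y c e₁ e₂ φ)
    (hq' : q' ∈ ridgeTube f y c e₁ (-e₂) (2 * Real.pi - φ)) : χ q ≠ χ q' := by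
  have hyne := face_nonempty hy.mem
  obtain ⟨x, hx1, hx2⟩ := ridgeTube_inter_facetTube hsep.1 hyne h hy.notMem_a
  obtain ⟨x', hx1', hx2'⟩ := ridgeTube_inter_facetTube hsep.1 hyne h.flip hy.notMem_a
  rw [hχ.eq_of_isPreconnected (isPreconnected_ridgeTube _ _ _ _ _ _)
      (disjoint_ridgeTube hK hsep hy h) hq hx1,
    hχ.eq_of_isPreconnected (isPreconnected_ridgeTube _ _ _ _ _ _)
      (disjoint_ridgeTube hK hsep hy h.flip) hq' hx1']
  exact facetTube_ne hK hsep hχ hy.mem_a hy.card_a h.norm₂ (fun δ hδ => h.normal hy.notMem_a hδ)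
    hx2 hx2'

theorem ridgeTube_eq_const [DecidableEq V] (hK : IsClosedComplex d K) (hsep : Separated K f c)
    (hχ : IsInside K f χ) {y : Finset V} {a b : V} (hy : IsRidge d K y a b)
    {e₁ e₂ : EuclideanSpace ℝ (Fin d)} {φ : ℝ} (h : HingeFrame f y a b e₁ e₂ φ)
    {q q' : EuclideanSpace ℝ (Fin d)} (hq : q ∈ ridgeTube f y c e₁ e₂ φ)
    (hq' : q' ∈ ridgeTube f y c e₁ e₂ φ) : χ q = χ q' :=
  hχ.eq_of_isPreconnected (isPreconnected_ridgeTube _ _ _ _ _ _)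
    (disjoint_ridgeTube hK hsep hy h) hq hq'

/-- The component of `q` touches one facet by `exists_facetTube_subset`. Along a chain of facets it
is passed on at every ridge by the one of the two wedges that has the same value of `χ` as `q`,
since this wedge meets a tube of either facet. -/
theorem facetTube_subset_component (hd : 2 ≤ d) (hK : IsClosedComplex d K)
    (hsep : Separated K f c) (hχ : IsInside K f χ) {q : EuclideanSpace ℝ (Fin d)}
    (hq : q ∉ polyhedron K f) {B : Finset V} (hB : B ∈ K) (hBd : B.card = d)
    {n : EuclideanSpace ℝ (Fin d)} (hn1 : ‖n‖ = 1)
    (hn : ∀ δ ∈ balanced B, inner ℝ (affExtend f δ) n = 0) (hnC : ∀ x ∈ facetTube f B c n,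
      χ x = χ q) :
    facetTube f B c n ⊆ connectedComponentIn {x | x ∉ polyhedron K f ∧ χ x = χ q} q := by
  classical
  set C := {x | x ∉ polyhedron K f ∧ χ x = χ q} with hC
  set X := connectedComponentIn C q with hX
  have hXC : X ⊆ C := connectedComponentIn_subset C q
  have hE := isEmbedded_iff_compat.1 hsep.isEmbedded
  have extend : ∀ S : Set (EuclideanSpace ℝ (Fin d)), IsPreconnected S →
      Disjoint S (polyhedron K f) → (S ∩ X).Nonempty → S ⊆ X := by
    rintro S hS hSP ⟨z, hzS, hzX⟩
    rw [hX, connectedComponentIn_eq hzX]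
    refine hS.subset_connectedComponentIn hzS fun x hx => ⟨disjoint_left.1 hSP hx, ?_⟩
    rw [hχ.eq_of_isPreconnected hS hSP hx hzS]
    exact (hXC hzX).2
  -- The two sides of a facet have different values of `χ`, so the side with the value of `q` is
  -- unambiguous.
  have hside : ∀ A ∈ K, A.card = d → ∀ m : EuclideanSpace ℝ (Fin d), ‖m‖ = 1 →
      (∀ δ ∈ balanced A, inner ℝ (affExtend f δ) m = 0) → facetTube f A c m ⊆ X →
      ∀ m' : EuclideanSpace ℝ (Fin d), ‖m'‖ = 1 →
      (∀ δ ∈ balanced A, inner ℝ (affExtend f δ) m' = 0) →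
      (∀ x ∈ facetTube f A c m', χ x = χ q) → facetTube f A c m' ⊆ X := by
    intro A hA hAd m hm1 hm hmX m' hm'1 hm' hm'C
    rcases eq_or_eq_neg_of_normal (by omega) hAd (hE A hA A hA) hm1 hm'1 hm hm' with rfl | rfl
    · exact hmX
    · obtain ⟨x, hx⟩ := facetTube_nonempty (f := f) hsep.1 hA m
      obtain ⟨x', hx'⟩ := facetTube_nonempty (f := f) hsep.1 hA (-m)
      exact absurd ((hXC (hmX hx)).2.trans (hm'C x' hx').symm)
        (facetTube_ne hK hsep hχ hA hAd hm1 hm hx hx')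
  obtain ⟨A, hA, hAd, n₀, hn₀1, hn₀, hn₀X⟩ := exists_facetTube_subset hd hK hsep hχ hq
  have hchain := hK.strongly_connected A hA B hB hAd hBd
  have main : ∃ m : EuclideanSpace ℝ (Fin d), ‖m‖ = 1 ∧
      (∀ δ ∈ balanced B, inner ℝ (affExtend f δ) m = 0) ∧ facetTube f B c m ⊆ X := by
    clear hn hnC hB hBd
    induction hchain with
    | refl => exact ⟨n₀, hn₀1, hn₀, hn₀X⟩
    | @tail σ τ _ hστ ih =>
      obtain ⟨m, hm1, hm, hmX⟩ := ih
      obtain ⟨⟨hσ, hσd⟩, ⟨hτ, hτd⟩, y, hy, hyd, hyσ, hyτ⟩ := hστ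
      by_cases hne : τ = σ
      · subst hne
        exact ⟨m, hm1, hm, hmX⟩
      obtain ⟨a, b, rfl, rfl, hr⟩ := hK.isRidge_of_facets hy hyd hσ hσd hyσ hτ hτd hyτ hne
      have hyne := face_nonempty hy
      have step : ∀ e₁ e₂ φ, HingeFrame f y a b e₁ e₂ φ →
          (∀ x ∈ ridgeTube f y c e₁ e₂ φ, χ x = χ q) →
          ∃ m : EuclideanSpace ℝ (Fin d), ‖m‖ = 1 ∧
            (∀ δ ∈ balanced (insert b y), inner ℝ (affExtend f δ) m = 0) ∧
            facetTube f (insert b y) c m ⊆ X := by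
        intro e₁ e₂ φ h hC'
        have hnA := fun δ hδ => h.normal hr.notMem_a (δ := δ) hδ
        obtain ⟨x, hx1, hx2⟩ := ridgeTube_inter_facetTube hsep.1 hyne h hr.notMem_a
        have h1 := hside _ hσ hσd m hm1 hm hmX e₂ h.norm₂ hnA fun z hz => by
          rw [hχ.eq_of_isPreconnected (isPreconnected_facetTube _ _ _)
            (disjoint_facetTube hK hsep hσ hσd h.norm₂ hnA) hz hx2]
          exact hC' x hx1
        have h2 := extend _ (isPreconnected_ridgeTube f y c e₁ e₂ φ)
          (disjoint_ridgeTube hK hsep hr h) ⟨x, hx1, h1 hx2⟩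
        obtain ⟨x', hx1', hx2'⟩ := ridgeTube_inter_facetTube hsep.1 hyne h.swap hr.notMem_b
        rw [ridgeTube_swap] at hx1'
        have hnB := fun δ hδ => h.swap.normal hr.notMem_b (δ := δ) hδ
        exact ⟨_, h.swap.norm₂, hnB, extend _ (isPreconnected_facetTube _ _ _)
          (disjoint_facetTube hK hsep hτ hτd h.swap.norm₂ hnB) ⟨x', hx2', h2 hx1'⟩⟩
      obtain ⟨e₁, e₂, φ, h⟩ := exists_hingeFrame hd hsep.isEmbedded hr
      obtain ⟨x, hx, -⟩ := ridgeTube_inter_facetTube hsep.1 hyne h hr.notMem_a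
      obtain ⟨x', hx', -⟩ := ridgeTube_inter_facetTube hsep.1 hyne h.flip hr.notMem_a
      by_cases hxq : χ x = χ q
      · exact step e₁ e₂ φ h fun z hz => (ridgeTube_eq_const hK hsep hχ hr h hz hx).trans hxq
      · refine step e₁ (-e₂) _ h.flip fun z hz => ?_
        have h1 := ridgeTube_ne hK hsep hχ hr h hx hz
        have h2 : ∀ i j k : ZMod 2, i ≠ k → i ≠ j → j = k := by decide
        exact h2 _ _ _ hxq h1
  obtain ⟨m, hm1, hm, hmX⟩ := main
  exact hside B hB hBd m hm1 hm hmX n hn1 hn hnC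

/-- The components of `q` and `q'` contain the same side of one facet, so they coincide. -/
theorem IsInside.isPreconnected (hd : 2 ≤ d) (hK : IsClosedComplex d K) (hemb : IsEmbedded K f)
    (hχ : IsInside K f χ) (i : ZMod 2) :
    IsPreconnected {x | x ∉ polyhedron K f ∧ χ x = i} := by
  obtain ⟨c, hsep⟩ := exists_separated hemb
  apply isPreconnected_of_forall_pair
  intro q hq q' hq'
  obtain ⟨A, hA, hAd, n, hn1, hn, hnX⟩ := exists_facetTube_subset hd hK hsep hχ hq.1
  have hnX' := facetTube_subset_component hd hK hsep hχ hq'.1 hA hAd hn1 hn fun x hx =>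
    ((connectedComponentIn_subset _ _ (hnX hx)).2.trans hq.2).trans hq'.2.symm
  rw [hq.2] at hnX
  rw [hq'.2] at hnX'
  obtain ⟨x, hx⟩ := facetTube_nonempty (f := f) hsep.1 hA n
  refine ⟨_, connectedComponentIn_subset _ q, mem_connectedComponentIn hq, ?_,
    isPreconnected_connectedComponentIn⟩
  rw [connectedComponentIn_eq (hnX hx), ← connectedComponentIn_eq (hnX' hx)]
  exact mem_connectedComponentIn hq'

/-- The zero set of one indicator off the polyhedron is connected and reaches arbitrarily far. The
other indicator is constant on it, hence zero, and the roles can be exchanged. -/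
theorem IsInside.unique (hd : 2 ≤ d) (hK : IsClosedComplex d K) (hemb : IsEmbedded K f)
    (hχ : IsInside K f χ) (hχ' : IsInside K f χ') {q : EuclideanSpace ℝ (Fin d)}
    (hq : q ∉ polyhedron K f) : χ q = χ' q := by
  have key : ∀ χ χ' : EuclideanSpace ℝ (Fin d) → ZMod 2, IsInside K f χ → IsInside K f χ' →
      ∀ q ∉ polyhedron K f, χ q = 0 → χ' q = 0 := by
    intro χ χ' h h' q hq h0
    obtain ⟨R, hR⟩ := h.far
    obtain ⟨R', hR'⟩ := h'.far
    obtain ⟨B, hB⟩ := (isCompact_polyhedron K f).isBounded.exists_norm_le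
    have : Nontrivial (EuclideanSpace ℝ (Fin d)) := by
      have : Nontrivial (Fin d) := Fin.nontrivial_iff_two_le.2 hd
      infer_instance
    obtain ⟨x, hx⟩ := NormedSpace.exists_lt_norm ℝ (EuclideanSpace ℝ (Fin d)) (max B (max R R'))
    have hxP : x ∉ polyhedron K f := fun hxP =>
      absurd (hB x hxP) (not_le.2 ((le_max_left _ _).trans_lt hx))
    have e := h'.eq_of_isPreconnected (h.isPreconnected hd hK hemb 0)
      (disjoint_left.2 fun z hz => hz.1) (q := q) (q' := x) ⟨hq, h0⟩
      ⟨hxP, hR x (((le_max_left _ _).trans (le_max_right _ _)).trans_lt hx)⟩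
    rw [e]
    exact hR' x (((le_max_right _ _).trans (le_max_right _ _)).trans_lt hx)
  have h2 : ∀ i j : ZMod 2, (i = 0 → j = 0) → (j = 0 → i = 0) → i = j := by decide
  exact h2 _ _ (key χ χ' hχ hχ' q hq) (key χ' χ hχ' hχ q hq)

theorem exists_facetTube_eq (hd : 0 < d) (hK : IsClosedComplex d K)
    (hsep : Separated K f c) (hχ : IsInside K f χ) {A : Finset V} (hA : A ∈ K) (hAd : A.card = d)
    (i : ZMod 2) :
    ∃ n : EuclideanSpace ℝ (Fin d), facetTube f A c n ⊆ {x | x ∉ polyhedron K f ∧ χ x = i} := by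
  obtain ⟨n, hn1, hn⟩ := exists_normal (f := f) hd hAd
  have hn' : ∀ δ ∈ balanced A, inner ℝ (affExtend f δ) (-n) = 0 := fun δ hδ => by
    rw [inner_neg_right, hn δ hδ, neg_zero]
  obtain ⟨x, hx⟩ := facetTube_nonempty (f := f) hsep.1 hA n
  obtain ⟨x', hx'⟩ := facetTube_nonempty (f := f) hsep.1 hA (-n)
  have hne := facetTube_ne hK hsep hχ hA hAd hn1 hn hx hx'
  have h1 := disjoint_facetTube hK hsep hA hAd hn1 hn
  have h2 := disjoint_facetTube hK hsep hA hAd (by rwa [norm_neg]) hn'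
  by_cases hi : χ x = i
  · exact ⟨n, fun z hz => ⟨disjoint_left.1 h1 hz,
      (hχ.eq_of_isPreconnected (isPreconnected_facetTube _ _ _) h1 hz hx).trans hi⟩⟩
  · have h3 : ∀ i j k : ZMod 2, i ≠ k → i ≠ j → j = k := by decide
    exact ⟨-n, fun z hz => ⟨disjoint_left.1 h2 hz,
      (hχ.eq_of_isPreconnected (isPreconnected_facetTube _ _ _) h2 hz hx').trans
        (h3 _ _ _ hi hne)⟩⟩

theorem IsInside.isOpen (hχ : IsInside K f χ) (i : ZMod 2) :
    IsOpen {x | x ∉ polyhedron K f ∧ χ x = i} := by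
  rw [isOpen_iff_mem_nhds]
  rintro x ⟨hx, hxi⟩
  filter_upwards [hχ.locally_const x hx, (isClosed_polyhedron K f).isOpen_compl.mem_nhds hx]
    with z hz hz'
  exact ⟨hz', hz.trans hxi⟩

theorem IsInside.isDomainBoundedBy (hd : 2 ≤ d) (hK : IsClosedComplex d K)
    (hemb : IsEmbedded K f) (hχ : IsInside K f χ) :
    IsDomainBoundedBy {x | x ∉ polyhedron K f ∧ χ x = 1} (polyhedron K f) := by
  obtain ⟨c, hsep⟩ := exists_separated hemb
  refine ⟨hχ.isOpen 1, ⟨?_, hχ.isPreconnected hd hK hemb 1⟩, ?_, ?_⟩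
  · obtain ⟨v₁⟩ := hK.nonempty
    obtain ⟨A, hA, hAd, -⟩ := hK.pure {v₁} (K.singleton_mem v₁)
    obtain ⟨n, hn⟩ := exists_facetTube_eq (by omega) hK hsep hχ hA hAd 1
    exact (facetTube_nonempty hsep.1 hA n).mono hn
  · obtain ⟨R, hR⟩ := hχ.far
    apply (Metric.isBounded_closedBall (x := (0 : EuclideanSpace ℝ (Fin d))) (r := R)).subset
    rintro x ⟨-, hx⟩
    rw [mem_closedBall_zero_iff]
    by_contra hcon
    rw [hR x (not_le.1 hcon)] at hx
    exact zero_ne_one hx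
  · rw [(hχ.isOpen 1).frontier_eq]
    apply Subset.antisymm
    · rintro x ⟨hx, hx'⟩
      by_contra hxP
      have h0 : χ x = 0 := by
        have h1 : ∀ i : ZMod 2, i ≠ 1 → i = 0 := by decide
        exact h1 _ fun h => hx' ⟨hxP, h⟩
      obtain ⟨z, hz, hz'⟩ := mem_closure_iff.1 hx _ (hχ.isOpen 0) ⟨hxP, h0⟩
      exact zero_ne_one (hz.2.symm.trans hz'.2)
    · intro x hx
      refine ⟨?_, fun h => h.1 hx⟩
      obtain ⟨w, ⟨hw0, hw1, τ', hτ', hws'⟩, rfl⟩ := hx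
      obtain ⟨A, hA, hAd, hτ'A⟩ := hK.pure τ' hτ'
      have hws : ∀ v ∉ A, w v = 0 := fun v hv => hws' v fun h => hv (hτ'A h)
      have hAne := face_nonempty hA
      obtain ⟨n, hn⟩ := exists_facetTube_eq (by omega) hK hsep hχ hA hAd 1
      apply closure_mono hn
      have hcard : 0 < (A.card : ℝ)⁻¹ := by
        rw [inv_pos]
        exact_mod_cast Finset.card_pos.2 hAne
      -- The point `w` is approached inside the inner tube of a facet containing it: weights move
      -- towards the barycentre by `s`, which leaves room for the height `s * k`.
      set k := c * (A.card : ℝ)⁻¹ / 2 with hk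
      have hkpos : 0 < k := by
        have := mul_pos hsep.1 hcard
        positivity
      have ht : Tendsto (fun s : ℝ => affExtend f ((1 - s) • w + s • barycenter A) + (s * k) • n)
          (𝓝[>] 0) (𝓝 (affExtend f w)) := by
        have h1 : ContinuousAt (fun s : ℝ => affExtend f ((1 - s) • w + s • barycenter A) +
            (s * k) • n) 0 := by
          simp only [affExtend_add, affExtend_smul]
          fun_prop
        have h2 := h1.tendsto
        simp only [sub_zero, one_smul, zero_smul, add_zero, zero_mul] at h2
        exact h2.mono_left nhdsWithin_le_nhds
      refine mem_closure_of_tendsto ht ?_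
      filter_upwards [self_mem_nhdsWithin, nhdsWithin_le_nhds (eventually_lt_nhds one_pos)]
        with s hs0 hs1
      have hs0' : 0 < s := hs0
      refine ⟨((1 - s) • w + s • barycenter A, s * k), ⟨fun v hv => ?_, ?_, mul_pos hs0' hkpos,
        fun v hv => ?_⟩, rfl⟩
      · simp [hws v hv, barycenter_of_notMem hv]
      · simp [Finset.sum_add_distrib, ← Finset.mul_sum, hw1, sum_barycenter hAne]
      · simp only [Pi.add_apply, Pi.smul_apply, smul_eq_mul, barycenter_of_mem hv]
        have h1 : 0 ≤ c * ((1 - s) * w v) :=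
          mul_nonneg hsep.1.le (mul_nonneg (by linarith) (hw0 v))
        have h2 : 0 < s * (c * (A.card : ℝ)⁻¹) := mul_pos hs0' (mul_pos hsep.1 hcard)
        rw [hk]
        nlinarith

end Domain


/-! ### The interior dihedral angle -/

section DihedralAngle

variable {V : Type*} [Fintype V] [DecidableEq V] {d : ℕ} {K : AbstractSimplicialComplex V}
  {f : V → EuclideanSpace ℝ (Fin d)} {c : ℝ} {χ : EuclideanSpace ℝ (Fin d) → ZMod 2}
  {y : Finset V} {a b : V} {e₁ e₂ : EuclideanSpace ℝ (Fin d)} {φ : ℝ}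

theorem HingeFrame.mem_polyhedron_of_near (h : HingeFrame f y a b e₁ e₂ φ)
    (hy : IsRidge d K y a b) (hsep : Separated K f c) {w δ : V → ℝ} (hws : ∀ v ∉ y, w v = 0)
    (hw1 : ∑ v, w v = 1) (hδ : δ ∈ balanced y) {ρ : ℝ} (hρ : 0 ≤ ρ)
    (hn : ∀ v ∈ y, ‖affExtend f δ + ρ • e₁‖ < c * w v) :
    affExtend f w + (affExtend f δ + ρ • e₁) ∈ polyhedron K f := by
  obtain ⟨l, r, hl1, hls, hr, hfa⟩ := h.foot_a
  have he : affExtend f (δ + (ρ / r) • (Pi.single a 1 - l)) = affExtend f δ + ρ • e₁ := by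
    rw [affExtend_add, affExtend_smul, affExtend_sub, affExtend_single, one_smul, hfa,
      add_sub_cancel_left, smul_smul, div_mul_cancel₀ _ hr.ne']
  rw [← he]
  refine (hsep.mem_polyhedron_of_near hy.mem_a hws hw1 (Finset.subset_insert a y)
    ⟨?_, fun v hv => ?_⟩ (fun v hv hvy => ?_) (by rwa [he])).2
  · simp [Finset.sum_add_distrib, Finset.sum_sub_distrib, ← Finset.mul_sum, hl1, hδ.1]
  · rw [Finset.mem_insert, not_or] at hv
    simp [hv.1, hls v hv.2, hδ.2 v hv.2]
  · rcases Finset.mem_insert.1 hv with rfl | hv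
    · simpa [hls v hvy, hδ.2 v hvy] using div_nonneg hρ hr.le
    · exact absurd hv hvy

/-- The angle of the hinge on the side of the bounded domain is the interior dihedral angle. -/
theorem HingeFrame.isInteriorDihedralAngle (h : HingeFrame f y a b e₁ e₂ φ) (hd : 2 ≤ d)
    (hK : IsClosedComplex d K) (hsep : Separated K f c) (hχ : IsInside K f χ)
    (hy : IsRidge d K y a b) {q₀ : EuclideanSpace ℝ (Fin d)}
    (hq₀ : q₀ ∈ ridgeTube f y c e₁ e₂ φ) (hq₀1 : χ q₀ = 1) :
    IsInteriorDihedralAngle {q | q ∉ polyhedron K f ∧ χ q = 1} f y φ := by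
  have hE := isEmbedded_iff_compat.1 hsep.isEmbedded
  refine ⟨h.pos, h.lt, e₁, e₂, h.norm₁, h.norm₂, h.inner₁₂, fun u hu v hv => ?_, ?_⟩
  · have e : f u - f v = affExtend f (Pi.single u 1 - Pi.single v 1) := by
      rw [affExtend_sub, affExtend_single, affExtend_single, one_smul, one_smul]
    have hm : (Pi.single u 1 - Pi.single v 1 : V → ℝ) ∈ balanced y :=
      single_sub_single_mem_balanced hu hv
    rw [e]
    exact ⟨h.orth₁ _ hm, h.orth₂ _ hm⟩
  intro w' hw' hw'1 p hp
  set w : V → ℝ := fun v => if v ∈ y then w' v else 0 with hw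
  have hws : ∀ v ∉ y, w v = 0 := fun v hv => if_neg hv
  have hwpos : ∀ v ∈ y, 0 < w v := fun v hv => by
    simp only [hw, if_pos hv]
    exact hw' v hv
  have hw1 : ∑ v, w v = 1 := by
    rw [sum_eq_of_support hws, ← hw'1]
    exact Finset.sum_congr rfl fun v hv => if_pos hv
  have hpw : p = affExtend f w := by
    rw [hp, affExtend_eq_sum_of_support f hws]
    exact Finset.sum_congr rfl fun v hv => by simp only [hw, if_pos hv]
  -- The component of `q - p` along the ridge has norm at most `3 * ‖q - p‖` and the distance `ρ` to
  -- the ridge is at most `2 * ‖q - p‖`. The factor `5` leaves `ρ < c * (w + δ) v`, as the tubes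
  -- require.
  have hev : ∀ᶠ q in 𝓝 p, ∀ v ∈ y, 5 * ‖q - p‖ < c * w v := by
    rw [Filter.eventually_all_finset]
    intro v hv
    have hc : Continuous fun q : EuclideanSpace ℝ (Fin d) => 5 * ‖q - p‖ := by fun_prop
    refine hc.continuousAt.eventually_lt continuousAt_const ?_
    simpa using mul_pos hsep.1 (hwpos v hv)
  filter_upwards [hev] with q hq
  set α : ℝ := inner ℝ (q - p) e₁ with hα
  set β : ℝ := inner ℝ (q - p) e₂ with hβ
  have hαn : |α| ≤ ‖q - p‖ := by
    have := abs_real_inner_le_norm (q - p) e₁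
    rwa [h.norm₁, mul_one] at this
  have hβn : |β| ≤ ‖q - p‖ := by
    have := abs_real_inner_le_norm (q - p) e₂
    rwa [h.norm₂, mul_one] at this
  obtain ⟨δ, hδ, hδq⟩ := mem_direction.1 (mem_direction_of_orthogonal_pair
    (hE y hy.mem y hy.mem) hy.card (by omega) h.norm₁ h.norm₂ h.inner₁₂ h.orth₁ h.orth₂
    (x := q - p - (α • e₁ + β • e₂))
    (by rw [inner_sub_left, h.inner_polar₁, ← hα, sub_self])
    (by rw [inner_sub_left, h.inner_polar₂, ← hβ, sub_self]))
  have hqp : q = affExtend f w + (affExtend f δ + (α • e₁ + β • e₂)) := by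
    rw [hδq, ← hpw]
    abel
  have hqp' : affExtend f δ + (α • e₁ + β • e₂) = q - p := by
    rw [hδq]
    abel
  have hδn : ‖affExtend f δ‖ ≤ 3 * ‖q - p‖ := by
    rw [hδq]
    have h1 := norm_sub_le (q - p) (α • e₁ + β • e₂)
    have h2 := norm_add_le (α • e₁) (β • e₂)
    rw [norm_smul, norm_smul, h.norm₁, h.norm₂, Real.norm_eq_abs, Real.norm_eq_abs] at h2
    linarith
  have hδw : ∀ v ∈ y, 2 * ‖q - p‖ < c * (w + δ) v := by
    intro v hv
    have h1 := hsep.norm_balanced hy.mem hδ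
    have h2 : |δ v| ≤ ∑ u, |δ u| :=
      Finset.single_le_sum (f := fun u => |δ u|) (fun u _ => abs_nonneg _) (Finset.mem_univ v)
    have h3 := mul_le_mul_of_nonneg_left h2 hsep.1.le
    have h4 := mul_le_mul_of_nonneg_left (neg_abs_le (δ v)) hsep.1.le
    have h5 := hq v hv
    rw [Pi.add_apply, mul_add]
    linarith
  have hn : ∀ v ∈ y, ‖q - p‖ < c * w v := fun v hv => by
    linarith [hq v hv, norm_nonneg (q - p)]
  have hwδs : ∀ v ∉ y, (w + δ) v = 0 := fun v hv => by simp [hws v hv, hδ.2 v hv]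
  have hwδ1 : ∑ v, (w + δ) v = 1 := by simp [Finset.sum_add_distrib, hw1, hδ.1]
  by_cases h0 : α ≠ 0 ∨ β ≠ 0
  · obtain ⟨ρ, θ, hρ, hθ0, hθ2, hαρ, hβρ⟩ := exists_polar h0
    have hρn : ρ ≤ 2 * ‖q - p‖ := by
      have h1 : ρ ^ 2 = α ^ 2 + β ^ 2 := by
        rw [hαρ, hβρ]
        linear_combination (-ρ ^ 2) * Real.cos_sq_add_sin_sq θ
      refine le_of_sq_le_sq ?_ (by positivity)
      rw [h1, ← sq_abs α, ← sq_abs β]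
      nlinarith [norm_nonneg (q - p), abs_nonneg α, abs_nonneg β]
    have hpol : q = affExtend f (w + δ) + ρ • (Real.cos θ • e₁ + Real.sin θ • e₂) := by
      rw [hqp, hαρ, hβρ, affExtend_add]
      module
    have hiff : (∃ ρ' θ' : ℝ, 0 < ρ' ∧ 0 < θ' ∧ θ' < φ ∧ α = ρ' * Real.cos θ' ∧
        β = ρ' * Real.sin θ') ↔ 0 < θ ∧ θ < φ := by
      constructor
      · rintro ⟨ρ', θ', hρ', hθ', hθ'φ, h1, h2⟩
        rw [hαρ] at h1
        rw [hβρ] at h2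
        have hθpos : 0 < θ := by
          refine hθ0.lt_of_ne fun h3 => ?_
          refine polar_ne (θ := θ') (φ := 2 * Real.pi) hρ' hρ.le (by linarith [h.lt]) (by linarith)
            ?_ ?_
          · rw [← h1, ← h3, Real.cos_zero, Real.cos_two_pi]
          · rw [← h2, ← h3, Real.sin_zero, Real.sin_two_pi]
        refine ⟨hθpos, ?_⟩
        by_contra h3
        exact polar_ne (θ := θ') (φ := θ) hρ' hρ.le (by linarith) (by linarith) h1.symm h2.symm
      · rintro ⟨h1, h2⟩
        exact ⟨ρ, θ, hρ, h1, h2, hαρ, hβρ⟩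
    rw [hiff]
    -- For `θ = 0` and `θ = φ` the point lies on one of the two facets, between them in the inner
    -- wedge, and beyond `φ` in the complementary wedge, which has the other parity.
    rcases hθ0.eq_or_lt with h3 | h3
    · have hqP : q ∈ polyhedron K f := by
        rw [← h3, Real.cos_zero, mul_one] at hαρ
        rw [← h3, Real.sin_zero, mul_zero] at hβρ
        rw [hβρ, zero_smul, add_zero, hαρ] at hqp hqp'
        rw [hqp]
        exact h.mem_polyhedron_of_near hy hsep hws hw1 hδ hρ.le (by rwa [hqp'])
      exact iff_of_false (fun hh => hh.1 hqP) fun hh => hh.1.ne h3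
    · rcases lt_trichotomy θ φ with h4 | h4 | h4
      · refine iff_of_true ?_ ⟨h3, h4⟩
        have hmem : q ∈ ridgeTube f y c e₁ e₂ φ := ⟨(w + δ, ρ, θ), ⟨hwδs, hwδ1, hρ,
          fun v hv => hρn.trans_lt (hδw v hv), h3, h4⟩, hpol.symm⟩
        exact ⟨disjoint_left.1 (disjoint_ridgeTube hK hsep hy h) hmem,
          (ridgeTube_eq_const hK hsep hχ hy h hmem hq₀).trans hq₀1⟩
      · have hqP : q ∈ polyhedron K f := by
          have e : α • e₁ + β • e₂ = ρ • (Real.cos φ • e₁ + Real.sin φ • e₂) := by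
            rw [hαρ, hβρ, h4]
            module
          rw [e] at hqp hqp'
          rw [hqp]
          exact h.swap.mem_polyhedron_of_near hy.swap hsep hws hw1 hδ hρ.le (by rwa [hqp'])
        exact iff_of_false (fun hh => hh.1 hqP) fun hh => hh.2.ne h4
      · refine iff_of_false (fun hh => ?_) fun hh => lt_asymm hh.2 h4
        have hmem : q ∈ ridgeTube f y c e₁ (-e₂) (2 * Real.pi - φ) := by
          refine ⟨(w + δ, ρ, 2 * Real.pi - θ), ⟨hwδs, hwδ1, hρ,
            fun v hv => hρn.trans_lt (hδw v hv), by dsimp only; linarith,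
            by dsimp only; linarith⟩, ?_⟩
          dsimp only
          rw [hpol, Real.cos_two_pi_sub, Real.sin_two_pi_sub, smul_neg, neg_smul, neg_neg]
        exact ridgeTube_ne hK hsep hχ hy h hq₀ hmem (hq₀1.trans hh.2.symm)
  · push Not at h0
    refine iff_of_false (fun hh => hh.1 ?_) ?_
    · rw [h0.1, h0.2, zero_smul, zero_smul, add_zero, add_zero] at hqp hqp'
      rw [hqp]
      exact (hsep.mem_polyhedron_of_near hy.mem hws hw1 subset_rfl hδ
        (fun v hv hvy => absurd hv hvy) (by rwa [hqp'])).2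
    · rintro ⟨ρ', θ', hρ', hθ', hθ'φ, h1, h2⟩
      -- With `t = 0` the second angle is arbitrary; `θ' + 1` satisfies the inequalities.
      refine polar_ne (θ := θ') (φ := θ' + 1) (t := 0) hρ' le_rfl (by linarith)
        (by linarith [Real.pi_gt_three]) ?_ ?_
      · rw [← h1, h0.1, zero_mul]
      · rw [← h2, h0.2, zero_mul]

theorem exists_isInteriorDihedralAngle (hd : 2 ≤ d) (hK : IsClosedComplex d K)
    (hsep : Separated K f c) (hχ : IsInside K f χ) (hy : IsRidge d K y a b)
    (h : HingeFrame f y a b e₁ e₂ φ) :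
    ∃ ψ, IsInteriorDihedralAngle {q | q ∉ polyhedron K f ∧ χ q = 1} f y ψ ∧
      (ψ = φ ∨ ψ = 2 * Real.pi - φ) := by
  have hyne := face_nonempty hy.mem
  obtain ⟨x, hx, -⟩ := ridgeTube_inter_facetTube hsep.1 hyne h hy.notMem_a
  obtain ⟨x', hx', -⟩ := ridgeTube_inter_facetTube hsep.1 hyne h.flip hy.notMem_a
  by_cases hx1 : χ x = 1
  · exact ⟨φ, h.isInteriorDihedralAngle hd hK hsep hχ hy hx hx1, Or.inl rfl⟩
  · have h2 : ∀ i j : ZMod 2, i ≠ 1 → i ≠ j → j = 1 := by decide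
    exact ⟨_, h.flip.isInteriorDihedralAngle hd hK hsep hχ hy hx'
      (h2 _ _ hx1 (ridgeTube_ne hK hsep hχ hy h hx hx')), Or.inr rfl⟩

end DihedralAngle


/-! ### Stability of the inside under deformation -/

section Deformation

variable {V : Type*} [Fintype V] {d : ℕ} {K : AbstractSimplicialComplex V}
  {f : V → EuclideanSpace ℝ (Fin d)} {χ : EuclideanSpace ℝ (Fin d) → ZMod 2}

theorem norm_affExtend_sub_le {f f' : V → EuclideanSpace ℝ (Fin d)} {r : ℝ}
    (h : ∀ v, ‖f' v - f v‖ ≤ r) (w : V → ℝ) :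
    ‖affExtend f' w - affExtend f w‖ ≤ r * ∑ v, |w v| := by
  have e : affExtend f' w - affExtend f w = affExtend (fun v => f' v - f v) w := by
    simp [affExtend, smul_sub, Finset.sum_sub_distrib]
  rw [e]
  exact norm_affExtend_le _ h w

theorem sum_abs_of_mem_realization {w : V → ℝ} (hw : w ∈ realization K) : ∑ v, |w v| = 1 := by
  rw [← hw.2.1]
  exact Finset.sum_congr rfl fun v _ => abs_of_nonneg (hw.1 v)

/-- The inside of an embedded polyhedron is stable under small deformations. -/
theorem IsInside.exists_stable (hd : 2 ≤ d) (hK : IsClosedComplex d K) (hemb : IsEmbedded K f)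
    (hχ : IsInside K f χ) {q : EuclideanSpace ℝ (Fin d)} (hq : q ∉ polyhedron K f) :
    ∃ r > 0, ∀ f' : V → EuclideanSpace ℝ (Fin d), IsEmbedded K f' → (∀ v, ‖f' v - f v‖ < r) →
      ∀ χ', IsInside K f' χ' → ∀ q' ∈ Metric.ball q r, χ' q' = χ q := by
  obtain ⟨ρ, hρ, hball⟩ := Metric.isOpen_iff.1 (isClosed_polyhedron K f).isOpen_compl q hq
  obtain ⟨R, hR⟩ : ∃ R, ∀ v, ‖f v‖ ≤ R := by
    obtain ⟨R, hR⟩ := (Set.finite_range fun v => ‖f v‖).bddAbove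
    exact ⟨R, fun v => hR ⟨v, rfl⟩⟩
  -- The margin `1` lets the same `O` serve for all polyhedra whose vertices differ by less than
  -- `1`.
  obtain ⟨O, hO, hOi, -⟩ := exists_forall_coneIndep (by omega) hemb (ι := Empty)
    (fun _ => 0) (fun _ => 0) (U := {O | R + 1 < ‖O‖})
    (isOpen_lt continuous_const continuous_norm) (by
      have : Nontrivial (EuclideanSpace ℝ (Fin d)) := by
        have : Nontrivial (Fin d) := Fin.nontrivial_iff_two_le.2 hd
        infer_instance
      obtain ⟨x, hx⟩ := NormedSpace.exists_lt_norm ℝ (EuclideanSpace ℝ (Fin d)) (R + 1)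
      exact ⟨x, hx⟩)
  have hO' : R + 1 < ‖O‖ := hO
  set g : V → EuclideanSpace ℝ (Fin d) := fun v => f v - O with hg
  obtain ⟨μ, hμ⟩ := exists_isConeCoord (by omega) hOi
  obtain ⟨z, hzg, hz⟩ : ∃ z, Generic K μ (z - O) ∧ z ∈ Metric.ball q (ρ / 2) := by
    obtain ⟨x, hx, hxg⟩ := exists_generic' hμ (U := (fun x => x + O) ⁻¹' Metric.ball q (ρ / 2))
      (Metric.isOpen_ball.preimage (by fun_prop)) ⟨q - O, by simpa using hρ⟩
    exact ⟨x + O, by rwa [add_sub_cancel_right], hx⟩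
  have hzP : z ∉ polyhedron K f := hball (Metric.ball_subset_ball (by linarith) hz)
  have hχz : χ z = crossings K μ (z - O) := by
    obtain ⟨χ₁, hχ₁, h1⟩ := exists_isInside_of_origin hd hK hemb hR (by linarith) hμ
    rw [hχ.unique hd hK hemb hχ₁ hzP, h1 z hzP hzg]
  have hχq : χ q = χ z := hχ.eq_of_isPreconnected (Metric.isPreconnected_ball (x := q) (r := ρ))
    (disjoint_left.2 fun x hx hx' => hball hx hx') (Metric.mem_ball_self hρ)
    (Metric.ball_subset_ball (by linarith) hz)
  set x := z - O with hx
  have hc : ∃ c > 0, ∀ τ ∈ facets d K, ∀ w : V → ℝ, (∀ v ∉ τ, w v = 0) →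
      c * ∑ v, |w v| ≤ ‖affExtend g w‖ := by
    have h1 : ∀ τ, ∃ c > 0, τ ∈ facets d K → ∀ w : V → ℝ, (∀ v ∉ τ, w v = 0) →
        c * ∑ v, |w v| ≤ ‖affExtend g w‖ := by
      intro τ
      by_cases hτ : τ ∈ facets d K
      · obtain ⟨c, hc, h⟩ := exists_uniform_lower_bound (X := Unit) (T := univ) isCompact_univ
          (F := fun _ => g) (fun v => continuousOn_const) (C := {w | ∀ v ∉ τ, w v = 0})
          (by
            simp only [ofPred_forall]
            exact isClosed_iInter fun v => isClosed_iInter fun _ =>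
              isClosed_eq (continuous_apply v) continuous_const)
          (fun w hw r _ v hv => by simp [hw v hv]) (fun _ _ w hw => hOi τ hτ w hw)
        exact ⟨c, hc, fun _ => h () trivial⟩
      · exact ⟨1, one_pos, fun h => absurd h hτ⟩
    choose c hc h using h1
    obtain ⟨c', hc', h'⟩ : ∃ c' > 0, ∀ τ ∈ facets d K, c' < c τ := by
      have hev : ∀ᶠ c' in 𝓝[>] (0 : ℝ), ∀ τ ∈ facets d K, c' < c τ :=
        nhdsWithin_le_nhds ((Filter.eventually_all_finset _).2 fun τ _ => eventually_lt_nhds (hc τ))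
      have hev0 : ∀ᶠ ε in 𝓝[>] (0 : ℝ), 0 < ε := self_mem_nhdsWithin
      exact (hev0.and hev).exists
    refine ⟨c', hc', fun τ hτ w hw => (mul_le_mul_of_nonneg_right (h' τ hτ).le ?_).trans
      (h τ hτ w hw)⟩
    exact Finset.sum_nonneg fun v _ => abs_nonneg _
  obtain ⟨c, hc, hcw⟩ := hc
  -- A margin within which no sign that decides a crossing by the segment from `O` to `z` changes.
  obtain ⟨η, hη, hηw⟩ : ∃ η > 0, ∀ τ ∈ facets d K, (∀ v ∈ τ, η < |μ τ x v|) ∧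
      (∑ v, μ τ x v ≠ 1 → η < |∑ v, μ τ x v - 1|) := by
    have hev : ∀ᶠ η in 𝓝[>] (0 : ℝ), ∀ τ ∈ facets d K, (∀ v ∈ τ, η < |μ τ x v|) ∧
        (∑ v, μ τ x v ≠ 1 → η < |∑ v, μ τ x v - 1|) := by
      refine nhdsWithin_le_nhds ((Filter.eventually_all_finset _).2 fun τ hτ => Eventually.and
        ((Filter.eventually_all_finset _).2 fun v hv =>
          eventually_lt_nhds (abs_pos.2 (hzg τ hτ v hv))) ?_)
      by_cases h1 : ∑ v, μ τ x v = 1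
      · exact Eventually.of_forall fun _ h => absurd h1 h
      · filter_upwards [eventually_lt_nhds (abs_pos.2 (sub_ne_zero.2 h1))] with η hη _ using hη
    have hev0 : ∀ᶠ ε in 𝓝[>] (0 : ℝ), 0 < ε := self_mem_nhdsWithin
    exact (hev0.and hev).exists
  -- In this order: the half ball around `q` stays off the new polyhedron, `O` stays far away, the
  -- cones stay nondegenerate with constant `c / 2`, and the coordinates of `x` change by less than
  -- `η`.
  obtain ⟨r, hr, ⟨hr1, hr2⟩, hr3, hr4⟩ : ∃ r > 0, (r < ρ / 2 ∧ r < 1) ∧ r < c / 2 ∧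
      r * (‖x‖ / (c / 2)) < c * η := by
    have hev : ∀ᶠ r in 𝓝[>] (0 : ℝ), (r < ρ / 2 ∧ r < 1) ∧ r < c / 2 ∧
        r * (‖x‖ / (c / 2)) < c * η := by
      refine nhdsWithin_le_nhds (((eventually_lt_nhds (by positivity)).and
        (eventually_lt_nhds one_pos)).and ((eventually_lt_nhds (by positivity)).and ?_))
      refine (continuous_mul_const _).continuousAt.eventually_lt continuousAt_const ?_
      rw [zero_mul]
      positivity
    have hev0 : ∀ᶠ ε in 𝓝[>] (0 : ℝ), 0 < ε := self_mem_nhdsWithin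
    exact (hev0.and hev).exists
  refine ⟨r, hr, fun f' hemb' hff' χ' hχ' q' hq' => ?_⟩
  set g' : V → EuclideanSpace ℝ (Fin d) := fun v => f' v - O with hg'
  have hgg' : ∀ v, ‖g' v - g v‖ ≤ r := fun v => by
    simp only [hg, hg', sub_sub_sub_cancel_right]
    exact (hff' v).le
  have hdisj : Disjoint (Metric.ball q (ρ / 2)) (polyhedron K f') := by
    rw [disjoint_left]
    rintro _ hx ⟨w, hw, rfl⟩
    have h1 := norm_affExtend_sub_le (fun v => (hff' v).le) w
    rw [sum_abs_of_mem_realization hw, mul_one] at h1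
    have hmem : affExtend f w ∈ Metric.ball q ρ := by
      rw [mem_ball_iff_norm] at hx ⊢
      have h2 := norm_sub_le (affExtend f' w - q) (affExtend f' w - affExtend f w)
      rw [sub_sub_sub_cancel_left] at h2
      linarith
    exact hball hmem ⟨w, hw, rfl⟩
  have hlow : ∀ τ ∈ facets d K, ∀ w : V → ℝ, (∀ v ∉ τ, w v = 0) →
      c / 2 * ∑ v, |w v| ≤ ‖affExtend g' w‖ := by
    intro τ hτ w hw
    have h1 := norm_affExtend_sub_le hgg' w
    have h2 := hcw τ hτ w hw
    have h3 := norm_sub_norm_le (affExtend g w) (affExtend g' w)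
    rw [norm_sub_rev] at h3
    have h4 : r * ∑ v, |w v| ≤ c / 2 * ∑ v, |w v| :=
      mul_le_mul_of_nonneg_right hr3.le (Finset.sum_nonneg fun v _ => abs_nonneg _)
    linarith
  have hOi' : ∀ τ ∈ facets d K, ConeIndep g' τ := by
    intro τ hτ w hw h0
    have h1 := hlow τ hτ w hw
    rw [h0, norm_zero] at h1
    have h2 : ∑ v, |w v| ≤ 0 := by
      by_contra h
      exact absurd h1 (not_le.2 (mul_pos (by positivity) (not_le.1 h)))
    funext v
    have h3 : |w v| ≤ ∑ u, |w u| :=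
      Finset.single_le_sum (f := fun u => |w u|) (fun u _ => abs_nonneg _) (Finset.mem_univ v)
    exact abs_nonpos_iff.1 (h3.trans h2)
  obtain ⟨μ', hμ'⟩ := exists_isConeCoord (by omega) hOi'
  have hclose : ∀ τ ∈ facets d K, ∑ v, |μ' τ x v - μ τ x v| < η := by
    intro τ hτ
    have h1 := hlow τ hτ _ (hμ'.supp τ hτ x)
    rw [hμ'.affExtend_eq τ hτ] at h1
    have h2 := norm_affExtend_sub_le hgg' (μ' τ x)
    rw [hμ'.affExtend_eq τ hτ] at h2
    have h3 := hcw τ hτ (μ' τ x - μ τ x) fun v hv => by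
      simp [hμ'.supp τ hτ x v hv, hμ.supp τ hτ x v hv]
    rw [affExtend_sub, hμ.affExtend_eq τ hτ, norm_sub_rev] at h3
    have h4 : ∑ v, |μ' τ x v| ≤ ‖x‖ / (c / 2) := by
      rw [le_div_iff₀ (by positivity)]
      linarith
    have h5 := mul_le_mul_of_nonneg_left h4 hr.le
    have h6 : c * ∑ v, |(μ' τ x - μ τ x) v| < c * η := by linarith
    exact lt_of_mul_lt_mul_left h6 hc.le
  have hclose1 : ∀ τ ∈ facets d K, ∀ v, |μ' τ x v - μ τ x v| < η := fun τ hτ v =>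
    (Finset.single_le_sum (f := fun u => |μ' τ x u - μ τ x u|) (fun u _ => abs_nonneg _)
      (Finset.mem_univ v)).trans_lt (hclose τ hτ)
  have hclose2 : ∀ τ ∈ facets d K, |∑ v, μ' τ x v - ∑ v, μ τ x v| < η := fun τ hτ => by
    rw [← Finset.sum_sub_distrib]
    exact (Finset.abs_sum_le_sum_abs _ _).trans_lt (hclose τ hτ)
  have hsum : ∀ τ ∈ facets d K, (∀ v ∈ τ, 0 < μ τ x v) → ∑ v, μ τ x v ≠ 1 := by
    intro τ hτ hpos h1
    refine hzP ⟨μ τ x, mem_realization_of_mem (mem_facets.1 hτ).1 (fun v hv => (hpos v hv).le)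
      (hμ.supp τ hτ x) h1, ?_⟩
    have h2 := hμ.affExtend_eq τ hτ x
    rw [hg, affExtend_sub_const, h1, one_smul, hx] at h2
    exact sub_left_injective h2
  have hcr : crossings K μ' x = crossings K μ x := by
    classical
    unfold crossings
    refine Finset.sum_congr rfl fun τ hτ => ?_
    congr 1
    rw [eq_iff_iff]
    have hsign : ∀ v ∈ τ, (0 < μ' τ x v ↔ 0 < μ τ x v) := by
      intro v hv
      have h1 := abs_lt.1 (hclose1 τ hτ v)
      rcases lt_abs.1 ((hηw τ hτ).1 v hv) with h2 | h2
      · exact iff_of_true (by linarith) (by linarith)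
      · exact iff_of_false (by linarith) (by linarith)
    have hall : (∀ v ∈ τ, 0 < μ' τ x v) ↔ ∀ v ∈ τ, 0 < μ τ x v :=
      forall₂_congr hsign
    unfold Crosses
    rw [hall]
    refine and_congr_right fun hpos => ?_
    have h1 := abs_lt.1 (hclose2 τ hτ)
    rcases lt_abs.1 ((hηw τ hτ).2 (hsum τ hτ hpos)) with h2 | h2
    · exact iff_of_true (by linarith) (by linarith)
    · exact iff_of_false (by linarith) (by linarith)
  have hzg' : Generic K μ' x := by
    intro τ hτ v hv h0
    have h1 := hclose1 τ hτ v
    rw [h0, zero_sub, abs_neg] at h1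
    exact absurd h1 (not_lt.2 ((hηw τ hτ).1 v hv).le)
  have hR' : ∀ v, ‖f' v‖ ≤ R + 1 := by
    intro v
    have h1 := norm_sub_norm_le (f' v) (f v)
    linarith [hff' v, hR v]
  obtain ⟨χ₁, hχ₁, h1⟩ := exists_isInside_of_origin hd hK hemb' hR' hO' hμ'
  have hz' : z ∉ polyhedron K f' := disjoint_left.1 hdisj hz
  rw [hχ'.eq_of_isPreconnected (Metric.isPreconnected_ball (x := q) (r := ρ / 2)) hdisj
    (Metric.ball_subset_ball hr1.le hq') hz, hχ'.unique hd hK hemb' hχ₁ hz', h1 z hz' hzg', hcr,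
    hχq, hχz]

/-- By `IsInside.exists_stable` the value at the moving point is locally constant in time. -/
theorem IsInside.eq_of_continuousOn (hd : 2 ≤ d) (hK : IsClosedComplex d K)
    {F : ℝ → V → EuclideanSpace ℝ (Fin d)} {I : Set ℝ} (hI : IsPreconnected I)
    (hF : ∀ v, ContinuousOn (fun t => F t v) I) (hemb : ∀ t ∈ I, IsEmbedded K (F t))
    {q : ℝ → EuclideanSpace ℝ (Fin d)} (hq : ContinuousOn q I)
    (hqP : ∀ t ∈ I, q t ∉ polyhedron K (F t)) {χ : ℝ → EuclideanSpace ℝ (Fin d) → ZMod 2}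
    (hχ : ∀ t ∈ I, IsInside K (F t) (χ t)) {s t : ℝ} (hs : s ∈ I) (ht : t ∈ I) :
    χ s (q s) = χ t (q t) := by
  have hI' : IsPreconnected (univ : Set I) :=
    isPreconnected_iff_preconnectedSpace.1 hI |>.isPreconnected_univ
  refine FlexPoly.eq_of_isPreconnected hI' (h := fun t : I => χ t (q t)) ?_ (x := ⟨s, hs⟩)
    (y := ⟨t, ht⟩) trivial trivial
  rintro ⟨u, hu⟩ -
  obtain ⟨r, hr, h⟩ := (hχ u hu).exists_stable hd hK (hemb u hu) (hqP u hu)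
  have h1 : ∀ᶠ t in 𝓝[I] u, (∀ v, ‖F t v - F u v‖ < r) ∧ q t ∈ Metric.ball (q u) r := by
    refine Eventually.and (Filter.eventually_all.2 fun v => ?_)
      ((hq u hu).eventually (Metric.ball_mem_nhds _ hr))
    filter_upwards [(hF v u hu).eventually (Metric.ball_mem_nhds _ hr)] with t ht
    rwa [dist_eq_norm] at ht
  rw [nhdsWithin_eq_map_subtype_coe hu, eventually_map] at h1
  filter_upwards [h1] with t ht
  exact h _ (hemb t t.2) ht.1 _ (hχ t t.2) _ ht.2

end Deformation


/-! ### Rigidity when no distance across a ridge changes -/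

/-- A continuous function on a connected set cannot jump between the two roots. This excludes
reflecting a vertex in the hyperplane of a facet. -/
theorem eq_of_sq_eq_const {I : Set ℝ} (hI : IsPreconnected I) {g : ℝ → ℝ} (hg : ContinuousOn g I)
    {C : ℝ} (hC : ∀ t ∈ I, g t ^ 2 = C) {s t : ℝ} (hs : s ∈ I) (ht : t ∈ I) : g s = g t := by
  by_cases h0 : g t = 0
  · have h1 := hC s hs
    rw [← hC t ht, h0] at h1
    rw [h0]
    exact pow_eq_zero_iff two_ne_zero |>.1 (h1.trans (zero_pow two_ne_zero))
  · refine hI.eq_of_sq_eq (g := fun _ => g t) hg continuousOn_const (fun u hu => ?_)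
      (fun _ => h0) ht rfl hs
    simp [hC u hu, hC t ht]

section Rigidity

variable {V : Type*} [Fintype V] {d : ℕ} {K : AbstractSimplicialComplex V}

/-- Both vectors are multiples of the unit normal: equality in Cauchy-Schwarz. -/
theorem inner_sq_eq_of_orthogonal_facet {f : V → EuclideanSpace ℝ (Fin d)} {σ : Finset V}
    (hd : 0 < d) (hσ : Compat f σ σ) (hσd : σ.card = d) {x z : EuclideanSpace ℝ (Fin d)}
    (hx : ∀ δ ∈ balanced σ, inner ℝ (affExtend f δ) x = 0)
    (hz : ∀ δ ∈ balanced σ, inner ℝ (affExtend f δ) z = 0) :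
    inner ℝ x z ^ 2 = (inner ℝ x x : ℝ) * inner ℝ z z := by
  obtain ⟨n, hn1, hn⟩ := exists_normal (f := f) hd hσd
  have hn0 : n ≠ 0 := by
    rintro rfl
    simp at hn1
  have hnn : inner ℝ n n = (1 : ℝ) := by rw [real_inner_self_eq_norm_sq, hn1, one_pow]
  have key : ∀ x : EuclideanSpace ℝ (Fin d), (∀ δ ∈ balanced σ, inner ℝ (affExtend f δ) x = 0) →
      x = (inner ℝ x n : ℝ) • n := by
    intro x hx
    set k : ℝ := inner ℝ x n with hk
    have h1 : inner ℝ (x - k • n) n = 0 := by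
      rw [inner_sub_left, real_inner_smul_left, hnn, ← hk]
      ring
    obtain ⟨δ, hδ, hδn⟩ := mem_direction.1 (mem_direction_of_orthogonal_normal hσ hσd hd hn0 hn h1)
    have h2 : inner ℝ (x - k • n) (x - k • n) = 0 := by
      rw [inner_sub_right, real_inner_smul_right, h1, mul_zero, sub_zero, ← hδn]
      exact hx δ hδ
    exact sub_eq_zero.1 (inner_self_eq_zero.1 h2)
  rw [key x hx, key z hz]
  simp only [real_inner_smul_left, real_inner_smul_right, hnn]
  ring

variable {F : ℝ → V → EuclideanSpace ℝ (Fin d)} {I : Set ℝ}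

/-- If the distances from `u` and `v` to a facet do not change, neither does their distance. -/
theorem dist_eq_of_dist_facet_eq (hd : 0 < d) (hI : IsPreconnected I)
    (hF : ∀ v, ContinuousOn (fun t => F t v) I) {σ : Finset V} (hσd : σ.card = d)
    (hσ : ∀ t ∈ I, Compat (F t) σ σ) {s : ℝ} (hs : s ∈ I)
    (hσc : ∀ t ∈ I, ∀ i ∈ σ, ∀ j ∈ σ, dist (F t i) (F t j) = dist (F s i) (F s j)) {u v : V}
    (hu : ∀ t ∈ I, ∀ i ∈ σ, dist (F t u) (F t i) = dist (F s u) (F s i))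
    (hv : ∀ t ∈ I, ∀ i ∈ σ, dist (F t v) (F t i) = dist (F s v) (F s i)) {t : ℝ} (ht : t ∈ I) :
    dist (F t u) (F t v) = dist (F s u) (F s v) := by
  classical
  have hσne : σ.Nonempty := Finset.card_pos.1 (hσd ▸ hd)
  have hins : ∀ u, (∀ t ∈ I, ∀ i ∈ σ, dist (F t u) (F t i) = dist (F s u) (F s i)) → ∀ t ∈ I,
      ∀ i ∈ insert u σ, ∀ j ∈ insert u σ, dist (F t i) (F t j) = dist (F s i) (F s j) := by
    intro u hu t ht i hi j hj
    rcases Finset.mem_insert.1 hi with rfl | hi'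
    · rcases Finset.mem_insert.1 hj with rfl | hj'
      · simp
      · exact hu t ht j hj'
    · rcases Finset.mem_insert.1 hj with rfl | hj'
      · rw [dist_comm, hu t ht i hi', dist_comm]
      · exact hσc t ht i hi' j hj'
  -- The weights of the foot of `u` on the facet, found at time `s`, remain those of the foot, and
  -- the height keeps its length, because both are inner products determined by the preserved
  -- distances.
  have foot : ∀ u, (∀ t ∈ I, ∀ i ∈ σ, dist (F t u) (F t i) = dist (F s u) (F s i)) →
      ∃ l : V → ℝ, ∑ v, l v = 1 ∧ (∀ v ∉ σ, l v = 0) ∧ ∀ t ∈ I,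
        (∀ δ ∈ balanced σ, inner ℝ (affExtend (F t) δ) (affExtend (F t) (Pi.single u 1 - l)) = 0) ∧
        inner ℝ (affExtend (F t) (Pi.single u 1 - l)) (affExtend (F t) (Pi.single u 1 - l)) =
        (inner ℝ (affExtend (F s) (Pi.single u 1 - l)) (affExtend (F s) (Pi.single u 1 - l)) : ℝ) := by
    intro u hu
    obtain ⟨l, hl1, hls, hl⟩ := exists_orthogonal_foot (F s) hσne (F s u)
    have hbal : (Pi.single u 1 - l : V → ℝ) ∈ balanced (insert u σ) := by
      refine ⟨by simp [Finset.sum_sub_distrib, hl1], fun v hv => ?_⟩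
      rw [Finset.mem_insert, not_or] at hv
      simp [hv.1, hls v hv.2]
    refine ⟨l, hl1, hls, fun t ht => ⟨fun δ hδ => ?_,
      inner_affExtend_eq_of_balanced hbal hbal (hins u hu t ht)⟩⟩
    rw [inner_affExtend_eq_of_balanced (balanced_mono (Finset.subset_insert u σ) hδ) hbal
      (hins u hu t ht), affExtend_sub, affExtend_single, one_smul]
    exact hl δ hδ
  obtain ⟨l, hl1, hls, hl⟩ := foot u hu
  obtain ⟨m, hm1, hms, hm⟩ := foot v hv
  obtain ⟨x, hx⟩ : ∃ x : ℝ → EuclideanSpace ℝ (Fin d), ∀ t, affExtend (F t) (Pi.single u 1 - l) = x t :=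
    ⟨_, fun _ => rfl⟩
  obtain ⟨z, hz⟩ : ∃ z : ℝ → EuclideanSpace ℝ (Fin d), ∀ t, affExtend (F t) (Pi.single v 1 - m) = z t :=
    ⟨_, fun _ => rfl⟩
  simp only [hx] at hl
  simp only [hz] at hm
  have hcx : ContinuousOn x I :=
    (continuousOn_affExtend (w := fun _ => Pi.single u 1 - l) hF fun _ => continuousOn_const).congr fun t _ => (hx t).symm
  have hcz : ContinuousOn z I :=
    (continuousOn_affExtend (w := fun _ => Pi.single v 1 - m) hF fun _ => continuousOn_const).congr fun t _ => (hz t).symm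
  have hcont : ContinuousOn (fun t => (inner ℝ (x t) (z t) : ℝ)) I := hcx.inner hcz
  -- The inner product of the two heights has constant square and varies continuously, so `u` and
  -- `v` stay on the same or on opposite sides.
  have hxz : inner ℝ (x t) (z t) = (inner ℝ (x s) (z s) : ℝ) := by
    refine eq_of_sq_eq_const hI hcont (C := inner ℝ (x s) (x s) * inner ℝ (z s) (z s))
      (fun r hr => ?_) ht hs
    rw [inner_sq_eq_of_orthogonal_facet hd (hσ r hr) hσd (hl r hr).1 (hm r hr).1, (hl r hr).2,
      (hm r hr).2]
  have hlm : l - m ∈ balanced σ := sub_mem_balanced (by rw [hl1, hm1]) hls hms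
  have hdecomp : ∀ r ∈ I, ‖F r u - F r v‖ ^ 2 = inner ℝ (affExtend (F r) (l - m))
      (affExtend (F r) (l - m)) + inner ℝ (x r) (x r) + inner ℝ (z r) (z r) -
        2 * inner ℝ (x r) (z r) := by
    intro r hr
    have e : F r u - F r v = affExtend (F r) (l - m) + (x r - z r) := by
      rw [← hx, ← hz]
      simp only [affExtend_sub, affExtend_single, one_smul]
      abel
    rw [e, norm_add_sq_real, norm_sub_sq_real, inner_sub_right, (hl r hr).1 _ hlm, (hm r hr).1 _ hlm,
      real_inner_self_eq_norm_sq, real_inner_self_eq_norm_sq, real_inner_self_eq_norm_sq]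
    ring
  rw [dist_eq_norm, dist_eq_norm]
  refine (pow_left_inj₀ (norm_nonneg _) (norm_nonneg _) two_ne_zero).1 ?_
  rw [hdecomp t ht, hdecomp s hs, hxz, inner_affExtend_eq_of_balanced hlm hlm (hσc t ht),
    (hl t ht).2, (hm t ht).2]

/-- A deformation with congruent faces that changes no distance across a ridge is a motion. -/
theorem congruent_of_ridge_dist_eq [DecidableEq V] (hd : 0 < d) (hK : IsClosedComplex d K)
    (hI : IsPreconnected I)
    (hF : ∀ v, ContinuousOn (fun t => F t v) I) (hemb : ∀ t ∈ I, IsEmbedded K (F t)) {s : ℝ}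
    (hs : s ∈ I)
    (hc : ∀ t ∈ I, ∀ σ ∈ K, ∀ i ∈ σ, ∀ j ∈ σ, dist (F t i) (F t j) = dist (F s i) (F s j))
    (hr : ∀ t ∈ I, ∀ y a b, IsRidge d K y a b → dist (F t a) (F t b) = dist (F s a) (F s b))
    {t : ℝ} (ht : t ∈ I) : Congruent (F t) (F s) := by
  have core : ∀ σ ∈ K, σ.card = d → ∀ u v,
      (∀ t ∈ I, ∀ i ∈ σ, dist (F t u) (F t i) = dist (F s u) (F s i)) →
      (∀ t ∈ I, ∀ i ∈ σ, dist (F t v) (F t i) = dist (F s v) (F s i)) → ∀ t ∈ I,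
      dist (F t u) (F t v) = dist (F s u) (F s v) := fun σ hσ hσd u v hu hv t ht =>
    dist_eq_of_dist_facet_eq hd hI hF hσd
      (fun t ht => isEmbedded_iff_compat.1 (hemb t ht) σ hσ σ hσ) hs
      (fun t ht => hc t ht σ hσ) hu hv ht
  have facet : ∀ v, ∃ τ ∈ K, τ.card = d ∧ v ∈ τ := fun v => by
    obtain ⟨τ, hτ, hτd, hv⟩ := hK.pure {v} (K.singleton_mem v)
    exact ⟨τ, hτ, hτd, Finset.singleton_subset_iff.1 hv⟩
  -- Distances from a fixed vertex `u` are passed along a chain of facets. At a ridge the only new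
  -- vertex is `b`, whose distances to the previous facet do not change by the assumption on ridges.
  have step : ∀ σ ∈ K, σ.card = d → ∀ τ ∈ K, τ.card = d → ∀ u ∈ σ, ∀ t ∈ I, ∀ i ∈ τ,
      dist (F t u) (F t i) = dist (F s u) (F s i) := by
    intro σ hσ hσd τ hτ hτd u hu
    induction hK.strongly_connected σ hσ τ hτ hσd hτd with
    | refl => exact fun t ht i hi => hc t ht σ hσ u hu i hi
    | @tail ρ τ _ h ih =>
      obtain ⟨⟨hρ, hρd⟩, -, y, hy, hyd, hyρ, hyτ⟩ := h
      have ih := ih hρ hρd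
      by_cases hne : τ = ρ
      · rwa [hne]
      obtain ⟨a, b, rfl, rfl, hrd⟩ := hK.isRidge_of_facets hy hyd hρ hρd hyρ hτ hτd hyτ hne
      have hb : ∀ t ∈ I, ∀ i ∈ insert a y, dist (F t b) (F t i) = dist (F s b) (F s i) := by
        intro t ht i hi
        rcases Finset.mem_insert.1 hi with rfl | hi
        · exact hr t ht y b i hrd.swap
        · exact hc t ht _ hτ b (Finset.mem_insert_self _ _) i (Finset.mem_insert_of_mem hi)
      intro t ht i hi
      rcases Finset.mem_insert.1 hi with rfl | hi
      · exact core _ hρ hρd u i ih hb t ht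
      · exact ih t ht i (Finset.mem_insert_of_mem hi)
  rw [congruent_iff_dist_eq]
  intro u v
  obtain ⟨σ, hσ, hσd, hu⟩ := facet u
  obtain ⟨τ, hτ, hτd, hv⟩ := facet v
  exact step σ hσ hσd τ hτ hτd u hu t ht v hv

end Rigidity


/-! ### The tent complex is again a closed complex -/

section Tent

open Finset (insertNone eraseNone)

variable {V : Type*}

theorem eq_map_some_or_eq_insertNone (s : Finset (Option V)) :
    (∃ σ : Finset V, s = σ.map Function.Embedding.some) ∨ ∃ σ : Finset V, s = insertNone σ := by
  classical
  by_cases h : none ∈ s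
  · exact Or.inr ⟨eraseNone s, by rw [Finset.insertNone_eraseNone, Finset.insert_eq_of_mem h]⟩
  · exact Or.inl ⟨eraseNone s, by rw [Finset.map_some_eraseNone, Finset.erase_eq_of_notMem h]⟩

theorem none_notMem_map_some (σ : Finset V) : none ∉ σ.map Function.Embedding.some := by simp

theorem some_mem_map_some {σ : Finset V} {v : V} :
    some v ∈ σ.map Function.Embedding.some ↔ v ∈ σ := by simp

theorem map_some_subset_insertNone {σ τ : Finset V} :
    σ.map Function.Embedding.some ⊆ insertNone τ ↔ σ ⊆ τ := by
  simp [Finset.subset_iff]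

theorem insertNone_subset_insertNone {σ τ : Finset V} :
    insertNone σ ⊆ insertNone τ ↔ σ ⊆ τ := Finset.insertNone.le_iff_le

theorem not_insertNone_subset_map_some {σ τ : Finset V} :
    ¬ insertNone σ ⊆ τ.map Function.Embedding.some := fun h =>
  none_notMem_map_some τ (h Finset.none_mem_insertNone)

/-- `A` is a maximal face with at least two vertices. -/
structure IsTentBase (K : AbstractSimplicialComplex V) (A : Finset V) : Prop where
  mem : A ∈ K
  maximal : ∀ σ ∈ K, A ⊆ σ → σ = A
  one_lt_card : 1 < A.card

variable {K : AbstractSimplicialComplex V} {A : Finset V}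

/-- The maximal face `A` is replaced by the cone with the new apex `none` over its boundary. -/
def tentComplex (K : AbstractSimplicialComplex V) (A : Finset V) (hA : IsTentBase K A) :
    AbstractSimplicialComplex (Option V) where
  -- A face through the apex is the apex with a proper, possibly empty, subset of `A`; the proper
  -- faces of `A` itself are kept by the second alternative.
  faces := {s | (none ∈ s ∧ eraseNone s ⊂ A) ∨ (none ∉ s ∧ eraseNone s ∈ K ∧ eraseNone s ≠ A)}
  isRelLowerSet_faces := by
    intro s hs
    have hle : ∀ t : Finset (Option V), t ⊆ s → eraseNone t ⊆ eraseNone s := fun t ht =>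
      eraseNone.monotone ht
    have hne : ∀ t : Finset (Option V), t.Nonempty → none ∉ t → (eraseNone t).Nonempty := by
      rintro t ⟨o, ho⟩ hn
      cases o with
      | none => exact absurd ho hn
      | some v => exact ⟨v, Finset.mem_eraseNone.2 ho⟩
    rcases hs with ⟨h1, h2⟩ | ⟨h1, h2, h3⟩
    · refine ⟨⟨none, h1⟩, fun t ht htne => ?_⟩
      have h4 := (hle t ht).trans_ssubset h2
      by_cases hnt : none ∈ t
      · exact Or.inl ⟨hnt, h4⟩
      · exact Or.inr ⟨hnt, face_of_subset hA.mem h4.subset (hne t htne hnt), h4.ne⟩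
    · refine ⟨?_, fun t ht htne => ?_⟩
      · obtain ⟨v, hv⟩ := face_nonempty h2
        exact ⟨some v, Finset.mem_eraseNone.1 hv⟩
      · have hnt : none ∉ t := fun h => h1 (ht h)
        refine Or.inr ⟨hnt, face_of_subset h2 (hle t ht) (hne t htne hnt), fun h4 => ?_⟩
        exact h3 (hA.maximal _ h2 (h4 ▸ hle t ht))
  singleton_mem := by
    intro o
    cases o with
    | none =>
      refine Or.inl ⟨Finset.mem_singleton_self _, ?_⟩
      rw [Finset.eraseNone_none, Finset.empty_ssubset]
      exact Finset.card_pos.1 (by linarith [hA.one_lt_card])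
    | some v =>
      have e : eraseNone ({some v} : Finset (Option V)) = {v} := by
        ext u
        simp
      refine Or.inr ⟨by simp, ?_, ?_⟩
      · rw [e]
        exact K.singleton_mem v
      · rw [e]
        intro h
        have := hA.one_lt_card
        rw [← h, Finset.card_singleton] at this
        exact lt_irrefl _ this

variable {hA : IsTentBase K A}

theorem map_some_mem_tentComplex {σ : Finset V} :
    σ.map Function.Embedding.some ∈ tentComplex K A hA ↔ σ ∈ K ∧ σ ≠ A := by
  change (_ ∨ _) ↔ _
  rw [Finset.eraseNone_map_some]
  simp

theorem insertNone_mem_tentComplex {σ : Finset V} :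
    insertNone σ ∈ tentComplex K A hA ↔ σ ⊂ A := by
  change (_ ∨ _) ↔ _
  rw [Finset.eraseNone_insertNone]
  simp

theorem card_erase_facet [DecidableEq V] {d : ℕ} (hAd : A.card = d) {v : V} (hv : v ∈ A) :
    (insertNone (A.erase v)).card = d := by
  rw [Finset.card_insertNone, Finset.card_erase_add_one hv, hAd]

theorem insertNone_erase_mem [DecidableEq V] {v : V} (hv : v ∈ A) :
    insertNone (A.erase v) ∈ tentComplex K A hA :=
  insertNone_mem_tentComplex.2 (Finset.erase_ssubset hv)

theorem IsClosedComplex.isTentBase [Fintype V] {d : ℕ} (hd : 2 ≤ d) (hK : IsClosedComplex d K)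
    (hA : A ∈ K) (hAd : A.card = d) : IsTentBase K A :=
  ⟨hA, fun _ hσ h => hK.eq_of_subset hσ hAd h, by omega⟩

variable {d : ℕ}

theorem tentComplex_pure (hK : IsClosedComplex d K) (hAd : A.card = d) :
    ∀ s ∈ tentComplex K A hA, ∃ t ∈ tentComplex K A hA, t.card = d ∧ s ⊆ t := by
  classical
  intro s hs
  have key : ∀ σ : Finset V, σ ⊂ A → ∃ v ∈ A, σ ⊆ A.erase v := by
    intro σ hσ
    obtain ⟨v, hv, hvσ⟩ := Finset.exists_of_ssubset hσ
    exact ⟨v, hv, fun u hu => Finset.mem_erase.2 ⟨fun huv => hvσ (huv ▸ hu), hσ.subset hu⟩⟩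
  rcases eq_map_some_or_eq_insertNone s with ⟨σ, rfl⟩ | ⟨σ, rfl⟩
  · rw [map_some_mem_tentComplex] at hs
    obtain ⟨τ, hτ, hτd, hστ⟩ := hK.pure σ hs.1
    by_cases hτA : τ = A
    · subst hτA
      obtain ⟨v, hv, h⟩ := key σ (hστ.ssubset_of_ne hs.2)
      exact ⟨_, insertNone_erase_mem hv, card_erase_facet hAd hv, map_some_subset_insertNone.2 h⟩
    · exact ⟨τ.map Function.Embedding.some, map_some_mem_tentComplex.2 ⟨hτ, hτA⟩,
        by rw [Finset.card_map, hτd], Finset.map_subset_map.2 hστ⟩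
  · rw [insertNone_mem_tentComplex] at hs
    obtain ⟨v, hv, h⟩ := key σ hs
    exact ⟨_, insertNone_erase_mem hv, card_erase_facet hAd hv, insertNone_subset_insertNone.2 h⟩

/-- For an old ridge both facets survive, except that `A` is replaced by the cone over the ridge.
For a ridge that is the cone over `σ`, the two facets come from the two vertices of `A` outside `σ`.
-/
theorem tentComplex_boundary_free (hK : IsClosedComplex d K) (hAd : A.card = d) :
    ∀ s ∈ tentComplex K A hA, s.card + 1 = d →
      {t | t ∈ tentComplex K A hA ∧ t.card = d ∧ s ⊆ t}.ncard = 2 := by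
  classical
  intro s hs hsd
  rw [Set.ncard_eq_two]
  rcases eq_map_some_or_eq_insertNone s with ⟨σ, rfl⟩ | ⟨σ, rfl⟩
  · rw [map_some_mem_tentComplex] at hs
    rw [Finset.card_map] at hsd
    obtain ⟨a, b, h⟩ := hK.exists_isRidge hs.1 hsd
    obtain ⟨M, hMA, hMn⟩ : ∃ M : V → Finset (Option V),
        (∀ v, insert v σ = A → M v = insertNone σ) ∧
        ∀ v, insert v σ ≠ A → M v = (insert v σ).map Function.Embedding.some :=
      ⟨fun v => if insert v σ = A then insertNone σ else (insert v σ).map Function.Embedding.some,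
        fun v hv => if_pos hv, fun v hv => if_neg hv⟩
    have hab : insert a σ ≠ insert b σ := fun hh => by
      have : a ∈ insert b σ := hh ▸ Finset.mem_insert_self a σ
      rcases Finset.mem_insert.1 this with h1 | h1
      · exact h.ne h1
      · exact h.notMem_a h1
    have hM : ∀ v, v ∉ σ → insert v σ ∈ K → (insert v σ).card = d → M v ∈ tentComplex K A hA ∧
        (M v).card = d ∧ σ.map Function.Embedding.some ⊆ M v := by
      intro v hv hvK hvd
      by_cases hvA : insert v σ = A
      · rw [hMA v hvA, insertNone_mem_tentComplex, Finset.card_insertNone,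
          map_some_subset_insertNone, ← hvA]
        exact ⟨Finset.ssubset_insert hv, hsd, subset_rfl⟩
      · rw [hMn v hvA, map_some_mem_tentComplex, Finset.card_map, Finset.map_subset_map]
        exact ⟨⟨hvK, hvA⟩, hvd, Finset.subset_insert v σ⟩
    refine ⟨M a, M b, ?_, ?_⟩
    · by_cases haA : insert a σ = A
      · rw [hMA a haA, hMn b fun hbA => hab (haA.trans hbA.symm)]
        exact fun hh => not_insertNone_subset_map_some hh.subset
      · by_cases hbA : insert b σ = A
        · rw [hMn a haA, hMA b hbA]
          exact fun hh => not_insertNone_subset_map_some hh.symm.subset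
        · rw [hMn a haA, hMn b hbA]
          exact fun hh => hab (Finset.map_injective _ hh)
    · ext t
      rw [mem_ofPred_eq, mem_insert_iff, mem_singleton_iff]
      constructor
      · rintro ⟨ht, htd, hst⟩
        rcases eq_map_some_or_eq_insertNone t with ⟨τ, rfl⟩ | ⟨τ, rfl⟩
        · rw [map_some_mem_tentComplex] at ht
          rw [Finset.card_map] at htd
          rw [Finset.map_subset_map] at hst
          rcases h.eq_or_eq τ ht.1 htd hst with h1 | h1
          · exact Or.inl (by rw [hMn a (h1 ▸ ht.2), h1])
          · exact Or.inr (by rw [hMn b (h1 ▸ ht.2), h1])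
        · rw [insertNone_mem_tentComplex] at ht
          rw [Finset.card_insertNone] at htd
          rw [map_some_subset_insertNone] at hst
          have h1 : σ = τ := Finset.eq_of_subset_of_card_le hst (by omega)
          subst h1
          rcases h.eq_or_eq A hA.mem hAd ht.subset with h2 | h2
          · exact Or.inl (hMA a h2.symm).symm
          · exact Or.inr (hMA b h2.symm).symm
      · rintro (rfl | rfl)
        · exact hM a h.notMem_a h.mem_a h.card_a
        · exact hM b h.notMem_b h.mem_b h.swap.card_a
  · rw [insertNone_mem_tentComplex] at hs
    rw [Finset.card_insertNone] at hsd
    have hcard : (A \ σ).card = 2 := by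
      rw [Finset.card_sdiff_of_subset hs.subset]
      omega
    obtain ⟨v, w, hvw, hA2⟩ := Finset.card_eq_two.1 hcard
    have hmem : ∀ u, u ∈ A ∧ u ∉ σ ↔ u = v ∨ u = w := fun u => by
      rw [← Finset.mem_sdiff, hA2, Finset.mem_insert, Finset.mem_singleton]
    obtain ⟨hvA, hvσ⟩ := (hmem v).2 (Or.inl rfl)
    obtain ⟨hwA, hwσ⟩ := (hmem w).2 (Or.inr rfl)
    have hM : ∀ u, u ∈ A → u ∉ σ → insertNone (insert u σ) ∈ tentComplex K A hA ∧
        (insertNone (insert u σ)).card = d ∧ insertNone σ ⊆ insertNone (insert u σ) := by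
      intro u hu huσ
      rw [insertNone_mem_tentComplex, Finset.card_insertNone, Finset.card_insert_of_notMem huσ,
        insertNone_subset_insertNone]
      refine ⟨(Finset.insert_subset hu hs.subset).ssubset_of_ne fun h => ?_, hsd,
        Finset.subset_insert u σ⟩
      have := congrArg Finset.card h
      rw [Finset.card_insert_of_notMem huσ] at this
      omega
    refine ⟨insertNone (insert v σ), insertNone (insert w σ), fun h => ?_, ?_⟩
    · have h1 := congrArg eraseNone h
      rw [Finset.eraseNone_insertNone, Finset.eraseNone_insertNone] at h1
      have : v ∈ insert w σ := h1 ▸ Finset.mem_insert_self v σ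
      exact (Finset.mem_insert.1 this).elim hvw hvσ
    · ext t
      rw [mem_ofPred_eq, mem_insert_iff, mem_singleton_iff]
      constructor
      · rintro ⟨ht, htd, hst⟩
        rcases eq_map_some_or_eq_insertNone t with ⟨τ, rfl⟩ | ⟨τ, rfl⟩
        · exact absurd hst not_insertNone_subset_map_some
        · rw [insertNone_mem_tentComplex] at ht
          rw [Finset.card_insertNone] at htd
          rw [insertNone_subset_insertNone] at hst
          obtain ⟨u, hu, rfl⟩ := exists_insert_of_card hst (by omega)
          rcases (hmem u).1 ⟨ht.subset (Finset.mem_insert_self u σ), hu⟩ with rfl | rfl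
          · exact Or.inl rfl
          · exact Or.inr rfl
      · rintro (rfl | rfl)
        · exact hM v hvA hvσ
        · exact hM w hwA hwσ

/-- The facets of the tent complex replacing the facet `σ`. -/
def liftsOf (A σ : Finset V) : Set (Finset (Option V)) :=
  {s | (σ ≠ A ∧ s = σ.map Function.Embedding.some) ∨
    (σ = A ∧ ∃ ρ, s = insertNone ρ ∧ ρ ⊂ A ∧ ρ.card + 1 = A.card)}

/-- A chain of facets is lifted: any two distinct facets of the tent are adjacent, and facets of `K`
sharing a ridge have lifts sharing it, the cone over the ridge being the lift taken for `A`. -/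
theorem tentComplex_strongly_connected (hd : 3 ≤ d) (hK : IsClosedComplex d K)
    (hAd : A.card = d) : ∀ s ∈ tentComplex K A hA, ∀ t ∈ tentComplex K A hA, s.card = d →
      t.card = d → Relation.ReflTransGen (fun a b : Finset (Option V) =>
      (a ∈ tentComplex K A hA ∧ a.card = d) ∧ (b ∈ tentComplex K A hA ∧ b.card = d) ∧
        ∃ ρ ∈ tentComplex K A hA, ρ.card + 1 = d ∧ ρ ⊆ a ∧ ρ ⊆ b) s t := by
  classical
  set R := fun a b : Finset (Option V) =>
      (a ∈ tentComplex K A hA ∧ a.card = d) ∧ (b ∈ tentComplex K A hA ∧ b.card = d) ∧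
        ∃ ρ ∈ tentComplex K A hA, ρ.card + 1 = d ∧ ρ ⊆ a ∧ ρ ⊆ b with hR
  have hlift : ∀ s ∈ tentComplex K A hA, s.card = d → ∃ σ ∈ K, σ.card = d ∧ s ∈ liftsOf A σ := by
    intro s hs hsd
    rcases eq_map_some_or_eq_insertNone s with ⟨σ, rfl⟩ | ⟨σ, rfl⟩
    · rw [map_some_mem_tentComplex] at hs
      exact ⟨σ, hs.1, by rwa [Finset.card_map] at hsd, Or.inl ⟨hs.2, rfl⟩⟩
    · rw [insertNone_mem_tentComplex] at hs
      rw [Finset.card_insertNone] at hsd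
      exact ⟨A, hA.mem, hAd, Or.inr ⟨rfl, σ, rfl, hs, hsd.trans hAd.symm⟩⟩
  have hmem : ∀ σ ∈ K, σ.card = d → ∀ s ∈ liftsOf A σ, s ∈ tentComplex K A hA ∧ s.card = d := by
    rintro σ hσ hσd s (⟨h1, rfl⟩ | ⟨rfl, ρ, rfl, h2, h3⟩)
    · exact ⟨map_some_mem_tentComplex.2 ⟨hσ, h1⟩, by rw [Finset.card_map, hσd]⟩
    · exact ⟨insertNone_mem_tentComplex.2 h2, by rw [Finset.card_insertNone, h3, hσd]⟩
  have hin : ∀ σ ∈ K, σ.card = d → ∀ s ∈ liftsOf A σ, ∀ t ∈ liftsOf A σ,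
      Relation.ReflTransGen R s t := by
    intro σ hσ hσd s hs t ht
    have hs' := hmem σ hσ hσd s hs
    have ht' := hmem σ hσ hσd t ht
    rcases hs with ⟨h1, rfl⟩ | ⟨rfl, ρ, rfl, h2, h3⟩
    · rcases ht with ⟨-, rfl⟩ | ⟨h1', -⟩
      · exact .refl
      · exact absurd h1' h1
    · rcases ht with ⟨h1', -⟩ | ⟨-, ρ', rfl, h2', h3'⟩
      · exact absurd rfl h1'
      · by_cases hρ : ρ = ρ'
        · rw [hρ]
        -- Two different subsets of `A` lacking one vertex each have `d - 2` vertices in common, to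
        -- which the apex is added.
        · refine .single ⟨hs', ht', insertNone (ρ ∩ ρ'), ?_, ?_, ?_, ?_⟩
          · exact insertNone_mem_tentComplex.2 (Finset.inter_subset_left.trans_ssubset h2)
          · rw [Finset.card_insertNone]
            have h4 := Finset.card_union_add_card_inter ρ ρ'
            have h5 : ρ ⊂ ρ ∪ ρ' := Finset.subset_union_left.ssubset_of_ne fun h => hρ
              (Finset.eq_of_subset_of_card_le (h ▸ Finset.subset_union_right) (by omega)).symm
            have h6 := Finset.card_lt_card h5
            have h7 := Finset.card_le_card (Finset.union_subset h2.subset h2'.subset)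
            omega
          · exact insertNone_subset_insertNone.2 Finset.inter_subset_left
          · exact insertNone_subset_insertNone.2 Finset.inter_subset_right
  have hstep : ∀ σ τ ρ : Finset V, σ ∈ K → σ.card = d → τ ∈ K → τ.card = d → ρ ∈ K →
      ρ.card + 1 = d → ρ ⊆ σ → ρ ⊆ τ → ∃ s ∈ liftsOf A σ, ∃ t ∈ liftsOf A τ, R s t := by
    intro σ τ ρ hσ hσd hτ hτd hρ hρd hρσ hρτ
    have key : ∀ σ ∈ K, σ.card = d → ρ ⊆ σ → ∃ s ∈ liftsOf A σ,
        ρ.map Function.Embedding.some ⊆ s := by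
      intro σ hσ hσd hρσ
      by_cases h : σ = A
      · refine ⟨insertNone ρ, Or.inr ⟨h, ρ, rfl, ?_, by omega⟩,
          map_some_subset_insertNone.2 subset_rfl⟩
        rw [← h]
        exact hρσ.ssubset_of_ne fun hh => by
          rw [hh] at hρd
          omega
      · exact ⟨_, Or.inl ⟨h, rfl⟩, Finset.map_subset_map.2 hρσ⟩
    obtain ⟨s, hs, hρs⟩ := key σ hσ hσd hρσ
    obtain ⟨t, ht, hρt⟩ := key τ hτ hτd hρτ
    refine ⟨s, hs, t, ht, hmem σ hσ hσd s hs, hmem τ hτ hτd t ht,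
      ρ.map Function.Embedding.some, map_some_mem_tentComplex.2 ⟨hρ, fun h => ?_⟩,
      by rw [Finset.card_map, hρd], hρs, hρt⟩
    rw [h] at hρd
    omega
  intro s hs t ht hsd htd
  obtain ⟨σ, hσ, hσd, hsσ⟩ := hlift s hs hsd
  obtain ⟨τ, hτ, hτd, htτ⟩ := hlift t ht htd
  have hchain := hK.strongly_connected σ hσ τ hτ hσd hτd
  clear ht htd hτ hτd
  induction hchain generalizing t with
  | refl => exact hin σ hσ hσd s hsσ t htτ
  | tail _ h ih =>
    obtain ⟨⟨hb, hbd⟩, ⟨hc, hcd⟩, ρ, hρ, hρd, hρb, hρc⟩ := h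
    obtain ⟨s', hs', t', ht', hR'⟩ := hstep _ _ ρ hb hbd hc hcd hρ hρd hρb hρc
    exact ((ih s' hs').tail hR').trans (hin _ hc hcd t' ht' t htτ)

theorem IsClosedComplex.tentComplex (hd : 3 ≤ d) (hK : IsClosedComplex d K) (hAd : A.card = d) :
    IsClosedComplex d (tentComplex K A hA) :=
  ⟨⟨none⟩, tentComplex_pure hK hAd, tentComplex_boundary_free hK hAd,
    tentComplex_strongly_connected hd hK hAd⟩

/-- The cone over `x` takes the place of the old facet at `x`, so the apex replaces `a` and a second
tent can be erected at the same ridge. -/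
theorem IsRidge.tentComplex [DecidableEq V] {x : Finset V} {a b : V}
    (h : IsRidge d K x a b) (hA : IsTentBase K (insert a x)) :
    IsRidge d (tentComplex K (insert a x) hA) (x.map Function.Embedding.some) none (some b) := by
  have hxA : x ≠ insert a x := fun hh => h.notMem_a (hh ▸ Finset.mem_insert_self a x)
  have hbA : insert b x ≠ insert a x := fun hh => by
    have : b ∈ insert a x := hh ▸ Finset.mem_insert_self b x
    rcases Finset.mem_insert.1 this with h1 | h1
    · exact h.ne h1.symm
    · exact h.notMem_b h1
  have e1 : insert none (x.map Function.Embedding.some) = insertNone x := by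
    ext o
    cases o <;> simp
  have e2 : insert (some b) (x.map Function.Embedding.some) =
      (insert b x).map Function.Embedding.some := by
    ext o
    cases o <;> simp
  refine ⟨map_some_mem_tentComplex.2 ⟨h.mem, hxA⟩, by rw [Finset.card_map, h.card],
    none_notMem_map_some x, ?_, by simp, ?_, ?_, fun t ht htd hxt => ?_⟩
  · rw [some_mem_map_some]
    exact h.notMem_b
  · rw [e1, insertNone_mem_tentComplex]
    exact Finset.ssubset_insert h.notMem_a
  · rw [e2, map_some_mem_tentComplex]
    exact ⟨h.mem_b, hbA⟩
  · rw [e1, e2]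
    rcases eq_map_some_or_eq_insertNone t with ⟨τ, rfl⟩ | ⟨τ, rfl⟩
    · rw [map_some_mem_tentComplex] at ht
      rw [Finset.card_map] at htd
      rw [Finset.map_subset_map] at hxt
      rcases h.eq_or_eq τ ht.1 htd hxt with h1 | h1
      · exact absurd h1 ht.2
      · exact Or.inr (by rw [h1])
    · rw [Finset.card_insertNone] at htd
      rw [map_some_subset_insertNone] at hxt
      exact Or.inl (by rw [Finset.eq_of_subset_of_card_le hxt (by have := h.card; omega)])

end Tent


/-! ### The tent as a subdivision close to the original polyhedron -/

section Subdivision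

open Finset (insertNone eraseNone)

theorem affExtend_affExtend {V V' : Type*} [Fintype V] [Fintype V'] {M : Type*} [AddCommGroup M]
    [Module ℝ M] (f : V → M) (g : V' → V → ℝ) (w : V' → ℝ) :
    affExtend f (affExtend g w) = affExtend (fun v => affExtend f (g v)) w := by
  simp only [affExtend, Finset.sum_apply, Pi.smul_apply, smul_eq_mul, Finset.sum_smul,
    Finset.smul_sum, smul_smul]
  rw [Finset.sum_comm]

theorem IsSubdivision.trans {V V' V'' : Type*} [Fintype V] [Fintype V'] [Fintype V'']
    {K : AbstractSimplicialComplex V} {K' : AbstractSimplicialComplex V'}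
    {K'' : AbstractSimplicialComplex V''} (h : IsSubdivision K' K) (h' : IsSubdivision K'' K') :
    IsSubdivision K'' K := by
  obtain ⟨g, hg, hgb⟩ := h
  obtain ⟨g', hg', hgb'⟩ := h'
  refine ⟨fun v => affExtend g (g' v), fun σ hσ => ?_, ?_⟩
  · obtain ⟨τ, hτ, h1⟩ := hg' σ hσ
    obtain ⟨ρ, hρ, h2⟩ := hg τ hτ
    refine ⟨ρ, hρ, fun v hv u hu => ?_⟩
    simp only [affExtend, Finset.sum_apply, Pi.smul_apply, smul_eq_mul]
    refine Finset.sum_eq_zero fun i _ => ?_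
    by_cases hi : i ∈ τ
    · rw [h2 i hi u hu, mul_zero]
    · rw [h1 v hv i hi, zero_mul]
  · have e : affExtend (fun v => affExtend g (g' v)) = affExtend g ∘ affExtend g' := by
      funext w
      exact (affExtend_affExtend g g' w).symm
    rw [e]
    exact hgb.comp hgb'

variable {V : Type*} [Fintype V] {K : AbstractSimplicialComplex V} {A : Finset V}
  {hA : IsTentBase K A}

theorem affExtend_option {M : Type*} [AddCommGroup M] [Module ℝ M] (f : Option V → M)
    (w : Option V → ℝ) :
    affExtend f w = w none • f none + affExtend (fun v => f (some v)) fun v => w (some v) := by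
  simp [affExtend, Fintype.sum_option]

theorem mem_tent_realization {w : Option V → ℝ} (hw : w ∈ realization (tentComplex K A hA)) :
    (∀ v, 0 ≤ w v) ∧ w none + ∑ v, w (some v) = 1 ∧
      ((∃ σ, σ ⊂ A ∧ ∀ v ∉ σ, w (some v) = 0) ∨
        (w none = 0 ∧ ∃ σ ∈ K, σ ≠ A ∧ ∀ v ∉ σ, w (some v) = 0)) := by
  obtain ⟨h0, h1, s, hs, hws⟩ := hw
  rw [Fintype.sum_option] at h1
  refine ⟨h0, h1, ?_⟩
  rcases eq_map_some_or_eq_insertNone s with ⟨σ, rfl⟩ | ⟨σ, rfl⟩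
  · rw [map_some_mem_tentComplex] at hs
    exact Or.inr ⟨hws none (none_notMem_map_some σ), σ, hs.1, hs.2, fun v hv =>
      hws (some v) (mt some_mem_map_some.1 hv)⟩
  · rw [insertNone_mem_tentComplex] at hs
    exact Or.inl ⟨σ, hs, fun v hv => hws (some v) (mt Finset.some_mem_insertNone.1 hv)⟩

theorem tent_realization_mem {w : Option V → ℝ} (h0 : ∀ v, 0 ≤ w v)
    (h1 : w none + ∑ v, w (some v) = 1)
    (h : (∃ σ, σ ⊂ A ∧ ∀ v ∉ σ, w (some v) = 0) ∨
        (w none = 0 ∧ ∃ σ ∈ K, σ ≠ A ∧ ∀ v ∉ σ, w (some v) = 0)) :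
    w ∈ realization (tentComplex K A hA) := by
  refine ⟨h0, by rwa [Fintype.sum_option], ?_⟩
  rcases h with ⟨σ, hσ, hw⟩ | ⟨hn, σ, hσ, hσA, hw⟩
  · refine ⟨insertNone σ, insertNone_mem_tentComplex.2 hσ, fun o ho => ?_⟩
    cases o with
    | none => exact absurd Finset.none_mem_insertNone ho
    | some v => exact hw v (mt Finset.some_mem_insertNone.2 ho)
  · refine ⟨σ.map Function.Embedding.some, map_some_mem_tentComplex.2 ⟨hσ, hσA⟩, fun o ho => ?_⟩
    cases o with
    | none => exact hn
    | some v => exact hw v (mt some_mem_map_some.2 ho)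

/-- Pushing the apex of the tent to the barycentre of a face `x` of the base. -/
noncomputable def flatten (x : Finset V) (w : Option V → ℝ) : V → ℝ :=
  (fun v => w (some v)) + w none • barycenter x

theorem flatten_mem_realization {x : Finset V} (hx : x ⊆ A) (hxne : x.Nonempty)
    {w : Option V → ℝ} (hw : w ∈ realization (tentComplex K A hA)) :
    flatten x w ∈ realization K := by
  obtain ⟨h0, h1, h⟩ := mem_tent_realization hw
  have hb : ∀ v, 0 ≤ barycenter x v := fun v => by
    by_cases hv : v ∈ x
    · exact (barycenter_pos hv).le
    · exact (barycenter_of_notMem hv).ge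
  refine ⟨fun v => add_nonneg (h0 _) (mul_nonneg (h0 _) (hb v)), ?_, ?_⟩
  · simp only [flatten, Pi.add_apply, Pi.smul_apply, smul_eq_mul, Finset.sum_add_distrib,
      ← Finset.mul_sum, sum_barycenter hxne, mul_one]
    linarith
  · rcases h with ⟨σ, hσ, hw⟩ | ⟨hn, σ, hσ, -, hw⟩
    · refine ⟨A, hA.mem, fun v hv => ?_⟩
      simp [flatten, hw v fun h => hv (hσ.subset h), barycenter_of_notMem fun h => hv (hx h)]
    · exact ⟨σ, hσ, fun v hv => by simp [flatten, hw v hv, hn]⟩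

/-- A point of `A` gives the apex as much weight as possible, until a weight on `x` vanishes; the
rest then lies in a proper face of `A`. Other points give it none. -/
theorem exists_flatten_eq {x : Finset V} (hx : x ⊆ A) (hxne : x.Nonempty) {u : V → ℝ}
    (hu : u ∈ realization K) : ∃ w ∈ realization (tentComplex K A hA), flatten x w = u := by
  classical
  obtain ⟨h0, h1, σ, hσ, hs⟩ := hu
  by_cases hA' : ∀ v ∉ A, u v = 0
  · obtain ⟨v₀, hv₀, hmin⟩ := Finset.exists_min_image x u hxne
    have hcard : (x.card : ℝ) ≠ 0 := by exact_mod_cast (Finset.card_pos.2 hxne).ne'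
    obtain ⟨w, hwn, hws⟩ : ∃ w : Option V → ℝ, w none = x.card * u v₀ ∧
        ∀ v, w (some v) = u v - (x.card * u v₀) * barycenter x v :=
      ⟨fun o => o.elim (x.card * u v₀) fun v => u v - (x.card * u v₀) * barycenter x v, rfl,
        fun _ => rfl⟩
    have hmem : ∀ v ∈ x, (x.card * u v₀) * barycenter x v = u v₀ := fun v hv => by
      rw [barycenter_of_mem hv]
      field_simp
    refine ⟨w, tent_realization_mem (fun o => ?_) ?_ (Or.inl ⟨A.erase v₀,
      Finset.erase_ssubset (hx hv₀), fun v hv => ?_⟩), ?_⟩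
    · cases o with
      | none =>
        rw [hwn]
        exact mul_nonneg (Nat.cast_nonneg _) (h0 v₀)
      | some v =>
        rw [hws]
        by_cases hv : v ∈ x
        · rw [hmem v hv]
          exact sub_nonneg.2 (hmin v hv)
        · rw [barycenter_of_notMem hv, mul_zero, sub_zero]
          exact h0 v
    · simp only [hwn, hws, Finset.sum_sub_distrib, ← Finset.mul_sum, sum_barycenter hxne, h1]
      ring
    · rw [hws]
      by_cases hvv : v = v₀
      · rw [hvv, hmem v₀ hv₀, sub_self]
      · have hvA : v ∉ A := fun h => hv (Finset.mem_erase.2 ⟨hvv, h⟩)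
        rw [hA' v hvA, barycenter_of_notMem fun h => hvA (hx h), mul_zero, sub_zero]
    · funext v
      simp only [flatten, Pi.add_apply, Pi.smul_apply, smul_eq_mul, hws, hwn]
      ring
  · refine ⟨fun o => o.elim 0 u, tent_realization_mem (fun o => ?_) (by simpa using h1)
      (Or.inr ⟨rfl, σ, hσ, ?_, hs⟩), ?_⟩
    · cases o with
      | none => exact le_rfl
      | some v => exact h0 v
    · rintro rfl
      exact hA' hs
    · funext v
      simp [flatten]

/-- The apex is placed at the barycentre of all of `A`, not of `x`, since only an interior point of
`A` gives an injective map. The apex weight is recovered as `A.card` times the smallest flattened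
weight on `A`, and the other weights follow. -/
theorem isSubdivision_tentComplex : IsSubdivision (tentComplex K A hA) K := by
  classical
  have hAne := face_nonempty hA.mem
  have hcard : 0 < (A.card : ℝ) := by exact_mod_cast Finset.card_pos.2 hAne
  have e : affExtend (fun o : Option V => o.elim (barycenter A) fun v => Pi.single v (1 : ℝ)) =
      flatten A := by
    funext w
    rw [affExtend_option]
    have : affExtend (fun v => (Pi.single v 1 : V → ℝ)) (fun v => w (some v)) =
        fun v => w (some v) := by
      funext u
      simp [affExtend, Finset.sum_apply, Pi.single_apply]
    simp only [Option.elim_none, Option.elim_some, this, flatten]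
    rw [add_comm]
  refine ⟨fun o => o.elim (barycenter A) fun v => Pi.single v 1, fun s hs => ?_, ?_⟩
  · rcases eq_map_some_or_eq_insertNone s with ⟨σ, rfl⟩ | ⟨σ, rfl⟩
    · rw [map_some_mem_tentComplex] at hs
      refine ⟨σ, hs.1, fun o ho u hu => ?_⟩
      cases o with
      | none => exact absurd ho (none_notMem_map_some σ)
      | some v =>
        have hv := some_mem_map_some.1 ho
        exact Pi.single_eq_of_ne (fun h => hu (by rwa [h])) 1
    · rw [insertNone_mem_tentComplex] at hs
      refine ⟨A, hA.mem, fun o ho u hu => ?_⟩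
      cases o with
      | none => exact barycenter_of_notMem hu
      | some v =>
        have hv := Finset.some_mem_insertNone.1 ho
        exact Pi.single_eq_of_ne (fun h => hu (by rw [h]; exact hs.subset hv)) 1
  · rw [e]
    have hge : ∀ w ∈ realization (tentComplex K A hA), ∀ v ∈ A,
        w none * (A.card : ℝ)⁻¹ ≤ flatten A w v := by
      intro w hw v hv
      simpa [flatten, barycenter_of_mem hv] using hw.1 (some v)
    have heq : ∀ w ∈ realization (tentComplex K A hA), ∃ v ∈ A,
        flatten A w v = w none * (A.card : ℝ)⁻¹ := by
      intro w hw
      obtain ⟨-, -, h⟩ := mem_tent_realization hw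
      have : ∃ v ∈ A, w (some v) = 0 := by
        rcases h with ⟨σ, hσ, hw⟩ | ⟨-, σ, hσ, hσA, hw⟩
        · obtain ⟨v, hv, hvσ⟩ := Finset.exists_of_ssubset hσ
          exact ⟨v, hv, hw v hvσ⟩
        · obtain ⟨v, hv, hvσ⟩ := Finset.not_subset.1 fun h => hσA (hA.maximal σ hσ h)
          exact ⟨v, hv, hw v hvσ⟩
      obtain ⟨v, hv, hv0⟩ := this
      exact ⟨v, hv, by simp [flatten, barycenter_of_mem hv, hv0]⟩
    refine ⟨fun w hw => flatten_mem_realization subset_rfl hAne hw, ?_,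
      fun u hu => exists_flatten_eq subset_rfl hAne hu⟩
    intro w hw w' hw' hww
    have key : ∀ w ∈ realization (tentComplex K A hA), ∀ w' ∈ realization (tentComplex K A hA),
        flatten A w = flatten A w' → w none ≤ w' none := by
      intro w hw w' hw' hww
      obtain ⟨v, hv, h1⟩ := heq w' hw'
      have h2 := hge w hw v hv
      rw [hww, h1] at h2
      exact le_of_mul_le_mul_right h2 (inv_pos.2 hcard)
    have hn : w none = w' none := (key w hw w' hw' hww).antisymm (key w' hw' w hw hww.symm)
    funext o
    cases o with
    | none => exact hn
    | some v =>
      have h1 := congrFun hww v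
      simpa [flatten, hn] using h1

variable {d : ℕ}

/-- The vertices of the tent: the apex is displaced by `n` from the barycentre of `x`. -/
noncomputable def tentMap (f : V → EuclideanSpace ℝ (Fin d)) (x : Finset V)
    (n : EuclideanSpace ℝ (Fin d)) (o : Option V) : EuclideanSpace ℝ (Fin d) :=
  o.elim (affExtend f (barycenter x) + n) f

theorem affExtend_tentMap (f : V → EuclideanSpace ℝ (Fin d)) (x : Finset V)
    (n : EuclideanSpace ℝ (Fin d)) (w : Option V → ℝ) :
    affExtend (tentMap f x n) w = affExtend f (flatten x w) + w none • n := by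
  rw [affExtend_option, flatten, affExtend_add, affExtend_smul]
  simp only [tentMap, Option.elim_none, Option.elim_some, smul_add]
  abel

/-- Each point of the tent is matched with its flattening, at distance `w none * ‖n‖`. Only
surjectivity of the flattening matters, so `x` may be a proper face of `A`. -/
theorem hausdorffDist_tent_le {x : Finset V} (hx : x ⊆ A) (hxne : x.Nonempty)
    (f : V → EuclideanSpace ℝ (Fin d)) (n : EuclideanSpace ℝ (Fin d)) :
    Metric.hausdorffDist (polyhedron (tentComplex K A hA) (tentMap f x n)) (polyhedron K f) ≤
      ‖n‖ := by
  have key : ∀ w ∈ realization (tentComplex K A hA), dist (affExtend (tentMap f x n) w)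
      (affExtend f (flatten x w)) ≤ ‖n‖ := by
    intro w hw
    have h1 : w none ≤ 1 := by
      rw [← hw.2.1]
      exact Finset.single_le_sum (fun o _ => hw.1 o) (Finset.mem_univ none)
    rw [affExtend_tentMap, dist_eq_norm, add_sub_cancel_left, norm_smul, Real.norm_eq_abs,
      abs_of_nonneg (hw.1 none)]
    exact mul_le_of_le_one_left (norm_nonneg n) h1
  refine Metric.hausdorffDist_le_of_mem_dist (norm_nonneg n) ?_ ?_
  · rintro _ ⟨w, hw, rfl⟩
    exact ⟨_, ⟨flatten x w, flatten_mem_realization hx hxne hw, rfl⟩, key w hw⟩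
  · rintro _ ⟨u, hu, rfl⟩
    obtain ⟨w, hw, rfl⟩ := exists_flatten_eq (hA := hA) hx hxne hu
    exact ⟨_, ⟨w, hw, rfl⟩, by rw [dist_comm]; exact key w hw⟩

end Subdivision


/-! ### Embeddedness of the tent -/

/-- In the plane, the cone spanned by the rays of angles `0` and `α < π` meets the ray of angle `φ`,
with `α < φ < 2π`, in the origin only. This is the only place where the tent must fit into the
wedge. -/
theorem cone_eq_zero {X Y Z α φ : ℝ} (hX : 0 ≤ X) (hY : 0 ≤ Y) (hZ : 0 ≤ Z) (h0 : 0 < α)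
    (h1 : α < Real.pi) (h2 : α < φ) (h3 : φ < 2 * Real.pi)
    (hc : X * Real.cos α + Y = Z * Real.cos φ) (hs : X * Real.sin α = Z * Real.sin φ) :
    X = 0 ∧ Y = 0 ∧ Z = 0 := by
  have hsα := Real.sin_pos_of_pos_of_lt_pi h0 h1
  have e : Y * Real.sin α = -(Z * Real.sin (φ - α)) := by
    rw [Real.sin_sub]
    linear_combination Real.sin α * hc - Real.cos α * hs
  have hZ0 : Z = 0 := by
    -- If `φ - α < π`, the ray of angle `φ` is strictly on the other side of the line of angle `α`;
    -- otherwise it lies strictly below the axis of angle `0`.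
    rcases lt_or_ge (φ - α) Real.pi with h4 | h4
    · have h5 := Real.sin_pos_of_pos_of_lt_pi (sub_pos.2 h2) h4
      have h6 := mul_nonneg hY hsα.le
      by_contra hne
      have := mul_pos (hZ.lt_of_ne' hne) h5
      linarith
    · have h5 : 0 < Real.sin (φ - Real.pi) :=
        Real.sin_pos_of_pos_of_lt_pi (by linarith) (by linarith)
      rw [Real.sin_sub_pi] at h5
      have h6 := mul_nonneg hX hsα.le
      by_contra hne
      have := mul_pos (hZ.lt_of_ne' hne) h5
      linarith
  rw [hZ0, zero_mul] at hs e
  rw [neg_zero] at e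
  exact ⟨(mul_eq_zero.1 hs).resolve_right hsα.ne', (mul_eq_zero.1 e).resolve_right hsα.ne', hZ0⟩

section TentCompat

open Finset (insertNone eraseNone)

variable {V : Type*} [Fintype V] {d : ℕ} {K : AbstractSimplicialComplex V}
  {f : V → EuclideanSpace ℝ (Fin d)} {c : ℝ} {x A : Finset V} {n : EuclideanSpace ℝ (Fin d)}

theorem sum_flatten (hxne : x.Nonempty) (δ : Option V → ℝ) : ∑ v, flatten x δ v = ∑ o, δ o := by
  simp only [flatten, Pi.add_apply, Pi.smul_apply, smul_eq_mul, Finset.sum_add_distrib,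
    ← Finset.mul_sum, sum_barycenter hxne, mul_one, Fintype.sum_option]
  ring

theorem flatten_apply_of_notMem {V : Type*} {x : Finset V} {δ : Option V → ℝ} {v : V} (hv : v ∉ x) :
    flatten x δ v = δ (some v) := by
  simp [flatten, barycenter_of_notMem hv]

theorem flatten_apply_of_mem {V : Type*} {x : Finset V} {δ : Option V → ℝ} {v : V} (hv : v ∈ x) :
    flatten x δ v = δ (some v) + δ none * (x.card : ℝ)⁻¹ := by
  simp [flatten, barycenter_of_mem hv]

theorem eq_zero_of_flatten_eq_zero {V : Type*} {x : Finset V} {δ : Option V → ℝ} (h0 : δ none = 0) (h : flatten x δ = 0) :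
    δ = 0 := by
  funext o
  cases o with
  | none => exact h0
  | some v =>
    have := congrFun h v
    simpa [flatten, h0] using this

theorem Compat.tentMap {σ τ : Finset V} (h : Compat f σ τ) (hxne : x.Nonempty) :
    Compat (tentMap f x n) (σ.map Function.Embedding.some) (τ.map Function.Embedding.some) := by
  intro δ h1 h2 h3 h4
  have hn : δ none = 0 :=
    (h2 none (none_notMem_map_some σ)).antisymm (h3 none (none_notMem_map_some τ))
  have hfl : ∀ v, flatten x δ v = δ (some v) := fun v => by simp [flatten, hn]
  rw [affExtend_tentMap, hn, zero_smul, add_zero] at h4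
  refine eq_zero_of_flatten_eq_zero hn (h _ (by rw [sum_flatten hxne, h1]) (fun v hv => ?_)
    (fun v hv => ?_) h4)
  · rw [hfl]
    exact h2 _ (mt some_mem_map_some.1 hv)
  · rw [hfl]
    exact h3 _ (mt some_mem_map_some.1 hv)

/-- Let `v` be a vertex of `x` outside `B`. Flattening puts the share `δ none / x.card` of the apex
on `v` and nothing there cancels it, whereas the flattened weight has an image of norm only `δ none
* ‖n‖`. For a low tent separation forces `δ none = 0`. -/
theorem Separated.compat_tent (hsep : Separated K f c) (hA : A ∈ K) {B : Finset V} (hB : B ∈ K)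
    (hxA : x ⊆ A) (hxB : ¬ x ⊆ B) (hn : ‖n‖ * x.card < c) :
    Compat (tentMap f x n) (insertNone A) (B.map Function.Embedding.some) := by
  obtain ⟨v, hvx, hvB⟩ := Finset.not_subset.1 hxB
  have hxne : x.Nonempty := ⟨v, hvx⟩
  have hcard : 0 < (x.card : ℝ) := by exact_mod_cast Finset.card_pos.2 hxne
  intro δ h1 h2 h3 h4
  have hs : 0 ≤ δ none := h3 none (none_notMem_map_some B)
  have hpos : ∀ v ∉ B, 0 ≤ flatten x δ v := fun v hv =>
    add_nonneg (h3 _ (mt some_mem_map_some.1 hv)) (mul_nonneg hs (by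
      by_cases hv : v ∈ x
      · exact (barycenter_pos hv).le
      · exact (barycenter_of_notMem hv).ge))
  have hneg : ∀ v ∉ A, flatten x δ v ≤ 0 := fun v hv => by
    rw [flatten_apply_of_notMem fun h => hv (hxA h)]
    exact h2 _ (mt Finset.some_mem_insertNone.1 hv)
  rw [affExtend_tentMap] at h4
  have h5 := hsep.2 A hA B hB (flatten x δ) (by rw [sum_flatten hxne, h1]) hneg hpos
  rw [eq_neg_of_add_eq_zero_left h4, norm_neg, norm_smul, Real.norm_eq_abs, abs_of_nonneg hs] at h5
  have h6 : |flatten x δ v| ≤ ∑ u, |flatten x δ u| :=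
    Finset.single_le_sum (f := fun u => |flatten x δ u|) (fun u _ => abs_nonneg _)
      (Finset.mem_univ v)
  have h7 : δ none * (x.card : ℝ)⁻¹ ≤ |flatten x δ v| := by
    rw [flatten_apply_of_mem hvx]
    exact (le_add_of_nonneg_left (h3 _ (mt some_mem_map_some.1 hvB))).trans (le_abs_self _)
  have hs0 : δ none = 0 := by
    by_contra hne
    have hs' := hs.lt_of_ne' hne
    have h8 : c * (δ none * (x.card : ℝ)⁻¹) ≤ δ none * ‖n‖ :=
      (mul_le_mul_of_nonneg_left (h7.trans h6) hsep.1.le).trans h5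
    have h9 : c * (x.card : ℝ)⁻¹ ≤ ‖n‖ := by
      refine le_of_mul_le_mul_left ?_ hs'
      linarith
    rw [← div_eq_mul_inv, div_le_iff₀ hcard] at h9
    exact absurd h9 (not_le.2 hn)
  refine eq_zero_of_flatten_eq_zero (x := x) hs0 ?_
  rw [hs0, zero_mul] at h5
  exact isEmbedded_iff_compat.1 hsep.isEmbedded A hA B hB _ (by rw [sum_flatten hxne, h1]) hneg hpos
    (by rw [hs0, zero_smul, add_zero] at h4; exact h4)

/-- The apex is off the hyperplane of `A`, so together they span a nondegenerate `d`-simplex. -/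
theorem compat_tent_self (hA : Compat f A A) (hxA : x ⊆ A) (hxne : x.Nonempty)
    {e : EuclideanSpace ℝ (Fin d)} (he : ∀ δ ∈ balanced A, inner ℝ (affExtend f δ) e = 0)
    (hne : inner ℝ n e ≠ 0) : Compat (tentMap f x n) (insertNone A) (insertNone A) := by
  intro δ h1 h2 h3 h4
  have hbal : flatten x δ ∈ balanced A := by
    refine ⟨by rw [sum_flatten hxne, h1], fun v hv => ?_⟩
    rw [flatten_apply_of_notMem fun h => hv (hxA h)]
    have hv' : some v ∉ insertNone A := mt Finset.some_mem_insertNone.1 hv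
    exact (h2 _ hv').antisymm (h3 _ hv')
  rw [affExtend_tentMap] at h4
  have hs0 : δ none = 0 := by
    have h5 := congrArg (fun z => (inner ℝ z e : ℝ)) h4
    simp only [inner_add_left, he _ hbal, real_inner_smul_left, inner_zero_left, zero_add] at h5
    exact (mul_eq_zero.1 h5).resolve_right hne
  rw [hs0, zero_smul, add_zero] at h4
  exact eq_zero_of_flatten_eq_zero hs0 (hA.eq_zero_of_balanced hbal h4)

variable [DecidableEq V] {a b : V} {e₁ e₂ : EuclideanSpace ℝ (Fin d)} {φ α h : ℝ}

/-- A weight on `x ∪ {a, b}` splits into a part on `x` and the contributions of `a` and `b`. -/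
theorem HingeFrame.exists_balanced_pair (hf : HingeFrame f x a b e₁ e₂ φ) (ha : a ∉ x)
    (hb : b ∉ x) (hab : a ≠ b) : ∃ r > 0, ∃ r' > 0, ∀ δ : V → ℝ, ∑ v, δ v = 0 →
      (∀ v ∉ x, v ≠ a → v ≠ b → δ v = 0) → ∃ δ' ∈ balanced x,
      affExtend f δ = affExtend f δ' + (δ a * r) • e₁ +
        (δ b * r') • (Real.cos φ • e₁ + Real.sin φ • e₂) ∧ (δ a = 0 → δ b = 0 → δ' = δ) := by
  obtain ⟨l, r, hl1, hls, hr, hfa⟩ := hf.foot_a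
  obtain ⟨m, r', hm1, hms, hr', hfb⟩ := hf.foot_b
  refine ⟨r, hr, r', hr', fun δ hδ hs => ⟨δ - δ a • (Pi.single a 1 - l) - δ b • (Pi.single b 1 - m),
    ⟨?_, fun v hv => ?_⟩, ?_, fun h1 h2 => by simp [h1, h2]⟩⟩
  · simp [Finset.sum_sub_distrib, ← Finset.mul_sum, hδ, hl1, hm1]
  · by_cases hva : v = a
    · subst hva
      simp [hls v hv, hms v hv, hab]
    · by_cases hvb : v = b
      · subst hvb
        simp [hls v hv, hms v hv, hva]
      · simp [hls v hv, hms v hv, hva, hvb, hs v hv hva hvb]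
  · rw [affExtend_sub, affExtend_sub, affExtend_smul, affExtend_smul, affExtend_sub, affExtend_sub,
      affExtend_single, affExtend_single, one_smul, one_smul, hfa, hfb]
    module

/-- In the plane orthogonal to `x` the apex contributes to the ray of angle `α`, the vertex `a` to
that of angle `0` and `b` to that of angle `φ`, with the signs required by `cone_eq_zero`. -/
theorem HingeFrame.compat_tent (hf : HingeFrame f x a b e₁ e₂ φ) (ha : a ∉ x) (hb : b ∉ x)
    (hab : a ≠ b) (hx : Compat f x x) (hxne : x.Nonempty) (hα : 0 < α) (hαπ : α < Real.pi)
    (hαφ : α < φ) (hh : 0 < h) :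
    Compat (tentMap f x (h • (Real.cos α • e₁ + Real.sin α • e₂))) (insertNone (insert a x))
      ((insert b x).map Function.Embedding.some) := by
  obtain ⟨r, hr, r', hr', hsplit⟩ := hf.exists_balanced_pair ha hb hab
  intro δ h1 h2 h3 h4
  have hs : 0 ≤ δ none := h3 none (none_notMem_map_some _)
  have hδa : 0 ≤ δ (some a) := h3 _ (by simp [ha, hab])
  have hδb : δ (some b) ≤ 0 := h2 _ (by simp [hb, hab.symm])
  obtain ⟨δ', hδ', he, hzero⟩ := hsplit (flatten x δ) (by rw [sum_flatten hxne, h1])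
    fun v hv hva hvb => by
      rw [flatten_apply_of_notMem hv]
      exact (h2 _ (by simp [hv, hva])).antisymm (h3 _ (by simp [hv, hvb]))
  rw [flatten_apply_of_notMem ha, flatten_apply_of_notMem hb] at he hzero
  rw [affExtend_tentMap, he] at h4
  have i1 := congrArg (fun z => (inner ℝ z e₁ : ℝ)) h4
  have i2 := congrArg (fun z => (inner ℝ z e₂ : ℝ)) h4
  simp only [inner_add_left, hf.orth₁ δ' hδ', real_inner_smul_left, inner_zero_left,
    hf.inner_self₁, hf.inner₂₁] at i1
  simp only [inner_add_left, hf.orth₂ δ' hδ', real_inner_smul_left, inner_zero_left,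
    hf.inner_self₂, hf.inner₁₂] at i2
  obtain ⟨z1, z2, z3⟩ := cone_eq_zero (X := δ none * h) (Y := δ (some a) * r)
    (Z := -(δ (some b) * r')) (mul_nonneg hs hh.le) (mul_nonneg hδa hr.le)
    (neg_nonneg.2 (mul_nonpos_of_nonpos_of_nonneg hδb hr'.le)) hα hαπ hαφ hf.lt (by linarith)
    (by linarith)
  have hs0 : δ none = 0 := (mul_eq_zero.1 z1).resolve_right hh.ne'
  have hδa0 : δ (some a) = 0 := (mul_eq_zero.1 z2).resolve_right hr.ne'
  have hδb0 : δ (some b) = 0 := (mul_eq_zero.1 (neg_eq_zero.1 z3)).resolve_right hr'.ne'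
  have hfl := hzero hδa0 hδb0
  rw [hs0, hδa0, hδb0, zero_mul, zero_smul, add_zero, zero_mul, zero_smul, add_zero, zero_smul,
    add_zero] at h4
  refine eq_zero_of_flatten_eq_zero (x := x) hs0 ?_
  rw [← hfl]
  exact hx.eq_zero_of_balanced hδ' h4

theorem HingeFrame.inner_apex (hf : HingeFrame f x a b e₁ e₂ φ) :
    inner ℝ (h • (Real.cos α • e₁ + Real.sin α • e₂)) e₂ = h * Real.sin α := by
  rw [real_inner_smul_left, hf.inner_polar₂]

theorem HingeFrame.norm_apex (hf : HingeFrame f x a b e₁ e₂ φ) (hh : 0 < h) :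
    ‖h • (Real.cos α • e₁ + Real.sin α • e₂)‖ = h := by
  rw [norm_smul, hf.norm_polar, mul_one, Real.norm_eq_abs, abs_of_pos hh]

/-- Two faces of the tent complex meet properly, except perhaps a face of the tent and a face
through the ridge `x`. -/
theorem Separated.compat_tentMap (hsep : Separated K f c) (hx : IsRidge d K x a b)
    {hA : IsTentBase K (insert a x)} {e : EuclideanSpace ℝ (Fin d)}
    (he : ∀ δ ∈ balanced (insert a x), inner ℝ (affExtend f δ) e = 0) (hne : inner ℝ n e ≠ 0)
    (hn : ‖n‖ * x.card < c) {s t : Finset (Option V)}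
    (hs : s ∈ tentComplex K (insert a x) hA) (ht : t ∈ tentComplex K (insert a x) hA)
    (hst : none ∈ s → none ∉ t → ¬ x.map Function.Embedding.some ⊆ t)
    (hts : none ∈ t → none ∉ s → ¬ x.map Function.Embedding.some ⊆ s) :
    Compat (FlexPoly.tentMap f x n) s t := by
  have hE := isEmbedded_iff_compat.1 hsep.isEmbedded
  have hxne := face_nonempty hx.mem
  have hxA : x ⊆ insert a x := Finset.subset_insert a x
  rcases eq_map_some_or_eq_insertNone s with ⟨σ, rfl⟩ | ⟨σ, rfl⟩
  · rw [map_some_mem_tentComplex] at hs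
    rcases eq_map_some_or_eq_insertNone t with ⟨τ, rfl⟩ | ⟨τ, rfl⟩
    · rw [map_some_mem_tentComplex] at ht
      exact (hE σ hs.1 τ ht.1).tentMap hxne
    · rw [insertNone_mem_tentComplex] at ht
      have h1 := hts Finset.none_mem_insertNone (none_notMem_map_some σ)
      rw [Finset.map_subset_map] at h1
      exact ((hsep.compat_tent hx.mem_a hs.1 hxA h1 hn).mono
        (insertNone_subset_insertNone.2 ht.subset) subset_rfl).symm
  · rw [insertNone_mem_tentComplex] at hs
    rcases eq_map_some_or_eq_insertNone t with ⟨τ, rfl⟩ | ⟨τ, rfl⟩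
    · rw [map_some_mem_tentComplex] at ht
      have h1 := hst Finset.none_mem_insertNone (none_notMem_map_some τ)
      rw [Finset.map_subset_map] at h1
      exact (hsep.compat_tent hx.mem_a ht.1 hxA h1 hn).mono
        (insertNone_subset_insertNone.2 hs.subset) subset_rfl
    · rw [insertNone_mem_tentComplex] at ht
      exact (compat_tent_self (hE _ hx.mem_a _ hx.mem_a) hxA hxne he hne).mono
        (insertNone_subset_insertNone.2 hs.subset) (insertNone_subset_insertNone.2 ht.subset)

theorem IsRidge.eq_of_subset (hx : IsRidge d K x a b) (hK : IsClosedComplex d K)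
    (hA : IsTentBase K (insert a x)) {τ : Finset V} (hτ : τ ∈ K) (hτA : τ ≠ insert a x)
    (hxτ : x ⊆ τ) : τ ⊆ insert b x := by
  obtain ⟨ρ, hρ, hρd, hτρ⟩ := hK.pure τ hτ
  rcases hx.eq_or_eq ρ hρ hρd (hxτ.trans hτρ) with rfl | rfl
  · have h1 : τ ≠ x → False := by
      intro hne
      obtain ⟨v, hv, hvx⟩ := Finset.not_subset.1 fun h => hne (h.antisymm hxτ)
      have hva : v = a := (Finset.mem_insert.1 (hτρ hv)).resolve_right hvx
      subst hva
      exact hτA (hτρ.antisymm (Finset.insert_subset hv hxτ))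
    by_cases h : τ = x
    · rw [h]
      exact Finset.subset_insert b x
    · exact (h1 h).elim
  · exact hτρ

/-- The tent is embedded if it stays inside the wedge of the hinge. -/
theorem HingeFrame.isEmbedded_tentMap (hf : HingeFrame f x a b e₁ e₂ φ) (hK : IsClosedComplex d K)
    (hsep : Separated K f c) (hx : IsRidge d K x a b) {hA : IsTentBase K (insert a x)}
    (hα : 0 < α) (hαπ : α < Real.pi) (hαφ : α < φ) (hh : 0 < h) (hhc : h * x.card < c) :
    IsEmbedded (tentComplex K (insert a x) hA)
      (FlexPoly.tentMap f x (h • (Real.cos α • e₁ + Real.sin α • e₂))) := by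
  have hE := isEmbedded_iff_compat.1 hsep.isEmbedded
  have hxne := face_nonempty hx.mem
  -- Only a tent face against a face through `x` needs the wedge; for all other pairs low height
  -- suffices.
  have hinge : ∀ s ∈ tentComplex K (insert a x) hA, ∀ t ∈ tentComplex K (insert a x) hA,
      none ∈ s → none ∉ t → x.map Function.Embedding.some ⊆ t →
      Compat (FlexPoly.tentMap f x (h • (Real.cos α • e₁ + Real.sin α • e₂))) s t := by
    intro s hs t ht hns hnt hxt
    rcases eq_map_some_or_eq_insertNone s with ⟨σ, rfl⟩ | ⟨σ, rfl⟩
    · exact absurd hns (none_notMem_map_some σ)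
    · rcases eq_map_some_or_eq_insertNone t with ⟨τ, rfl⟩ | ⟨τ, rfl⟩
      · rw [insertNone_mem_tentComplex] at hs
        rw [map_some_mem_tentComplex] at ht
        rw [Finset.map_subset_map] at hxt
        exact (hf.compat_tent hx.notMem_a hx.notMem_b hx.ne (hE x hx.mem x hx.mem) hxne hα hαπ hαφ
          hh).mono (insertNone_subset_insertNone.2 hs.subset)
          (Finset.map_subset_map.2 (hx.eq_of_subset hK hA ht.1 ht.2 hxt))
      · exact absurd Finset.none_mem_insertNone hnt
  rw [isEmbedded_iff_compat]
  intro s hs t ht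
  by_cases h1 : none ∈ s ∧ none ∉ t ∧ x.map Function.Embedding.some ⊆ t
  · exact hinge s hs t ht h1.1 h1.2.1 h1.2.2
  · by_cases h2 : none ∈ t ∧ none ∉ s ∧ x.map Function.Embedding.some ⊆ s
    · exact (hinge t ht s hs h2.1 h2.2.1 h2.2.2).symm
    · refine hsep.compat_tentMap hx (e := e₂) (fun δ hδ => hf.normal hx.notMem_a hδ) ?_
        (by rwa [hf.norm_apex hh]) hs ht (fun i j k => h1 ⟨i, j, k⟩) fun i j k => h2 ⟨i, j, k⟩
      rw [hf.inner_apex]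
      exact (mul_pos hh (Real.sin_pos_of_pos_of_lt_pi hα hαπ)).ne'

/-- At a ridge other than `x` the two facets of the tent complex meet properly. -/
theorem Separated.compat_tentMap_ridge (hsep : Separated K f c) (hx : IsRidge d K x a b)
    (hK : IsClosedComplex d K)
    {hA : IsTentBase K (insert a x)} {e : EuclideanSpace ℝ (Fin d)}
    (he : ∀ δ ∈ balanced (insert a x), inner ℝ (affExtend f δ) e = 0) (hne : inner ℝ n e ≠ 0)
    (hn : ‖n‖ * x.card < c) {y s t : Finset (Option V)}
    (hs : s ∈ tentComplex K (insert a x) hA) (ht : t ∈ tentComplex K (insert a x) hA)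
    (hys : y ⊆ s) (hyt : y ⊆ t) (hyd : y.card + 1 = d)
    (hyx : y ≠ x.map Function.Embedding.some) :
    Compat (FlexPoly.tentMap f x n) s t := by
  -- A tent face through `y` and a face without apex containing both `x` and `y` lie over `x ∪ {a}`
  -- and `x ∪ {b}`, so `y` would be `x`. Thus no relation between `α` and `φ` is needed, and the
  -- conclusion holds even when the hinge is closed.
  have key : ∀ s ∈ tentComplex K (insert a x) hA, ∀ t ∈ tentComplex K (insert a x) hA,
      y ⊆ s → y ⊆ t → none ∈ s → none ∉ t → ¬ x.map Function.Embedding.some ⊆ t := by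
    intro s hs t ht hys hyt hns hnt hxt
    rcases eq_map_some_or_eq_insertNone s with ⟨σ, rfl⟩ | ⟨σ, rfl⟩
    · exact absurd hns (none_notMem_map_some σ)
    rcases eq_map_some_or_eq_insertNone t with ⟨τ, rfl⟩ | ⟨τ, rfl⟩
    · rw [insertNone_mem_tentComplex] at hs
      rw [map_some_mem_tentComplex] at ht
      rw [Finset.map_subset_map] at hxt
      have hτ := hx.eq_of_subset hK hA ht.1 ht.2 hxt
      rcases eq_map_some_or_eq_insertNone y with ⟨η, rfl⟩ | ⟨η, rfl⟩
      · rw [map_some_subset_insertNone] at hys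
        rw [Finset.map_subset_map] at hyt
        rw [Finset.card_map] at hyd
        refine hyx ?_
        congr 1
        refine Finset.eq_of_subset_of_card_le (fun v hv => ?_) (by have := hx.card; omega)
        rcases Finset.mem_insert.1 (hs.subset (hys hv)) with rfl | h1
        · rcases Finset.mem_insert.1 (hτ (hyt hv)) with h2 | h2
          · exact absurd h2 hx.ne
          · exact h2
        · exact h1
      · exact absurd hyt not_insertNone_subset_map_some
    · exact absurd Finset.none_mem_insertNone hnt
  exact hsep.compat_tentMap hx he hne hn hs ht (key s hs t ht hys hyt) (key t ht s hs hyt hys)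

end TentCompat


/-! ### A tent does not change the inside beyond it -/

section TentSide

open Finset (insertNone eraseNone)

/-- The simplex lies in a half-space `⟪·, ν⟫ < u`, whereas the whole segment from `O` to `q` lies
beyond it. -/
theorem IsConeCoord.not_crosses {V : Type*} [Fintype V] {d : ℕ} {K : AbstractSimplicialComplex V}
    {f : V → EuclideanSpace ℝ (Fin d)} {O q ν : EuclideanSpace ℝ (Fin d)} {u : ℝ}
    {μ : Finset V → EuclideanSpace ℝ (Fin d) →ₗ[ℝ] (V → ℝ)}
    (hμ : IsConeCoord K (fun v => f v - O) μ) {τ : Finset V} (hτ : τ ∈ facets d K)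
    (hτν : ∀ v ∈ τ, inner ℝ (f v) ν < u) (hq : u < inner ℝ q ν)
    (hO : inner ℝ q ν < (inner ℝ O ν : ℝ)) : ¬ Crosses μ τ (q - O) := by
  rintro ⟨hpos, h1⟩
  have h2 := congrArg (fun z => (inner ℝ z ν : ℝ)) (hμ.affExtend_eq τ hτ (q - O))
  rw [affExtend_sub_const] at h2
  rw [affExtend_eq_sum_of_support f (hμ.supp τ hτ (q - O))] at h2
  simp only [inner_sub_left, sum_inner, real_inner_smul_left] at h2
  have h3 : ∑ v ∈ τ, μ τ (q - O) v * inner ℝ (f v) ν ≤ (∑ v, μ τ (q - O) v) * u := by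
    rw [sum_eq_of_support (hμ.supp τ hτ (q - O)), Finset.sum_mul]
    exact Finset.sum_le_sum fun v hv =>
      mul_le_mul_of_nonneg_left (hτν v hv).le (hpos v hv).le
  nlinarith

theorem eq_mul_of_generic {V : Type*} [Fintype V] {d : ℕ} {K : AbstractSimplicialComplex V}
    {f : V → EuclideanSpace ℝ (Fin d)} {O q : EuclideanSpace ℝ (Fin d)}
    {μ : Finset V → EuclideanSpace ℝ (Fin d) →ₗ[ℝ] (V → ℝ)}
    (hμ : IsConeCoord K (fun v => f v - O) μ)
    (h : ∀ i : Finset V × V, (LinearMap.proj i.2).comp (μ i.1) ≠ 0 →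
      (LinearMap.proj i.2).comp (μ i.1) q ≠ (LinearMap.proj i.2).comp (μ i.1) O) :
    Generic K μ (q - O) := by
  classical
  intro τ hτ v hv h0
  refine h (τ, v) (fun h1 => ?_) ?_
  · have := LinearMap.congr_fun h1 (f v - O)
    simp [hμ.apply_vertex hτ hv] at this
  · rw [map_sub, Pi.sub_apply, sub_eq_zero] at h0
    exact h0

variable {V : Type*} [Fintype V] {d : ℕ} {K : AbstractSimplicialComplex V}
  {f : V → EuclideanSpace ℝ (Fin d)} {x A : Finset V} {n : EuclideanSpace ℝ (Fin d)}
  {hA : IsTentBase K A} {χ : EuclideanSpace ℝ (Fin d) → ZMod 2}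
  {χ' : EuclideanSpace ℝ (Fin d) → ZMod 2}

/-- Erecting a tent does not change the inside of a polyhedron beyond a plane that has the tent on
one side. -/
theorem IsInside.eq_tent (hd : 3 ≤ d) (hK : IsClosedComplex d K) (hAd : A.card = d)
    (hemb : IsEmbedded K f)
    (hemb' : IsEmbedded (tentComplex K A hA) (tentMap f x n)) (hχ : IsInside K f χ)
    (hχ' : IsInside (tentComplex K A hA) (tentMap f x n) χ') {q ν : EuclideanSpace ℝ (Fin d)}
    {u : ℝ} (hν : ∀ o ∈ insertNone A, inner ℝ (tentMap f x n o) ν < u) (hq : u < inner ℝ q ν)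
    (hqP : q ∉ polyhedron K f) (hqP' : q ∉ polyhedron (tentComplex K A hA) (tentMap f x n)) :
    χ' q = χ q := by
  classical
  have hK' : IsClosedComplex d (tentComplex K A hA) := hK.tentComplex hd hAd
  set f' := tentMap f x n with hf'
  have hf's : ∀ v, f' (some v) = f v := fun v => rfl
  obtain ⟨R, hR⟩ : ∃ R, ∀ o, ‖f' o‖ ≤ R := by
    obtain ⟨R, hR⟩ := (Set.finite_range fun v => ‖f' v‖).bddAbove
    exact ⟨R, fun v => hR ⟨v, rfl⟩⟩
  obtain ⟨nA, hnA1, hnA⟩ := exists_normal (f := f) (by omega) hAd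
  obtain ⟨v₀, hv₀⟩ := face_nonempty hA.mem
  -- The origin is taken far away and further than `q` in the direction `ν`, so the segment to `q`
  -- meets neither the tent nor its base. Such points lie on the ray from the apex through `q`.
  set U : Set (EuclideanSpace ℝ (Fin d)) := {O | R < ‖O‖ ∧ inner ℝ q ν < (inner ℝ O ν : ℝ)} with hU
  have hνc : Continuous fun O : EuclideanSpace ℝ (Fin d) => (inner ℝ O ν : ℝ) := by fun_prop
  have hUo : IsOpen U := (isOpen_lt continuous_const continuous_norm).inter
    (isOpen_lt continuous_const hνc)
  have hUne : U.Nonempty := by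
    set z := q - f' none with hz
    have hzν : 0 < (inner ℝ z ν : ℝ) := by
      rw [hz, inner_sub_left]
      linarith [hν none Finset.none_mem_insertNone]
    have hz0 : 0 < ‖z‖ := norm_pos_iff.2 fun h => by
      rw [h, inner_zero_left] at hzν
      exact lt_irrefl _ hzν
    obtain ⟨N, hN⟩ := exists_gt (max 0 ((R + ‖q‖) / ‖z‖))
    obtain ⟨hN0, hN1⟩ := max_lt_iff.1 hN
    refine ⟨q + N • z, ?_, ?_⟩
    · rw [div_lt_iff₀ hz0] at hN1
      have h1 := norm_sub_le (q + N • z) q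
      rw [add_sub_cancel_left, norm_smul, Real.norm_eq_abs, abs_of_pos hN0] at h1
      linarith
    · rw [inner_add_left, real_inner_smul_left]
      linarith [mul_pos hN0 hzν]
  -- The hyperplane of `A` has to be avoided separately, because `A` is not a facet of the tent
  -- complex.
  obtain ⟨O, ⟨hOR, hOν⟩, hOi', hOA⟩ := exists_forall_coneIndep (by omega) hemb' (ι := Unit)
    (fun _ => (innerSL ℝ nA : EuclideanSpace ℝ (Fin d) →ₗ[ℝ] ℝ)) (fun _ => inner ℝ nA (f v₀))
    hUo hUne
  have hOi : ∀ B ∈ facets d K, ConeIndep (fun v => f v - O) B := by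
    intro B hB
    obtain ⟨hB, hBd⟩ := mem_facets.1 hB
    by_cases hBA : B = A
    · subst hBA
      refine coneIndep_of_inner_ne (isEmbedded_iff_compat.1 hemb B hB B hB) hv₀ hnA ?_
      have := hOA () fun h => by
        have h2 := LinearMap.congr_fun h nA
        simp [hnA1] at h2
      simp only [ContinuousLinearMap.coe_coe, innerSL_apply_apply] at this
      rw [inner_sub_left, sub_ne_zero, real_inner_comm, real_inner_comm nA]
      exact this.symm
    · intro w hw h0
      have h1 := hOi' (B.map Function.Embedding.some) (mem_facets.2
        ⟨map_some_mem_tentComplex.2 ⟨hB, hBA⟩, by rw [Finset.card_map, hBd]⟩)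
        (fun o => o.elim 0 w) (fun o ho => by
          cases o with
          | none => rfl
          | some v => exact hw v (mt some_mem_map_some.2 ho)) (by
          rw [affExtend_option, Option.elim_none, zero_smul, zero_add]
          exact h0)
      funext v
      exact congrFun h1 (some v)
  obtain ⟨μ, hμ⟩ := exists_isConeCoord (by omega) hOi
  obtain ⟨μ', hμ'⟩ := exists_isConeCoord (by omega) hOi'
  obtain ⟨r, hr, hball⟩ := Metric.isOpen_iff.1 (isClosed_polyhedron K f).isOpen_compl q hqP
  obtain ⟨r', hr', hball'⟩ := Metric.isOpen_iff.1
    (isClosed_polyhedron (tentComplex K A hA) f').isOpen_compl q hqP'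
  obtain ⟨z, ⟨⟨hz, hz'⟩, hzu, hzO⟩, hzg⟩ := exists_mem_forall_apply_ne
    (ι := (Finset V × V) ⊕ (Finset (Option V) × Option V))
    (Sum.elim (fun i => (LinearMap.proj i.2).comp (μ i.1))
      fun i => (LinearMap.proj i.2).comp (μ' i.1))
    (Sum.elim (fun i => (LinearMap.proj i.2).comp (μ i.1) O)
      fun i => (LinearMap.proj i.2).comp (μ' i.1) O)
    (U := (Metric.ball q r ∩ Metric.ball q r') ∩
      {z | u < (inner ℝ z ν : ℝ) ∧ inner ℝ z ν < (inner ℝ O ν : ℝ)})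
    ((Metric.isOpen_ball.inter Metric.isOpen_ball).inter
      ((isOpen_lt continuous_const hνc).inter
        (isOpen_lt hνc continuous_const)))
    ⟨q, ⟨Metric.mem_ball_self hr, Metric.mem_ball_self hr'⟩, hq, hOν⟩
  have hgen : Generic K μ (z - O) := eq_mul_of_generic hμ fun i => hzg (Sum.inl i)
  have hgen' : Generic (tentComplex K A hA) μ' (z - O) :=
    eq_mul_of_generic hμ' fun i => hzg (Sum.inr i)
  obtain ⟨χ₁, hχ₁, h1⟩ := exists_isInside_of_origin (by omega) hK hemb
    (fun v => hR (some v)) hOR hμ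
  obtain ⟨χ₂, hχ₂, h2⟩ := exists_isInside_of_origin (by omega) hK' hemb' hR hOR hμ'
  rw [hχ.eq_of_isPreconnected (Metric.isPreconnected_ball (x := q) (r := r))
      (disjoint_left.2 fun x hx hx' => hball hx hx') (Metric.mem_ball_self hr) hz,
    hχ'.eq_of_isPreconnected (Metric.isPreconnected_ball (x := q) (r := r'))
      (disjoint_left.2 fun x hx hx' => hball' hx hx') (Metric.mem_ball_self hr') hz',
    hχ.unique (by omega) hK hemb hχ₁ (hball hz), hχ'.unique (by omega) hK' hemb' hχ₂ (hball' hz'),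
    h1 z (hball hz) hgen, h2 z (hball' hz') hgen']
  -- The facets common to both complexes have the same coordinates and are crossed alike. Neither
  -- `A` nor the tent facets are crossed, so the counts agree.
  have hcross : ∀ B ∈ (facets d K).erase A,
      (Crosses μ' (B.map Function.Embedding.some) (z - O) ↔ Crosses μ B (z - O)) := by
    intro B hB
    obtain ⟨hBA, hB⟩ := Finset.mem_erase.1 hB
    have hB' : B.map Function.Embedding.some ∈ facets d (tentComplex K A hA) := by
      obtain ⟨hB, hBd⟩ := mem_facets.1 hB
      exact mem_facets.2 ⟨map_some_mem_tentComplex.2 ⟨hB, hBA⟩, by rw [Finset.card_map, hBd]⟩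
    have hs := hμ'.supp _ hB' (z - O)
    have e1 : μ B (z - O) = fun v => μ' (B.map Function.Embedding.some) (z - O) (some v) := by
      have h3 := hμ.unique B hB
        (fun v => μ' (B.map Function.Embedding.some) (z - O) (some v))
        fun v hv => hs _ (mt some_mem_map_some.1 hv)
      have h4 := hμ'.affExtend_eq _ hB' (z - O)
      rw [affExtend_option, hs none (none_notMem_map_some B), zero_smul, zero_add] at h4
      rw [← h3]
      congr 1
      exact h4.symm
    unfold Crosses
    rw [e1, Fintype.sum_option, hs none (none_notMem_map_some B), zero_add]
    simp
  unfold crossings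
  rw [← Finset.sum_erase (facets d K) (a := A) (if_neg (hμ.not_crosses
    (mem_facets.2 ⟨hA.mem, hAd⟩) (fun v hv => hν (some v) (Finset.some_mem_insertNone.2 hv)) hzu
    hzO))]
  rw [← Finset.sum_subset (s₁ := ((facets d K).erase A).image (Finset.map Function.Embedding.some))]
  · rw [Finset.sum_image fun B _ B' _ h => Finset.map_injective _ h]
    refine Finset.sum_congr rfl fun B hB => ?_
    rw [hcross B hB]
  · intro s hs
    obtain ⟨B, hB, rfl⟩ := Finset.mem_image.1 hs
    obtain ⟨hBA, hB⟩ := Finset.mem_erase.1 hB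
    obtain ⟨hB, hBd⟩ := mem_facets.1 hB
    exact mem_facets.2 ⟨map_some_mem_tentComplex.2 ⟨hB, hBA⟩, by rw [Finset.card_map, hBd]⟩
  · intro s hs hs'
    obtain ⟨hst, hsd⟩ := mem_facets.1 hs
    refine if_neg (hμ'.not_crosses hs (fun o ho => hν o ?_) hzu hzO)
    rcases eq_map_some_or_eq_insertNone s with ⟨B, rfl⟩ | ⟨σ, rfl⟩
    · rw [map_some_mem_tentComplex] at hst
      rw [Finset.card_map] at hsd
      exact absurd (Finset.mem_image_of_mem _ (Finset.mem_erase.2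
        ⟨hst.2, mem_facets.2 ⟨hst.1, hsd⟩⟩)) hs'
    · rw [insertNone_mem_tentComplex] at hst
      exact insertNone_subset_insertNone.2 hst.subset ho

end TentSide


/-! ### The hinge after erecting the tent -/

section TentFrame

variable {V : Type*} [Fintype V] {d : ℕ} {K : AbstractSimplicialComplex V}
  {f : V → EuclideanSpace ℝ (Fin d)} {c c' : ℝ} {x : Finset V} {n : EuclideanSpace ℝ (Fin d)}

theorem affExtend_tentMap_elim (w : V → ℝ) :
    affExtend (tentMap f x n) (fun o => o.elim 0 w) = affExtend f w := by
  rw [affExtend_option, Option.elim_none, zero_smul, zero_add]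
  rfl

theorem sum_elim_zero (w : V → ℝ) : ∑ o : Option V, o.elim 0 w = ∑ v, w v := by
  rw [Fintype.sum_option, Option.elim_none, zero_add]
  rfl

theorem elim_zero_eq_zero {V : Type*} {y : Finset V} {w : V → ℝ} (hw : ∀ v ∉ y, w v = 0)
    (o : Option V) (ho : o ∉ y.map Function.Embedding.some) : o.elim 0 w = 0 := by
  cases o with
  | none => rfl
  | some v => exact hw v (mt some_mem_map_some.2 ho)

theorem exists_balanced_of_map_some {y : Finset V} {δ : Option V → ℝ}
    (hδ : δ ∈ balanced (y.map Function.Embedding.some)) :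
    ∃ δ' ∈ balanced y, affExtend (tentMap f x n) δ = affExtend f δ' := by
  have h0 : δ none = 0 := hδ.2 none (none_notMem_map_some y)
  refine ⟨fun v => δ (some v), ⟨?_, fun v hv => hδ.2 _ (mt some_mem_map_some.1 hv)⟩, ?_⟩
  · have := hδ.1
    rwa [Fintype.sum_option, h0, zero_add] at this
  · rw [affExtend_option, h0, zero_smul, zero_add]
    rfl

variable {a b : V} {e₁ e₂ : EuclideanSpace ℝ (Fin d)} {φ α h : ℝ}

/-- The frame is rotated by `α` in the plane orthogonal to `x`: the apex lies on the ray of angle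
`α`, so the first facet moves there while the second one stays. -/
theorem HingeFrame.tentMap (hf : HingeFrame f x a b e₁ e₂ φ) (hxne : x.Nonempty) (hα : 0 < α)
    (hαφ : α < φ) (hh : 0 < h) :
    HingeFrame (tentMap f x (h • (Real.cos α • e₁ + Real.sin α • e₂)))
      (x.map Function.Embedding.some) none (some b) (Real.cos α • e₁ + Real.sin α • e₂)
      (Real.cos α • e₂ - Real.sin α • e₁) (φ - α) where
  norm₁ := hf.norm_polar α
  norm₂ := by
    have := hf.norm_sq_polar (-Real.sin α) (Real.cos α)
    rw [neg_sq, Real.sin_sq_add_cos_sq, neg_smul, neg_add_eq_sub] at this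
    exact (pow_eq_one_iff_of_nonneg (norm_nonneg _) two_ne_zero).1 this
  inner₁₂ := by
    rw [inner_sub_right, real_inner_smul_right, real_inner_smul_right, hf.inner_polar₁,
      hf.inner_polar₂]
    ring
  orth₁ := fun δ hδ => by
    obtain ⟨δ', hδ', he⟩ := exists_balanced_of_map_some hδ
    rw [he, inner_add_right, real_inner_smul_right, real_inner_smul_right, hf.orth₁ δ' hδ',
      hf.orth₂ δ' hδ']
    ring
  orth₂ := fun δ hδ => by
    obtain ⟨δ', hδ', he⟩ := exists_balanced_of_map_some hδ
    rw [he, inner_sub_right, real_inner_smul_right, real_inner_smul_right, hf.orth₁ δ' hδ',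
      hf.orth₂ δ' hδ']
    ring
  pos := by linarith
  lt := by linarith [hf.lt]
  foot_a := ⟨fun o => o.elim 0 (barycenter x), h, by rw [sum_elim_zero, sum_barycenter hxne],
    elim_zero_eq_zero fun v hv => barycenter_of_notMem hv, hh, by
      rw [affExtend_tentMap_elim]
      rfl⟩
  foot_b := by
    obtain ⟨l, r, hl1, hls, hr, hfb⟩ := hf.foot_b
    refine ⟨fun o => o.elim 0 l, r, by rw [sum_elim_zero, hl1], elim_zero_eq_zero hls, hr, ?_⟩
    rw [affExtend_tentMap_elim]
    change f b = _
    have e : Real.cos (φ - α) • (Real.cos α • e₁ + Real.sin α • e₂) +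
        Real.sin (φ - α) • (Real.cos α • e₂ - Real.sin α • e₁) =
        Real.cos (φ - α + α) • e₁ + Real.sin (φ - α + α) • e₂ := by
      rw [Real.cos_add (φ - α) α, Real.sin_add (φ - α) α]
      module
    rw [e, sub_add_cancel, hfb]

/-- The wedge beyond the tent is inside if the original wedge is. -/
theorem HingeFrame.exists_inside_tentMap [DecidableEq V] (hf : HingeFrame f x a b e₁ e₂ φ)
    (hd : 3 ≤ d) (hK : IsClosedComplex d K) (hx : IsRidge d K x a b)
    {hA : IsTentBase K (insert a x)} (hsep : Separated K f c)
    (hsep' : Separated (tentComplex K (insert a x) hA)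
      (FlexPoly.tentMap f x (h • (Real.cos α • e₁ + Real.sin α • e₂))) c') (hα : 0 < α)
    (hαπ : α < Real.pi) (hαφ : α < φ) (hh : 0 < h) {χ χ' : EuclideanSpace ℝ (Fin d) → ZMod 2}
    (hχ : IsInside K f χ) (hχ' : IsInside (tentComplex K (insert a x) hA)
      (FlexPoly.tentMap f x (h • (Real.cos α • e₁ + Real.sin α • e₂))) χ')
    {q₀ : EuclideanSpace ℝ (Fin d)} (hq₀ : q₀ ∈ ridgeTube f x c e₁ e₂ φ) (hq₀1 : χ q₀ = 1) :
    ∃ q ∈ ridgeTube (FlexPoly.tentMap f x (h • (Real.cos α • e₁ + Real.sin α • e₂)))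
      (x.map Function.Embedding.some) c' (Real.cos α • e₁ + Real.sin α • e₂)
      (Real.cos α • e₂ - Real.sin α • e₁) (φ - α), χ' q = 1 := by
  have hxne := face_nonempty hx.mem
  have hcard : 0 < (x.card : ℝ)⁻¹ := by
    rw [inv_pos]
    exact_mod_cast Finset.card_pos.2 hxne
  -- The test point makes the angle `β` with the tent facet at `x`: `β < φ - α` keeps it in the
  -- wedge, and `β < π` puts it strictly above the plane of this facet.
  obtain ⟨β, hβ0, hβ⟩ := exists_between (lt_min (sub_pos.2 hαφ) Real.pi_pos)
  obtain ⟨hβφ, hβπ⟩ := lt_min_iff.1 hβ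
  obtain ⟨ρ, hρ0, hρ⟩ := exists_between (lt_min (mul_pos hsep.1 hcard) (mul_pos hsep'.1 hcard))
  obtain ⟨hρc, hρc'⟩ := lt_min_iff.1 hρ
  have hframe := hf.tentMap hxne hα hαφ hh
  have hridge := hx.tentComplex hA
  have hK' : IsClosedComplex d (tentComplex K (insert a x) hA) := hK.tentComplex hd hx.card_a
  set q := affExtend f (barycenter x) +
    ρ • (Real.cos (α + β) • e₁ + Real.sin (α + β) • e₂) with hq
  have hmem : q ∈ ridgeTube f x c e₁ e₂ φ := ⟨(barycenter x, ρ, α + β),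
    ⟨fun v hv => barycenter_of_notMem hv, sum_barycenter hxne, hρ0,
      fun v hv => by simpa only [barycenter_of_mem hv] using hρc, by dsimp only; linarith,
      by dsimp only; linarith⟩, rfl⟩
  have hmem' : q ∈ ridgeTube (FlexPoly.tentMap f x (h • (Real.cos α • e₁ + Real.sin α • e₂)))
      (x.map Function.Embedding.some) c' (Real.cos α • e₁ + Real.sin α • e₂)
      (Real.cos α • e₂ - Real.sin α • e₁) (φ - α) := by
    refine ⟨(fun o => o.elim 0 (barycenter x), ρ, β),
      ⟨elim_zero_eq_zero fun v hv => barycenter_of_notMem hv,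
        by rw [sum_elim_zero, sum_barycenter hxne], hρ0, fun o ho => ?_, hβ0, hβφ⟩, ?_⟩
    · cases o with
      | none => exact absurd ho (none_notMem_map_some x)
      | some v => simpa only [Option.elim_some, barycenter_of_mem (some_mem_map_some.1 ho)]
          using hρc'
    · dsimp only
      rw [affExtend_tentMap_elim, hq, Real.cos_add, Real.sin_add]
      module
  refine ⟨q, hmem', ?_⟩
  -- The normal of the tent facet at `x`. The apex and `x` are at level `k`, and `a` is below it
  -- because `0 < α < π`; half the height of the test point separates them from it.
  set ν := Real.cos α • e₂ - Real.sin α • e₁ with hν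
  have i1 : inner ℝ e₁ ν = -Real.sin α := by
    rw [hν, inner_sub_right, real_inner_smul_right, real_inner_smul_right, hf.inner_self₁,
      hf.inner₁₂]
    ring
  have i2 : inner ℝ e₂ ν = Real.cos α := by
    rw [hν, inner_sub_right, real_inner_smul_right, real_inner_smul_right, hf.inner_self₂,
      hf.inner₂₁]
    ring
  have ibal : ∀ δ ∈ balanced x, inner ℝ (affExtend f δ) ν = 0 := fun δ hδ => by
    rw [hν, inner_sub_right, real_inner_smul_right, real_inner_smul_right, hf.orth₁ δ hδ,
      hf.orth₂ δ hδ]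
    ring
  set k : ℝ := inner ℝ (affExtend f (barycenter x)) ν with hk
  have iw : ∀ w : V → ℝ, (∀ v ∉ x, w v = 0) → ∑ v, w v = 1 → inner ℝ (affExtend f w) ν = k := by
    intro w hw hw1
    have := ibal (w - barycenter x) (sub_mem_balanced (by rw [hw1, sum_barycenter hxne]) hw
      fun v hv => barycenter_of_notMem hv)
    rwa [affExtend_sub, inner_sub_left, sub_eq_zero] at this
  have iq : inner ℝ q ν = k + ρ * Real.sin β := by
    rw [hq, inner_add_left, real_inner_smul_left, inner_add_left, real_inner_smul_left,
      real_inner_smul_left, i1, i2, ← hk]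
    have : Real.sin β = Real.sin (α + β) * Real.cos α - Real.cos (α + β) * Real.sin α := by
      rw [← Real.sin_sub]
      congr 1
      ring
    rw [this]
    ring
  have hsβ := mul_pos hρ0 (Real.sin_pos_of_pos_of_lt_pi hβ0 hβπ)
  rw [← (hχ.eq_of_isPreconnected (isPreconnected_ridgeTube f x c e₁ e₂ φ)
    (disjoint_ridgeTube hK hsep hx hf) hmem hq₀).trans hq₀1]
  refine IsInside.eq_tent hd hK hx.card_a hsep.isEmbedded hsep'.isEmbedded hχ hχ' (ν := ν)
    (u := k + ρ * Real.sin β / 2) (fun o ho => ?_) (by rw [iq]; linarith)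
    (disjoint_left.1 (disjoint_ridgeTube hK hsep hx hf) hmem)
    (disjoint_left.1 (disjoint_ridgeTube hK' hsep' hridge hframe) hmem')
  cases o with
  | none =>
    change inner ℝ (affExtend f (barycenter x) + h • (Real.cos α • e₁ + Real.sin α • e₂)) ν < _
    rw [inner_add_left, real_inner_smul_left, inner_add_left, real_inner_smul_left,
      real_inner_smul_left, i1, i2, ← hk]
    linarith
  | some v =>
    change inner ℝ (f v) ν < _
    rcases Finset.mem_insert.1 (Finset.some_mem_insertNone.1 ho) with rfl | hv
    · obtain ⟨l, r, hl1, hls, hr, hfa⟩ := hf.foot_a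
      rw [hfa, inner_add_left, real_inner_smul_left, i1, iw l hls hl1]
      have := mul_pos hr (Real.sin_pos_of_pos_of_lt_pi hα hαπ)
      linarith
    · have h1 := iw (Pi.single v 1) (fun u hu => Pi.single_eq_of_ne (fun huv => hu (by rwa [huv])) 1)
        (by simp)
      rw [affExtend_single, one_smul] at h1
      rw [h1]
      linarith

end TentFrame

/-! ### Perpendiculars on a ridge during the motion -/

section Feet

variable {V : Type*} [Fintype V] [DecidableEq V] {d : ℕ} {K : AbstractSimplicialComplex V}
  {y : Finset V} {a b : V}

/-- The two feet differ by a vector parallel to the ridge that is also orthogonal to it. So any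
frame of the hinge uses the same unit vectors. -/
theorem unit_foot_unique {V : Type*} [Fintype V] {y : Finset V} {f : V → EuclideanSpace ℝ (Fin d)} {l l' : V → ℝ} {r r' : ℝ}
    {u u' : EuclideanSpace ℝ (Fin d)} (hl : ∑ v, l v = 1) (hls : ∀ v ∉ y, l v = 0) (hr : 0 < r)
    (hu : ‖u‖ = 1) (ho : ∀ δ ∈ balanced y, inner ℝ (affExtend f δ) u = 0)
    (hl' : ∑ v, l' v = 1) (hls' : ∀ v ∉ y, l' v = 0) (hr' : 0 < r')
    (hu' : ‖u'‖ = 1) (ho' : ∀ δ ∈ balanced y, inner ℝ (affExtend f δ) u' = 0)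
    (h : affExtend f l + r • u = affExtend f l' + r' • u') : u = u' := by
  have hbal : l' - l ∈ balanced y := sub_mem_balanced (by rw [hl, hl']) hls' hls
  have h1 : affExtend f (l' - l) = r • u - r' • u' := by
    rw [affExtend_sub, sub_eq_sub_iff_add_eq_add, add_comm (r • u), h]
  have h2 : inner ℝ (affExtend f (l' - l)) (r • u - r' • u') = 0 := by
    rw [inner_sub_right, real_inner_smul_right, real_inner_smul_right, ho _ hbal, ho' _ hbal]
    ring
  rw [h1] at h2
  have h3 : r • u = r' • u' := sub_eq_zero.1 (inner_self_eq_zero.1 h2)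
  have h4 : r = r' := by
    have := congrArg norm h3
    rwa [norm_smul, norm_smul, hu, hu', mul_one, mul_one, Real.norm_eq_abs, Real.norm_eq_abs,
      abs_of_pos hr, abs_of_pos hr'] at this
  rw [h4] at h3
  exact smul_right_injective _ hr'.ne' h3

/-- The foot of `a` on the ridge `y` moves rigidly with the facet. -/
theorem exists_foot_family {F : ℝ → V → EuclideanSpace ℝ (Fin d)} {I : Set ℝ} {s : ℝ}
    (hF : ∀ v, ContinuousOn (fun t => F t v) I)
    (hdist : ∀ t ∈ I, ∀ i ∈ insert a y, ∀ j ∈ insert a y, dist (F t i) (F t j) =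
      dist (F s i) (F s j))
    (hc : Compat (F s) (insert a y) (insert a y)) (hyne : y.Nonempty) (ha : a ∉ y) :
    ∃ (l : V → ℝ) (r : ℝ) (u : ℝ → EuclideanSpace ℝ (Fin d)), ∑ v, l v = 1 ∧
      (∀ v ∉ y, l v = 0) ∧ 0 < r ∧ (∀ t, F t a = affExtend (F t) l + r • u t) ∧
      ContinuousOn u I ∧ ∀ t ∈ I, ‖u t‖ = 1 ∧
        ∀ δ ∈ balanced y, inner ℝ (affExtend (F t) δ) (u t) = 0 := by
  obtain ⟨l, r, u₀, hl1, hls, hr, hu₀, ho, hfa⟩ := exists_unit_foot hc hyne ha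
  have hbal : (Pi.single a 1 - l : V → ℝ) ∈ balanced (insert a y) := by
    refine ⟨by simp [Finset.sum_sub_distrib, hl1], fun v hv => ?_⟩
    rw [Finset.mem_insert, not_or] at hv
    simp [hv.1, hls v hv.2]
  have hu : ∀ t, F t a - affExtend (F t) l = affExtend (F t) (Pi.single a 1 - l) := fun t => by
    rw [affExtend_sub, affExtend_single, one_smul]
  have hus : affExtend (F s) (Pi.single a 1 - l) = r • u₀ := by
    rw [← hu, hfa, add_sub_cancel_left]
  refine ⟨l, r, fun t => r⁻¹ • (F t a - affExtend (F t) l), hl1, hls, hr, fun t => ?_, ?_,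
    fun t ht => ⟨?_, fun δ hδ => ?_⟩⟩
  · rw [smul_smul, mul_inv_cancel₀ hr.ne', one_smul, add_sub_cancel]
  · have h1 : ContinuousOn (fun _ : ℝ => r⁻¹) I := continuousOn_const
    exact h1.smul
      ((hF a).sub (continuousOn_affExtend (w := fun _ => l) hF fun _ => continuousOn_const))
  -- Length and orthogonality of the perpendicular are inner products of weights in one facet, hence
  -- the same at time `t` as at time `s`.
  · have h1 := inner_affExtend_eq_of_balanced hbal hbal (hdist t ht)
    rw [real_inner_self_eq_norm_sq, real_inner_self_eq_norm_sq, hus, norm_smul, hu₀, mul_one,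
      Real.norm_eq_abs, abs_of_pos hr] at h1
    beta_reduce
    rw [hu, norm_smul, (pow_left_inj₀ (norm_nonneg _) hr.le two_ne_zero).1 h1, norm_inv,
      Real.norm_eq_abs, abs_of_pos hr, inv_mul_cancel₀ hr.ne']
  · have h1 := inner_affExtend_eq_of_balanced (balanced_mono (Finset.subset_insert a y) hδ) hbal
      (hdist t ht)
    beta_reduce
    rw [hu, real_inner_smul_right, h1, hus, real_inner_smul_right, ho δ hδ]
    ring

/-- The angles at a hinge stay away from `0` and `2π` as long as the facets do not touch. -/
theorem exists_cos_le {F : ℝ → V → EuclideanSpace ℝ (Fin d)} {I : Set ℝ} {s : ℝ} (hs : s ∈ I)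
    (hI : IsCompact I) (hF : ∀ v, ContinuousOn (fun t => F t v) I)
    (ha : a ∉ y) (hb : b ∉ y) (hab : a ≠ b) (hyne : y.Nonempty)
    (hdist : ∀ t ∈ I, ∀ i ∈ insert a y, ∀ j ∈ insert a y, dist (F t i) (F t j) =
      dist (F s i) (F s j))
    (hdist' : ∀ t ∈ I, ∀ i ∈ insert b y, ∀ j ∈ insert b y, dist (F t i) (F t j) =
      dist (F s i) (F s j))
    (hca : Compat (F s) (insert a y) (insert a y)) (hcb : Compat (F s) (insert b y) (insert b y))
    (hc : ∀ t ∈ I, Compat (F t) (insert a y) (insert b y)) :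
    ∃ k < 1, ∀ t ∈ I, ∀ e₁ e₂ φ, HingeFrame (F t) y a b e₁ e₂ φ → Real.cos φ ≤ k := by
  obtain ⟨l, r, u, hl1, hls, hr, hfa, hu, huI⟩ := exists_foot_family hF hdist hca hyne ha
  obtain ⟨m, r', u', hm1, hms, hr', hfb, hu', huI'⟩ := exists_foot_family hF hdist' hcb hyne hb
  have hcont : ContinuousOn (fun t => (inner ℝ (u t) (u' t) : ℝ)) I := hu.inner hu'
  -- The cosine of the hinge is the inner product of the two perpendicular unit vectors; its maximum
  -- over the compact set is below `1` because the facets do not overlap at any time.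
  obtain ⟨t₀, ht₀, hmax⟩ := hI.exists_isMaxOn ⟨s, hs⟩ hcont
  refine ⟨inner ℝ (u t₀) (u' t₀), (hc t₀ ht₀).inner_lt_one ha hb hab hl1 hls hr (huI t₀ ht₀).1
    (hfa t₀) hm1 hms hr' (huI' t₀ ht₀).1 (hfb t₀), fun t ht e₁ e₂ φ hf => ?_⟩
  have h1 : u t = e₁ := by
    obtain ⟨l', r'', hl1', hls', hr'', hf'⟩ := hf.foot_a
    exact unit_foot_unique hl1 hls hr (huI t ht).1 (huI t ht).2 hl1' hls' hr'' hf.norm₁ hf.orth₁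
      ((hfa t).symm.trans hf')
  have h2 : u' t = Real.cos φ • e₁ + Real.sin φ • e₂ := by
    obtain ⟨l', r'', hl1', hls', hr'', hf'⟩ := hf.foot_b
    exact unit_foot_unique hm1 hms hr' (huI' t ht).1 (huI' t ht).2 hl1' hls' hr''
      hf.swap.norm₁ hf.swap.orth₁ ((hfb t).symm.trans hf')
  have h3 : Real.cos φ = inner ℝ (u t) (u' t) := by
    rw [h1, h2, real_inner_comm, hf.inner_polar₁]
  rw [h3]
  exact hmax ht

end Feet


/-! ### Hinge flexes and the tent over a moving facet -/

section HingeFlex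

variable {V : Type*} [Fintype V] [DecidableEq V] {d : ℕ} {K : AbstractSimplicialComplex V}
  {F : ℝ → V → EuclideanSpace ℝ (Fin d)} {J : Set ℝ} {x : Finset V} {a b : V}
  {e₁ e₂ : ℝ → EuclideanSpace ℝ (Fin d)} {φ : ℝ → ℝ}

/-- A flex over `[0, 1]` with a ridge `x` at which the interior dihedral angle at the times in `J`,
where the polyhedron is embedded, is `φ`. -/
structure IsHingeFlex (K : AbstractSimplicialComplex V) (F : ℝ → V → EuclideanSpace ℝ (Fin d))
    (J : Set ℝ) (x : Finset V) (a b : V) (e₁ e₂ : ℝ → EuclideanSpace ℝ (Fin d))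
    (φ : ℝ → ℝ) : Prop where
  closed : IsClosedComplex d K
  ridge : IsRidge d K x a b
  cont : ∀ v, ContinuousOn (fun t => F t v) (Icc 0 1)
  dist_eq : ∀ t ∈ Icc (0 : ℝ) 1, ∀ σ ∈ K, ∀ i ∈ σ, ∀ j ∈ σ,
    dist (F t i) (F t j) = dist (F 0 i) (F 0 j)
  not_congr : ∀ t ∈ Icc (0 : ℝ) 1, t ≠ 0 → ¬ Congruent (F t) (F 0)
  cont₁ : ContinuousOn e₁ (Icc 0 1)
  cont₂ : ContinuousOn e₂ (Icc 0 1)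
  cont_angle : ContinuousOn φ (Icc 0 1)
  embedded : ∀ t ∈ J, IsEmbedded K (F t)
  frame : ∀ t ∈ J, HingeFrame (F t) x a b (e₁ t) (e₂ t) (φ t)
  inside : ∀ t ∈ J, ∀ χ, IsInside K (F t) χ → ∃ c, Separated K (F t) c ∧
    ∃ q ∈ ridgeTube (F t) x c (e₁ t) (e₂ t) (φ t), χ q = 1

/-- The projection of the apex to the hyperplane of the facet has fixed weights there, and its
height along `e₂` is the constant `h * sin α`; Pythagoras gives the distance. -/
theorem dist_apex_eq {f g : V → EuclideanSpace ℝ (Fin d)} {e₁ e₂ e₁' e₂' : EuclideanSpace ℝ (Fin d)}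
    {φ φ' h α : ℝ} (hf : HingeFrame f x a b e₁ e₂ φ) (hg : HingeFrame g x a b e₁' e₂' φ')
    (hxne : x.Nonempty) (ha : a ∉ x)
    (hc : Compat f (insert a x) (insert a x))
    (hdist : ∀ i ∈ insert a x, ∀ j ∈ insert a x, dist (g i) (g j) = dist (f i) (f j)) {v : V}
    (hv : v ∈ insert a x) :
    dist (affExtend g (barycenter x) + h • (Real.cos α • e₁' + Real.sin α • e₂')) (g v) =
      dist (affExtend f (barycenter x) + h • (Real.cos α • e₁ + Real.sin α • e₂)) (f v) := by
  -- The two positions are regarded as a motion over the times `0` and `1`, so that they share the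
  -- weights `l` and the length `r`.
  obtain ⟨l, r, u, hl1, hls, hr, hfa, -, hu⟩ := exists_foot_family
    (F := fun t : ℝ => if t = 0 then f else g) (I := {0, 1}) (s := 0)
    (fun v => (Set.toFinite _).continuousOn _) (by
      rintro t (rfl | rfl)
      · simp
      · simpa using hdist) (by simpa using hc) hxne ha
  have hfu : u 0 = e₁ := by
    obtain ⟨l', r', hl1', hls', hr', hf'⟩ := hf.foot_a
    have h0 := hu 0 (by simp)
    have h1 := hfa 0
    simp only [if_true] at h0 h1
    exact unit_foot_unique hl1 hls hr h0.1 h0.2 hl1' hls' hr' hf.norm₁ hf.orth₁ (h1.symm.trans hf')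
  have hgu : u 1 = e₁' := by
    obtain ⟨l', r', hl1', hls', hr', hf'⟩ := hg.foot_a
    have h0 := hu 1 (by simp)
    have h1 := hfa 1
    simp only [one_ne_zero, if_false] at h0 h1
    exact unit_foot_unique hl1 hls hr h0.1 h0.2 hl1' hls' hr' hg.norm₁ hg.orth₁ (h1.symm.trans hf')
  have hfa0 := hfa 0
  have hfa1 := hfa 1
  simp only [if_true, one_ne_zero, if_false, hfu, hgu] at hfa0 hfa1
  set δ : V → ℝ := barycenter x + (h * Real.cos α * r⁻¹) • (Pi.single a 1 - l) - Pi.single v 1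
    with hδ
  have hbal : δ ∈ balanced (insert a x) := by
    refine ⟨by simp [hδ, Finset.sum_add_distrib, Finset.sum_sub_distrib, ← Finset.mul_sum,
      sum_barycenter hxne, hl1], fun w hw => ?_⟩
    have hwv : w ≠ v := fun h => hw (h ▸ hv)
    rw [Finset.mem_insert, not_or] at hw
    simp [hδ, barycenter_of_notMem hw.2, hw.1, hls w hw.2, hwv]
  have key : ∀ (f : V → EuclideanSpace ℝ (Fin d)) (e₁ e₂ : EuclideanSpace ℝ (Fin d)) (φ : ℝ),
      HingeFrame f x a b e₁ e₂ φ → f a = affExtend f l + r • e₁ →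
      dist (affExtend f (barycenter x) + h • (Real.cos α • e₁ + Real.sin α • e₂)) (f v) ^ 2 =
        inner ℝ (affExtend f δ) (affExtend f δ) + (h * Real.sin α) ^ 2 := by
    intro f e₁ e₂ φ hf hfa
    have e : affExtend f (barycenter x) + h • (Real.cos α • e₁ + Real.sin α • e₂) - f v =
        affExtend f δ + (h * Real.sin α) • e₂ := by
      rw [hδ, affExtend_sub, affExtend_add, affExtend_smul, affExtend_sub, affExtend_single,
        affExtend_single, one_smul, one_smul, hfa, add_sub_cancel_left, smul_smul, mul_assoc,
        inv_mul_cancel₀ hr.ne', mul_one]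
      module
    rw [dist_eq_norm, e, norm_add_sq_real, real_inner_smul_right, hf.normal ha hbal, norm_smul,
      hf.norm₂, real_inner_self_eq_norm_sq, mul_one, Real.norm_eq_abs, sq_abs]
    ring
  refine (pow_left_inj₀ dist_nonneg dist_nonneg two_ne_zero).1 ?_
  rw [key g e₁' e₂' φ' hg hfa1, key f e₁ e₂ φ hf hfa0,
    inner_affExtend_eq_of_balanced hbal hbal hdist]

/-- Erecting a flexible tent on a facet at the hinge. -/
theorem IsHingeFlex.exists_tent (H : IsHingeFlex K F (Icc 0 1) x a b e₁ e₂ φ) (hd : 3 ≤ d)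
    {α : ℝ} (hα : 0 < α) (hαπ : α < Real.pi) (hJ : J ⊆ Icc 0 1) (hαφ : ∀ t ∈ J, α < φ t)
    (hA : IsTentBase K (insert a x)) {ε : ℝ} (hε : 0 < ε) :
    ∃ h, 0 < h ∧ h < ε ∧
      IsHingeFlex (tentComplex K (insert a x) hA)
        (fun t => tentMap (F t) x (h • (Real.cos α • e₁ t + Real.sin α • e₂ t))) J
        (x.map Function.Embedding.some) none (some b)
        (fun t => Real.cos α • e₁ t + Real.sin α • e₂ t)
        (fun t => Real.cos α • e₂ t - Real.sin α • e₁ t) (fun t => φ t - α) ∧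
      ∀ t ∈ Icc (0 : ℝ) 1, ∀ y s s', y.card + 1 = d → y ≠ x.map Function.Embedding.some →
        s ∈ tentComplex K (insert a x) hA → s' ∈ tentComplex K (insert a x) hA → y ⊆ s → y ⊆ s' →
        Compat (tentMap (F t) x (h • (Real.cos α • e₁ t + Real.sin α • e₂ t))) s s' := by
  have hxne := face_nonempty H.ridge.mem
  have hcard : 0 < (x.card : ℝ) := by exact_mod_cast Finset.card_pos.2 hxne
  obtain ⟨c, hc, hsep⟩ := exists_separated_of_compact isCompact_Icc H.cont H.embedded
  -- The separation constant is uniform in time, so one height makes the tent low enough throughout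
  -- the motion.
  obtain ⟨h, hh, hh'⟩ := exists_between (lt_min hε (div_pos hc hcard))
  obtain ⟨hhε, hhc⟩ := lt_min_iff.1 hh'
  rw [lt_div_iff₀ hcard] at hhc
  have hemb : ∀ t ∈ J, IsEmbedded (tentComplex K (insert a x) hA)
      (tentMap (F t) x (h • (Real.cos α • e₁ t + Real.sin α • e₂ t))) := fun t ht =>
    (H.frame t (hJ ht)).isEmbedded_tentMap H.closed (hsep t (hJ ht)) H.ridge hα hαπ (hαφ t ht) hh hhc
  refine ⟨h, hh, hhε, ⟨H.closed.tentComplex hd H.ridge.card_a, H.ridge.tentComplex hA, ?_, ?_, ?_,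
    ?_, ?_, H.cont_angle.sub continuousOn_const, hemb, fun t ht =>
      (H.frame t (hJ ht)).tentMap hxne hα (hαφ t ht) hh, ?_⟩, ?_⟩
  · have h1 : ContinuousOn (fun _ : ℝ => h) (Icc 0 1) := continuousOn_const
    have h2 : ContinuousOn (fun _ : ℝ => Real.cos α) (Icc 0 1) := continuousOn_const
    have h3 : ContinuousOn (fun _ : ℝ => Real.sin α) (Icc 0 1) := continuousOn_const
    intro o
    cases o with
    | none =>
      exact (continuousOn_affExtend (w := fun _ => barycenter x) H.cont
        fun _ => continuousOn_const).add (h1.smul ((h2.smul H.cont₁).add (h3.smul H.cont₂)))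
    | some v => exact H.cont v
  · have h0 : (0 : ℝ) ∈ Icc (0 : ℝ) 1 := by simp
    have hapex : ∀ t ∈ Icc (0 : ℝ) 1, ∀ v ∈ insert a x,
        dist (tentMap (F t) x (h • (Real.cos α • e₁ t + Real.sin α • e₂ t)) none) (F t v) =
        dist (tentMap (F 0) x (h • (Real.cos α • e₁ 0 + Real.sin α • e₂ 0)) none) (F 0 v) :=
      fun t ht v hv => dist_apex_eq (H.frame 0 h0) (H.frame t ht) hxne H.ridge.notMem_a
        (isEmbedded_iff_compat.1 (H.embedded 0 h0) _ H.ridge.mem_a _ H.ridge.mem_a)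
        (H.dist_eq t ht _ H.ridge.mem_a) hv
    intro t ht s hs i hi j hj
    rcases eq_map_some_or_eq_insertNone s with ⟨σ, rfl⟩ | ⟨σ, rfl⟩
    · rw [map_some_mem_tentComplex] at hs
      cases i with
      | none => exact absurd hi (none_notMem_map_some σ)
      | some i =>
        cases j with
        | none => exact absurd hj (none_notMem_map_some σ)
        | some j =>
          exact H.dist_eq t ht σ hs.1 i (some_mem_map_some.1 hi) j (some_mem_map_some.1 hj)
    · rw [insertNone_mem_tentComplex] at hs
      have hmem : ∀ v, some v ∈ Finset.insertNone σ → v ∈ insert a x := fun v hv =>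
        hs.subset (Finset.some_mem_insertNone.1 hv)
      cases i with
      | none =>
        cases j with
        | none => rw [dist_self, dist_self]
        | some j => exact hapex t ht j (hmem j hj)
      | some i =>
        cases j with
        | none =>
          rw [dist_comm, dist_comm (tentMap (F 0) _ _ (some i))]
          exact hapex t ht i (hmem i hi)
        | some j => exact H.dist_eq t ht _ H.ridge.mem_a i (hmem i hi) j (hmem j hj)
  · exact fun t ht ht0 hcon => H.not_congr t ht ht0 fun i j => hcon (some i) (some j)
  · have h2 : ContinuousOn (fun _ : ℝ => Real.cos α) (Icc 0 1) := continuousOn_const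
    have h3 : ContinuousOn (fun _ : ℝ => Real.sin α) (Icc 0 1) := continuousOn_const
    exact (h2.smul H.cont₁).add (h3.smul H.cont₂)
  · have h2 : ContinuousOn (fun _ : ℝ => Real.cos α) (Icc 0 1) := continuousOn_const
    have h3 : ContinuousOn (fun _ : ℝ => Real.sin α) (Icc 0 1) := continuousOn_const
    exact (h2.smul H.cont₂).sub (h3.smul H.cont₁)
  · intro t ht χ' hχ'
    obtain ⟨c', hsep'⟩ := exists_separated (hemb t ht)
    obtain ⟨χ, hχ⟩ := exists_isInside (by omega) H.closed (H.embedded t (hJ ht))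
    obtain ⟨c₀, hsep₀, q₀, hq₀, hq₀1⟩ := H.inside t (hJ ht) χ hχ
    exact ⟨c', hsep', (H.frame t (hJ ht)).exists_inside_tentMap hd H.closed H.ridge hsep₀ hsep' hα
      hαπ (hαφ t ht) hh hχ hχ' hq₀ hq₀1⟩
  -- Away from `x` the angle plays no part, so this holds on all of `[0, 1]` and not only on `J`.
  · intro t ht y s s' hyd hyx hs hs' hys hys'
    have hf := H.frame t ht
    refine (hsep t ht).compat_tentMap_ridge H.ridge H.closed (e := e₂ t)
      (fun δ hδ => hf.normal H.ridge.notMem_a hδ) ?_ (by rwa [hf.norm_apex hh]) hs hs' hys hys' hyd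
      hyx
    rw [hf.inner_apex]
    exact (mul_pos hh (Real.sin_pos_of_pos_of_lt_pi hα hαπ)).ne'

end HingeFlex


/-! ### Reparametrisation between two levels -/

section Path

/-- A continuous function taking values below `A` and above `B` rises from `A` to `B` along a
segment, staying strictly between them. -/
theorem exists_rising_path {g : ℝ → ℝ} {I : Set ℝ} (hI : Convex ℝ I) (hg : ContinuousOn g I)
    {p q A B : ℝ} (hp : p ∈ I) (hq : q ∈ I) (hpA : g p < A) (hAB : A < B) (hBq : B < g q) :
    ∃ T : ℝ → ℝ, Continuous T ∧ MapsTo T (Icc 0 1) I ∧ g (T 0) = A ∧ g (T 1) = B ∧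
      ∀ s ∈ Ioo (0 : ℝ) 1, A < g (T s) ∧ g (T s) < B := by
  have hseg : ∀ s ∈ Icc (0 : ℝ) 1, p + s * (q - p) ∈ I := fun s hs => by
    have := hI hp hq (sub_nonneg.2 hs.2) hs.1 (by ring)
    simp only [smul_eq_mul] at this
    convert this using 1
    ring
  obtain ⟨h, hh⟩ : ∃ h : ℝ → ℝ, h = fun s => g (p + s * (q - p)) := ⟨_, rfl⟩
  have hc : ContinuousOn h (Icc 0 1) := by
    rw [hh]
    exact hg.comp (Continuous.continuousOn (by fun_prop)) hseg
  have h0 : h 0 < A := by simpa [hh] using hpA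
  have h1 : B < h 1 := by simpa [hh] using hBq
  -- `s₀` is the last parameter with a value at most `A`, and `s₁` the first one after it with a
  -- value at least `B`. In between the values are strictly between the two levels.
  obtain ⟨s₀, ⟨hs₀, hs₀A⟩, hmax⟩ := (isCompact_Icc.of_isClosed_subset
    (hc.preimage_isClosed_of_isClosed isClosed_Icc (isClosed_Iic (a := A)))
    inter_subset_left).exists_isGreatest ⟨0, by simp, h0.le⟩
  have hA : h s₀ = A := by
    obtain ⟨s, hs, hsA⟩ := intermediate_value_Icc hs₀.2 (hc.mono (Icc_subset_Icc hs₀.1 le_rfl))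
      ⟨hs₀A, (hAB.trans h1).le⟩
    have : s ≤ s₀ := hmax ⟨⟨hs₀.1.trans hs.1, hs.2⟩, hsA.le⟩
    rwa [le_antisymm this hs.1] at hsA
  have hc' : ContinuousOn h (Icc s₀ 1) := hc.mono (Icc_subset_Icc hs₀.1 le_rfl)
  obtain ⟨s₁, ⟨hs₁, hs₁B⟩, hmin⟩ := (isCompact_Icc.of_isClosed_subset
    (hc'.preimage_isClosed_of_isClosed isClosed_Icc (isClosed_Ici (a := B)))
    inter_subset_left).exists_isLeast ⟨1, ⟨hs₀.2, le_rfl⟩, h1.le⟩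
  have hB : h s₁ = B := by
    obtain ⟨s, hs, hsB⟩ := intermediate_value_Icc hs₁.1 (hc'.mono (Icc_subset_Icc le_rfl hs₁.2))
      ⟨(hA.trans_lt hAB).le, hs₁B⟩
    have : s₁ ≤ s := hmin ⟨⟨hs.1, hs.2.trans hs₁.2⟩, hsB.ge⟩
    rwa [le_antisymm hs.2 this] at hsB
  have hlt : s₀ < s₁ := lt_of_le_of_ne hs₁.1 fun he => hAB.ne (by rw [← hA, ← hB, he])
  have hT : ∀ s ∈ Icc (0 : ℝ) 1, s₀ + s * (s₁ - s₀) ∈ Icc s₀ s₁ := fun s hs =>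
    ⟨by nlinarith [hs.1], by nlinarith [hs.2]⟩
  have hgT : ∀ s, g (p + (s₀ + s * (s₁ - s₀)) * (q - p)) = h (s₀ + s * (s₁ - s₀)) := fun s => by
    rw [hh]
  refine ⟨fun s => p + (s₀ + s * (s₁ - s₀)) * (q - p), by fun_prop,
    fun s hs => hseg _ ⟨hs₀.1.trans (hT s hs).1, (hT s hs).2.trans hs₁.2⟩, ?_, ?_, fun s hs => ?_⟩
  · rw [hgT, ← hA]
    ring_nf
  · rw [hgT, ← hB]
    ring_nf
  · beta_reduce
    rw [hgT]
    have hpos := mul_pos hs.1 (sub_pos.2 hlt)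
    have hpos' := mul_pos (sub_pos.2 hs.2) (sub_pos.2 hlt)
    constructor
    · by_contra hcon
      have := hmax ⟨⟨by linarith [hs₀.1], by linarith [hs₁.2]⟩, not_lt.1 hcon⟩
      linarith
    · by_contra hcon
      have := hmin ⟨⟨by linarith, by linarith [hs₁.2]⟩, not_lt.1 hcon⟩
      linarith

end Path

/-! ### Hinge frames along a motion and the side of the interior -/

section Start

variable {V : Type*} [Fintype V] {d : ℕ} {K : AbstractSimplicialComplex V}
  {x : Finset V} {a b : V}

theorem Separated.perturb {f f' : V → EuclideanSpace ℝ (Fin d)} {c r : ℝ} (h : Separated K f c)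
    (hr : r < c) (hf : ∀ v, ‖f' v - f v‖ ≤ r) : Separated K f' (c - r) := by
  refine ⟨sub_pos.2 hr, fun σ hσ τ hτ δ h0 h1 h2 => ?_⟩
  have h3 := h.2 σ hσ τ hτ δ h0 h1 h2
  have h4 := norm_affExtend_sub_le hf δ
  have h5 := norm_sub_norm_le (affExtend f δ) (affExtend f' δ)
  rw [norm_sub_rev] at h5
  linarith

/-- Gram-Schmidt by an explicit formula, which depends continuously on `u`, `u'` and `κ` as long as
`κ` stays inside `(-1, 1)`. -/
theorem hingeFrame_of_inner {f : V → EuclideanSpace ℝ (Fin d)} {u u' : EuclideanSpace ℝ (Fin d)}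
    {l l' : V → ℝ} {r r' κ : ℝ} (hl : ∑ v, l v = 1) (hls : ∀ v ∉ x, l v = 0) (hr : 0 < r)
    (hfa : f a = affExtend f l + r • u) (hu : ‖u‖ = 1)
    (ho : ∀ δ ∈ balanced x, inner ℝ (affExtend f δ) u = 0)
    (hl' : ∑ v, l' v = 1) (hls' : ∀ v ∉ x, l' v = 0) (hr' : 0 < r')
    (hfb : f b = affExtend f l' + r' • u') (hu' : ‖u'‖ = 1)
    (ho' : ∀ δ ∈ balanced x, inner ℝ (affExtend f δ) u' = 0)
    (hκ : inner ℝ u u' = κ) (h1 : -1 < κ) (h2 : κ < 1) :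
    HingeFrame f x a b u ((√(1 - κ ^ 2))⁻¹ • (u' - κ • u)) (Real.arccos κ) := by
  have hpos : 0 < 1 - κ ^ 2 := by nlinarith
  have hs : 0 < √(1 - κ ^ 2) := Real.sqrt_pos.2 hpos
  have huu : inner ℝ u u = (1 : ℝ) := by rw [real_inner_self_eq_norm_sq, hu, one_pow]
  have huu' : inner ℝ u' u' = (1 : ℝ) := by rw [real_inner_self_eq_norm_sq, hu', one_pow]
  have hn : ‖u' - κ • u‖ = √(1 - κ ^ 2) := by
    refine (pow_left_inj₀ (norm_nonneg _) hs.le two_ne_zero).1 ?_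
    rw [Real.sq_sqrt hpos.le, ← real_inner_self_eq_norm_sq, inner_sub_left, inner_sub_right,
      inner_sub_right, real_inner_smul_left, real_inner_smul_right, real_inner_smul_left,
      real_inner_smul_right, huu, huu', real_inner_comm, hκ]
    ring
  refine ⟨hu, ?_, ?_, ho, fun δ hδ => ?_, Real.arccos_pos.2 h2, ?_, ⟨l, r, hl, hls, hr, hfa⟩,
    ⟨l', r', hl', hls', hr', ?_⟩⟩
  · rw [norm_smul, hn, norm_inv, Real.norm_eq_abs, abs_of_pos hs, inv_mul_cancel₀ hs.ne']
  · rw [real_inner_smul_right, inner_sub_right, real_inner_smul_right, huu, hκ]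
    ring
  · rw [real_inner_smul_right, inner_sub_right, real_inner_smul_right, ho δ hδ, ho' δ hδ]
    ring
  · have := Real.arccos_le_pi κ
    linarith [Real.pi_pos]
  · rw [hfb, Real.cos_arccos h1.le h2.le, Real.sin_arccos, smul_smul, mul_inv_cancel₀ hs.ne',
      one_smul, add_sub_cancel]

/-- The law of cosines at the hinge: the distance of `a` and `b` changes exactly when the cosine of
the angle does. -/
theorem dist_sq_of_feet {F : ℝ → V → EuclideanSpace ℝ (Fin d)} {I : Set ℝ} {s : ℝ}
    {u u' : ℝ → EuclideanSpace ℝ (Fin d)} {l l' : V → ℝ} {r r' : ℝ} (hl : ∑ v, l v = 1)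
    (hls : ∀ v ∉ x, l v = 0) (hl' : ∑ v, l' v = 1) (hls' : ∀ v ∉ x, l' v = 0)
    (hfa : ∀ t, F t a = affExtend (F t) l + r • u t)
    (hfb : ∀ t, F t b = affExtend (F t) l' + r' • u' t)
    (hu : ∀ t ∈ I, ‖u t‖ = 1 ∧ ∀ δ ∈ balanced x, inner ℝ (affExtend (F t) δ) (u t) = 0)
    (hu' : ∀ t ∈ I, ‖u' t‖ = 1 ∧ ∀ δ ∈ balanced x, inner ℝ (affExtend (F t) δ) (u' t) = 0)
    (hdist : ∀ t ∈ I, ∀ i ∈ x, ∀ j ∈ x, dist (F t i) (F t j) = dist (F s i) (F s j)) {t : ℝ}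
    (ht : t ∈ I) :
    dist (F t a) (F t b) ^ 2 = inner ℝ (affExtend (F s) (l - l')) (affExtend (F s) (l - l')) +
      r ^ 2 + r' ^ 2 - 2 * r * r' * inner ℝ (u t) (u' t) := by
  have hbal : l - l' ∈ balanced x := sub_mem_balanced (by rw [hl, hl']) hls hls'
  have e : F t a - F t b = affExtend (F t) (l - l') + (r • u t - r' • u' t) := by
    rw [hfa, hfb, affExtend_sub]
    abel
  have i1 : inner ℝ (u t) (u t) = (1 : ℝ) := by
    rw [real_inner_self_eq_norm_sq, (hu t ht).1, one_pow]
  have i2 : inner ℝ (u' t) (u' t) = (1 : ℝ) := by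
    rw [real_inner_self_eq_norm_sq, (hu' t ht).1, one_pow]
  have i3 : inner ℝ (affExtend (F t) (l - l')) (r • u t - r' • u' t) = 0 := by
    rw [inner_sub_right, real_inner_smul_right, real_inner_smul_right, (hu t ht).2 _ hbal,
      (hu' t ht).2 _ hbal]
    ring
  rw [dist_eq_norm, e, norm_add_sq_real, i3, ← real_inner_self_eq_norm_sq,
    ← real_inner_self_eq_norm_sq, inner_affExtend_eq_of_balanced hbal hbal (hdist t ht),
    inner_sub_left, inner_sub_right, inner_sub_right, real_inner_smul_left, real_inner_smul_left,
    real_inner_smul_left, real_inner_smul_left, real_inner_smul_right, real_inner_smul_right,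
    real_inner_smul_right, real_inner_smul_right, i1, i2, real_inner_comm (u t) (u' t)]
  ring

variable [DecidableEq V]

/-- The interior of an embedded polyhedron stays on the same side of a hinge during a motion. -/
theorem inside_or_inside_flip {F : ℝ → V → EuclideanSpace ℝ (Fin d)} {S : Set ℝ}
    {e₁ e₂ : ℝ → EuclideanSpace ℝ (Fin d)} {φ : ℝ → ℝ} (hd : 2 ≤ d) (hK : IsClosedComplex d K)
    (hx : IsRidge d K x a b) (hS : IsCompact S) (hSp : IsPreconnected S)
    (hF : ∀ v, ContinuousOn (fun t => F t v) S) (hemb : ∀ t ∈ S, IsEmbedded K (F t))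
    (he₁ : ContinuousOn e₁ S) (he₂ : ContinuousOn e₂ S) (hφ : ContinuousOn φ S)
    (hframe : ∀ t ∈ S, HingeFrame (F t) x a b (e₁ t) (e₂ t) (φ t)) :
    (∀ t ∈ S, ∀ χ, IsInside K (F t) χ → ∃ c, Separated K (F t) c ∧
      ∃ q ∈ ridgeTube (F t) x c (e₁ t) (e₂ t) (φ t), χ q = 1) ∨
    (∀ t ∈ S, ∀ χ, IsInside K (F t) χ → ∃ c, Separated K (F t) c ∧
      ∃ q ∈ ridgeTube (F t) x c (e₁ t) (-e₂ t) (2 * Real.pi - φ t), χ q = 1) := by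
  have hxne := face_nonempty hx.mem
  have hcard : 0 < (x.card : ℝ)⁻¹ := by
    rw [inv_pos]
    exact_mod_cast Finset.card_pos.2 hxne
  obtain ⟨c, hc, hsep⟩ := exists_separated_of_compact hS hF hemb
  obtain ⟨ρ, hρ, hρc⟩ := exists_between (mul_pos hc hcard)
  -- A point on the bisector of the wedge. It moves continuously off the polyhedron, so it is inside
  -- either always or never.
  obtain ⟨q, hq⟩ : ∃ q : ℝ → EuclideanSpace ℝ (Fin d), q = fun t =>
    affExtend (F t) (barycenter x) +
      ρ • (Real.cos (φ t / 2) • e₁ t + Real.sin (φ t / 2) • e₂ t) := ⟨_, rfl⟩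
  have hqmem : ∀ t ∈ S, q t ∈ ridgeTube (F t) x c (e₁ t) (e₂ t) (φ t) := fun t ht => by
    have := (hframe t ht).pos
    rw [hq]
    exact ⟨(barycenter x, ρ, φ t / 2), ⟨fun v hv => barycenter_of_notMem hv, sum_barycenter hxne,
      hρ, fun v hv => by simpa only [barycenter_of_mem hv] using hρc, by dsimp only; linarith,
      by dsimp only; linarith⟩, rfl⟩
  have hqc : ContinuousOn q S := by
    have h1 : ContinuousOn (fun _ : ℝ => ρ) S := continuousOn_const
    have h2 : ContinuousOn (fun t => Real.cos (φ t / 2)) S :=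
      Real.continuous_cos.comp_continuousOn (hφ.div_const 2)
    have h3 : ContinuousOn (fun t => Real.sin (φ t / 2)) S :=
      Real.continuous_sin.comp_continuousOn (hφ.div_const 2)
    rw [hq]
    exact (continuousOn_affExtend (w := fun _ => barycenter x) hF fun _ => continuousOn_const).add
      (h1.smul ((h2.smul he₁).add (h3.smul he₂)))
  have hqP : ∀ t ∈ S, q t ∉ polyhedron K (F t) := fun t ht =>
    disjoint_left.1 (disjoint_ridgeTube hK (hsep t ht) hx (hframe t ht)) (hqmem t ht)
  have hconst : ∀ t ∈ S, ∀ t' ∈ S, ∀ χ χ', IsInside K (F t) χ → IsInside K (F t') χ' →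
      χ (q t) = χ' (q t') := by
    intro t ht t' ht' χ χ' hχ hχ'
    have hex : ∀ s, ∃ χ, s ∈ S → IsInside K (F s) χ := fun s => by
      by_cases hs : s ∈ S
      · obtain ⟨χ, hχ⟩ := exists_isInside hd hK (hemb s hs)
        exact ⟨χ, fun _ => hχ⟩
      · exact ⟨0, fun h => (hs h).elim⟩
    choose X hX using hex
    rw [IsInside.unique hd hK (hemb t ht) hχ (hX t ht) (hqP t ht),
      IsInside.unique hd hK (hemb t' ht') hχ' (hX t' ht') (hqP t' ht')]
    exact IsInside.eq_of_continuousOn hd hK hSp hF hemb hqc hqP hX ht ht'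
  by_cases h : ∃ t ∈ S, ∃ χ, IsInside K (F t) χ ∧ χ (q t) = 1
  · obtain ⟨t₀, ht₀, χ₀, hχ₀, h1⟩ := h
    exact Or.inl fun t ht χ hχ => ⟨c, hsep t ht, q t, hqmem t ht,
      (hconst t ht t₀ ht₀ χ χ₀ hχ hχ₀).trans h1⟩
  · refine Or.inr fun t ht χ hχ => ?_
    obtain ⟨z, hz, -⟩ := ridgeTube_inter_facetTube hc hxne (hframe t ht).flip hx.notMem_a
    have h2 : ∀ i j : ZMod 2, i ≠ 1 → i ≠ j → j = 1 := by decide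
    exact ⟨c, hsep t ht, z, hz, h2 _ _ (fun h1 => h ⟨t, ht, χ, hχ, h1⟩)
      (ridgeTube_ne hK (hsep t ht) hχ hx (hframe t ht) (hqmem t ht) hz)⟩

/-- Reparametrising by `T` may go back and forth in time; that no later position is congruent to the
first one is read off from the distance of `a` and `b` alone. -/
theorem isHingeFlex_comp {F : ℝ → V → EuclideanSpace ℝ (Fin d)} {S : Set ℝ}
    {e₁ e₂ : ℝ → EuclideanSpace ℝ (Fin d)} {φ : ℝ → ℝ} (hK : IsClosedComplex d K)
    (hx : IsRidge d K x a b) (hF : ∀ v, ContinuousOn (fun t => F t v) S)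
    (hdist : ∀ t ∈ S, ∀ t' ∈ S, ∀ σ ∈ K, ∀ i ∈ σ, ∀ j ∈ σ,
      dist (F t i) (F t j) = dist (F t' i) (F t' j))
    (hemb : ∀ t ∈ S, IsEmbedded K (F t))
    (he₁ : ContinuousOn e₁ S) (he₂ : ContinuousOn e₂ S) (hφ : ContinuousOn φ S)
    (hframe : ∀ t ∈ S, HingeFrame (F t) x a b (e₁ t) (e₂ t) (φ t))
    (hin : ∀ t ∈ S, ∀ χ, IsInside K (F t) χ → ∃ c, Separated K (F t) c ∧
      ∃ q ∈ ridgeTube (F t) x c (e₁ t) (e₂ t) (φ t), χ q = 1)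
    {T : ℝ → ℝ} (hT : Continuous T) (hTS : MapsTo T (Icc 0 1) S)
    (hne : ∀ s ∈ Icc (0 : ℝ) 1, s ≠ 0 →
      dist (F (T s) a) (F (T s) b) ≠ dist (F (T 0) a) (F (T 0) b)) :
    IsHingeFlex K (fun s => F (T s)) (Icc 0 1) x a b (fun s => e₁ (T s)) (fun s => e₂ (T s))
      (fun s => φ (T s)) where
  closed := hK
  ridge := hx
  cont := fun v => (hF v).comp hT.continuousOn hTS
  dist_eq := fun t ht => hdist _ (hTS ht) _ (hTS (by simp))
  not_congr := fun t ht ht0 hcon => hne t ht ht0 (congruent_iff_dist_eq.1 hcon a b)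
  cont₁ := he₁.comp hT.continuousOn hTS
  cont₂ := he₂.comp hT.continuousOn hTS
  cont_angle := hφ.comp hT.continuousOn hTS
  embedded := fun t ht => hemb _ (hTS ht)
  frame := fun t ht => hframe _ (hTS ht)
  inside := fun t ht => hin _ (hTS ht)

end Start


/-! ### A flex that closes one hinge -/

section Start

variable {V : Type*} [Fintype V] {d : ℕ} {K : AbstractSimplicialComplex V}
  {f : V → EuclideanSpace ℝ (Fin d)}

theorem IsFlex.dist_eq {V : Type*} {K : AbstractSimplicialComplex V}
    {F : ℝ → V → EuclideanSpace ℝ (Fin d)} {I : Set ℝ} (h : IsFlex K I F)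
    {t : ℝ} (ht : t ∈ I) {σ : Finset V} (hσ : σ ∈ K) {i j : V} (hi : i ∈ σ) (hj : j ∈ σ) :
    dist (F t i) (F t j) = dist (F 0 i) (F 0 j) :=
  congruent_iff_dist_eq.1 (h.face_congruent t ht σ hσ) ⟨i, hi⟩ ⟨j, hj⟩

/-- A flexible embedded polyhedron has, up to a small deformation, a flex closing a hinge. -/
theorem exists_isHingeFlex [DecidableEq V] (hd : 3 ≤ d) (hK : IsClosedComplex d K)
    (hemb : IsEmbedded K f) (hflex : IsFlexible K f) {r : ℝ} (hr : 0 < r) :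
    ∃ (G : ℝ → V → EuclideanSpace ℝ (Fin d)) (x : Finset V) (a b : V)
      (e₁ e₂ : ℝ → EuclideanSpace ℝ (Fin d)) (φ : ℝ → ℝ),
      IsHingeFlex K G (Icc 0 1) x a b e₁ e₂ φ ∧ (∀ t ∈ Ico (0 : ℝ) 1, φ 1 < φ t) ∧
      ∀ v, ‖G 0 v - f v‖ ≤ r := by
  obtain ⟨F, hF0, hF⟩ := hflex
  obtain ⟨c, hsep⟩ := exists_separated hemb
  obtain ⟨r', hr', hr'2⟩ := exists_between (lt_min hr hsep.1)
  obtain ⟨hr'r, hr'c⟩ := lt_min_iff.1 hr'2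
  have h01 : (0 : ℝ) ∈ Icc (0 : ℝ) 1 := by simp
  have hev : ∀ᶠ t in 𝓝[Icc 0 1] (0 : ℝ), ∀ v, ‖F t v - f v‖ < r' := by
    rw [Filter.eventually_all]
    intro v
    have := (hF.continuousOn v) 0 h01
    rw [ContinuousWithinAt, hF0, Metric.tendsto_nhds] at this
    filter_upwards [this r' hr'] with t ht
    rwa [← dist_eq_norm]
  obtain ⟨τ, hτ, hball⟩ := Metric.mem_nhdsWithin_iff.1 hev
  obtain ⟨δ, hδ, hδ2⟩ := exists_between (lt_min hτ one_pos)
  obtain ⟨hδτ, hδ1⟩ := lt_min_iff.1 hδ2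
  have hI1 : ∀ t ∈ Icc (0 : ℝ) δ, t ∈ Icc (0 : ℝ) 1 := fun t ht => ⟨ht.1, ht.2.trans hδ1.le⟩
  have hclose : ∀ t ∈ Icc (0 : ℝ) δ, ∀ v, ‖F t v - f v‖ ≤ r' := fun t ht v =>
    (hball ⟨by
      rw [Metric.mem_ball, Real.dist_eq, sub_zero, abs_of_nonneg ht.1]
      exact ht.2.trans_lt hδτ, hI1 t ht⟩ v).le
  have hembI : ∀ t ∈ Icc (0 : ℝ) δ, IsEmbedded K (F t) := fun t ht =>
    (hsep.perturb hr'c (hclose t ht)).isEmbedded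
  have hFI : ∀ v, ContinuousOn (fun t => F t v) (Icc 0 δ) := fun v =>
    (hF.continuousOn v).mono hI1
  have h0I : (0 : ℝ) ∈ Icc (0 : ℝ) δ := ⟨le_rfl, hδ.le⟩
  have hdist0 : ∀ t ∈ Icc (0 : ℝ) δ, ∀ σ ∈ K, ∀ i ∈ σ, ∀ j ∈ σ,
      dist (F t i) (F t j) = dist (F 0 i) (F 0 j) := fun t ht σ hσ i hi j hj =>
    hF.dist_eq (hI1 t ht) hσ hi hj
  -- Otherwise the motion up to time `δ` would be rigid.
  obtain ⟨t₁, ht₁, x, a, b, hx, hne⟩ : ∃ t ∈ Icc (0 : ℝ) δ, ∃ x a b, IsRidge d K x a b ∧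
      dist (F t a) (F t b) ≠ dist (F 0 a) (F 0 b) := by
    by_contra hcon
    push Not at hcon
    exact hF.not_congruent δ ⟨hδ.le, hδ1.le⟩ hδ.ne' (congruent_of_ridge_dist_eq (by omega) hK
      isPreconnected_Icc hFI hembI h0I hdist0 hcon ⟨hδ.le, le_rfl⟩)
  have hxne := face_nonempty hx.mem
  have hE := isEmbedded_iff_compat.1 (hembI 0 h0I)
  obtain ⟨l, ra, u, hl, hls, hra, hfa, huc, hu⟩ := exists_foot_family hFI
    (fun t ht => hdist0 t ht _ hx.mem_a) (hE _ hx.mem_a _ hx.mem_a) hxne hx.notMem_a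
  obtain ⟨l', rb, u', hl', hls', hrb, hfb, huc', hu'⟩ := exists_foot_family hFI
    (fun t ht => hdist0 t ht _ hx.mem_b) (hE _ hx.mem_b _ hx.mem_b) hxne hx.notMem_b
  obtain ⟨κ, hκ⟩ : ∃ κ : ℝ → ℝ, κ = fun t => inner ℝ (u t) (u' t) := ⟨_, rfl⟩
  have hκc : ContinuousOn κ (Icc 0 δ) := hκ ▸ huc.inner huc'
  have hdsq : ∀ t ∈ Icc (0 : ℝ) δ, dist (F t a) (F t b) ^ 2 =
      inner ℝ (affExtend (F 0) (l - l')) (affExtend (F 0) (l - l')) + ra ^ 2 + rb ^ 2 -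
        2 * ra * rb * κ t := fun t ht => by
    rw [hκ]
    exact dist_sq_of_feet hl hls hl' hls' hfa hfb hu hu' (fun t ht => hdist0 t ht _ hx.mem) ht
  have hrab : 2 * ra * rb ≠ 0 := by positivity
  have hκne : κ t₁ ≠ κ 0 := fun h => hne ((pow_left_inj₀ dist_nonneg dist_nonneg two_ne_zero).1
    (by rw [hdsq t₁ ht₁, hdsq 0 h0I, h]))
  have hdne : ∀ t ∈ Icc (0 : ℝ) δ, ∀ t' ∈ Icc (0 : ℝ) δ, κ t ≠ κ t' →
      dist (F t a) (F t b) ≠ dist (F t' a) (F t' b) := fun t ht t' ht' h he => by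
    have h1 := hdsq t ht
    rw [he, hdsq t' ht', sub_right_inj] at h1
    exact h (mul_left_cancel₀ hrab h1).symm
  obtain ⟨p, hp, q, hq, hpq⟩ : ∃ p ∈ Icc (0 : ℝ) δ, ∃ q ∈ Icc (0 : ℝ) δ, κ p < κ q := by
    rcases lt_or_gt_of_ne hκne with h | h
    · exact ⟨t₁, ht₁, 0, h0I, h⟩
    · exact ⟨0, h0I, t₁, ht₁, h⟩
  -- Levels strictly between two attained cosines lie in `(-1, 1)`, where the frame is continuous.
  obtain ⟨A, hpA, hAq⟩ := exists_between hpq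
  obtain ⟨B, hAB, hBq⟩ := exists_between hAq
  have habs : ∀ t ∈ Icc (0 : ℝ) δ, |κ t| ≤ 1 := fun t ht => by
    have := abs_real_inner_le_norm (u t) (u' t)
    rwa [(hu t ht).1, (hu' t ht).1, mul_one, ← congrFun hκ t] at this
  have hA1 : -1 < A := (abs_le.1 (habs p hp)).1.trans_lt hpA
  have hB1 : B < 1 := hBq.trans_le (abs_le.1 (habs q hq)).2
  obtain ⟨T, hT, hTI, hT0, hT1, hTs⟩ :=
    exists_rising_path (convex_Icc 0 δ) hκc hp hq hpA hAB hBq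
  have hTle : ∀ s ∈ Icc (0 : ℝ) 1, A ≤ κ (T s) ∧ κ (T s) ≤ B := fun s hs => by
    rcases hs.1.eq_or_lt with rfl | h0
    · rw [hT0]
      exact ⟨le_rfl, hAB.le⟩
    · rcases hs.2.eq_or_lt with rfl | h1
      · rw [hT1]
        exact ⟨hAB.le, le_rfl⟩
      · exact ⟨(hTs s ⟨h0, h1⟩).1.le, (hTs s ⟨h0, h1⟩).2.le⟩
  obtain ⟨S, hS⟩ : ∃ S, S = T '' Icc 0 1 := ⟨_, rfl⟩
  have hSI : S ⊆ Icc 0 δ := hS ▸ hTI.image_subset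
  have hTS : MapsTo T (Icc 0 1) S := hS ▸ mapsTo_image T _
  have hSκ : ∀ t ∈ S, -1 < κ t ∧ κ t < 1 := by
    rw [hS]
    rintro _ ⟨s, hs, rfl⟩
    exact ⟨hA1.trans_le (hTle s hs).1, (hTle s hs).2.trans_lt hB1⟩
  have hSc : IsCompact S := hS ▸ isCompact_Icc.image hT
  have hSp : IsPreconnected S := hS ▸ isPreconnected_Icc.image T hT.continuousOn
  have hframe : ∀ t ∈ S, HingeFrame (F t) x a b (u t)
      ((√(1 - κ t ^ 2))⁻¹ • (u' t - κ t • u t)) (Real.arccos (κ t)) := fun t ht =>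
    hingeFrame_of_inner hl hls hra (hfa t) (hu t (hSI ht)).1 (hu t (hSI ht)).2 hl' hls' hrb (hfb t)
      (hu' t (hSI ht)).1 (hu' t (hSI ht)).2 (congrFun hκ t).symm (hSκ t ht).1 (hSκ t ht).2
  have hκS := hκc.mono hSI
  have huS := huc.mono hSI
  have he₂ : ContinuousOn (fun t => (√(1 - κ t ^ 2))⁻¹ • (u' t - κ t • u t)) S := by
    have h1 : ContinuousOn (fun t => √(1 - κ t ^ 2)) S :=
      Real.continuous_sqrt.comp_continuousOn (continuousOn_const.sub (hκS.pow 2))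
    refine ContinuousOn.smul (h1.inv₀ fun t ht => ?_) ((huc'.mono hSI).sub (hκS.smul huS))
    have h2 := hSκ t ht
    exact (Real.sqrt_pos.2 (by nlinarith)).ne'
  have hφ : ContinuousOn (fun t => Real.arccos (κ t)) S :=
    Real.continuous_arccos.comp_continuousOn hκS
  have hFS : ∀ v, ContinuousOn (fun t => F t v) S := fun v => (hFI v).mono hSI
  have hembS : ∀ t ∈ S, IsEmbedded K (F t) := fun t ht => hembI t (hSI ht)
  have hdistS : ∀ t ∈ S, ∀ t' ∈ S, ∀ σ ∈ K, ∀ i ∈ σ, ∀ j ∈ σ,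
      dist (F t i) (F t j) = dist (F t' i) (F t' j) := fun t ht t' ht' σ hσ i hi j hj =>
    (hdist0 t (hSI ht) σ hσ i hi j hj).trans (hdist0 t' (hSI ht') σ hσ i hi j hj).symm
  -- The cosine rises along `T`. If the interior is in the wedge of angle `arccos κ`, this angle
  -- falls; if it is in the complementary wedge, the angle `2π - arccos κ` falls when `T` is run
  -- backwards.
  rcases inside_or_inside_flip (by omega) hK hx hSc hSp hFS hembS huS he₂ hφ hframe with hin | hin
  · refine ⟨_, x, a, b, _, _, _, isHingeFlex_comp hK hx hFS hdistS hembS huS he₂ hφ hframe hin hT hTS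
      fun s hs hs0 => hdne _ (hTI hs) _ (hTI h01) ?_, fun s hs => ?_,
      fun v => (hclose _ (hTI h01) v).trans hr'r.le⟩
    · have h0s : 0 < s := lt_of_le_of_ne hs.1 (Ne.symm hs0)
      rw [hT0]
      rcases hs.2.eq_or_lt with rfl | h1
      · rw [hT1]
        exact hAB.ne'
      · exact (hTs s ⟨h0s, h1⟩).1.ne'
    · have hs' : s ∈ Icc (0 : ℝ) 1 := ⟨hs.1, hs.2.le⟩
      rw [hT1]
      refine Real.arccos_lt_arccos (hA1.le.trans (hTle s hs').1) ?_ hB1.le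
      rcases hs.1.eq_or_lt with rfl | h0
      · rwa [hT0]
      · exact (hTs s ⟨h0, hs.2⟩).2
  · have hR : MapsTo (fun s : ℝ => 1 - s) (Icc 0 1) (Icc 0 1) := fun s hs =>
      ⟨by linarith [hs.2], by linarith [hs.1]⟩
    refine ⟨_, x, a, b, _, _, _, isHingeFlex_comp hK hx hFS hdistS hembS huS he₂.neg
      (φ := fun t => 2 * Real.pi - Real.arccos (κ t))
      (continuousOn_const.sub hφ) (fun t ht => (hframe t ht).flip) hin (T := fun s => T (1 - s))
      (hT.comp (by fun_prop)) (hTS.comp hR)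
      fun s hs hs0 => hdne _ (hTI (hR hs)) _ (hTI (hR h01)) ?_, fun s hs => ?_,
      fun v => (hclose _ (hTI (hR h01)) v).trans hr'r.le⟩
    · have h0s : 0 < s := lt_of_le_of_ne hs.1 (Ne.symm hs0)
      beta_reduce
      rw [sub_zero, hT1]
      rcases hs.2.eq_or_lt with rfl | h1
      · rw [sub_self, hT0]
        exact hAB.ne
      · exact (hTs (1 - s) ⟨by linarith, by linarith⟩).2.ne
    · have hs' : s ∈ Icc (0 : ℝ) 1 := ⟨hs.1, hs.2.le⟩
      rw [sub_self, hT0]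
      refine sub_lt_sub_left (Real.arccos_lt_arccos hA1.le ?_ ((hTle _ (hR hs')).2.trans hB1.le)) _
      rcases hs.1.eq_or_lt with rfl | h0
      · beta_reduce
        rwa [sub_zero, hT1]
      · exact (hTs (1 - s) ⟨by linarith [hs.2], by linarith⟩).1

end Start


/-! ### Two tents and the bounds on the dihedral angles -/

section Closing

variable {V : Type*} [Fintype V] [DecidableEq V] {d : ℕ} {K : AbstractSimplicialComplex V}
  {F : ℝ → V → EuclideanSpace ℝ (Fin d)} {x : Finset V} {a b : V}
  {e₁ e₂ : ℝ → EuclideanSpace ℝ (Fin d)} {φ : ℝ → ℝ}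

theorem polyhedron_nonempty {V : Type*} [Fintype V] [Nonempty V] (K : AbstractSimplicialComplex V)
    (f : V → EuclideanSpace ℝ (Fin d)) : (polyhedron K f).Nonempty := by
  classical
  obtain ⟨v⟩ := ‹Nonempty V›
  refine ⟨_, Pi.single v 1, ⟨fun u => ?_, by simp, {v}, K.singleton_mem v, fun u hu => ?_⟩, rfl⟩
  · by_cases h : u = v
    · subst h
      simp
    · simp [h]
  · exact Pi.single_eq_of_ne (by simpa using hu) 1

theorem hausdorffDist_polyhedron_triangle {V V' V'' : Type*} [Fintype V] [Fintype V']
    [Fintype V''] {K : AbstractSimplicialComplex V} {K' : AbstractSimplicialComplex V'}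
    {K'' : AbstractSimplicialComplex V''} [Nonempty V] [Nonempty V']
    (f : V → EuclideanSpace ℝ (Fin d)) (f' : V' → EuclideanSpace ℝ (Fin d))
    (f'' : V'' → EuclideanSpace ℝ (Fin d)) :
    Metric.hausdorffDist (polyhedron K f) (polyhedron K'' f'') ≤
      Metric.hausdorffDist (polyhedron K f) (polyhedron K' f') +
        Metric.hausdorffDist (polyhedron K' f') (polyhedron K'' f'') := by
  exact Metric.hausdorffDist_triangle (Metric.hausdorffEDist_ne_top_of_nonempty_of_bounded
    (polyhedron_nonempty K f) (polyhedron_nonempty K' f')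
    (isCompact_polyhedron K f).isBounded (isCompact_polyhedron K' f').isBounded)

theorem hausdorffDist_polyhedron_le {V : Type*} [Fintype V] {K : AbstractSimplicialComplex V}
    {f f' : V → EuclideanSpace ℝ (Fin d)} {r : ℝ} (hr : 0 ≤ r)
    (h : ∀ v, ‖f' v - f v‖ ≤ r) :
    Metric.hausdorffDist (polyhedron K f') (polyhedron K f) ≤ r := by
  have key : ∀ w ∈ realization K, dist (affExtend f' w) (affExtend f w) ≤ r := fun w hw => by
    have := norm_affExtend_sub_le h w
    rwa [sum_abs_of_mem_realization hw, mul_one, ← dist_eq_norm] at this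
  refine Metric.hausdorffDist_le_of_mem_dist hr ?_ ?_
  · rintro _ ⟨w, hw, rfl⟩
    exact ⟨_, ⟨w, hw, rfl⟩, key w hw⟩
  · rintro _ ⟨w, hw, rfl⟩
    exact ⟨_, ⟨w, hw, rfl⟩, by rw [dist_comm]; exact key w hw⟩

/-- Two tents reduce the smallest angle of a closing hinge to zero. -/
theorem IsHingeFlex.exists_closing (H : IsHingeFlex K F (Icc 0 1) x a b e₁ e₂ φ) (hd : 3 ≤ d)
    (hφ : ∀ t ∈ Ico (0 : ℝ) 1, φ 1 < φ t) {ε : ℝ} (hε : 0 < ε) :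
    ∃ (K' : AbstractSimplicialComplex (Option (Option V)))
      (G : ℝ → Option (Option V) → EuclideanSpace ℝ (Fin d)) (x' : Finset (Option (Option V)))
      (a' b' : Option (Option V)) (e₁' e₂' : ℝ → EuclideanSpace ℝ (Fin d)) (φ' : ℝ → ℝ),
      IsHingeFlex K' G (Ico 0 1) x' a' b' e₁' e₂' φ' ∧ Tendsto φ' (𝓝[<] 1) (𝓝 0) ∧
      (∀ t ∈ Icc (0 : ℝ) 1, ∀ y s s', y.card + 1 = d → y ≠ x' → s ∈ K' → s' ∈ K' → y ⊆ s →
        y ⊆ s' → Compat (G t) s s') ∧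
      IsSubdivision K' K ∧
      Metric.hausdorffDist (polyhedron K' (G 0)) (polyhedron K (F 0)) ≤ ε := by
  have h0 : (0 : ℝ) ∈ Icc (0 : ℝ) 1 := by simp
  have h1 : (1 : ℝ) ∈ Icc (0 : ℝ) 1 := by simp
  have hle : ∀ t ∈ Icc (0 : ℝ) 1, φ 1 ≤ φ t := fun t ht => by
    rcases ht.2.eq_or_lt with rfl | h
    · exact le_rfl
    · exact (hφ t ⟨ht.1, h⟩).le
  have hpos := (H.frame 1 h1).pos
  have hlt := (H.frame 1 h1).lt
  -- Half of the final angle is less than `π`, as a tent requires, and two tents remove all of it.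
  have hα : 0 < φ 1 / 2 := by linarith
  have hαπ : φ 1 / 2 < Real.pi := by linarith
  have hA := H.closed.isTentBase (by omega) H.ridge.mem_a H.ridge.card_a
  obtain ⟨h, hh, hhε, H', -⟩ := H.exists_tent hd hα hαπ Subset.rfl
    (fun t ht => by linarith [hle t ht]) hA (half_pos hε)
  have hA' := H'.closed.isTentBase (by omega) H'.ridge.mem_a H'.ridge.card_a
  -- After the first tent the angle is `φ t - φ 1 / 2`. It exceeds `φ 1 / 2` only for `t < 1`, so
  -- time `1` is now excluded from embeddedness.
  obtain ⟨h', hh', hhε', H'', hcompat⟩ := H'.exists_tent (J := Ico 0 1) hd hα hαπ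
    Ico_subset_Icc_self (fun t ht => by linarith [hφ t ht]) hA' (half_pos hε)
  refine ⟨_, _, _, _, _, _, _, _, H'', ?_, hcompat,
    isSubdivision_tentComplex.trans isSubdivision_tentComplex, ?_⟩
  · have h2 := (H''.cont_angle 1 h1).mono_left
      (nhdsWithin_le_of_mem (mem_of_superset (Ioo_mem_nhdsLT zero_lt_one) Ioo_subset_Icc_self))
    convert h2 using 2
    ring
  · have := H.closed.nonempty
    refine (hausdorffDist_polyhedron_triangle _ _ _).trans
      ((add_le_add ((hausdorffDist_tent_le (Finset.subset_insert _ _)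
        (face_nonempty H'.ridge.mem) _ _).trans ?_) ((hausdorffDist_tent_le
          (Finset.subset_insert _ _) (face_nonempty H.ridge.mem) _ _).trans ?_)).trans_eq
            (add_halves ε))
    · rw [(H'.frame 0 h0).norm_apex hh']
      exact hhε'.le
    · rw [(H.frame 0 h0).norm_apex hh]
      exact hhε.le

/-- The angle lies in `[arccos k, 2π - arccos k]`; halving the margin makes the bounds strict. -/
theorem lt_angle_of_cos_le {k φ : ℝ} (hk : k < 1) (h0 : 0 < φ) (h2 : φ < 2 * Real.pi)
    (h : Real.cos φ ≤ k) :
    Real.arccos k / 2 < φ ∧ φ < 2 * Real.pi - Real.arccos k / 2 := by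
  have hpos := Real.arccos_pos.2 hk
  have hle := Real.arccos_le_arccos h
  have hπ := Real.arccos_le_pi k
  rcases le_total φ Real.pi with hφ | hφ
  · rw [Real.arccos_cos h0.le hφ] at hle
    constructor <;> linarith
  · rw [← Real.cos_two_pi_sub, Real.arccos_cos (by linarith) (by linarith)] at hle
    constructor <;> linarith

/-- In a flex closing one hinge, all other dihedral angles stay away from `0` and `2π`. -/
theorem IsHingeFlex.exists_angles (H : IsHingeFlex K F (Ico 0 1) x a b e₁ e₂ φ) (hd : 2 ≤ d)
    (hlim : Tendsto φ (𝓝[<] 1) (𝓝 0))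
    (hcompat : ∀ t ∈ Icc (0 : ℝ) 1, ∀ y s s', y.card + 1 = d → y ≠ x → s ∈ K → s' ∈ K → y ⊆ s →
      y ⊆ s' → Compat (F t) s s') :
    ∃ (D : ℝ → Set (EuclideanSpace ℝ (Fin d))) (Φ : Finset V → ℝ → ℝ),
      (∀ s ∈ Ico (0 : ℝ) 1, IsDomainBoundedBy (D s) (polyhedron K (F s)) ∧
        ∀ y ∈ K, y.card + 1 = d → IsInteriorDihedralAngle (D s) (F s) y (Φ y s)) ∧
      Tendsto (Φ x) (𝓝[<] 1) (𝓝 0) ∧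
      ∃ m M : ℝ, 0 < m ∧ m < M ∧ M < 2 * Real.pi ∧
        ∀ y ∈ K, y.card + 1 = d → y ≠ x → ∀ s ∈ Ico (0 : ℝ) 1, m < Φ y s ∧ Φ y s < M := by
  have h0 : (0 : ℝ) ∈ Icc (0 : ℝ) 1 := by simp
  have hχ : ∀ s, ∃ χ, s ∈ Ico (0 : ℝ) 1 → IsInside K (F s) χ := fun s => by
    by_cases hs : s ∈ Ico (0 : ℝ) 1
    · obtain ⟨χ, hχ⟩ := exists_isInside hd H.closed (H.embedded s hs)
      exact ⟨χ, fun _ => hχ⟩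
    · exact ⟨0, fun h => (hs h).elim⟩
  choose χ hχ using hχ
  have hk : ∀ y, ∃ k < 1, y ∈ K → y.card + 1 = d → y ≠ x → ∃ a b, IsRidge d K y a b ∧
      ∀ t ∈ Icc (0 : ℝ) 1, ∀ e₁ e₂ φ, HingeFrame (F t) y a b e₁ e₂ φ → Real.cos φ ≤ k := by
    intro y
    by_cases hy : y ∈ K ∧ y.card + 1 = d ∧ y ≠ x
    · obtain ⟨hyK, hyd, hyx⟩ := hy
      obtain ⟨a, b, hr⟩ := H.closed.exists_isRidge hyK hyd
      have hsa := Finset.subset_insert a y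
      have hsb := Finset.subset_insert b y
      obtain ⟨k, hk1, hk⟩ := exists_cos_le h0 isCompact_Icc H.cont hr.notMem_a hr.notMem_b hr.ne
        (face_nonempty hyK) (fun t ht => H.dist_eq t ht _ hr.mem_a)
        (fun t ht => H.dist_eq t ht _ hr.mem_b)
        (hcompat 0 h0 y _ _ hyd hyx hr.mem_a hr.mem_a hsa hsa)
        (hcompat 0 h0 y _ _ hyd hyx hr.mem_b hr.mem_b hsb hsb)
        (fun t ht => hcompat t ht y _ _ hyd hyx hr.mem_a hr.mem_b hsa hsb)
      exact ⟨k, hk1, fun _ _ _ => ⟨a, b, hr, hk⟩⟩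
    · exact ⟨0, one_pos, fun h1 h2 h3 => (hy ⟨h1, h2, h3⟩).elim⟩
  choose k hk1 hk using hk
  -- The smallest margin over all vertex sets; those that are not ridges, and `x` itself, contribute
  -- a dummy value.
  obtain ⟨y₀, -, hmin⟩ := (Finset.univ : Finset (Finset V)).exists_min_image
    (fun y => Real.arccos (k y) / 2) ⟨∅, Finset.mem_univ _⟩
  have hΦ : ∀ (y : Finset V) (s : ℝ), ∃ ψ, s ∈ Ico (0 : ℝ) 1 → y ∈ K → y.card + 1 = d →
      IsInteriorDihedralAngle {q | q ∉ polyhedron K (F s) ∧ χ s q = 1} (F s) y ψ ∧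
      (y = x → ψ = φ s) ∧
      (y ≠ x → Real.arccos (k y) / 2 < ψ ∧ ψ < 2 * Real.pi - Real.arccos (k y) / 2) := by
    intro y s
    by_cases hs : s ∈ Ico (0 : ℝ) 1 ∧ y ∈ K ∧ y.card + 1 = d
    swap
    · exact ⟨0, fun h1 h2 h3 => (hs ⟨h1, h2, h3⟩).elim⟩
    obtain ⟨hs, hyK, hyd⟩ := hs
    by_cases hyx : y = x
    · obtain ⟨c, hsep, q, hq, hq1⟩ := H.inside s hs (χ s) (hχ s hs)
      exact ⟨φ s, fun _ _ _ => ⟨hyx ▸ (H.frame s hs).isInteriorDihedralAngle hd H.closed hsep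
        (hχ s hs) H.ridge hq hq1, fun _ => rfl, fun h => (h hyx).elim⟩⟩
    · obtain ⟨a, b, hr, hcos⟩ := hk y hyK hyd hyx
      obtain ⟨c, hsep⟩ := exists_separated (H.embedded s hs)
      obtain ⟨e₁, e₂, θ, hf⟩ := exists_hingeFrame hd (H.embedded s hs) hr
      have hb := lt_angle_of_cos_le (hk1 y) hf.pos hf.lt
        (hcos s (Ico_subset_Icc_self hs) _ _ _ hf)
      -- The bounds are symmetric under `ψ ↦ 2π - ψ`, so the side of the interior at these ridges
      -- need not be known.
      obtain ⟨ψ, hψ, rfl | rfl⟩ := exists_isInteriorDihedralAngle hd H.closed hsep (hχ s hs) hr hf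
      · exact ⟨_, fun _ _ _ => ⟨hψ, fun h => (hyx h).elim, fun _ => hb⟩⟩
      · exact ⟨_, fun _ _ _ => ⟨hψ, fun h => (hyx h).elim, fun _ => ⟨by linarith, by linarith⟩⟩⟩
  choose Φ hΦ using hΦ
  have hpos := Real.arccos_pos.2 (hk1 y₀)
  have hπ := Real.arccos_le_pi (k y₀)
  refine ⟨fun s => {q | q ∉ polyhedron K (F s) ∧ χ s q = 1}, Φ, fun s hs =>
    ⟨(hχ s hs).isDomainBoundedBy hd H.closed (H.embedded s hs), fun y hy hyd =>
      (hΦ y s hs hy hyd).1⟩, ?_, Real.arccos (k y₀) / 2, 2 * Real.pi - Real.arccos (k y₀) / 2,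
    by linarith, by linarith, by linarith, fun y hy hyd hyx s hs => ?_⟩
  · refine hlim.congr' ?_
    filter_upwards [Ioo_mem_nhdsLT (zero_lt_one (α := ℝ))] with s hs
    exact ((hΦ x s (Ioo_subset_Ico_self hs) H.ridge.mem H.ridge.card).2.1 rfl).symm
  · have h1 := (hΦ y s hs hy hyd).2.2 hyx
    have h2 := hmin y (Finset.mem_univ _)
    constructor <;> linarith

end Closing


/-! ### Renaming the vertices, in order to number them by `Fin n` -/

section Relabel

variable {V W : Type*} {d : ℕ} {K : AbstractSimplicialComplex V}
  {e : W ≃ V}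

/-- The complex `K` with its vertices renamed along `e`. -/
def relabel (K : AbstractSimplicialComplex V) (e : W ≃ V) : AbstractSimplicialComplex W where
  faces := {σ | σ.map e.toEmbedding ∈ K}
  isRelLowerSet_faces := fun σ hσ => ⟨by
    simpa using face_nonempty (K := K) hσ, fun τ hτ hne => face_of_subset (K := K) hσ
      (Finset.map_subset_map.2 hτ) (by simpa using hne)⟩
  singleton_mem := fun w => by
    change Finset.map e.toEmbedding {w} ∈ K
    rw [Finset.map_singleton]
    exact K.singleton_mem _

theorem mem_relabel {σ : Finset W} : σ ∈ relabel K e ↔ σ.map e.toEmbedding ∈ K := Iff.rfl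

theorem exists_map_eq (e : W ≃ V) (σ : Finset V) : ∃ τ : Finset W, τ.map e.toEmbedding = σ :=
  ⟨σ.map e.symm.toEmbedding, by
    ext v
    simp⟩

theorem IsFlex.relabel {F : ℝ → V → EuclideanSpace ℝ (Fin d)} {I : Set ℝ} (h : IsFlex K I F) :
    IsFlex (relabel K e) I (fun t => F t ∘ e) where
  continuousOn := fun v => h.continuousOn (e v)
  face_congruent := fun t ht σ hσ => congruent_iff_dist_eq.2 fun i j =>
    h.dist_eq ht hσ (Finset.mem_map_of_mem _ i.2) (Finset.mem_map_of_mem _ j.2)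
  not_congruent := fun t ht ht0 hcon => h.not_congruent t ht ht0
    (congruent_iff_dist_eq.2 fun i j => by
      simpa using congruent_iff_dist_eq.1 hcon (e.symm i) (e.symm j))

theorem IsInteriorDihedralAngle.relabel {D : Set (EuclideanSpace ℝ (Fin d))}
    {f : V → EuclideanSpace ℝ (Fin d)} {σ : Finset W} {φ : ℝ}
    (h : IsInteriorDihedralAngle D f (σ.map e.toEmbedding) φ) :
    IsInteriorDihedralAngle D (f ∘ e) σ φ := by
  obtain ⟨h1, h2, e₁, e₂, h3, h4, h5, h6, h7⟩ := h
  refine ⟨h1, h2, e₁, e₂, h3, h4, h5, fun u hu v hv => h6 _ (Finset.mem_map_of_mem _ hu) _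
    (Finset.mem_map_of_mem _ hv), fun w hw hw1 p hp => h7 (w ∘ e.symm) ?_ ?_ p ?_⟩
  · intro v hv
    obtain ⟨u, hu, rfl⟩ := Finset.mem_map.1 hv
    simpa using hw u hu
  · simpa [Finset.sum_map] using hw1
  · simpa [Finset.sum_map] using hp

theorem IsClosedComplex.relabel (h : IsClosedComplex d K) : IsClosedComplex d (relabel K e) where
  nonempty := (Equiv.nonempty_congr e).2 h.nonempty
  pure := fun σ hσ => by
    obtain ⟨τ, hτ, hτd, hστ⟩ := h.pure _ hσ
    obtain ⟨τ, rfl⟩ := exists_map_eq e τ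
    exact ⟨τ, hτ, by simpa using hτd, Finset.map_subset_map.1 hστ⟩
  boundary_free := fun σ hσ hσd => by
    rw [← h.boundary_free _ hσ (by simpa using hσd)]
    rw [← ncard_image_of_injective _ (Finset.map_injective e.toEmbedding)]
    congr 1
    ext τ
    constructor
    · rintro ⟨τ, ⟨h1, h2, h3⟩, rfl⟩
      exact ⟨h1, by simpa using h2, Finset.map_subset_map.2 h3⟩
    · rintro ⟨h1, h2, h3⟩
      obtain ⟨τ, rfl⟩ := exists_map_eq e τ
      exact ⟨τ, ⟨h1, by simpa using h2, Finset.map_subset_map.1 h3⟩, rfl⟩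
  strongly_connected := fun σ hσ τ hτ hσd hτd => by
    have hm : ∀ ρ : Finset V, (ρ.map e.symm.toEmbedding).map e.toEmbedding = ρ := fun ρ => by
      ext
      simp
    have hm' : ∀ ρ : Finset W, (ρ.map e.toEmbedding).map e.symm.toEmbedding = ρ := fun ρ => by
      ext
      simp
    have := (h.strongly_connected _ hσ _ hτ (by simpa using hσd) (by simpa using hτd)).lift
      (p := fun a b : Finset W => (a ∈ FlexPoly.relabel K e ∧ a.card = d) ∧
        (b ∈ FlexPoly.relabel K e ∧ b.card = d) ∧
        ∃ ρ ∈ FlexPoly.relabel K e, ρ.card + 1 = d ∧ ρ ⊆ a ∧ ρ ⊆ b)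
      (fun ρ => ρ.map e.symm.toEmbedding) ?_
    · simpa only [Function.onFun, hm'] using this
    · rintro s t ⟨⟨h1, h2⟩, ⟨h3, h4⟩, ρ, h5, h6, h7, h8⟩
      exact ⟨⟨mem_relabel.2 (by rwa [hm]), by simpa using h2⟩,
        ⟨mem_relabel.2 (by rwa [hm]), by simpa using h4⟩, ρ.map e.symm.toEmbedding,
        mem_relabel.2 (by rwa [hm]), by simpa using h6, Finset.map_subset_map.2 h7,
        Finset.map_subset_map.2 h8⟩

variable [Fintype V] [Fintype W]

theorem affExtend_comp {M : Type*} [AddCommGroup M] [Module ℝ M] (e : W ≃ V) (f : V → M)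
    (w : W → ℝ) : affExtend (f ∘ e) w = affExtend f (w ∘ e.symm) := by
  unfold affExtend
  exact Fintype.sum_equiv e _ _ fun x => by simp

theorem comp_symm_mem_realization {w : W → ℝ} :
    w ∘ e.symm ∈ realization K ↔ w ∈ realization (relabel K e) := by
  constructor
  · rintro ⟨h1, h2, σ, hσ, h3⟩
    obtain ⟨τ, rfl⟩ := exists_map_eq e σ
    refine ⟨fun v => by simpa using h1 (e v), ?_, τ, hσ, fun v hv => ?_⟩
    · rw [← h2]
      exact Fintype.sum_equiv e _ _ fun x => by simp
    · simpa using h3 (e v) (by simpa using hv)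
  · rintro ⟨h1, h2, τ, hτ, h3⟩
    refine ⟨fun v => h1 _, ?_, τ.map e.toEmbedding, hτ, fun v hv => h3 _ fun h => hv ?_⟩
    · rw [← h2]
      exact Fintype.sum_equiv e.symm _ _ fun x => by simp
    · exact Finset.mem_map.2 ⟨_, h, by simp⟩

theorem bijOn_realization_relabel :
    BijOn (fun w : W → ℝ => w ∘ e.symm) (realization (relabel K e)) (realization K) := by
  refine ⟨fun w hw => comp_symm_mem_realization.2 hw, fun w _ w' _ h => ?_, fun w hw =>
    ⟨w ∘ e, ?_, ?_⟩⟩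
  · funext i
    simpa using congrFun h (e i)
  · rw [← comp_symm_mem_realization]
    simpa [Function.comp_assoc] using hw
  · funext v
    simp

theorem polyhedron_relabel (f : V → EuclideanSpace ℝ (Fin d)) :
    polyhedron (relabel K e) (f ∘ e) = polyhedron K f := by
  unfold polyhedron
  rw [← (bijOn_realization_relabel (K := K) (e := e)).image_eq, image_image]
  exact image_congr fun w _ => affExtend_comp e f w

theorem IsEmbedded.relabel {f : V → EuclideanSpace ℝ (Fin d)} (h : IsEmbedded K f) :
    IsEmbedded (relabel K e) (f ∘ e) := by
  intro w hw w' hw' he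
  rw [affExtend_comp, affExtend_comp] at he
  exact bijOn_realization_relabel.injOn hw hw'
    (h (comp_symm_mem_realization.2 hw) (comp_symm_mem_realization.2 hw') he)

theorem isSubdivision_relabel : IsSubdivision (relabel K e) K := by
  classical
  refine ⟨fun w => Pi.single (e w) 1, fun σ hσ => ⟨_, hσ, fun v hv u hu =>
    Pi.single_eq_of_ne ?_ 1⟩, ?_⟩
  · rintro rfl
    exact hu (Finset.mem_map_of_mem _ hv)
  · refine bijOn_realization_relabel.congr fun w _ => ?_
    funext v
    simp [affExtend, Pi.single_apply, ← Equiv.symm_apply_eq]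

end Relabel

/-! ### From hinge flexes to flexes -/

section Flex

theorem IsHingeFlex.isFlex {V : Type*} [Fintype V] [DecidableEq V] {d : ℕ}
    {K : AbstractSimplicialComplex V} {F : ℝ → V → EuclideanSpace ℝ (Fin d)} {J : Set ℝ}
    {x : Finset V} {a b : V} {e₁ e₂ : ℝ → EuclideanSpace ℝ (Fin d)} {φ : ℝ → ℝ}
    (H : IsHingeFlex K F J x a b e₁ e₂ φ) : IsFlex K (Icc 0 1) F where
  continuousOn := H.cont
  face_congruent := fun t ht σ hσ => congruent_iff_dist_eq.2 fun i j =>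
    H.dist_eq t ht σ hσ i i.2 j j.2
  not_congruent := H.not_congr

theorem IsFlex.mono {V : Type*} {d : ℕ} {K : AbstractSimplicialComplex V}
    {F : ℝ → V → EuclideanSpace ℝ (Fin d)} {I J : Set ℝ} (h : IsFlex K I F) (hJ : J ⊆ I) :
    IsFlex K J F :=
  ⟨fun v => (h.continuousOn v).mono hJ, fun t ht => h.face_congruent t (hJ ht),
    fun t ht => h.not_congruent t (hJ ht)⟩

end Flex

end FlexPoly

/-! ### The main result -/

theorem lemma2 {d : ℕ} (hd : 3 ≤ d) {ε : ℝ} (hε : 0 < ε)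
    {V : Type*} [Fintype V] (K : AbstractSimplicialComplex V) (hK : IsClosedComplex d K)
    (f : V → EuclideanSpace ℝ (Fin d)) (hemb : IsEmbedded K f) (hflex : IsFlexible K f) :
    ∃ (n : ℕ) (K' : AbstractSimplicialComplex (Fin n))
      (F : ℝ → Fin n → EuclideanSpace ℝ (Fin d)),
      IsClosedComplex d K' ∧ IsEmbedded K' (F 0) ∧ IsFlexible K' (F 0) ∧
      IsFlex K' (Ico 0 1) F ∧
      IsSubdivision K' K ∧
      Metric.hausdorffDist (polyhedron K' (F 0)) (polyhedron K f) < ε ∧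
      (∀ s ∈ Ioo (0 : ℝ) 1, IsEmbedded K' (F s)) ∧
      ∃ (D : ℝ → Set (EuclideanSpace ℝ (Fin d))) (φ : Finset (Fin n) → ℝ → ℝ),
        (∀ s ∈ Ico (0 : ℝ) 1, IsDomainBoundedBy (D s) (polyhedron K' (F s)) ∧
          ∀ y ∈ K', y.card + 1 = d → IsInteriorDihedralAngle (D s) (F s) y (φ y s)) ∧
        ∃ x ∈ K', x.card + 1 = d ∧
          Tendsto (φ x) (𝓝[<] 1) (𝓝 0) ∧
          ∃ m M : ℝ, 0 < m ∧ m < M ∧ M < 2 * Real.pi ∧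
            ∀ y ∈ K', y.card + 1 = d → y ≠ x →
              ∀ s ∈ Ico (0 : ℝ) 1, m < φ y s ∧ φ y s < M := by
  classical
  -- The new starting position is within `ε / 4` of `f`, and the tents cost another `ε / 4`.
  obtain ⟨G, x, a, b, e₁, e₂, φ, H, hφ, hG⟩ :=
    exists_isHingeFlex hd hK hemb hflex (r := ε / 4) (by linarith)
  obtain ⟨K', F, x', a', b', e₁', e₂', φ', H', hlim, hcompat, hsub, hdist⟩ :=
    H.exists_closing hd hφ (ε := ε / 4) (by linarith)
  obtain ⟨D, Φ, hD, hΦ, m, M, hm, hmM, hM, hbound⟩ := H'.exists_angles (by omega) hlim hcompat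
  have hV := hK.nonempty
  have hflex' := H'.isFlex
  let e := (Fintype.equivFin (Option (Option V))).symm
  obtain ⟨y, hy⟩ := exists_map_eq e x'
  refine ⟨_, relabel K' e, fun s => F s ∘ e, H'.closed.relabel,
    (H'.embedded 0 (by simp)).relabel, ⟨_, rfl, hflex'.relabel⟩,
    (hflex'.mono Ico_subset_Icc_self).relabel, hsub.trans isSubdivision_relabel, ?_,
    fun s hs => (H'.embedded s (Ioo_subset_Ico_self hs)).relabel, D,
    fun σ => Φ (σ.map e.toEmbedding), fun s hs => ⟨?_, fun σ hσ hσd =>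
      ((hD s hs).2 _ hσ (by simpa using hσd)).relabel⟩, y, ?_, ?_, ?_, m, M, hm, hmM, hM,
    fun σ hσ hσd hne s hs => hbound _ hσ (by simpa using hσd) (fun h => hne ?_) s hs⟩
  · rw [polyhedron_relabel]
    have h1 := hausdorffDist_polyhedron_triangle (K := K') (K' := K) (K'' := K) (F 0) (G 0) f
    have h2 := hausdorffDist_polyhedron_le (K := K) (by linarith) hG
    linarith
  · rw [polyhedron_relabel]
    exact (hD s hs).1
  · rw [mem_relabel, hy]
    exact H'.ridge.mem
  · rw [← H'.ridge.card, ← hy, Finset.card_map]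
  · beta_reduce
    rwa [hy]
  · exact Finset.map_injective _ (h.trans hy.symm)
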